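/- **Setting.** Let $M$ be a compact finite-dimensional Riemannian manifold with distance $d$, and let $f\colon M\to M$ be a piecewise $C^1$ diffeomorphism: there are countably many pairwise disjoint open sets with dense union, each mapped $C^1$-diffeomorphically onto its image by $f$; the complement of their union is the singular set. For a $C^1$ disk $\gamma\subset M$ let $\mathrm{Leb}_\gamma$ be its Riemannian volume. A *continuous family of $C^1$ disks* is a family $\{\Phi(\{x\}\times D)\}_{x\in K}$, where $K$ is a compact metric space, $D$ is a closed unit disk in some $\mathbb R^k$, $\Phi\colon K\times D\to M$ is a homeomorphism onto its image, and $x\mapsto\Phi|_{\{x\}\times D}$ is continuous into the space of $C^1$ embeddings of $D$ in $M$. A set $\Lambda$ has a *product structure* given by continuous families $\Gamma^s,\Gamma^u$ if $\Lambda=\bigcup\Gamma^s\cap\bigcup\Gamma^u$, the dimensions of the disks of $\Gamma^s$ and $\Gamma^u$ add up to $\dim M$, and each $\gamma\in\Gamma^s$ meets each $\gamma'\in\Gamma^u$ in exactly one point. An *s-subset* (*u-subset*) of $\Lambda$ is a set with a product structure given by $\Gamma^s_0\subset\Gamma^s$ and $\Gamma^u$ (by $\Gamma^s$ and $\Gamma^u_0\subset\Gamma^u$).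 Write $\gamma^{s}(x),\gamma^u(x)$ for the disks through $x\in\Lambda$. A *Young structure* is a compact set $\Lambda$ with a product structure given by $\Gamma^s,\Gamma^u$, with $\mathrm{Leb}_\gamma(\Lambda\cap\gamma)>0$ for all $\gamma\in\Gamma^u$, together with pairwise disjoint s-subsets $\Lambda_1,\Lambda_2,\dots$, integers $R_i\ge1$ and constants $C>0$, $0<\beta<1$, such that the following holds. Put $R=R_i$ and $f^R=f^{R_i}$ on $\Lambda_i$; let $\Lambda'$ be the set of points all of whose iterates under $f^R$ are defined and lie in $\bigcup_i\Lambda_i$; for $x,y\in\Lambda'$ let $s(x,y)\in\{0,1,\dots,\infty\}$ be the smallest $n$ such that $(f^R)^n(x)$ and $(f^R)^n(y)$ lie in distinct $\Lambda_i$'s, and $s(x,y)=0$ for all other pairs. 1. $\mathrm{Leb}_\gamma\big((\Lambda\setminus\bigcup_i\Lambda_i)\cap\gamma\big)=0$ for $\gamma\in\Gamma^u$; each $f^{R_i}(\Lambda_i)$ is a u-subset; and for $x\in\Lambda_i$ one has $f^{R_i}(\gamma^s(x))\subset\gamma^s(f^{R_i}(x))$ and $f^{R_i}(\gamma^u(x))\supset\gamma^u(f^{R_i}(x))$,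 where the latter disk is the image under $f^{R_i}$ of a part of $\gamma^u(x)$ which contains $\gamma^u(x)\cap\Lambda_i$ and whose first $R_i$ iterates $f^j$, $0\le j<R_i$, avoid the singular set. 2. For $x,y\in\gamma\cap\Lambda_i$, $\gamma\in\Gamma^s$: $d((f^R)^n(x),(f^R)^n(y))\le C\beta^n$ for $n\ge0$ (if $x,y\in\Lambda'$), and $d(f^j(x),f^j(y))\le C\,d(x,y)$ for $1\le j\le R_i$. 3. For $x,y\in\gamma\cap\Lambda_i$, $\gamma\in\Gamma^u$: $d((f^R)^n(x),(f^R)^n(y))\le C\beta^{s(x,y)-n}$ for $n\ge0$ (if $x,y\in\Lambda'$), and $d(f^j(x),f^j(y))\le C\,d(f^R(x),f^R(y))$ for $1\le j\le R_i$. 4. For $x,y\in\gamma\cap\Lambda_i$, $\gamma\in\Gamma^u$: $\log\dfrac{|\det Df^R|_{T_x\gamma}|}{|\det Df^R|_{T_y\gamma}|}\le C\beta^{s(f^R(x),f^R(y))}$. 5. For $\gamma,\gamma'\in\Gamma^u$, let $\Theta_{\gamma,\gamma'}\colon\gamma\cap\Lambda\to\gamma'\cap\Lambda$ be the holonomy $x\mapsto\gamma^s(x)\cap\gamma'$.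 Then $(\Theta_{\gamma,\gamma'})_*(\mathrm{Leb}_\gamma|_{\Lambda})$ has a density $\rho$ with respect to $\mathrm{Leb}_{\gamma'}$ with $1/C\le\int_{\gamma'\cap\Lambda}\rho\,d\mathrm{Leb}_{\gamma'}\le C$ and $\log(\rho(x)/\rho(y))\le C\beta^{s(x,y)}$ for $x,y\in\gamma'\cap\Lambda$. The *Young tower* is $\Delta=\{(x,\ell):x\in\Lambda',\ 0\le\ell<R(x)\}$ with $T(x,\ell)=(x,\ell+1)$ if $\ell<R(x)-1$ and $T(x,R(x)-1)=(f^R(x),0)$. An *SRB measure* of $T$ is a $T$-invariant probability measure $\nu$ on $\Delta$ whose conditional measures on the unstable disks of $\Gamma^u$ (on each level of the tower) are absolutely continuous with respect to the Lebesgue measures of those disks. Put $s((x,\ell),(x',\ell'))=s(x,x')$ if $\ell=\ell'$ and $0$ otherwise. Let $\mathcal F_\beta(\Delta)$ be the space of $\varphi\colon\Delta\to\mathbb R$ with $|\varphi(y)-\varphi(z)|\le C_\varphi\beta^{s(y,z)}$ for some $C_\varphi$ and all $y,z\in\Delta$, with $\|\varphi\|_\beta=\sup_{y\ne z}\frac{|\varphi(y)-\varphi(z)|}{\beta^{s(y,z)}}+\|\varphi\|_\infty$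 (where $\|\varphi\|_\infty=\sup|\varphi|$, $\beta^\infty=0$ and $0/0=0$). Write $$\mathrm{Cor}_\nu(\psi,\xi\circ T^n)=\Big|\int\psi\,(\xi\circ T^n)\,d\nu-\int\psi\,d\nu\int\xi\,d\nu\Big|,\qquad \mathrm{mld}_\nu(\varphi,\epsilon,n)=\nu\Big(\sup_{j\ge n}\Big|\frac1j\sum_{i=0}^{j-1}\varphi\circ T^i-\int\varphi\,d\nu\Big|>\epsilon\Big).$$ **Theorem B.** Let $T\colon\Delta\to\Delta$ be a Young tower and let $\nu$ be its SRB measure. (a) Let $\alpha>1$. If there is $C>0$ with $\mathrm{Cor}_\nu(\psi,\xi\circ T^n)\le C\|\psi\|_\beta\|\xi\|_\beta\,n^{-\alpha}$ for all $\psi,\xi\in\mathcal F_\beta(\Delta)$ and $n\ge1$, then for every $q>\max\{1,\alpha\}$ there is $C_{\alpha,q}>0$, depending (for the given $T$ and $\nu$) only on $\alpha$ and $q$, such that $$\mathrm{mld}_\nu(\varphi,\epsilon,n)\le C_{\alpha,q}\,\|\varphi\|_\beta\,\|\varphi\|_\infty^{2q-1}\,\epsilon^{-2q}\,n^{-\alpha}\qquad\text{for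 all }\varphi\in\mathcal F_\beta(\Delta),\ \epsilon>0,\ n\ge1.$$ (b) Let $\tau,\theta>0$. If there is $C>0$ with $\mathrm{Cor}_\nu(\psi,\xi\circ T^n)\le C\|\psi\|_\beta\|\xi\|_\beta\,e^{-\tau n^\theta}$ for all $\psi,\xi\in\mathcal F_\beta(\Delta)$ and $n\ge1$, then there is $C_{\tau,\theta}>0$, depending (for the given $T$ and $\nu$) only on $\tau,\theta$, and for every $\varphi\in\mathcal F_\beta(\Delta)$ there is $C_{\tau,\theta,\varphi}>0$, depending only on $\tau,\theta,\varphi$, such that $$\mathrm{mld}_\nu(\varphi,\epsilon,n)\le C_{\tau,\theta,\varphi}\,e^{-\tau' n^{\theta'}\epsilon^{2\theta'}}\qquad\text{for all }\epsilon>0,\ n\ge1,$$ where $\theta'=\theta/(\theta+1)$ and $\tau'=C_{\tau,\theta}\|\varphi\|_\beta^{-2\theta'}$ (for $\varphi=0$, where $\mathrm{mld}_\nu=0$, the exponent is read as $0$). -/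

import Mathlib

open MeasureTheory ProbabilityTheory Manifold ContDiff Bundle Set
open scoped ENNReal NNReal Topology

noncomputable section

universe u

namespace YoungTower

/-! ### Correlations and maximal large deviations of a general system `(T, ν)` -/

section Statistics

variable {Ω : Type*} [MeasurableSpace Ω]

/-- The correlation `|∫ ψ · (ξ ∘ Tⁿ) dν - ∫ ψ dν · ∫ ξ dν|`. -/
def corr (ν : Measure Ω) (T : Ω → Ω) (ψ ξ : Ω → ℝ) (n : ℕ) : ℝ :=
  |∫ z, ψ z * ξ (T^[n] z) ∂ν - (∫ z, ψ z ∂ν) * ∫ z, ξ z ∂ν|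

/-- The maximal large deviation at time `n`, that is, the measure of the set where
`sup_{j ≥ n} |(1/j) ∑_{i<j} φ ∘ Tⁱ - ∫ φ dν| > ε`.  The supremum is taken in `[0, ∞]`. -/
def mld (ν : Measure Ω) (T : Ω → Ω) (φ : Ω → ℝ) (ε : ℝ) (n : ℕ) : ℝ :=
  (ν {z | ENNReal.ofReal ε <
    ⨆ j : ℕ, ⨆ _ : n ≤ j,
      ENNReal.ofReal |(1 / (j : ℝ)) * ∑ i ∈ Finset.range j, φ (T^[i] z) - ∫ w, φ w ∂ν|}).toReal

end Statistics

/-! ### Riemannian geometry of embedded disks -/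

section Geometry

/-- The closed unit disk in `ℝᵏ`. -/
abbrev unitDisk (k : ℕ) : Set (EuclideanSpace ℝ (Fin k)) := Metric.closedBall 0 1

/-- The `k`-dimensional volume of the parallelepiped spanned by `v₁, …, v_k` in an inner product
space: the square root of the Gram determinant. -/
def gramVolume {V : Type*} [NormedAddCommGroup V] [InnerProductSpace ℝ V] {k : ℕ}
    (v : Fin k → V) : ℝ :=
  Real.sqrt (Matrix.det (Matrix.of fun i j => inner ℝ (v i) (v j)))

variable {d : ℕ} {M : Type*} [EMetricSpace M] [ChartedSpace (EuclideanSpace ℝ (Fin d)) M]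

/-- The derivative at `p` of a map `φ` from the unit disk of `ℝᵏ` to `M`, applied to a vector. -/
def diskDeriv {k : ℕ} (φ : EuclideanSpace ℝ (Fin k) → M) (p v : EuclideanSpace ℝ (Fin k)) :
    TangentSpace (𝓡 d) (φ p) :=
  mfderivWithin (𝓡 k) (𝓡 d) φ (unitDisk k) p v

end Geometry

/-- `f` is a piecewise `C¹` diffeomorphism with pieces `U 0, U 1, …`: these are pairwise disjoint
open sets with dense union, and `f` maps each of them `C¹` diffeomorphically onto its image.  The
complement of `⋃ j, U j` consists of the critical, singular or discontinuity points. -/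
structure IsPiecewiseC1Diffeo {d : ℕ} {M : Type*} [EMetricSpace M]
    [ChartedSpace (EuclideanSpace ℝ (Fin d)) M] (f : M → M) (U : ℕ → Set M) : Prop where
  isOpen : ∀ j, IsOpen (U j)
  disjoint : Pairwise fun i j => Disjoint (U i) (U j)
  dense : Dense (⋃ j, U j)
  contMDiffOn : ∀ j, ContMDiffOn (𝓡 d) (𝓡 d) 1 f (U j)
  injOn : ∀ j, InjOn f (U j)
  bijective_mfderiv : ∀ j, ∀ x ∈ U j, Function.Bijective (mfderiv (𝓡 d) (𝓡 d) f x)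

/-- A continuous family of `C¹` disks of dimension `k` in `M`: the disks are `Φ x (unitDisk k)`,
`x ∈ K`, with `K` a compact metric space (which is homeomorphic to a subset of `M`, so that it may
be taken in the universe of `M`).  (As `K × unitDisk k` is compact, an injective continuous
`Φ` is automatically a homeomorphism onto its image.) -/
structure DiskFamily (d : ℕ) (M : Type u) [EMetricSpace M]
    [ChartedSpace (EuclideanSpace ℝ (Fin d)) M] [IsManifold (𝓡 d) 1 M] (k : ℕ) where
  /-- the parameter space -/
  K : Type u
  [metricK : MetricSpace K]
  [compactK : CompactSpace K]
  /-- the parametrisation; only its values on `K × unitDisk k` matter -/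
  Φ : K → EuclideanSpace ℝ (Fin k) → M
  continuousOn : ContinuousOn (fun q : K × EuclideanSpace ℝ (Fin k) => Φ q.1 q.2)
    (univ ×ˢ unitDisk k)
  injOn : InjOn (fun q : K × EuclideanSpace ℝ (Fin k) => Φ q.1 q.2) (univ ×ˢ unitDisk k)
  /-- each `Φ x` is a `C¹` embedding of the unit disk -/
  contMDiffOn : ∀ x, ContMDiffOn (𝓡 k) (𝓡 d) 1 (Φ x) (unitDisk k)
  injective_deriv : ∀ x, ∀ p ∈ unitDisk k,
    Function.Injective (mfderivWithin (𝓡 k) (𝓡 d) (Φ x) (unitDisk k) p)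
  /-- `x ↦ Φ x` is continuous into the space of `C¹` embeddings with the `C¹` topology, that is,
  the tangent maps of the `Φ x` depend continuously on `x` -/
  continuousOn_tangent : ContinuousOn
    (fun q : K × EuclideanSpace ℝ (Fin k) × EuclideanSpace ℝ (Fin k) =>
      (⟨Φ q.1 q.2.1, diskDeriv (d := d) (Φ q.1) q.2.1 q.2.2⟩ : TangentBundle (𝓡 d) M))
    (univ ×ˢ unitDisk k ×ˢ univ)

namespace DiskFamily

variable {d : ℕ} {M : Type u} [EMetricSpace M] [ChartedSpace (EuclideanSpace ℝ (Fin d)) M]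
  [IsManifold (𝓡 d) 1 M] {k : ℕ}

instance (Γ : DiskFamily d M k) : MetricSpace Γ.K := Γ.metricK
instance (Γ : DiskFamily d M k) : CompactSpace Γ.K := Γ.compactK
instance (Γ : DiskFamily d M k) : MeasurableSpace Γ.K := borel Γ.K
instance (Γ : DiskFamily d M k) : BorelSpace Γ.K := ⟨rfl⟩

/-- The disk with parameter `x`. -/
def disk (Γ : DiskFamily d M k) (x : Γ.K) : Set M := Γ.Φ x '' unitDisk k

/-- The family as a set of disks. -/
def disks (Γ : DiskFamily d M k) : Set (Set M) := range Γ.disk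

/-- The union of the disks. -/
def support (Γ : DiskFamily d M k) : Set M := ⋃ x, Γ.disk x

/-- The Lebesgue (Riemannian volume) measure on the disk with parameter `x`, as a measure on `M`:
the image under `Φ x` of the volume density `√det ⟪∂ᵢΦ, ∂ⱼΦ⟫ dp` on the unit disk. -/
def leb [MeasurableSpace M] [RiemannianBundle (fun y : M => TangentSpace (𝓡 d) y)]
    (Γ : DiskFamily d M k) (x : Γ.K) : Measure M :=
  (((volume : Measure (EuclideanSpace ℝ (Fin k))).restrict (unitDisk k)).withDensity
    (fun p => ENNReal.ofReal
      (gramVolume fun i => diskDeriv (d := d) (Γ.Φ x) p (EuclideanSpace.single i 1)))).map (Γ.Φ x)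

/-- `|det Dg|_{T_y γ}|` for `γ` the disk with parameter `x` and `y = Φ x p`: the factor by which
`Dg(y)` multiplies `k`-dimensional volume on the tangent space of `γ` at `y`. -/
def absDet [RiemannianBundle (fun y : M => TangentSpace (𝓡 d) y)]
    (Γ : DiskFamily d M k) (g : M → M) (x : Γ.K) (p : EuclideanSpace ℝ (Fin k)) : ℝ :=
  (gramVolume fun i => mfderiv (𝓡 d) (𝓡 d) g (Γ.Φ x p)
      (diskDeriv (d := d) (Γ.Φ x) p (EuclideanSpace.single i 1))) /
    gramVolume fun i => diskDeriv (d := d) (Γ.Φ x) p (EuclideanSpace.single i 1)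

end DiskFamily

section Product

variable {d : ℕ} {M : Type u} [EMetricSpace M] [ChartedSpace (EuclideanSpace ℝ (Fin d)) M]
  [IsManifold (𝓡 d) 1 M]
  {ks ku : ℕ}

/-- `Λ` has a product structure given by the families `Γs` and `Γu`. -/
structure HasProductStructure (Λ : Set M) (Γs : DiskFamily d M ks) (Γu : DiskFamily d M ku) :
    Prop where
  eq_inter : Λ = Γs.support ∩ Γu.support
  dim_add : ks + ku = d
  existsUnique : ∀ a b, ∃! y, y ∈ Γs.disk a ∩ Γu.disk b

/-- `Λ₀` is an s-subset of the set with product structure given by `Γs` and `Γu`. -/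
def IsSSubset (Λ₀ : Set M) (Γs : DiskFamily d M ks) (Γu : DiskFamily d M ku) : Prop :=
  ∃ Γ₀ : DiskFamily d M ks, Γ₀.disks ⊆ Γs.disks ∧ HasProductStructure Λ₀ Γ₀ Γu

/-- `Λ₀` is a u-subset of the set with product structure given by `Γs` and `Γu`. -/
def IsUSubset (Λ₀ : Set M) (Γs : DiskFamily d M ks) (Γu : DiskFamily d M ku) : Prop :=
  ∃ Γ₀ : DiskFamily d M ku, Γ₀.disks ⊆ Γu.disks ∧ HasProductStructure Λ₀ Γs Γ₀

open Classical in
/-- The holonomy map onto the unstable disk with parameter `b`: a point `x` of a stable disk is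
sent to the intersection of that stable disk with the unstable disk. -/
def holonomy (Γs : DiskFamily d M ks) (Γu : DiskFamily d M ku) (b : Γu.K) (x : M) : M :=
  if h : ∃ y, ∃ a, x ∈ Γs.disk a ∧ y ∈ Γs.disk a ∩ Γu.disk b then h.choose else x

end Product

/-! ### Return map and separation time of a Markov family `(Λᵢ, Rᵢ)` -/

section Return

variable {M : Type*}

open Classical in
/-- The recurrence time: `R = Rᵢ` on `Λᵢ` (and, as a dummy value, `0` off `⋃ᵢ Λᵢ`). -/
def recTime (Λi : ℕ → Set M) (Ri : ℕ → ℕ) (x : M) : ℕ :=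
  if h : ∃ i, x ∈ Λi i then Ri h.choose else 0

/-- The return map `x ↦ f^{R(x)}(x)`. -/
def retMap (f : M → M) (Λi : ℕ → Set M) (Ri : ℕ → ℕ) (x : M) : M :=
  f^[recTime Λi Ri x] x

/-- The set `Λ'` of the points all of whose iterates under the return map lie in `⋃ᵢ Λᵢ`. -/
def fullSet (f : M → M) (Λi : ℕ → Set M) (Ri : ℕ → ℕ) : Set M :=
  {x | ∀ n, ∃ i, (retMap f Λi Ri)^[n] x ∈ Λi i}

open Classical in
/-- The separation time: for points of `Λ'` the smallest `n` such that the `n`-th iterates under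
the return map lie in distinct `Λᵢ`'s (`∞` if there is none); it is `0` for all other points. -/
def sepTime (f : M → M) (Λi : ℕ → Set M) (Ri : ℕ → ℕ) (x y : M) : ℕ∞ :=
  if x ∈ fullSet f Λi Ri ∧ y ∈ fullSet f Λi Ri then
    ⨅ n : ℕ, ⨅ _ : ∃ i j, i ≠ j ∧ (retMap f Λi Ri)^[n] x ∈ Λi i ∧ (retMap f Λi Ri)^[n] y ∈ Λi j,
      (n : ℕ∞)
  else 0

/-- `β ^ s` for `0 < β < 1` and `s ∈ {0, 1, …, ∞}`, with `β ^ ∞ = 0`. -/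
def powSep (β : ℝ) (s : ℕ∞) : ℝ := if s = ⊤ then 0 else β ^ s.toNat

end Return

/-! ### Young structures -/

/-- A Young structure for a piecewise `C¹` diffeomorphism `f` of the Riemannian manifold `M` with
pieces `U j`.  Unstable and stable disks are referred to by their parameters. -/
structure YoungStructure {d : ℕ} {M : Type u} [EMetricSpace M]
    [ChartedSpace (EuclideanSpace ℝ (Fin d)) M] [IsManifold (𝓡 d) 1 M] [MeasurableSpace M]
    [RiemannianBundle (fun y : M => TangentSpace (𝓡 d) y)] (f : M → M) (U : ℕ → Set M) where
  /-- the set `Λ`, the dimensions of the disks, and the stable and unstable families -/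
  Λ : Set M
  ks : ℕ
  ku : ℕ
  Γs : DiskFamily d M ks
  Γu : DiskFamily d M ku
  isCompact : IsCompact Λ
  product : HasProductStructure Λ Γs Γu
  leb_pos : ∀ b, 0 < Γu.leb b (Λ ∩ Γu.disk b)
  /-- the s-subsets `Λᵢ` (empty ones are allowed, so that there may be finitely many) and their
  return times -/
  Λi : ℕ → Set M
  Ri : ℕ → ℕ
  Ri_pos : ∀ i, 0 < Ri i
  /-- Markov property -/
  isSSubset : ∀ i, IsSSubset (Λi i) Γs Γu
  pairwise_disjoint : Pairwise fun i j => Disjoint (Λi i) (Λi j)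
  leb_compl : ∀ b, Γu.leb b ((Λ \ ⋃ i, Λi i) ∩ Γu.disk b) = 0
  isUSubset : ∀ i, IsUSubset (f^[Ri i] '' Λi i) Γs Γu
  markov_stable : ∀ i, ∀ x ∈ Λi i, ∀ a a', x ∈ Γs.disk a → f^[Ri i] x ∈ Γs.disk a' →
    f^[Ri i] '' Γs.disk a ⊆ Γs.disk a'
  /-- `f^{Rᵢ}(γᵘ(x)) ⊇ γᵘ(f^{Rᵢ}(x))`, the right-hand side being covered by a part `W` of `γᵘ(x)`
  that contains `γᵘ(x) ∩ Λᵢ` and does not meet the singular set before time `Rᵢ` -/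
  markov_unstable : ∀ i, ∀ x ∈ Λi i, ∀ b b', x ∈ Γu.disk b → f^[Ri i] x ∈ Γu.disk b' →
    ∃ W ⊆ Γu.disk b, Γu.disk b ∩ Λi i ⊆ W ∧ (∀ y ∈ W, ∀ j < Ri i, f^[j] y ∈ ⋃ l, U l) ∧
      f^[Ri i] '' W = Γu.disk b'
  /-- the constants of the remaining conditions -/
  C : ℝ
  β : ℝ
  C_pos : 0 < C
  β_pos : 0 < β
  β_lt_one : β < 1
  /-- Contraction on stable disks -/
  contraction_return : ∀ i a, ∀ x ∈ Γs.disk a ∩ Λi i ∩ fullSet f Λi Ri,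
    ∀ y ∈ Γs.disk a ∩ Λi i ∩ fullSet f Λi Ri, ∀ n : ℕ,
      edist ((retMap f Λi Ri)^[n] x) ((retMap f Λi Ri)^[n] y) ≤ ENNReal.ofReal (C * β ^ n)
  contraction_iterate : ∀ i a, ∀ x ∈ Γs.disk a ∩ Λi i, ∀ y ∈ Γs.disk a ∩ Λi i,
    ∀ j, 1 ≤ j → j ≤ Ri i → edist (f^[j] x) (f^[j] y) ≤ ENNReal.ofReal C * edist x y
  /-- Expansion on unstable disks -/
  expansion_return : ∀ i b, ∀ x ∈ Γu.disk b ∩ Λi i ∩ fullSet f Λi Ri,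
    ∀ y ∈ Γu.disk b ∩ Λi i ∩ fullSet f Λi Ri, ∀ n : ℕ,
      edist ((retMap f Λi Ri)^[n] x) ((retMap f Λi Ri)^[n] y) ≤
        ENNReal.ofReal (C * (powSep β (sepTime f Λi Ri x y) / β ^ n))
  expansion_iterate : ∀ i b, ∀ x ∈ Γu.disk b ∩ Λi i, ∀ y ∈ Γu.disk b ∩ Λi i,
    ∀ j, 1 ≤ j → j ≤ Ri i →
      edist (f^[j] x) (f^[j] y) ≤ ENNReal.ofReal C * edist (f^[Ri i] x) (f^[Ri i] y)
  /-- Gibbs property, for the points `x = Φ b p` and `y = Φ b p'` of an unstable disk -/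
  gibbs : ∀ i b, ∀ p ∈ unitDisk ku, ∀ p' ∈ unitDisk ku,
    Γu.Φ b p ∈ Λi i → Γu.Φ b p' ∈ Λi i →
      Real.log (Γu.absDet f^[Ri i] b p / Γu.absDet f^[Ri i] b p') ≤
        C * powSep β (sepTime f Λi Ri (f^[Ri i] (Γu.Φ b p)) (f^[Ri i] (Γu.Φ b p')))
  /-- Regularity of the stable holonomy; the bound on `log (ρ x / ρ y)` is written without
  the logarithm -/
  holonomy_regular : ∀ b b', ∃ ρ : M → ℝ≥0, Measurable ρ ∧
    ((Γu.leb b).restrict Λ).map (holonomy Γs Γu b') =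
      ((Γu.leb b').restrict Λ).withDensity (fun x => (ρ x : ℝ≥0∞)) ∧
    ENNReal.ofReal (1 / C) ≤ ∫⁻ x in Γu.disk b' ∩ Λ, (ρ x : ℝ≥0∞) ∂(Γu.leb b') ∧
    ∫⁻ x in Γu.disk b' ∩ Λ, (ρ x : ℝ≥0∞) ∂(Γu.leb b') ≤ ENNReal.ofReal C ∧
    ∀ x ∈ Γu.disk b' ∩ Λ, ∀ y ∈ Γu.disk b' ∩ Λ,
      (ρ x : ℝ) ≤ Real.exp (C * powSep β (sepTime f Λi Ri x y)) * ρ y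

namespace YoungStructure

variable {d : ℕ} {M : Type u} [EMetricSpace M]
  [ChartedSpace (EuclideanSpace ℝ (Fin d)) M] [IsManifold (𝓡 d) 1 M] [MeasurableSpace M]
  [RiemannianBundle (fun y : M => TangentSpace (𝓡 d) y)] {f : M → M} {U : ℕ → Set M}

/-- The recurrence time `R`. -/
def R (Y : YoungStructure (d := d) f U) : M → ℕ := recTime Y.Λi Y.Ri

/-- The return map `f^R`. -/
def fR (Y : YoungStructure (d := d) f U) : M → M := retMap f Y.Λi Y.Ri

/-- The full measure subset `Λ'` on which all iterates of the return map are defined. -/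
def Λ' (Y : YoungStructure (d := d) f U) : Set M := fullSet f Y.Λi Y.Ri

theorem fR_mem (Y : YoungStructure (d := d) f U) {x : M} (hx : x ∈ Y.Λ') : Y.fR x ∈ Y.Λ' := by
  intro n
  have h := hx (n + 1)
  rwa [Function.iterate_succ_apply] at h

theorem R_pos (Y : YoungStructure (d := d) f U) {x : M} (hx : x ∈ Y.Λ') : 0 < Y.R x := by
  have h : ∃ i, x ∈ Y.Λi i := hx 0
  unfold R recTime
  rw [dif_pos h]
  exact Y.Ri_pos _

/-- The tower `Δ`. -/
def Tower (Y : YoungStructure (d := d) f U) : Type _ :=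
  {z : M × ℕ // z.1 ∈ Y.Λ' ∧ z.2 < Y.R z.1}

instance (Y : YoungStructure (d := d) f U) : MeasurableSpace Y.Tower :=
  inferInstanceAs (MeasurableSpace {z : M × ℕ // z.1 ∈ Y.Λ' ∧ z.2 < Y.R z.1})

/-- The point of `Λ` below a point of the tower. -/
def base {Y : YoungStructure (d := d) f U} (z : Y.Tower) : M := z.1.1

/-- The level of a point of the tower. -/
def level {Y : YoungStructure (d := d) f U} (z : Y.Tower) : ℕ := z.1.2

/-- The tower map `T`. -/
def towerMap (Y : YoungStructure (d := d) f U) (z : Y.Tower) : Y.Tower :=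
  if h : level z + 1 < Y.R (base z) then ⟨(base z, level z + 1), z.2.1, h⟩
  else ⟨(Y.fR (base z), 0), Y.fR_mem z.2.1, Y.R_pos (Y.fR_mem z.2.1)⟩

/-- `ν` is an SRB measure of the tower map: an invariant probability measure whose conditional
measures on the unstable disks at the various levels of the tower are absolutely continuous with
respect to the Lebesgue measures on those disks.  The conditional measures are given by a
disintegration `κ` of `ν` over the parameters `(b, ℓ)` of the disks. -/
structure IsSRB (Y : YoungStructure (d := d) f U) (ν : Measure Y.Tower) : Prop where
  isProbabilityMeasure : IsProbabilityMeasure ν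
  measurePreserving : MeasurePreserving Y.towerMap ν ν
  exists_conditionals : ∃ (η : Measure (Y.Γu.K × ℕ)) (κ : Kernel (Y.Γu.K × ℕ) Y.Tower),
    IsProbabilityMeasure η ∧ IsMarkovKernel κ ∧ ν = η.bind κ ∧
    ∀ᵐ q ∂η, (∀ᵐ z ∂(κ q), base z ∈ Y.Γu.disk q.1 ∧ level z = q.2) ∧
      (κ q).map base ≪ Y.Γu.leb q.1

open Classical in
/-- The separation time on the tower. -/
def sep (Y : YoungStructure (d := d) f U) (y z : Y.Tower) : ℕ∞ :=
  if level y = level z then sepTime f Y.Λi Y.Ri (base y) (base z) else 0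

/-- The dynamical distance `β ^ s(y, z)`. -/
def dynDist (Y : YoungStructure (d := d) f U) (y z : Y.Tower) : ℝ := powSep Y.β (Y.sep y z)

/-- The space `F_β(Δ)` of observables. -/
def F (Y : YoungStructure (d := d) f U) : Set (Y.Tower → ℝ) :=
  {φ | ∃ C > 0, ∀ y z, |φ y - φ z| ≤ C * Y.dynDist y z}

/-- `‖φ‖_∞`. -/
def supNorm (Y : YoungStructure (d := d) f U) (φ : Y.Tower → ℝ) : ℝ := ⨆ z, |φ z|

/-- `|φ|_β`; for `φ ∈ F_β(Δ)` a quotient whose denominator `β ^ s(y, z)` vanishes is `0 / 0 = 0`. -/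
def seminorm (Y : YoungStructure (d := d) f U) (φ : Y.Tower → ℝ) : ℝ :=
  ⨆ q : {q : Y.Tower × Y.Tower // q.1 ≠ q.2}, |φ q.1.1 - φ q.1.2| / Y.dynDist q.1.1 q.1.2

/-- `‖φ‖_β = |φ|_β + ‖φ‖_∞`. -/
def normβ (Y : YoungStructure (d := d) f U) (φ : Y.Tower → ℝ) : ℝ := Y.seminorm φ + Y.supNorm φ

end YoungStructure

end YoungTower

end

/-! Coding. A point of the tower is coded by its itinerary under `f^R` and its level. The coding
semiconjugates `T` to the tower over the full shift on `ℕ → ℕ` with roof function `R (x 0)`. Since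
`β ^ ∞ = 0`, a function in `F_β` depends only on the code, and it extends to a Lipschitz function on
the whole symbolic tower. The stable direction thus disappears, and the problem becomes one about a
non-invertible map with a transfer operator.

Distortion. The Gibbs property, the change of variables along unstable disks and the regularity of
the stable holonomy show that prepending one symbol distorts the distribution of itineraries on an
unstable disk by at most `exp (2 C βᵏ)` on cylinders of length `k`. A geometric series extends this
to all inverse branches. The base measure of the SRB measure is invariant under the shift and
absolutely continuous with respect to this distribution, so martingale convergence gives it a
regular density and bounded distortion of its own. Hence all powers of the transfer operator
preserve Lipschitz observables, with uniform constants (`exists_transfer`).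

L¹ decay. Let `φ` be centred and let `g k` be its image under the `k`-th power of the transfer
operator. Then `∫ (g k)² = ∫ φ · g k ∘ Tᵏ`, and the right side is a correlation. By Cauchy-Schwarz
the L¹ norm of `g k` decays at half the exponential rate, which is enough for (b). For (a) the
square root would halve `α`, so a bootstrap is used instead (`unifDecay_step`). Averages over
cylinders of a fixed length `N` are tested against their signs, which are Lipschitz. The remainder
has size `βᴺ` and mean zero on each cylinder, and after it is pushed forward along the branches the
previous bound applies to it. Cylinders that are left too late have small measure, because
correlation decay also controls the tail of the roof.

Large deviations. The function `g k ∘ Tᵏ` is the conditional expectation of `φ` given `Tᵏ`.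
Telescoping over scales writes `φ` as a sum of differences of such functions plus a remainder. The
difference whose larger scale is `L` is orthogonal to all functions of `T^L`. Its sums over blocks
of length `L` with even (or odd) index are therefore reverse martingale sums, for which maximal,
moment and Hoeffding inequalities hold.

In (a), moments of order `2 q` bound the contribution of scale `L ≤ n` by a multiple of `(ε n)^(-2q)
(n/L)^q L^(2q) ‖φ‖_∞^(2q-1) ‖φ‖_β L^(-α)`. As `q > α`, the scale `L ≈ n` dominates and gives
`ε^(-2q) n^(-α)`. In (b), Hoeffding at a first scale `p` gives `exp (-c x / p)` with `x = n ε² /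
‖φ‖_β²`, and the later scales give `exp (-c p^θ)`. The balance `p^(θ+1) ≈ x` produces `θ' =
θ/(θ+1)`. Summation over dyadic times turns maxima up to time `n` into suprema over all later times.
-/

noncomputable section

namespace YoungTower

/-! ### Derivatives within a set at its density points -/

section Calculus

open scoped Pointwise in
/-- At almost every point of a set in a finite-dimensional space (a Lebesgue density point), the
derivative within the set is unique. -/
theorem ae_restrict_hasFDerivWithinAt_unique {E F : Type*} [NormedAddCommGroup E] [NormedSpace ℝ E]
    [FiniteDimensional ℝ E] [MeasurableSpace E] [BorelSpace E] (μ : Measure E)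
    [μ.IsAddHaarMeasure] [NormedAddCommGroup F] [NormedSpace ℝ F] {s : Set E}
    (hs : MeasurableSet s) :
    ∀ᵐ x ∂μ.restrict s, ∀ (f : E → F) (A B : E →L[ℝ] F),
      HasFDerivWithinAt f A s x → HasFDerivWithinAt f B s x → A = B := by
  filter_upwards [Besicovitch.ae_tendsto_measure_inter_div μ s, ae_restrict_mem hs]
  intro x hx xs f A B hA hB
  have hD : HasFDerivWithinAt (fun _ => (0 : F)) (A - B) s x := by
    simpa [Pi.zero_def] using hA.sub hB
  set D := A - B with hDdef
  suffices hz : ∀ z, D z = 0 by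
    refine sub_eq_zero.1 ?_
    exact ContinuousLinearMap.ext hz
  intro z
  suffices H : ∀ ε, 0 < ε → ‖D z‖ ≤ ε * (‖z‖ + ε) + ‖D‖ * ε by
    have h1 : Filter.Tendsto (fun ε : ℝ => ε * (‖z‖ + ε) + ‖D‖ * ε) (𝓝[>] 0)
        (𝓝 (0 * (‖z‖ + 0) + ‖D‖ * 0)) :=
      Filter.Tendsto.mono_left (Continuous.tendsto (by fun_prop) 0) nhdsWithin_le_nhds
    simp only [add_zero, mul_zero, zero_mul] at h1
    have h2 : ‖D z‖ ≤ 0 := by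
      apply le_of_tendsto_of_tendsto tendsto_const_nhds h1
      filter_upwards [self_mem_nhdsWithin]
      exact H
    exact norm_le_zero_iff.1 h2
  intro ε εpos
  -- At a density point the set meets every small rescaled copy of the ball around `z`. So some
  -- direction `a` within `ε` of `z` is realised by a point of `s`, and there both derivatives are
  -- seen.
  have B₁ : ∀ᶠ r in 𝓝[>] (0 : ℝ), (s ∩ ({x} + r • Metric.closedBall z ε)).Nonempty :=
    Measure.eventually_nonempty_inter_smul_of_density_one μ s x hx _ measurableSet_closedBall
      (Metric.measure_closedBall_pos μ z εpos).ne'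
  obtain ⟨ρ, ρpos, hρ⟩ := Metric.mem_nhdsWithin_iff.1 (hD.isLittleO.def εpos)
  have B₂ : ∀ᶠ r in 𝓝[>] (0 : ℝ), {x} + r • Metric.closedBall z ε ⊆ Metric.ball x ρ := by
    apply nhdsWithin_le_nhds
    exact eventually_singleton_add_smul_subset Metric.isBounded_closedBall
      (Metric.ball_mem_nhds x ρpos)
  obtain ⟨r, ⟨y, ⟨ys, hy⟩⟩, rρ, rpos⟩ :
    ∃ r : ℝ, (s ∩ ({x} + r • Metric.closedBall z ε)).Nonempty ∧
      {x} + r • Metric.closedBall z ε ⊆ Metric.ball x ρ ∧ 0 < r :=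
    (B₁.and (B₂.and self_mem_nhdsWithin)).exists
  obtain ⟨a, az, ya⟩ : ∃ a, a ∈ Metric.closedBall z ε ∧ y = x + r • a := by
    simp only [mem_smul_set, image_add_left, mem_preimage, singleton_add] at hy
    rcases hy with ⟨a, az, ha⟩
    exact ⟨a, az, by simp only [ha, add_neg_cancel_left]⟩
  have norm_a : ‖a‖ ≤ ‖z‖ + ε :=
    calc
      ‖a‖ = ‖z + (a - z)‖ := by simp only [add_sub_cancel]
      _ ≤ ‖z‖ + ‖a - z‖ := norm_add_le _ _
      _ ≤ ‖z‖ + ε := by grw [mem_closedBall_iff_norm.1 az]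
  have I : r * ‖D a‖ ≤ r * (ε * (‖z‖ + ε)) := by
    have h := hρ ⟨rρ hy, ys⟩
    simp only [mem_ofPred_eq, ya, add_sub_cancel_left, map_smul, sub_self, zero_sub, norm_neg,
      norm_smul, Real.norm_eq_abs, abs_of_pos rpos] at h
    calc r * ‖D a‖ ≤ ε * (r * ‖a‖) := h
      _ = r * (ε * ‖a‖) := by ring
      _ ≤ _ := by gcongr
  calc
    ‖D z‖ = ‖D a + D (z - a)‖ := by rw [← map_add]; congr 2; abel
    _ ≤ ‖D a‖ + ‖D (z - a)‖ := norm_add_le _ _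
    _ ≤ ε * (‖z‖ + ε) + ‖D‖ * ‖z - a‖ := by
      apply add_le_add
      · exact (mul_le_mul_iff_right₀ rpos).1 I
      · apply ContinuousLinearMap.le_opNorm
    _ ≤ ε * (‖z‖ + ε) + ‖D‖ * ε := by
      rw [mem_closedBall_iff_norm'] at az
      gcongr

/-- If `χ` has at `h p` a derivative with left inverse `L`, and `χ ∘ h` is differentiable at `p`,
then so is the continuous map `h`. -/
theorem hasFDerivWithinAt_of_comp_leftInverse {E E' F : Type*} [NormedAddCommGroup E]
    [NormedSpace ℝ E] [NormedAddCommGroup E'] [NormedSpace ℝ E'] [NormedAddCommGroup F]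
    [NormedSpace ℝ F] {s : Set E} {t : Set E'} {h : E → E'} {χ : E' → F} {p : E}
    {A₁ : E' →L[ℝ] F} {A₂ : E →L[ℝ] F} {L : F →L[ℝ] E'} (hL : ∀ v, L (A₁ v) = v)
    (hh : ContinuousWithinAt h s p) (hst : MapsTo h s t)
    (h₁ : HasFDerivWithinAt χ A₁ t (h p)) (h₂ : HasFDerivWithinAt (χ ∘ h) A₂ s p) :
    HasFDerivWithinAt h (L.comp A₂) s p := by
  have hu : HasFDerivWithinAt (fun x => L (χ (h x))) (L.comp A₂) s p :=
    L.hasFDerivAt.comp_hasFDerivWithinAt p h₂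
  have hv : HasFDerivWithinAt (fun x => L (χ x)) (ContinuousLinearMap.id ℝ E') t (h p) := by
    have := L.hasFDerivAt.comp_hasFDerivWithinAt (h p) h₁
    have hid : L.comp A₁ = ContinuousLinearMap.id ℝ E' := ContinuousLinearMap.ext hL
    rw [hid] at this
    exact this
  have htend : Filter.Tendsto h (𝓝[s] p) (𝓝[t] (h p)) :=
    tendsto_nhdsWithin_iff.2 ⟨hh, Filter.eventually_of_mem self_mem_nhdsWithin hst⟩
  have ho := hv.isLittleO.comp_tendsto htend
  simp only [Function.comp_def, ContinuousLinearMap.id_apply] at ho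
  -- Continuity of `h` makes the linearisation error of `L ∘ χ` along `h` of order `o(h x - h p)`.
  -- Absorbing it yields a Lipschitz bound for `h` at `p`, after which the error is `o(x - p)`.
  have hO : (fun x => h x - h p) =O[𝓝[s] p] fun x => x - p := by
    have h3 := ho.right_isBigO_add
    have h4 : (fun x => L (χ (h x)) - L (χ (h p))) =O[𝓝[s] p] fun x => x - p :=
      hu.isBigO_sub
    refine Asymptotics.IsBigO.trans ?_ h4
    simpa using h3
  rw [hasFDerivWithinAt_iff_isLittleO]
  have h5 := hu.isLittleO.sub (ho.trans_isBigO hO)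
  refine h5.congr_left fun x => ?_
  abel

end Calculus

/-! ### Gram determinants -/

section Gram

/-- If `N` is the matrix of `H`, the Gram matrix of the vectors `A (H eᵢ)` is `Nᵀ G N`, with `G` the
Gram matrix of the vectors `A eᵢ`. Its determinant thus picks up the square of `det N`. -/
theorem gramVolume_comp {k : ℕ} {V : Type*} [NormedAddCommGroup V] [InnerProductSpace ℝ V]
    (A : EuclideanSpace ℝ (Fin k) →ₗ[ℝ] V)
    (H : EuclideanSpace ℝ (Fin k) →L[ℝ] EuclideanSpace ℝ (Fin k)) :
    gramVolume (fun i => A (H (EuclideanSpace.single i 1))) =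
      |H.det| * gramVolume fun i => A (EuclideanSpace.single i 1) := by
  set b := (EuclideanSpace.basisFun (Fin k) ℝ).toBasis with hb
  set N := LinearMap.toMatrix b b (H : EuclideanSpace ℝ (Fin k) →ₗ[ℝ] _) with hN
  have hdet : H.det = N.det := by
    rw [hN, LinearMap.det_toMatrix]
  have hexp : ∀ i, A (H (EuclideanSpace.single i 1)) =
      ∑ l, N l i • A (EuclideanSpace.single l 1) := by
    intro i
    simp only [← map_smul, ← map_sum]
    congr 1
    have := b.sum_repr (H (EuclideanSpace.single i 1))
    rw [← this]
    refine Finset.sum_congr rfl fun l _ => ?_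
    simp [hN, hb, LinearMap.toMatrix_apply]
  have hmat : (Matrix.of fun i j => inner ℝ (A (H (EuclideanSpace.single i 1)))
      (A (H (EuclideanSpace.single j 1))) : Matrix (Fin k) (Fin k) ℝ) =
      N.transpose * (Matrix.of fun i j => inner ℝ (A (EuclideanSpace.single i 1))
      (A (EuclideanSpace.single j 1)) : Matrix (Fin k) (Fin k) ℝ) * N := by
    ext i j
    simp only [Matrix.of_apply, hexp, sum_inner, inner_sum, inner_smul_left, inner_smul_right,
      Matrix.mul_apply, Matrix.transpose_apply, Finset.sum_mul, Finset.mul_sum]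
    refine Finset.sum_congr rfl fun x _ => Finset.sum_congr rfl fun y _ => ?_
    simp; rw [real_inner_comm]; ring
  unfold gramVolume
  rw [hmat, Matrix.det_mul, Matrix.det_mul, Matrix.det_transpose, hdet]
  rw [show N.det * (Matrix.of fun i j => inner ℝ (A (EuclideanSpace.single i 1))
      (A (EuclideanSpace.single j 1)) : Matrix (Fin k) (Fin k) ℝ).det * N.det = N.det ^ 2 *
      (Matrix.of fun i j => inner ℝ (A (EuclideanSpace.single i 1))
      (A (EuclideanSpace.single j 1)) : Matrix (Fin k) (Fin k) ℝ).det by ring,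
    Real.sqrt_mul (sq_nonneg _), Real.sqrt_sq_eq_abs]

theorem gramVolume_pos {k : ℕ} {V : Type*} [NormedAddCommGroup V] [InnerProductSpace ℝ V]
    (A : EuclideanSpace ℝ (Fin k) →ₗ[ℝ] V) (hA : Function.Injective A) :
    0 < gramVolume fun i => A (EuclideanSpace.single i 1) := by
  have hli : LinearIndependent ℝ fun i => A (EuclideanSpace.single i (1 : ℝ)) := by
    have h := (EuclideanSpace.basisFun (Fin k) ℝ).toBasis.linearIndependent
    have h2 := h.map' A (LinearMap.ker_eq_bot.2 hA)
    have h3 : (A ∘ (EuclideanSpace.basisFun (Fin k) ℝ).toBasis) =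
        fun i => A (EuclideanSpace.single i (1 : ℝ)) := by
      ext i; simp
    rw [h3] at h2
    exact h2
  exact Real.sqrt_pos.2 (Matrix.posDef_gram_of_linearIndependent hli).det_pos

/-- All tangent spaces have the same underlying vector space, but the inner product depends on the
base point. This is needed when one point appears both as `χ (h p)` and as `g (φ p)`. -/
theorem gramVolume_congr_point {d k : ℕ} {M : Type*} [EMetricSpace M]
    [ChartedSpace (EuclideanSpace ℝ (Fin d)) M] [IsManifold (𝓡 d) 1 M]
    [RiemannianBundle (fun y : M => TangentSpace (𝓡 d) y)]
    {y y' : M} (h : y = y') (v : Fin k → EuclideanSpace ℝ (Fin d)) :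
    gramVolume (V := TangentSpace (𝓡 d) y) v = gramVolume (V := TangentSpace (𝓡 d) y') v := by
  subst h; rfl

end Gram

/-! ### Jacobians of transition maps between embedded disks -/

section Transition

variable {d : ℕ} {M : Type*} [EMetricSpace M] [ChartedSpace (EuclideanSpace ℝ (Fin d)) M] {k : ℕ}

theorem hasFDerivWithinAt_chart_of_mdifferentiableWithinAt
    {φ : EuclideanSpace ℝ (Fin k) → M} {s : Set (EuclideanSpace ℝ (Fin k))}
    {p : EuclideanSpace ℝ (Fin k)} (h : MDifferentiableWithinAt (𝓡 k) (𝓡 d) φ s p) :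
    HasFDerivWithinAt (extChartAt (𝓡 d) (φ p) ∘ φ)
      (mfderivWithin (𝓡 k) (𝓡 d) φ s p : EuclideanSpace ℝ (Fin k) →L[ℝ] EuclideanSpace ℝ (Fin d))
      s p := by
  have := h.hasMFDerivWithinAt.2
  simp only [writtenInExtChartAt, extChartAt_model_space_eq_id, PartialEquiv.refl_coe,
    PartialEquiv.refl_symm, Function.comp_id, preimage_id, ModelWithCorners.range_eq_univ,
    inter_univ, id_eq] at this
  exact this

theorem mdifferentiableAt_iterate {f : M → M} {U : ℕ → Set M}
    (hf : IsPiecewiseC1Diffeo (d := d) f U) {x : M}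
    {n : ℕ}
    (h : ∀ j < n, f^[j] x ∈ ⋃ l, U l) :
    MDifferentiableAt (𝓡 d) (𝓡 d) f^[n] x ∧
      Function.Injective (mfderiv (𝓡 d) (𝓡 d) f^[n] x) := by
  induction n with
  | zero =>
    refine ⟨mdifferentiableAt_id, ?_⟩
    rw [Function.iterate_zero, mfderiv_id]
    exact Function.injective_id
  | succ n ih =>
    obtain ⟨h1, h2⟩ := ih fun j hj => h j (hj.trans n.lt_succ_self)
    obtain ⟨l, hl⟩ := mem_iUnion.1 (h n n.lt_succ_self)
    have h3 : MDifferentiableAt (𝓡 d) (𝓡 d) f (f^[n] x) :=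
      ((hf.contMDiffOn l).contMDiffAt ((hf.isOpen l).mem_nhds hl)).mdifferentiableAt one_ne_zero
    rw [Function.iterate_succ']
    refine ⟨h3.comp x h1, ?_⟩
    rw [mfderiv_comp x h3 h1]
    exact (hf.bijective_mfderiv l _ hl).1.comp h2

/-- The transition map `h` between two embedded disks induced by a differentiable map `g` of the
ambient manifold is differentiable, and its Jacobian is the ratio of the volume distortions. -/
theorem exists_hasFDerivWithinAt_transition
    [IsManifold (𝓡 d) 1 M] [RiemannianBundle (fun y : M => TangentSpace (𝓡 d) y)]
    {φ χ : EuclideanSpace ℝ (Fin k) → M} {g : M → M} {S : Set (EuclideanSpace ℝ (Fin k))}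
    {h : EuclideanSpace ℝ (Fin k) → EuclideanSpace ℝ (Fin k)}
    (hS : MeasurableSet S) (hSD : S ⊆ unitDisk k)
    (hφ : ContMDiffOn (𝓡 k) (𝓡 d) 1 φ (unitDisk k))
    (hχ : ContMDiffOn (𝓡 k) (𝓡 d) 1 χ (unitDisk k))
    (hχ' : ∀ p ∈ unitDisk k, Function.Injective (mfderivWithin (𝓡 k) (𝓡 d) χ (unitDisk k) p))
    (hg : ∀ p ∈ S, MDifferentiableAt (𝓡 d) (𝓡 d) g (φ p))
    (hh : ContinuousOn h S) (hmaps : MapsTo h S (unitDisk k))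
    (hcomm : ∀ p ∈ S, χ (h p) = g (φ p)) :
    ∃ h' : EuclideanSpace ℝ (Fin k) → EuclideanSpace ℝ (Fin k) →L[ℝ] EuclideanSpace ℝ (Fin k),
      (∀ p ∈ S, HasFDerivWithinAt h (h' p) S p) ∧
      ∀ᵐ p ∂(volume.restrict S),
        (gramVolume fun i => mfderiv (𝓡 d) (𝓡 d) g (φ p)
          (diskDeriv (d := d) φ p (EuclideanSpace.single i 1))) =
        |(h' p).det| * gramVolume fun i => diskDeriv (d := d) χ (h p) (EuclideanSpace.single i 1) := by
  -- Differentiability holds at every point of `S`. The Jacobian identity compares two derivatives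
  -- within `S`, so it is stated under a uniqueness assumption, which is discharged almost
  -- everywhere at the end.
  have key : ∀ p ∈ S, ∃ H : EuclideanSpace ℝ (Fin k) →L[ℝ] EuclideanSpace ℝ (Fin k),
      HasFDerivWithinAt h H S p ∧
      ((∀ (f : EuclideanSpace ℝ (Fin k) → EuclideanSpace ℝ (Fin d))
          (A B : EuclideanSpace ℝ (Fin k) →L[ℝ] EuclideanSpace ℝ (Fin d)),
          HasFDerivWithinAt f A S p → HasFDerivWithinAt f B S p → A = B) →
        (gramVolume fun i => mfderiv (𝓡 d) (𝓡 d) g (φ p)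
          (diskDeriv (d := d) φ p (EuclideanSpace.single i 1))) =
        |H.det| * gramVolume fun i =>
          diskDeriv (d := d) χ (h p) (EuclideanSpace.single i 1)) := by
    intro p hp
    have hφp : MDifferentiableWithinAt (𝓡 k) (𝓡 d) φ (unitDisk k) p :=
      (hφ p (hSD hp)).mdifferentiableWithinAt one_ne_zero
    have hχp : MDifferentiableWithinAt (𝓡 k) (𝓡 d) χ (unitDisk k) (h p) :=
      (hχ (h p) (hmaps hp)).mdifferentiableWithinAt one_ne_zero
    have huniq : UniqueMDiffWithinAt (𝓡 k) (unitDisk k) p := by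
      rw [uniqueMDiffWithinAt_iff_uniqueDiffWithinAt]
      exact uniqueDiffWithinAt_convex (convex_closedBall _ _)
        (by rw [interior_closedBall _ one_ne_zero]; exact ⟨0, by simp⟩)
        (subset_closure (hSD hp))
    set A₁ : EuclideanSpace ℝ (Fin k) →L[ℝ] EuclideanSpace ℝ (Fin d) :=
      mfderivWithin (𝓡 k) (𝓡 d) χ (unitDisk k) (h p) with hA₁
    set A₂ : EuclideanSpace ℝ (Fin k) →L[ℝ] EuclideanSpace ℝ (Fin d) :=
      mfderivWithin (𝓡 k) (𝓡 d) (g ∘ φ) (unitDisk k) p with hA₂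
    have h₁ : HasFDerivWithinAt (extChartAt (𝓡 d) (χ (h p)) ∘ χ) A₁ (unitDisk k) (h p) :=
      hasFDerivWithinAt_chart_of_mdifferentiableWithinAt hχp
    have hgφ : MDifferentiableWithinAt (𝓡 k) (𝓡 d) (g ∘ φ) (unitDisk k) p :=
      (hg p hp).comp_mdifferentiableWithinAt p hφp
    have h₂ : HasFDerivWithinAt (extChartAt (𝓡 d) ((g ∘ φ) p) ∘ (g ∘ φ)) A₂ (unitDisk k) p :=
      hasFDerivWithinAt_chart_of_mdifferentiableWithinAt hgφ
    have h₂' : HasFDerivWithinAt ((extChartAt (𝓡 d) (χ (h p)) ∘ χ) ∘ h) A₂ S p := by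
      refine (h₂.mono hSD).congr' (fun x hx => ?_) hp
      simp only [Function.comp_apply, hcomm x hx, hcomm p hp]
    have hinj : Function.Injective A₁ := hχ' (h p) (hmaps hp)
    -- As `χ` is an immersion, its derivative has a left inverse. The derivative of `h` is then read
    -- off from that of `χ ∘ h = g ∘ φ`.
    obtain ⟨L, hL⟩ := LinearMap.exists_leftInverse_of_injective
      (A₁ : EuclideanSpace ℝ (Fin k) →ₗ[ℝ] EuclideanSpace ℝ (Fin d)) (LinearMap.ker_eq_bot.2 hinj)
    have hL' : ∀ v, (LinearMap.toContinuousLinearMap L) (A₁ v) = v := fun v => by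
      simpa using LinearMap.congr_fun hL v
    have hH := hasFDerivWithinAt_of_comp_leftInverse hL' (hh p hp) hmaps h₁ h₂'
    refine ⟨_, hH, fun huniqS => ?_⟩
    have hcomp : HasFDerivWithinAt ((extChartAt (𝓡 d) (χ (h p)) ∘ χ) ∘ h)
        (A₁.comp ((LinearMap.toContinuousLinearMap L).comp A₂)) S p :=
      h₁.comp p hH hmaps
    have hAA := huniqS _ _ _ hcomp h₂'
    have hA₂' : ∀ v, A₂ v = mfderiv (𝓡 d) (𝓡 d) g (φ p) (diskDeriv (d := d) φ p v) := by
      intro v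
      rw [hA₂, mfderiv_comp_mfderivWithin p (hg p hp) hφp huniq]
      rfl
    have e1 : (gramVolume fun i => mfderiv (𝓡 d) (𝓡 d) g (φ p)
          (diskDeriv (d := d) φ p (EuclideanSpace.single i 1))) =
        gramVolume (V := TangentSpace (𝓡 d) (g (φ p)))
          (fun i => A₂ (EuclideanSpace.single i 1)) := by
      congr 1
      funext i
      exact (hA₂' _).symm
    rw [e1, gramVolume_congr_point (hcomm p hp).symm]
    have e2 := gramVolume_comp (V := TangentSpace (𝓡 d) (χ (h p)))
      (A₁ : EuclideanSpace ℝ (Fin k) →ₗ[ℝ] EuclideanSpace ℝ (Fin d))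
      ((LinearMap.toContinuousLinearMap L).comp A₂)
    refine Eq.trans ?_ e2
    congr 1
    funext i
    exact (DFunLike.congr_fun hAA _).symm
  choose! h' hh' using key
  refine ⟨h', fun p hp => (hh' p hp).1, ?_⟩
  filter_upwards [ae_restrict_hasFDerivWithinAt_unique (F := EuclideanSpace ℝ (Fin d)) volume hS,
    ae_restrict_mem hS] with p hp hpS
  exact (hh' p hpS).2 hp

end Transition

/-! ### Itineraries and separation times -/

section Itinerary

variable {M : Type*}

open Classical in
/-- The itinerary of a point under the return map. -/
def itinerary (f : M → M) (Λi : ℕ → Set M) (Ri : ℕ → ℕ) (x : M) : ℕ → ℕ := fun n =>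
  if h : ∃ i, (retMap f Λi Ri)^[n] x ∈ Λi i then h.choose else 0

variable {f : M → M} {Λi : ℕ → Set M} {Ri : ℕ → ℕ}

theorem eq_of_mem_of_mem (hdisj : Pairwise fun i j => Disjoint (Λi i) (Λi j)) {x : M} {i j : ℕ}
    (hi : x ∈ Λi i) (hj : x ∈ Λi j) : i = j := by
  by_contra h
  exact (Set.disjoint_left.1 (hdisj h) hi) hj

theorem itinerary_eq (hdisj : Pairwise fun i j => Disjoint (Λi i) (Λi j)) {x : M} {n i : ℕ}
    (hi : (retMap f Λi Ri)^[n] x ∈ Λi i) : itinerary f Λi Ri x n = i := by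
  have h : ∃ i, (retMap f Λi Ri)^[n] x ∈ Λi i := ⟨i, hi⟩
  rw [itinerary, dif_pos h]
  exact eq_of_mem_of_mem hdisj h.choose_spec hi

theorem mem_itinerary {x : M} (hx : x ∈ fullSet f Λi Ri) (n : ℕ) :
    (retMap f Λi Ri)^[n] x ∈ Λi (itinerary f Λi Ri x n) := by
  rw [itinerary, dif_pos (hx n)]
  exact (hx n).choose_spec

theorem recTime_eq (hdisj : Pairwise fun i j => Disjoint (Λi i) (Λi j)) {x : M} {i : ℕ}
    (hi : x ∈ Λi i) : recTime Λi Ri x = Ri i := by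
  have h : ∃ i, x ∈ Λi i := ⟨i, hi⟩
  rw [recTime, dif_pos h, eq_of_mem_of_mem hdisj h.choose_spec hi]

theorem recTime_eq_itinerary (hdisj : Pairwise fun i j => Disjoint (Λi i) (Λi j)) {x : M}
    (hx : x ∈ fullSet f Λi Ri) : recTime Λi Ri x = Ri (itinerary f Λi Ri x 0) :=
  recTime_eq hdisj (mem_itinerary hx 0)

theorem retMap_eq (hdisj : Pairwise fun i j => Disjoint (Λi i) (Λi j)) {x : M} {i : ℕ}
    (hi : x ∈ Λi i) : retMap f Λi Ri x = f^[Ri i] x := by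
  rw [retMap, recTime_eq hdisj hi]

theorem mem_fullSet_of_retMap {x : M} {i : ℕ} (hi : x ∈ Λi i)
    (hx : retMap f Λi Ri x ∈ fullSet f Λi Ri) : x ∈ fullSet f Λi Ri := by
  intro n
  cases n with
  | zero => exact ⟨i, hi⟩
  | succ n => rw [Function.iterate_succ_apply]; exact hx n

theorem itinerary_retMap {x : M} (n : ℕ) :
    itinerary f Λi Ri (retMap f Λi Ri x) n = itinerary f Λi Ri x (n + 1) := by
  have h (i : ℕ) : (retMap f Λi Ri)^[n] (retMap f Λi Ri x) ∈ Λi i ↔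
      (retMap f Λi Ri)^[n + 1] x ∈ Λi i := by rw [Function.iterate_succ_apply]
  unfold itinerary
  congr 1

theorem le_sepTime (hdisj : Pairwise fun i j => Disjoint (Λi i) (Λi j)) {x y : M}
    (hx : x ∈ fullSet f Λi Ri) (hy : y ∈ fullSet f Λi Ri) {m : ℕ}
    (h : ∀ j < m, itinerary f Λi Ri x j = itinerary f Λi Ri y j) :
    (m : ℕ∞) ≤ sepTime f Λi Ri x y := by
  rw [sepTime, if_pos ⟨hx, hy⟩]
  refine le_iInf fun n => le_iInf fun ⟨i, j, hij, hi, hj⟩ => ?_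
  by_contra hlt
  push Not at hlt
  have hn : n < m := by exact_mod_cast hlt
  apply hij
  rw [← itinerary_eq hdisj hi, ← itinerary_eq hdisj hj, h n hn]

theorem itinerary_eq_of_lt_sepTime {x y : M}
    (hx : x ∈ fullSet f Λi Ri) (hy : y ∈ fullSet f Λi Ri) {n : ℕ}
    (h : (n : ℕ∞) < sepTime f Λi Ri x y) : itinerary f Λi Ri x n = itinerary f Λi Ri y n := by
  rw [sepTime, if_pos ⟨hx, hy⟩] at h
  by_contra hne
  refine absurd h (not_lt.2 ?_)
  exact iInf₂_le n ⟨_, _, hne, mem_itinerary hx n, mem_itinerary hy n⟩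

theorem powSep_le {β : ℝ} (h0 : 0 < β) (h1 : β < 1) {m : ℕ} {s : ℕ∞} (h : (m : ℕ∞) ≤ s) :
    powSep β s ≤ β ^ m := by
  unfold powSep
  split_ifs with hs
  · positivity
  · refine pow_le_pow_of_le_one h0.le h1.le ?_
    lift s to ℕ using hs
    simpa using h

theorem sepTime_eq_top (hdisj : Pairwise fun i j => Disjoint (Λi i) (Λi j)) {x y : M}
    (hx : x ∈ fullSet f Λi Ri) (hy : y ∈ fullSet f Λi Ri)
    (h : itinerary f Λi Ri x = itinerary f Λi Ri y) : sepTime f Λi Ri x y = ⊤ := by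
  refine ENat.eq_top_iff_forall_ge.2 fun m => le_sepTime hdisj hx hy fun j _ => by rw [h]

end Itinerary

/-! ### Disks of a continuous family and their Lebesgue measures -/

section Disks

variable {d : ℕ} {M : Type u} [EMetricSpace M] [ChartedSpace (EuclideanSpace ℝ (Fin d)) M]
  [IsManifold (𝓡 d) 1 M] {k : ℕ}

namespace DiskFamily

theorem eq_of_param_eq (Γ : DiskFamily d M k) {a a' : Γ.K} {p p' : EuclideanSpace ℝ (Fin k)}
    (hp : p ∈ unitDisk k) (hp' : p' ∈ unitDisk k) (h : Γ.Φ a p = Γ.Φ a' p') : a = a' ∧ p = p' := by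
  have h1 : ((a, p) : Γ.K × EuclideanSpace ℝ (Fin k)) ∈ (univ : Set Γ.K) ×ˢ unitDisk k :=
    mk_mem_prod (mem_univ _) hp
  have h2 : ((a', p') : Γ.K × EuclideanSpace ℝ (Fin k)) ∈ (univ : Set Γ.K) ×ˢ unitDisk k :=
    mk_mem_prod (mem_univ _) hp'
  exact Prod.mk.inj (Γ.injOn h1 h2 h)

theorem param_unique (Γ : DiskFamily d M k) {x : M} {a a' : Γ.K} (h : x ∈ Γ.disk a)
    (h' : x ∈ Γ.disk a') : a = a' := by
  obtain ⟨p, hp, hpe⟩ := h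
  obtain ⟨q, hq, hqe⟩ := h'
  exact (Γ.eq_of_param_eq hp hq (hpe.trans hqe.symm)).1

theorem injOn_disk (Γ : DiskFamily d M k) (a : Γ.K) : InjOn (Γ.Φ a) (unitDisk k) :=
  fun _ hp _ hq h => (Γ.eq_of_param_eq hp hq h).2

theorem continuousOn_disk (Γ : DiskFamily d M k) (a : Γ.K) : ContinuousOn (Γ.Φ a) (unitDisk k) :=
  (Γ.contMDiffOn a).continuousOn

theorem isCompact_disk (Γ : DiskFamily d M k) (a : Γ.K) : IsCompact (Γ.disk a) :=
  (isCompact_closedBall _ _).image_of_continuousOn (Γ.continuousOn_disk a)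

theorem support_eq_image (Γ : DiskFamily d M k) :
    Γ.support = (fun q : Γ.K × EuclideanSpace ℝ (Fin k) => Γ.Φ q.1 q.2) '' (univ ×ˢ unitDisk k) := by
  ext y
  simp only [support, mem_iUnion, disk, mem_image, mem_prod, mem_univ, true_and, Prod.exists]

theorem isCompact_support (Γ : DiskFamily d M k) : IsCompact Γ.support := by
  rw [support_eq_image]
  exact (isCompact_univ.prod (isCompact_closedBall _ _)).image_of_continuousOn Γ.continuousOn

theorem mem_support {Γ : DiskFamily d M k} {x : M} {a : Γ.K} (h : x ∈ Γ.disk a) : x ∈ Γ.support :=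
  mem_iUnion.2 ⟨a, h⟩

theorem support_subset {Γ₀ Γ : DiskFamily d M k} (h : Γ₀.disks ⊆ Γ.disks) :
    Γ₀.support ⊆ Γ.support := by
  intro x hx
  obtain ⟨a, ha⟩ := mem_iUnion.1 hx
  obtain ⟨a', ha'⟩ := h ⟨a, rfl⟩
  exact mem_iUnion.2 ⟨a', by rw [ha']; exact ha⟩

/-- The disks of a family are pairwise disjoint, so the disk through a point is unique. The member
of the subfamily through `x` must therefore be the given disk. Saturation of s-subsets and u-subsets
rests on this. -/
theorem disk_subset_support {Γ₀ Γ : DiskFamily d M k} (h : Γ₀.disks ⊆ Γ.disks) {x : M} {a : Γ.K}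
    (hx : x ∈ Γ₀.support) (ha : x ∈ Γ.disk a) : Γ.disk a ⊆ Γ₀.support := by
  obtain ⟨a₀, ha₀⟩ := mem_iUnion.1 hx
  obtain ⟨a', ha'⟩ := h ⟨a₀, rfl⟩
  have hx' : x ∈ Γ.disk a' := by rw [ha']; exact ha₀
  rw [Γ.param_unique ha hx', ha']
  exact subset_iUnion Γ₀.disk a₀

variable [MeasurableSpace M] [BorelSpace M]

theorem aemeasurable_param (Γ : DiskFamily d M k) (a : Γ.K) :
    AEMeasurable (Γ.Φ a) ((volume : Measure (EuclideanSpace ℝ (Fin k))).restrict (unitDisk k)) :=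
  (Γ.continuousOn_disk a).aemeasurable Metric.isClosed_closedBall.measurableSet

theorem measurableSet_param_preimage (Γ : DiskFamily d M k) (a : Γ.K) {E : Set M}
    (hE : MeasurableSet E) : MeasurableSet (unitDisk k ∩ Γ.Φ a ⁻¹' E) := by
  have h := (Γ.continuousOn_disk a).domRestrict.measurable hE
  have h2 := (MeasurableEmbedding.subtype_coe
    (Metric.isClosed_closedBall.measurableSet : MeasurableSet (unitDisk k))).measurableSet_image' h
  convert h2 using 1
  ext p
  simp [and_comm]

variable [RiemannianBundle (fun y : M => TangentSpace (𝓡 d) y)]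

theorem leb_apply (Γ : DiskFamily d M k) (a : Γ.K) {E : Set M} (hE : MeasurableSet E) :
    Γ.leb a E = ∫⁻ p in unitDisk k ∩ Γ.Φ a ⁻¹' E, ENNReal.ofReal
      (gramVolume fun i => diskDeriv (d := d) (Γ.Φ a) p (EuclideanSpace.single i 1)) := by
  rw [leb, Measure.map_apply_of_aemeasurable
    ((Γ.aemeasurable_param a).mono_ac (withDensity_absolutelyContinuous _ _)) hE]
  set G := fun p => ENNReal.ofReal
      (gramVolume fun i => diskDeriv (d := d) (Γ.Φ a) p (EuclideanSpace.single i 1))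
  have hD : MeasurableSet (unitDisk k) := Metric.isClosed_closedBall.measurableSet
  have h0 : ((volume.restrict (unitDisk k)).withDensity G) (unitDisk k)ᶜ = 0 := by
    refine (withDensity_absolutelyContinuous _ _) ?_
    rw [Measure.restrict_apply hD.compl]; simp
  rw [← measure_inter_conull (t := unitDisk k) h0, inter_comm,
    withDensity_apply _ (Γ.measurableSet_param_preimage a hE),
    Measure.restrict_restrict (Γ.measurableSet_param_preimage a hE)]
  congr 2
  ext p; simp; tauto

theorem leb_compl_disk (Γ : DiskFamily d M k) (a : Γ.K) : Γ.leb a (Γ.disk a)ᶜ = 0 := by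
  rw [Γ.leb_apply a (Γ.isCompact_disk a).isClosed.measurableSet.compl]
  have : unitDisk k ∩ Γ.Φ a ⁻¹' (Γ.disk a)ᶜ = ∅ := by
    ext p
    simp only [mem_inter_iff, mem_preimage, mem_compl_iff, mem_empty_iff_false, iff_false, not_and,
      not_not]
    exact fun hp => ⟨p, hp, rfl⟩
  rw [this]; simp

theorem leb_inter_disk (Γ : DiskFamily d M k) (a : Γ.K) (E : Set M) :
    Γ.leb a (E ∩ Γ.disk a) = Γ.leb a E :=
  measure_inter_conull (Γ.leb_compl_disk a)

end DiskFamily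

end Disks

/-! ### Markov structure: stable saturation, injectivity, covering, measurability -/

namespace YoungStructure

variable {d : ℕ} {M : Type u} [EMetricSpace M]
  [ChartedSpace (EuclideanSpace ℝ (Fin d)) M] [IsManifold (𝓡 d) 1 M] [MeasurableSpace M]
  [RiemannianBundle (fun y : M => TangentSpace (𝓡 d) y)] {f : M → M} {U : ℕ → Set M}
  (Y : YoungStructure (d := d) f U)

/-- The itinerary of a point of `Λ'`. -/
def itin : M → ℕ → ℕ := itinerary f Y.Λi Y.Ri

variable {Y}

theorem fR_eq {x : M} {i : ℕ} (hx : x ∈ Y.Λi i) : Y.fR x = f^[Y.Ri i] x :=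
  retMap_eq Y.pairwise_disjoint hx

theorem itin_eq {x : M} {n i : ℕ} (h : Y.fR^[n] x ∈ Y.Λi i) : Y.itin x n = i :=
  itinerary_eq Y.pairwise_disjoint h

theorem mem_itin {x : M} (hx : x ∈ Y.Λ') (n : ℕ) : Y.fR^[n] x ∈ Y.Λi (Y.itin x n) :=
  mem_itinerary hx n

theorem R_eq {x : M} (hx : x ∈ Y.Λ') : Y.R x = Y.Ri (Y.itin x 0) :=
  recTime_eq_itinerary Y.pairwise_disjoint hx

theorem itin_fR (x : M) (n : ℕ) : Y.itin (Y.fR x) n = Y.itin x (n + 1) := itinerary_retMap n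

theorem Λi_subset_Λ (i : ℕ) : Y.Λi i ⊆ Y.Λ := by
  obtain ⟨Γ₀, hΓ, hp⟩ := Y.isSSubset i
  rw [hp.eq_inter, Y.product.eq_inter]
  exact inter_subset_inter_left _ (DiskFamily.support_subset hΓ)

theorem Λ'_subset_Λ : Y.Λ' ⊆ Y.Λ := fun _ hx => Λi_subset_Λ _ (mem_itin hx 0)

theorem image_Λi_subset_Λ {x : M} {i : ℕ} (hx : x ∈ Y.Λi i) : f^[Y.Ri i] x ∈ Y.Λ := by
  obtain ⟨Γ₀, hΓ, hp⟩ := Y.isUSubset i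
  have h : f^[Y.Ri i] x ∈ f^[Y.Ri i] '' Y.Λi i := ⟨x, hx, rfl⟩
  rw [hp.eq_inter] at h
  rw [Y.product.eq_inter]
  exact ⟨h.1, DiskFamily.support_subset hΓ h.2⟩

theorem exists_stable {x : M} (hx : x ∈ Y.Λ) : ∃ a, x ∈ Y.Γs.disk a := by
  rw [Y.product.eq_inter] at hx
  exact mem_iUnion.1 hx.1

theorem exists_unstable {x : M} (hx : x ∈ Y.Λ) : ∃ b, x ∈ Y.Γu.disk b := by
  rw [Y.product.eq_inter] at hx
  exact mem_iUnion.1 hx.2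

theorem mem_Λ {x : M} {a : Y.Γs.K} {b : Y.Γu.K} (ha : x ∈ Y.Γs.disk a) (hb : x ∈ Y.Γu.disk b) :
    x ∈ Y.Λ := by
  rw [Y.product.eq_inter]
  exact ⟨DiskFamily.mem_support ha, DiskFamily.mem_support hb⟩

/-- The sets `Λᵢ` are saturated by stable disks. -/
theorem mem_Λi_of_stable {x y : M} {i : ℕ} {a : Y.Γs.K} (hx : x ∈ Y.Λi i) (ha : x ∈ Y.Γs.disk a)
    (hy : y ∈ Y.Λ) (hya : y ∈ Y.Γs.disk a) : y ∈ Y.Λi i := by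
  obtain ⟨Γ₀, hΓ, hp⟩ := Y.isSSubset i
  rw [hp.eq_inter] at hx ⊢
  rw [Y.product.eq_inter] at hy
  exact ⟨DiskFamily.disk_subset_support hΓ hx.1 ha hya, hy.2⟩

/-- The sets `f^{Rᵢ}(Λᵢ)` are saturated by unstable disks. -/
theorem mem_image_of_unstable {x y : M} {i : ℕ} {b : Y.Γu.K} (hx : x ∈ f^[Y.Ri i] '' Y.Λi i)
    (hb : x ∈ Y.Γu.disk b) (hy : y ∈ Y.Λ) (hyb : y ∈ Y.Γu.disk b) :
    y ∈ f^[Y.Ri i] '' Y.Λi i := by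
  obtain ⟨Γ₀, hΓ, hp⟩ := Y.isUSubset i
  rw [hp.eq_inter] at hx ⊢
  rw [Y.product.eq_inter] at hy
  exact ⟨hy.1, DiskFamily.disk_subset_support hΓ hx.2 hb hyb⟩

theorem fR_mem_Λ {x : M} {i : ℕ} (hx : x ∈ Y.Λi i) : Y.fR x ∈ Y.Λ := by
  rw [fR_eq hx]; exact image_Λi_subset_Λ hx

/-- Points of `Λ` on the same stable disk have the same itinerary. -/
theorem iterate_stable {x y : M} {a : Y.Γs.K} (hx : x ∈ Y.Λ') (ha : x ∈ Y.Γs.disk a) (hy : y ∈ Y.Λ)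
    (hya : y ∈ Y.Γs.disk a) (n : ℕ) : ∃ a', Y.fR^[n] x ∈ Y.Γs.disk a' ∧
      Y.fR^[n] y ∈ Y.Γs.disk a' ∧ Y.fR^[n] y ∈ Y.Λi (Y.itin x n) := by
  have key : ∃ a', Y.fR^[n] x ∈ Y.Γs.disk a' ∧ Y.fR^[n] y ∈ Y.Γs.disk a' ∧ Y.fR^[n] y ∈ Y.Λ := by
    induction n with
    | zero => exact ⟨a, ha, hya, hy⟩
    | succ n ih =>
      obtain ⟨a', h1, h2, h3⟩ := ih
      have hxi := mem_itin hx n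
      have hyi := mem_Λi_of_stable hxi h1 h3 h2
      rw [Function.iterate_succ_apply', Function.iterate_succ_apply']
      obtain ⟨a'', ha''⟩ := exists_stable (fR_mem_Λ hxi)
      refine ⟨a'', ha'', ?_, fR_mem_Λ hyi⟩
      rw [fR_eq hxi] at ha''
      rw [fR_eq hyi]
      exact Y.markov_stable _ _ hxi _ _ h1 ha'' ⟨_, h2, rfl⟩
  obtain ⟨a', h1, h2, h3⟩ := key
  exact ⟨a', h1, h2, mem_Λi_of_stable (mem_itin hx n) h1 h3 h2⟩

theorem mem_Λ'_of_stable {x y : M} {a : Y.Γs.K} (hx : x ∈ Y.Λ') (ha : x ∈ Y.Γs.disk a)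
    (hy : y ∈ Y.Λ) (hya : y ∈ Y.Γs.disk a) : y ∈ Y.Λ' := fun n => by
  obtain ⟨_, _, _, h⟩ := iterate_stable hx ha hy hya n
  exact ⟨_, h⟩

theorem itin_eq_of_stable {x y : M} {a : Y.Γs.K} (hx : x ∈ Y.Λ') (ha : x ∈ Y.Γs.disk a)
    (hy : y ∈ Y.Λ) (hya : y ∈ Y.Γs.disk a) : Y.itin y = Y.itin x := by
  funext n
  obtain ⟨_, _, _, h⟩ := iterate_stable hx ha hy hya n
  exact itin_eq h

theorem isClosed_Λi (i : ℕ) : IsClosed (Y.Λi i) := by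
  obtain ⟨Γ₀, -, hp⟩ := Y.isSSubset i
  rw [hp.eq_inter]
  exact Γ₀.isCompact_support.isClosed.inter Y.Γu.isCompact_support.isClosed

/-- Two points of the same `Λᵢ` with the same image have equal itineraries, hence infinite
separation time. As `β ^ ∞ = 0`, the expansion estimate with `n = 0` forces their distance to
vanish. -/
theorem fR_injOn {x y : M} {i : ℕ} {b : Y.Γu.K} (hx : x ∈ Y.Λ') (hxi : x ∈ Y.Λi i)
    (hxb : x ∈ Y.Γu.disk b) (hy : y ∈ Y.Λ') (hyi : y ∈ Y.Λi i) (hyb : y ∈ Y.Γu.disk b)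
    (h : Y.fR x = Y.fR y) : x = y := by
  have hit : Y.itin x = Y.itin y := by
    funext n
    cases n with
    | zero => exact (itin_eq (n := 0) hxi).trans (itin_eq (n := 0) hyi).symm
    | succ n => rw [← itin_fR, ← itin_fR, h]
  have hs := sepTime_eq_top Y.pairwise_disjoint hx hy hit
  have := Y.expansion_return i b x ⟨⟨hxb, hxi⟩, hx⟩ y ⟨⟨hyb, hyi⟩, hy⟩ 0
  rw [hs] at this
  simpa [powSep] using this

theorem iterate_mem_pieces {x : M} {i : ℕ} (hx : x ∈ Y.Λi i) : ∀ j < Y.Ri i, f^[j] x ∈ ⋃ l, U l := by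
  obtain ⟨b, hb⟩ := exists_unstable (Λi_subset_Λ i hx)
  obtain ⟨b', hb'⟩ := exists_unstable (image_Λi_subset_Λ hx)
  obtain ⟨W, -, hW, hWU, -⟩ := Y.markov_unstable i x hx b b' hb hb'
  exact hWU x (hW ⟨hb, hx⟩)

theorem continuousOn_iterate (hf : IsPiecewiseC1Diffeo (d := d) f U) (i : ℕ) :
    ContinuousOn f^[Y.Ri i] (Y.Λi i) := fun _ hx =>
  (mdifferentiableAt_iterate hf (iterate_mem_pieces hx)).1.continuousAt.continuousWithinAt

/-- An unstable disk is mapped by the return map, along `Λᵢ`, into one unstable disk. -/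
theorem fR_mem_disk {x y : M} {i : ℕ} {b b' : Y.Γu.K} (hx : x ∈ Y.Λi i) (hxb : x ∈ Y.Γu.disk b)
    (hxb' : Y.fR x ∈ Y.Γu.disk b') (hy : y ∈ Y.Λi i) (hyb : y ∈ Y.Γu.disk b) :
    Y.fR y ∈ Y.Γu.disk b' := by
  rw [fR_eq hx] at hxb'
  rw [fR_eq hy]
  obtain ⟨W, -, hW, -, hWb⟩ := Y.markov_unstable i x hx b b' hxb hxb'
  rw [← hWb]
  exact ⟨y, hW ⟨hyb, hy⟩, rfl⟩

/-- The image of an unstable disk under the return map covers the part of `Λ` in the target. -/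
theorem exists_preimage {x y : M} {i : ℕ} {b b' : Y.Γu.K} (hx : x ∈ Y.Λi i)
    (hxb : x ∈ Y.Γu.disk b) (hxb' : Y.fR x ∈ Y.Γu.disk b') (hy : y ∈ Y.Λ)
    (hyb' : y ∈ Y.Γu.disk b') : ∃ z ∈ Y.Λi i, z ∈ Y.Γu.disk b ∧ Y.fR z = y := by
  have hx' : Y.fR x ∈ f^[Y.Ri i] '' Y.Λi i := by rw [fR_eq hx]; exact ⟨x, hx, rfl⟩
  obtain ⟨w, hw, hwy⟩ := mem_image_of_unstable hx' hxb' hy hyb'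
  obtain ⟨a, ha⟩ := exists_stable (Λi_subset_Λ i hw)
  obtain ⟨a', ha'⟩ := exists_stable hy
  -- The preimage `w` of `y` may lie on another unstable disk. It is moved along its stable disk to
  -- the disk `b`. The image stays on the stable disk of `y` and lands on `b'`, and these two disks
  -- meet in one point only.
  obtain ⟨z, ⟨hza, hzb⟩, -⟩ := Y.product.existsUnique a b
  have hz := mem_Λi_of_stable hw ha (mem_Λ hza hzb) hza
  refine ⟨z, hz, hzb, ?_⟩
  obtain ⟨_, -, huniq⟩ := Y.product.existsUnique a' b'
  have h1 : Y.fR z ∈ Y.Γs.disk a' := by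
    rw [fR_eq hz]
    exact Y.markov_stable i w hw a a' ha (by rw [hwy]; exact ha') ⟨z, hza, rfl⟩
  rw [huniq _ ⟨h1, fR_mem_disk hx hxb hxb' hz hzb⟩, huniq _ ⟨ha', hyb'⟩]

section Measurability

variable [BorelSpace M]

theorem measurable_fR (hf : IsPiecewiseC1Diffeo (d := d) f U) : Measurable Y.fR := by
  intro B hB
  -- Off the union of the `Λᵢ` the recurrence time has the default value `0`, so the return map is
  -- the identity there.
  have hpre : Y.fR ⁻¹' B = (⋃ i, Y.Λi i ∩ f^[Y.Ri i] ⁻¹' B) ∪ ((⋃ i, Y.Λi i)ᶜ ∩ B) := by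
    ext x
    by_cases hx : ∃ i, x ∈ Y.Λi i
    · obtain ⟨i, hi⟩ := hx
      simp only [mem_preimage, mem_union, mem_iUnion, mem_inter_iff, mem_compl_iff]
      rw [fR_eq hi]
      constructor
      · exact fun h => Or.inl ⟨i, hi, h⟩
      · rintro (⟨j, hj, h⟩ | ⟨h, -⟩)
        · rwa [eq_of_mem_of_mem Y.pairwise_disjoint hi hj]
        · exact absurd ⟨i, hi⟩ h
    · have hR : Y.fR x = x := by
        show f^[recTime Y.Λi Y.Ri x] x = x
        rw [recTime, dif_neg hx]; rfl
      simp only [mem_preimage, hR, mem_union, mem_iUnion, mem_inter_iff, mem_compl_iff, hx,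
        not_false_eq_true, true_and]
      exact ⟨Or.inr, fun h => h.elim (fun ⟨j, hj, _⟩ => absurd ⟨j, hj⟩ hx) id⟩
  rw [hpre]
  have hΛ : ∀ i, MeasurableSet (Y.Λi i) := fun i => (isClosed_Λi i).measurableSet
  refine (MeasurableSet.iUnion fun i => ?_).union ((MeasurableSet.iUnion hΛ).compl.inter hB)
  have h := (continuousOn_iterate (Y := Y) hf i).domRestrict.measurable hB
  have h2 := (MeasurableEmbedding.subtype_coe (hΛ i)).measurableSet_image' h
  convert h2 using 1
  ext p
  simp [and_comm]

theorem measurableSet_Λ' (hf : IsPiecewiseC1Diffeo (d := d) f U) : MeasurableSet Y.Λ' := by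
  have : Y.Λ' = ⋂ n, ⋃ i, Y.fR^[n] ⁻¹' (Y.Λi i) := by
    ext x; simp only [mem_iInter, mem_iUnion]; rfl
  rw [this]
  exact MeasurableSet.iInter fun n => MeasurableSet.iUnion fun i =>
    ((measurable_fR hf).iterate n) (isClosed_Λi i).measurableSet

theorem measurable_itin (hf : IsPiecewiseC1Diffeo (d := d) f U) : Measurable Y.itin := by
  refine measurable_pi_iff.2 fun n => measurable_to_countable' fun i => ?_
  have hm : ∀ j, MeasurableSet (Y.fR^[n] ⁻¹' (Y.Λi j)) := fun j =>
    ((measurable_fR hf).iterate n) (isClosed_Λi j).measurableSet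
  -- The default symbol of an undefined itinerary entry is `0`, which accounts for the second set.
  have : (fun x => Y.itin x n) ⁻¹' {i} = (Y.fR^[n] ⁻¹' (Y.Λi i)) ∪
      ((⋃ j, Y.fR^[n] ⁻¹' (Y.Λi j))ᶜ ∩ {_x | i = 0}) := by
    ext x
    simp only [mem_preimage, mem_singleton_iff, mem_union, mem_inter_iff, mem_compl_iff, mem_iUnion,
      mem_ofPred_eq]
    by_cases hx : ∃ j, Y.fR^[n] x ∈ Y.Λi j
    · obtain ⟨j, hj⟩ := hx
      rw [itin_eq hj]
      constructor
      · rintro rfl; exact Or.inl hj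
      · rintro (h | ⟨h, -⟩)
        · exact eq_of_mem_of_mem Y.pairwise_disjoint hj h
        · exact absurd ⟨j, hj⟩ h
    · have h0 : Y.itin x n = 0 := dif_neg hx
      rw [h0]
      constructor
      · exact fun h => Or.inr ⟨hx, h.symm⟩
      · rintro (h | ⟨-, h⟩)
        · exact absurd ⟨i, h⟩ hx
        · exact h.symm
  rw [this]
  exact (hm i).union ((MeasurableSet.iUnion hm).compl.inter (MeasurableSet.const _))

end Measurability

end YoungStructure

/-- The left shift on sequences. -/
def shift (x : ℕ → ℕ) : ℕ → ℕ := fun n => x (n + 1)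

theorem measurable_shift : Measurable shift :=
  measurable_pi_iff.2 fun n => measurable_pi_apply (n + 1)

theorem measurableSet_cylinder (v : ℕ → ℕ) (m : ℕ) : MeasurableSet (PiNat.cylinder v m) := by
  rw [PiNat.cylinder_eq_pi]
  exact MeasurableSet.pi (Finset.countable_toSet _) fun _ _ => MeasurableSet.of_discrete

/-- A pointwise bound on ratios of `J` is integrated first over `P` and then over `Q`. The
cross-multiplied form avoids division by null measures; all distortion estimates below have this
shape. -/
theorem lintegral_mul_lintegral_le {α : Type*} [MeasurableSpace α] {μ : Measure α} {P Q : Set α}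
    (hP : MeasurableSet P) (hQ : MeasurableSet Q) {J : α → ℝ} {G : α → ℝ≥0∞} {c : ℝ} (hc : 0 ≤ c)
    (h : ∀ x ∈ P, ∀ y ∈ Q, J x ≤ c * J y)
    (hPG : ∫⁻ x in P, G x ∂μ ≠ ⊤) (hPJ : ∫⁻ x in P, ENNReal.ofReal (J x) * G x ∂μ ≠ ⊤) :
    (∫⁻ x in P, ENNReal.ofReal (J x) * G x ∂μ) * ∫⁻ x in Q, G x ∂μ ≤
      ENNReal.ofReal c * ((∫⁻ x in Q, ENNReal.ofReal (J x) * G x ∂μ) * ∫⁻ x in P, G x ∂μ) := by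
  have h1 : ∀ y ∈ Q, ∫⁻ x in P, ENNReal.ofReal (J x) * G x ∂μ ≤
      ENNReal.ofReal c * ENNReal.ofReal (J y) * ∫⁻ x in P, G x ∂μ := by
    intro y hy
    rw [← ENNReal.ofReal_mul hc, ← lintegral_const_mul' _ _ ENNReal.ofReal_ne_top]
    refine setLIntegral_mono' hP fun x hx => ?_
    gcongr
    exact h x hx y hy
  rw [← lintegral_const_mul' _ _ hPJ]
  calc ∫⁻ y in Q, (∫⁻ x in P, ENNReal.ofReal (J x) * G x ∂μ) * G y ∂μ
      ≤ ∫⁻ y in Q, (ENNReal.ofReal c * ∫⁻ x in P, G x ∂μ) * (ENNReal.ofReal (J y) * G y) ∂μ := by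
        refine setLIntegral_mono' hQ fun y hy => ?_
        calc _ ≤ (ENNReal.ofReal c * ENNReal.ofReal (J y) * ∫⁻ x in P, G x ∂μ) * G y := by
              gcongr; exact h1 y hy
          _ = _ := by ring
    _ = _ := by
        rw [lintegral_const_mul' _ _ (ENNReal.mul_ne_top ENNReal.ofReal_ne_top hPG)]
        ring

/-! ### Distribution of itineraries on unstable disks, and stable holonomy -/

namespace YoungStructure

variable {d : ℕ} {M : Type u} [EMetricSpace M]
  [ChartedSpace (EuclideanSpace ℝ (Fin d)) M] [IsManifold (𝓡 d) 1 M] [MeasurableSpace M]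
  [RiemannianBundle (fun y : M => TangentSpace (𝓡 d) y)] {f : M → M} {U : ℕ → Set M}
  (Y : YoungStructure (d := d) f U)

/-- The distribution of the itinerary under the Lebesgue measure of an unstable disk. -/
def unstableMeasure (b : Y.Γu.K) : Measure (ℕ → ℕ) := ((Y.Γu.leb b).restrict Y.Λ').map Y.itin

variable {Y}

theorem holonomy_spec (b : Y.Γu.K) {x : M} (hx : x ∈ Y.Λ) : ∃ a, x ∈ Y.Γs.disk a ∧
    holonomy Y.Γs Y.Γu b x ∈ Y.Γs.disk a ∩ Y.Γu.disk b := by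
  obtain ⟨a, ha⟩ := exists_stable hx
  obtain ⟨y, hy, -⟩ := Y.product.existsUnique a b
  have h : ∃ y, ∃ a, x ∈ Y.Γs.disk a ∧ y ∈ Y.Γs.disk a ∩ Y.Γu.disk b := ⟨y, a, ha, hy⟩
  rw [holonomy, dif_pos h]
  exact h.choose_spec

/-- Sliding a point of `Λ` along its stable disk changes neither its itinerary nor its membership in
`Λ'`. Sets defined by itineraries are thus invariant under holonomy, which makes distributions on
different unstable disks comparable. -/
theorem holonomy_preimage (b : Y.Γu.K) (A : Set (ℕ → ℕ)) :
    holonomy Y.Γs Y.Γu b ⁻¹' (Y.itin ⁻¹' A ∩ Y.Λ') ∩ Y.Λ = Y.itin ⁻¹' A ∩ Y.Λ' := by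
  ext x
  simp only [mem_inter_iff, mem_preimage]
  constructor
  · rintro ⟨⟨h1, h2⟩, hx⟩
    obtain ⟨a, ha, hy⟩ := holonomy_spec b hx
    exact ⟨by rwa [itin_eq_of_stable h2 hy.1 hx ha], mem_Λ'_of_stable h2 hy.1 hx ha⟩
  · rintro ⟨h1, h2⟩
    have hx := Λ'_subset_Λ h2
    obtain ⟨a, ha, hy⟩ := holonomy_spec b hx
    have hyΛ := mem_Λ hy.1 hy.2
    exact ⟨⟨by rwa [itin_eq_of_stable h2 ha hyΛ hy.1], mem_Λ'_of_stable h2 ha hyΛ hy.1⟩, hx⟩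

theorem le_sepTime_of_cylinder {A B : Set (ℕ → ℕ)} {v : ℕ → ℕ} {m : ℕ}
    (hAv : A ⊆ PiNat.cylinder v m) (hBv : B ⊆ PiNat.cylinder v m) {x y : M}
    (hx : x ∈ Y.itin ⁻¹' A ∩ Y.Λ') (hy : y ∈ Y.itin ⁻¹' B ∩ Y.Λ') :
    (m : ℕ∞) ≤ sepTime f Y.Λi Y.Ri x y :=
  le_sepTime Y.pairwise_disjoint hx.2 hy.2 fun j hj =>
    (hAv hx.1 j hj).trans (hBv hy.1 j hj).symm

theorem exp_powSep_le {m : ℕ} {s : ℕ∞} (h : (m : ℕ∞) ≤ s) :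
    Real.exp (Y.C * powSep Y.β s) ≤ Real.exp (Y.C * Y.β ^ m) :=
  Real.exp_le_exp.2 (mul_le_mul_of_nonneg_left (powSep_le Y.β_pos Y.β_lt_one h) Y.C_pos.le)

variable [BorelSpace M]

theorem unstableMeasure_apply (hf : IsPiecewiseC1Diffeo (d := d) f U) (b : Y.Γu.K)
    {A : Set (ℕ → ℕ)} (hA : MeasurableSet A) :
    Y.unstableMeasure b A = Y.Γu.leb b (Y.itin ⁻¹' A ∩ Y.Λ') := by
  rw [unstableMeasure, Measure.map_apply (measurable_itin hf) hA,
    Measure.restrict_apply (measurable_itin hf hA)]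

theorem exists_holonomy_density (hf : IsPiecewiseC1Diffeo (d := d) f U) (b b' : Y.Γu.K) :
    ∃ ρ : M → ℝ≥0,
      (∀ A, MeasurableSet A → Y.unstableMeasure b A =
        ∫⁻ x in (Y.itin ⁻¹' A ∩ Y.Λ') ∩ Y.Γu.disk b', (ρ x : ℝ≥0∞) ∂(Y.Γu.leb b')) ∧
      Y.Γu.leb b Y.Λ ≤ ENNReal.ofReal Y.C ∧
      ∀ x ∈ Y.Γu.disk b' ∩ Y.Λ, ∀ y ∈ Y.Γu.disk b' ∩ Y.Λ,
        (ρ x : ℝ) ≤ Real.exp (Y.C * powSep Y.β (sepTime f Y.Λi Y.Ri x y)) * ρ y := by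
  obtain ⟨ρ, -, hmap, hlow, hup, hreg⟩ := Y.holonomy_regular b b'
  have hΛ : MeasurableSet Y.Λ := Y.isCompact.isClosed.measurableSet
  have hdisk : MeasurableSet (Y.Γu.disk b') := (Y.Γu.isCompact_disk b').isClosed.measurableSet
  have haedisk : ∀ E : Set M, (E ∩ Y.Γu.disk b' : Set M) =ᵐ[Y.Γu.leb b'] E := fun E =>
    inter_ae_eq_left_of_ae_eq_univ (ae_eq_univ.2 (Y.Γu.leb_compl_disk b'))
  have hdens : ∀ E, MeasurableSet E →
      (((Y.Γu.leb b').restrict Y.Λ).withDensity fun x => (ρ x : ℝ≥0∞)) E =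
        ∫⁻ x in (E ∩ Y.Λ) ∩ Y.Γu.disk b', (ρ x : ℝ≥0∞) ∂(Y.Γu.leb b') := by
    intro E hE
    rw [withDensity_apply _ hE, Measure.restrict_restrict hE, setLIntegral_congr (haedisk _)]
  -- Measurability of the holonomy is not assumed. The image measure under a map that is not a.e.
  -- measurable is zero, and this contradicts the lower bound `1 / C` on its mass.
  have hae : AEMeasurable (holonomy Y.Γs Y.Γu b') ((Y.Γu.leb b).restrict Y.Λ) := by
    by_contra hne
    rw [Measure.map_of_not_aemeasurable hne] at hmap
    have h0 := hdens univ MeasurableSet.univ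
    rw [← hmap, univ_inter, inter_comm] at h0
    rw [← h0] at hlow
    simp only [Measure.coe_zero, Pi.zero_apply, nonpos_iff_eq_zero, ENNReal.ofReal_eq_zero] at hlow
    exact absurd hlow (not_le.2 (one_div_pos.2 Y.C_pos))
  refine ⟨ρ, fun A hA => ?_, ?_, hreg⟩
  · have hE : MeasurableSet (Y.itin ⁻¹' A ∩ Y.Λ') :=
      (measurable_itin hf hA).inter (measurableSet_Λ' hf)
    have h1 := congrArg (fun μ : Measure M => μ (Y.itin ⁻¹' A ∩ Y.Λ')) hmap
    rw [Measure.map_apply_of_aemeasurable hae hE, Measure.restrict_apply' hΛ, holonomy_preimage,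
      hdens _ hE, inter_eq_left.2 (inter_subset_right.trans Λ'_subset_Λ)] at h1
    rw [unstableMeasure_apply hf b hA, h1]
  · have h1 := congrArg (fun μ : Measure M => μ univ) hmap
    rw [Measure.map_apply_of_aemeasurable hae MeasurableSet.univ, hdens _ MeasurableSet.univ,
      preimage_univ, Measure.restrict_apply_univ, univ_inter, inter_comm] at h1
    rw [h1]; exact hup

theorem leb_Λ_lt_top (hf : IsPiecewiseC1Diffeo (d := d) f U) (b : Y.Γu.K) :
    Y.Γu.leb b Y.Λ < ⊤ := by
  obtain ⟨ρ, -, h, -⟩ := exists_holonomy_density hf b b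
  exact h.trans_lt ENNReal.ofReal_lt_top

theorem isFiniteMeasure_unstableMeasure (hf : IsPiecewiseC1Diffeo (d := d) f U) (b : Y.Γu.K) :
    IsFiniteMeasure (Y.unstableMeasure b) := by
  refine ⟨?_⟩
  rw [unstableMeasure_apply hf b MeasurableSet.univ]
  exact (measure_mono (inter_subset_right.trans Λ'_subset_Λ)).trans_lt (leb_Λ_lt_top hf b)

theorem unstableMeasure_absolutelyContinuous (hf : IsPiecewiseC1Diffeo (d := d) f U)
    (b b' : Y.Γu.K) : Y.unstableMeasure b ≪ Y.unstableMeasure b' := by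
  obtain ⟨ρ, h, -, -⟩ := exists_holonomy_density hf b b'
  refine Measure.AbsolutelyContinuous.mk fun A hA h0 => ?_
  rw [unstableMeasure_apply hf b' hA] at h0
  rw [h A hA]
  exact setLIntegral_measure_zero _ _ (measure_mono_null inter_subset_left h0)

/-- The holonomy density varies by at most the factor `exp (C βᵐ)` between points whose itineraries
share `m` symbols. Integrating this pointwise bound gives the comparison of the two disks. -/
theorem unstableMeasure_holonomy (hf : IsPiecewiseC1Diffeo (d := d) f U) (b b' : Y.Γu.K)
    {A B : Set (ℕ → ℕ)} (hA : MeasurableSet A) (hB : MeasurableSet B) {v : ℕ → ℕ} {m : ℕ}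
    (hAv : A ⊆ PiNat.cylinder v m) (hBv : B ⊆ PiNat.cylinder v m) :
    Y.unstableMeasure b A * Y.unstableMeasure b' B ≤
      ENNReal.ofReal (Real.exp (Y.C * Y.β ^ m)) *
        (Y.unstableMeasure b B * Y.unstableMeasure b' A) := by
  obtain ⟨ρ, h, -, hreg⟩ := exists_holonomy_density hf b b'
  have hdisk : MeasurableSet (Y.Γu.disk b') := (Y.Γu.isCompact_disk b').isClosed.measurableSet
  have hE : ∀ A, MeasurableSet A → MeasurableSet ((Y.itin ⁻¹' A ∩ Y.Λ') ∩ Y.Γu.disk b') :=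
    fun A hA => ((measurable_itin hf hA).inter (measurableSet_Λ' hf)).inter hdisk
  have hm : ∀ A, MeasurableSet A → Y.unstableMeasure b' A =
      ∫⁻ x in (Y.itin ⁻¹' A ∩ Y.Λ') ∩ Y.Γu.disk b', 1 ∂(Y.Γu.leb b') := fun A hA => by
    rw [setLIntegral_one, DiskFamily.leb_inter_disk, unstableMeasure_apply hf b' hA]
  have hm' : ∀ A, MeasurableSet A → Y.unstableMeasure b A =
      ∫⁻ x in (Y.itin ⁻¹' A ∩ Y.Λ') ∩ Y.Γu.disk b',
        ENNReal.ofReal (ρ x : ℝ) * 1 ∂(Y.Γu.leb b') := fun A hA => by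
    simp only [h A hA, ENNReal.ofReal_coe_nnreal, mul_one]
  have := isFiniteMeasure_unstableMeasure hf b
  have := isFiniteMeasure_unstableMeasure hf b'
  rw [hm A hA, hm B hB, hm' A hA, hm' B hB]
  refine lintegral_mul_lintegral_le (hE A hA) (hE B hB) (Real.exp_pos _).le ?_ ?_ ?_
  · rintro x ⟨hx, hxb⟩ y ⟨hy, hyb⟩
    refine (hreg x ⟨hxb, Λ'_subset_Λ hx.2⟩ y ⟨hyb, Λ'_subset_Λ hy.2⟩).trans ?_
    refine mul_le_mul_of_nonneg_right ?_ (ρ y).2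
    exact exp_powSep_le (le_sepTime_of_cylinder hAv hBv hx hy)
  · rw [← hm A hA]; exact measure_ne_top _ _
  · rw [← hm' A hA]; exact measure_ne_top _ _

end YoungStructure

/-! ### Change of variables and one-step distortion of the return map -/

namespace DiskFamily

variable {d : ℕ} {M : Type u} [EMetricSpace M] [ChartedSpace (EuclideanSpace ℝ (Fin d)) M]
  [IsManifold (𝓡 d) 1 M] {k : ℕ}

/-- A continuous map into a disk has continuous coordinates. -/
theorem continuousOn_coordinates (Γ : DiskFamily d M k) (a : Γ.K)
    {S : Set (EuclideanSpace ℝ (Fin k))} {h : EuclideanSpace ℝ (Fin k) → EuclideanSpace ℝ (Fin k)}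
    (hmaps : MapsTo h S (unitDisk k)) (hcont : ContinuousOn (fun p => Γ.Φ a (h p)) S) :
    ContinuousOn h S := by
  have hc : CompactSpace (unitDisk k) := isCompact_iff_compactSpace.1 (isCompact_closedBall _ _)
  have hemb : Topology.IsClosedEmbedding (fun p : unitDisk k => Γ.Φ a p) := by
    refine Continuous.isClosedEmbedding ?_ ?_
    · exact continuousOn_iff_continuous_domRestrict.1 (Γ.continuousOn_disk a)
    · intro p q hpq
      exact Subtype.ext (Γ.injOn_disk a p.2 q.2 hpq)
  have h1 : Continuous (fun p : S => (⟨h p, hmaps p.2⟩ : unitDisk k)) := by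
    rw [hemb.isEmbedding.continuous_iff]
    exact continuousOn_iff_continuous_domRestrict.1 hcont
  exact continuousOn_iff_continuous_domRestrict.2 (continuous_subtype_val.comp h1)

end DiskFamily

namespace YoungStructure

variable {d : ℕ} {M : Type u} [EMetricSpace M]
  [ChartedSpace (EuclideanSpace ℝ (Fin d)) M] [IsManifold (𝓡 d) 1 M] [MeasurableSpace M]
  [RiemannianBundle (fun y : M => TangentSpace (𝓡 d) y)] {f : M → M} {U : ℕ → Set M}
  {Y : YoungStructure (d := d) f U}

theorem itin_fR_eq_shift (x : M) : Y.itin (Y.fR x) = shift (Y.itin x) := funext (itin_fR x)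

theorem gramVolume_disk_pos (b : Y.Γu.K) {p : EuclideanSpace ℝ (Fin Y.ku)}
    (hp : p ∈ unitDisk Y.ku) :
    0 < gramVolume fun i => diskDeriv (d := d) (Y.Γu.Φ b) p (EuclideanSpace.single i 1) :=
  gramVolume_pos (V := TangentSpace (𝓡 d) (Y.Γu.Φ b p))
    (mfderivWithin (𝓡 Y.ku) (𝓡 d) (Y.Γu.Φ b) (unitDisk Y.ku) p :
      EuclideanSpace ℝ (Fin Y.ku) →L[ℝ] TangentSpace (𝓡 d) (Y.Γu.Φ b p)).toLinearMap
    (Y.Γu.injective_deriv b p hp)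

theorem gramVolume_image_pos {g : M → M} (b : Y.Γu.K) {p : EuclideanSpace ℝ (Fin Y.ku)}
    (hp : p ∈ unitDisk Y.ku)
    (hg : Function.Injective (mfderiv (𝓡 d) (𝓡 d) g (Y.Γu.Φ b p))) :
    0 < gramVolume fun i => mfderiv (𝓡 d) (𝓡 d) g (Y.Γu.Φ b p)
      (diskDeriv (d := d) (Y.Γu.Φ b) p (EuclideanSpace.single i 1)) :=
  gramVolume_pos (V := TangentSpace (𝓡 d) (g (Y.Γu.Φ b p)))
    ((mfderiv (𝓡 d) (𝓡 d) g (Y.Γu.Φ b p)).comp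
      (mfderivWithin (𝓡 Y.ku) (𝓡 d) (Y.Γu.Φ b) (unitDisk Y.ku) p :
      EuclideanSpace ℝ (Fin Y.ku) →L[ℝ] TangentSpace (𝓡 d) (Y.Γu.Φ b p))).toLinearMap
    (hg.comp (Y.Γu.injective_deriv b p hp))

/-- The logarithm in the Gibbs property can be removed because both Jacobians are positive: the
disks are immersed, and the iterates of `f` have injective derivative along orbits that avoid the
singular set. -/
theorem absDet_le (hf : IsPiecewiseC1Diffeo (d := d) f U) {b : Y.Γu.K} {i m : ℕ}
    {p p' : EuclideanSpace ℝ (Fin Y.ku)} (hp : p ∈ unitDisk Y.ku) (hp' : p' ∈ unitDisk Y.ku)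
    (hpi : Y.Γu.Φ b p ∈ Y.Λi i) (hpi' : Y.Γu.Φ b p' ∈ Y.Λi i)
    (hs : (m : ℕ∞) ≤ sepTime f Y.Λi Y.Ri (Y.fR (Y.Γu.Φ b p)) (Y.fR (Y.Γu.Φ b p'))) :
    Y.Γu.absDet f^[Y.Ri i] b p ≤
      Real.exp (Y.C * Y.β ^ m) * Y.Γu.absDet f^[Y.Ri i] b p' := by
  have hpos : ∀ q ∈ unitDisk Y.ku, Y.Γu.Φ b q ∈ Y.Λi i → 0 < Y.Γu.absDet f^[Y.Ri i] b q :=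
    fun q hq hqi => div_pos (gramVolume_image_pos b hq
      (mdifferentiableAt_iterate hf (iterate_mem_pieces hqi)).2) (gramVolume_disk_pos b hq)
  have h := Y.gibbs i b p hp p' hp' hpi hpi'
  rw [fR_eq hpi, fR_eq hpi'] at hs
  have h2 := h.trans (mul_le_mul_of_nonneg_left (powSep_le Y.β_pos Y.β_lt_one hs) Y.C_pos.le)
  rw [Real.log_le_iff_le_exp (div_pos (hpos p hp hpi) (hpos p' hp' hpi')),
    div_le_iff₀ (hpos p' hp' hpi')] at h2
  exact h2

variable [BorelSpace M]

/-- Change of variables for the return map between two unstable disks. -/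
theorem unstableMeasure_eq_lintegral_absDet (hf : IsPiecewiseC1Diffeo (d := d) f U) {i : ℕ}
    {b b' : Y.Γu.K} {x₀ : M} (hx₀ : x₀ ∈ Y.Λi i) (hb : x₀ ∈ Y.Γu.disk b)
    (hb' : Y.fR x₀ ∈ Y.Γu.disk b') {A : Set (ℕ → ℕ)} (hA : MeasurableSet A) :
    Y.unstableMeasure b' A = ∫⁻ p in unitDisk Y.ku ∩
        Y.Γu.Φ b ⁻¹' (Y.itin ⁻¹' ({x | x 0 = i} ∩ shift ⁻¹' A) ∩ Y.Λ'),
      ENNReal.ofReal (Y.Γu.absDet f^[Y.Ri i] b p) * ENNReal.ofReal (gramVolume fun l =>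
        diskDeriv (d := d) (Y.Γu.Φ b) p (EuclideanSpace.single l 1)) := by
  have hcyl : MeasurableSet {x : ℕ → ℕ | x 0 = i} :=
    measurableSet_eq_fun (measurable_pi_apply 0) measurable_const
  have hpre : MeasurableSet (Y.itin ⁻¹' ({x | x 0 = i} ∩ shift ⁻¹' A) ∩ Y.Λ') :=
    (measurable_itin hf (hcyl.inter (measurable_shift hA))).inter (measurableSet_Λ' hf)
  set S := unitDisk Y.ku ∩ Y.Γu.Φ b ⁻¹' (Y.itin ⁻¹' ({x | x 0 = i} ∩ shift ⁻¹' A) ∩ Y.Λ') with hS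
  have hSm : MeasurableSet S := Y.Γu.measurableSet_param_preimage b hpre
  have hSi : ∀ p ∈ S, Y.Γu.Φ b p ∈ Y.Λi i := by
    rintro p ⟨-, ⟨h1, -⟩, h2⟩
    have := mem_itin h2 0
    rwa [show Y.itin (Y.Γu.Φ b p) 0 = i from h1] at this
  have hSdisk : ∀ p ∈ S, ∃ q ∈ unitDisk Y.ku, Y.Γu.Φ b' q = Y.fR (Y.Γu.Φ b p) := fun p hp =>
    fR_mem_disk hx₀ hb hb' (hSi p hp) ⟨p, hp.1, rfl⟩
  -- The map `h` is the return map in the coordinates of the two disks.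
  choose! h hhD hhΦ using hSdisk
  have hhf : ∀ p ∈ S, Y.Γu.Φ b' (h p) = f^[Y.Ri i] (Y.Γu.Φ b p) := fun p hp => by
    rw [hhΦ p hp, fR_eq (hSi p hp)]
  have hcont : ContinuousOn h S := by
    refine Y.Γu.continuousOn_coordinates b' hhD ?_
    refine ContinuousOn.congr ?_ hhf
    exact (continuousOn_iterate hf i).comp ((Y.Γu.continuousOn_disk b).mono inter_subset_left) hSi
  have hinj : InjOn h S := by
    intro p hp q hq hpq
    refine Y.Γu.injOn_disk b hp.1 hq.1 ?_
    refine fR_injOn hp.2.2 (hSi p hp) ⟨p, hp.1, rfl⟩ hq.2.2 (hSi q hq) ⟨q, hq.1, rfl⟩ ?_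
    rw [← hhΦ p hp, ← hhΦ q hq, hpq]
  obtain ⟨h', hh', hdet⟩ := exists_hasFDerivWithinAt_transition hSm inter_subset_left
    (Y.Γu.contMDiffOn b) (Y.Γu.contMDiffOn b') (Y.Γu.injective_deriv b')
    (fun p hp => (mdifferentiableAt_iterate hf (iterate_mem_pieces (hSi p hp))).1) hcont hhD hhf
  -- Every point of `Λ'` on the target disk is covered: the Markov property supplies a preimage in
  -- `Λᵢ` on the disk `b`, and this preimage has a full itinerary beginning with `i`.
  have himage : h '' S = unitDisk Y.ku ∩ Y.Γu.Φ b' ⁻¹' (Y.itin ⁻¹' A ∩ Y.Λ') := by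
    ext q
    constructor
    · rintro ⟨p, hp, rfl⟩
      refine ⟨hhD p hp, ?_⟩
      rw [mem_preimage, hhΦ p hp]
      refine ⟨?_, Y.fR_mem hp.2.2⟩
      have h1 : shift (Y.itin (Y.Γu.Φ b p)) ∈ A := hp.2.1.2
      rwa [mem_preimage, itin_fR_eq_shift]
    · rintro ⟨hq, hqA, hqΛ⟩
      obtain ⟨z, hz, ⟨p, hp, rfl⟩, hzq⟩ :=
        exists_preimage hx₀ hb hb' (Λ'_subset_Λ hqΛ) ⟨q, hq, rfl⟩
      have hzΛ : Y.Γu.Φ b p ∈ Y.Λ' :=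
        mem_fullSet_of_retMap hz (by
          show Y.fR (Y.Γu.Φ b p) ∈ Y.Λ'
          rw [hzq]; exact hqΛ)
      have hpS : p ∈ S := by
        refine ⟨hp, ⟨itin_eq (n := 0) hz, ?_⟩, hzΛ⟩
        rw [mem_preimage, ← itin_fR_eq_shift, hzq]
        exact hqA
      refine ⟨p, hpS, ?_⟩
      exact Y.Γu.injOn_disk b' (hhD p hpS) hq (by rw [hhΦ p hpS, hzq])
  rw [unstableMeasure_apply hf b' hA, Y.Γu.leb_apply b'
    ((measurable_itin hf hA).inter (measurableSet_Λ' hf)), ← himage,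
    lintegral_image_eq_lintegral_abs_det_fderiv_mul volume hSm hh' hinj]
  refine lintegral_congr_ae ?_
  filter_upwards [hdet, ae_restrict_mem hSm] with p hp hpS
  have hG := gramVolume_disk_pos (Y := Y) b hpS.1
  rw [← ENNReal.ofReal_mul (abs_nonneg _), ← ENNReal.ofReal_mul', ← hp, DiskFamily.absDet,
    div_mul_cancel₀ _ hG.ne']
  exact hG.le

/-- Bounded distortion of the return map for the distribution of itineraries. -/
theorem unstableMeasure_gibbs (hf : IsPiecewiseC1Diffeo (d := d) f U) (b : Y.Γu.K) (i : ℕ)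
    {A B : Set (ℕ → ℕ)} (hA : MeasurableSet A) (hB : MeasurableSet B) {v : ℕ → ℕ} {m : ℕ}
    (hAv : A ⊆ PiNat.cylinder v m) (hBv : B ⊆ PiNat.cylinder v m) :
    Y.unstableMeasure b ({x | x 0 = i} ∩ shift ⁻¹' A) * Y.unstableMeasure b B ≤
      ENNReal.ofReal (Real.exp (2 * Y.C * Y.β ^ m)) *
        (Y.unstableMeasure b ({x | x 0 = i} ∩ shift ⁻¹' B) * Y.unstableMeasure b A) := by
  have hfin := isFiniteMeasure_unstableMeasure (Y := Y) hf
  have hcyl : MeasurableSet {x : ℕ → ℕ | x 0 = i} :=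
    measurableSet_eq_fun (measurable_pi_apply 0) measurable_const
  have hpre : ∀ A, MeasurableSet A →
      MeasurableSet (Y.itin ⁻¹' ({x | x 0 = i} ∩ shift ⁻¹' A) ∩ Y.Λ') := fun A hA =>
    (measurable_itin hf (hcyl.inter (measurable_shift hA))).inter (measurableSet_Λ' hf)
  by_cases hne : ∃ x₀ ∈ Y.Λi i, x₀ ∈ Y.Γu.disk b
  swap
  · have h0 : Y.unstableMeasure b ({x | x 0 = i} ∩ shift ⁻¹' A) = 0 := by
      rw [unstableMeasure_apply hf b (hcyl.inter (measurable_shift hA)),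
        ← DiskFamily.leb_inter_disk]
      refine measure_mono_null ?_ measure_empty
      rintro x ⟨⟨⟨h1, -⟩, h2⟩, h3⟩
      have := mem_itin h2 0
      rw [show Y.itin x 0 = i from h1] at this
      exact hne ⟨x, this, h3⟩
    rw [h0, zero_mul]; exact zero_le
  obtain ⟨x₀, hx₀, hb⟩ := hne
  obtain ⟨b', hb'⟩ := exists_unstable (fR_mem_Λ hx₀)
  -- The Jacobian relates the part of the disk `b` over the symbol `i` to the image disk `b'`. The
  -- Gibbs property bounds its variation and costs one factor `exp (C βᵐ)`.
  have key : Y.unstableMeasure b' B *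
      Y.unstableMeasure b ({x | x 0 = i} ∩ shift ⁻¹' A) ≤
      ENNReal.ofReal (Real.exp (Y.C * Y.β ^ m)) * (Y.unstableMeasure b' A *
        Y.unstableMeasure b ({x | x 0 = i} ∩ shift ⁻¹' B)) := by
    have hv := fun (A : Set (ℕ → ℕ)) (hA : MeasurableSet A) =>
      unstableMeasure_eq_lintegral_absDet hf hx₀ hb hb' hA
    have hu : ∀ A, MeasurableSet A → Y.unstableMeasure b ({x | x 0 = i} ∩ shift ⁻¹' A) = _ :=
      fun A hA => (unstableMeasure_apply hf b (hcyl.inter (measurable_shift hA))).trans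
        (Y.Γu.leb_apply b (hpre A hA))
    rw [hv A hA, hv B hB, hu A hA, hu B hB]
    refine lintegral_mul_lintegral_le (Y.Γu.measurableSet_param_preimage b (hpre B hB))
      (Y.Γu.measurableSet_param_preimage b (hpre A hA)) (Real.exp_pos _).le ?_ ?_ ?_
    · rintro p ⟨hp, ⟨hp1, hp2⟩, hp3⟩ q ⟨hq, ⟨hq1, hq2⟩, hq3⟩
      have hpi := mem_itin hp3 0
      have hqi := mem_itin hq3 0
      rw [show Y.itin (Y.Γu.Φ b p) 0 = i from hp1] at hpi
      rw [show Y.itin (Y.Γu.Φ b q) 0 = i from hq1] at hqi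
      refine absDet_le hf hp hq hpi hqi (le_sepTime_of_cylinder hBv hAv ⟨?_, Y.fR_mem hp3⟩
        ⟨?_, Y.fR_mem hq3⟩)
      · rw [mem_preimage, itin_fR_eq_shift]; exact hp2
      · rw [mem_preimage, itin_fR_eq_shift]; exact hq2
    · rw [← hu B hB]; exact measure_ne_top _ _
    · rw [← hv B hB]; exact measure_ne_top _ _
  -- The holonomy brings `b'` back to `b` at the price of a second factor `exp (C βᵐ)`, whence the
  -- constant `2 C`.
  have hol := unstableMeasure_holonomy hf b' b hA hB hAv hBv
  set e := ENNReal.ofReal (Real.exp (Y.C * Y.β ^ m)) with he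
  have he2 : ENNReal.ofReal (Real.exp (2 * Y.C * Y.β ^ m)) = e * e := by
    rw [he, ← ENNReal.ofReal_mul (Real.exp_pos _).le, ← Real.exp_add]; ring_nf
  rw [he2]
  set a := Y.unstableMeasure b A
  set a' := Y.unstableMeasure b' A with ha'
  set c := Y.unstableMeasure b B with hc
  set c' := Y.unstableMeasure b' B with hc'
  set P := Y.unstableMeasure b ({x | x 0 = i} ∩ shift ⁻¹' A)
  set Q := Y.unstableMeasure b ({x | x 0 = i} ∩ shift ⁻¹' B)
  -- The two estimates are multiplied and the measures on `b'` are cancelled. The cases in which one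
  -- of these vanishes are treated separately, through absolute continuity.
  have hac : c' = 0 → c = 0 := fun h0 => unstableMeasure_absolutelyContinuous hf b b' h0
  rcases eq_or_ne c' 0 with h0 | hc0
  · rw [hac h0, mul_zero]; exact zero_le
  rcases eq_or_ne a' 0 with h0 | ha0
  · have hP : P = 0 := by
      rw [h0, zero_mul, mul_zero, nonpos_iff_eq_zero, mul_eq_zero] at key
      exact key.resolve_left hc0
    rw [hP, zero_mul]; exact zero_le
  have hprod := mul_le_mul' key hol
  have hfin1 : c' * a' ≠ ⊤ := ENNReal.mul_ne_top (measure_ne_top _ _) (measure_ne_top _ _)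
  refine (ENNReal.mul_le_mul_iff_right (mul_ne_zero hc0 ha0) hfin1).1 ?_
  calc c' * a' * (P * c) = c' * P * (a' * c) := by ring
    _ ≤ e * (a' * Q) * (e * (c' * a)) := hprod
    _ = _ := by ring

end YoungStructure

/-! ### Bounded distortion and regular densities on the full shift -/

section Symbolic

/-- The truncation of a sequence to its first `N` symbols. -/
def trunc (N : ℕ) (x : ℕ → ℕ) : Fin N → ℕ := fun i => x i

theorem measurable_trunc (N : ℕ) : Measurable (trunc N) :=
  measurable_pi_iff.2 fun i => measurable_pi_apply (i : ℕ)

theorem trunc_preimage_singleton (N : ℕ) (x : ℕ → ℕ) :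
    trunc N ⁻¹' {trunc N x} = PiNat.cylinder x N := by
  ext y
  simp only [mem_preimage, mem_singleton_iff, PiNat.cylinder, mem_ofPred_eq, funext_iff, trunc]
  exact ⟨fun h i hi => h ⟨i, hi⟩, fun h i => h i i.2⟩

theorem trunc_surjective (N : ℕ) : Function.Surjective (trunc N) := fun t =>
  ⟨fun n => if h : n < N then t ⟨n, h⟩ else 0, by ext i; simp [trunc]⟩

/-- The σ-algebras generated by the first symbols of a sequence. -/
def truncFiltration : Filtration ℕ (inferInstance : MeasurableSpace (ℕ → ℕ)) where
  seq N := MeasurableSpace.comap (trunc N) inferInstance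
  mono' := by
    intro i j hij
    refine measurable_iff_comap_le.1 ?_
    have h : Measurable fun t : Fin j → ℕ => fun l : Fin i => t (Fin.castLE hij l) :=
      measurable_of_countable _
    exact h.comp (comap_measurable (trunc j))
  le' N := (measurable_trunc N).comap_le

theorem iSup_truncFiltration :
    ⨆ N, (truncFiltration N : MeasurableSpace (ℕ → ℕ)) = MeasurableSpace.pi := by
  refine le_antisymm (iSup_le fun N => truncFiltration.le N) ?_
  refine iSup_le fun a => le_trans ?_ (le_iSup _ (a + 1))
  refine measurable_iff_comap_le.1 ?_
  have h : Measurable fun t : Fin (a + 1) → ℕ => t (Fin.last a) := measurable_of_countable _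
  exact h.comp (comap_measurable (trunc (a + 1)))

theorem measurable_shift_iterate (n : ℕ) : Measurable (shift^[n]) := measurable_shift.iterate n

theorem shift_iterate_apply (n : ℕ) (x : ℕ → ℕ) (j : ℕ) : shift^[n] x j = x (j + n) := by
  induction n generalizing x with
  | zero => rfl
  | succ n ih => rw [Function.iterate_succ_apply, ih, shift]; congr 1

/-- The points beginning with the first `n` symbols of `w` and then continuing in `A`. -/
def prepend (w : ℕ → ℕ) (n : ℕ) (A : Set (ℕ → ℕ)) : Set (ℕ → ℕ) :=
  PiNat.cylinder w n ∩ shift^[n] ⁻¹' A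

theorem measurableSet_prepend (w : ℕ → ℕ) (n : ℕ) {A : Set (ℕ → ℕ)} (hA : MeasurableSet A) :
    MeasurableSet (prepend w n A) :=
  (measurableSet_cylinder w n).inter (measurable_shift_iterate n hA)

theorem prepend_univ (w : ℕ → ℕ) (n : ℕ) : prepend w n univ = PiNat.cylinder w n := by
  simp [prepend]

theorem prepend_zero (w : ℕ → ℕ) (A : Set (ℕ → ℕ)) : prepend w 0 A = A := by
  simp [prepend]

theorem prepend_succ (w : ℕ → ℕ) (n : ℕ) (A : Set (ℕ → ℕ)) :
    prepend w (n + 1) A = {x | x 0 = w 0} ∩ shift ⁻¹' prepend (shift w) n A := by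
  ext x
  simp only [prepend, mem_inter_iff, mem_preimage, PiNat.cylinder, mem_ofPred_eq, shift,
    Function.iterate_succ_apply, ← and_assoc, and_congr_left_iff]
  intro _
  constructor
  · exact fun h => ⟨h 0 (by omega), fun i hi => h (i + 1) (by omega)⟩
  · rintro ⟨h0, h⟩ i hi
    cases i with
    | zero => exact h0
    | succ i => exact h i (by omega)

theorem prepend_subset_cylinder (w v : ℕ → ℕ) (n m : ℕ) {A : Set (ℕ → ℕ)}
    (hA : A ⊆ PiNat.cylinder v m) :
    prepend w n A ⊆ PiNat.cylinder (fun j => if j < n then w j else v (j - n)) (n + m) := by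
  rintro x ⟨hx, hxA⟩ i hi
  by_cases h : i < n
  · simp only [h, if_true]; exact hx i h
  · have := hA hxA (i - n) (by omega)
    rw [shift_iterate_apply] at this
    simp only [h, if_false]
    rw [← this]; congr 1; omega

/-- `μ` has, up to the factor `exp (C βᵏ)` on cylinders of length `k`, constant density with
respect to `m`. -/
def HasRegularDensity (β C : ℝ) (μ m : Measure (ℕ → ℕ)) : Prop :=
  ∀ (v : ℕ → ℕ) (k : ℕ) (A B : Set (ℕ → ℕ)), MeasurableSet A → MeasurableSet B →
    A ⊆ PiNat.cylinder v k → B ⊆ PiNat.cylinder v k →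
    μ A * m B ≤ ENNReal.ofReal (Real.exp (C * β ^ k)) * (μ B * m A)

/-- Bounded distortion of all inverse branches of the shift with respect to `m`. -/
def BoundedDistortion (β C : ℝ) (m : Measure (ℕ → ℕ)) : Prop :=
  ∀ (w : ℕ → ℕ) (n : ℕ) (v : ℕ → ℕ) (k : ℕ) (A B : Set (ℕ → ℕ)),
    MeasurableSet A → MeasurableSet B → A ⊆ PiNat.cylinder v k → B ⊆ PiNat.cylinder v k →
    m (prepend w n A) * m B ≤ ENNReal.ofReal (Real.exp (C * β ^ k)) * (m (prepend w n B) * m A)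

/-- Symbols are prepended one at a time. After `j` of them the sets lie in cylinders of length `j +
k`, so the next one costs only `C β^(j+k)` in the exponent. The total is bounded by a geometric
series, independently of the number of symbols. -/
theorem boundedDistortion_of_one_step {β C : ℝ} (hβ0 : 0 < β) (hβ1 : β < 1) (hC : 0 ≤ C)
    {m : Measure (ℕ → ℕ)} [IsFiniteMeasure m]
    (h : ∀ (i : ℕ) (v : ℕ → ℕ) (k : ℕ) (A B : Set (ℕ → ℕ)),
      MeasurableSet A → MeasurableSet B → A ⊆ PiNat.cylinder v k → B ⊆ PiNat.cylinder v k →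
      m ({x | x 0 = i} ∩ shift ⁻¹' A) * m B ≤
        ENNReal.ofReal (Real.exp (C * β ^ k)) * (m ({x | x 0 = i} ∩ shift ⁻¹' B) * m A)) :
    BoundedDistortion β (C / (1 - β)) m := by
  have hsum : ∀ n, ∑ j ∈ Finset.range n, β ^ j ≤ 1 / (1 - β) := fun n => by
    rw [one_div, ← tsum_geometric_of_lt_one hβ0.le hβ1]
    exact (summable_geometric_of_lt_one hβ0.le hβ1).sum_le_tsum _ fun _ _ => by positivity
  have hnull : ∀ i A, MeasurableSet A → m A = 0 → m ({x | x 0 = i} ∩ shift ⁻¹' A) = 0 := by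
    intro i A hA h0
    have h1 := h i 0 0 A univ hA MeasurableSet.univ (by simp) (by simp)
    rw [h0, mul_zero, mul_zero, nonpos_iff_eq_zero, mul_eq_zero] at h1
    rcases h1 with h1 | h1
    · exact h1
    · rw [Measure.measure_univ_eq_zero.1 h1]; rfl
  have key : ∀ (n : ℕ) (w v : ℕ → ℕ) (k : ℕ) (A B : Set (ℕ → ℕ)),
      MeasurableSet A → MeasurableSet B → A ⊆ PiNat.cylinder v k → B ⊆ PiNat.cylinder v k →
      m (prepend w n A) * m B ≤
        ENNReal.ofReal (Real.exp (C * β ^ k * ∑ j ∈ Finset.range n, β ^ j)) *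
          (m (prepend w n B) * m A) := by
    intro n
    induction n with
    | zero => intro w v k A B _ _ _ _; simp [prepend_zero, mul_comm]
    | succ n ih =>
      intro w v k A B hA hB hAv hBv
      rw [prepend_succ, prepend_succ]
      set w' := shift w
      have hA1 := measurableSet_prepend w' n hA
      have hB1 := measurableSet_prepend w' n hB
      rcases eq_or_ne (m (prepend w' n A)) 0 with h0 | hne
      · rw [hnull _ _ hA1 h0, zero_mul]; exact zero_le
      have i1 := ih w' v k A B hA hB hAv hBv
      have i2 := h (w 0) _ _ _ _ hA1 hB1 (prepend_subset_cylinder w' v n k hAv)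
        (prepend_subset_cylinder w' v n k hBv)
      rcases eq_or_ne (m (prepend w' n B)) 0 with h0 | hne'
      · rw [h0, zero_mul, mul_zero, nonpos_iff_eq_zero, mul_eq_zero] at i1
        rw [i1.resolve_left hne, mul_zero]; exact zero_le
      have i3 := mul_le_mul' i2 i1
      have hfin : m (prepend w' n A) * m (prepend w' n B) ≠ ⊤ :=
        ENNReal.mul_ne_top (measure_ne_top _ _) (measure_ne_top _ _)
      refine (ENNReal.mul_le_mul_iff_right (mul_ne_zero hne hne') hfin).1 ?_
      have hexp : ENNReal.ofReal (Real.exp (C * β ^ k * ∑ j ∈ Finset.range (n + 1), β ^ j)) =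
          ENNReal.ofReal (Real.exp (C * β ^ (n + k))) *
          ENNReal.ofReal (Real.exp (C * β ^ k * ∑ j ∈ Finset.range n, β ^ j)) := by
        rw [← ENNReal.ofReal_mul (Real.exp_pos _).le, ← Real.exp_add, Finset.sum_range_succ]
        congr 2; ring
      rw [hexp]
      refine le_trans (le_of_eq ?_) (i3.trans (le_of_eq ?_)) <;> ring
  intro w n v k A B hA hB hAv hBv
  refine (key n w v k A B hA hB hAv hBv).trans ?_
  refine mul_le_mul_left (ENNReal.ofReal_le_ofReal (Real.exp_le_exp.2 ?_)) _
  calc C * β ^ k * ∑ j ∈ Finset.range n, β ^ j ≤ C * β ^ k * (1 / (1 - β)) := by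
        gcongr; exact hsum n
    _ = C / (1 - β) * β ^ k := by ring

/-- A weight depending on the first `N` symbols splits the integral into a countable sum over words.
Each word is an inverse branch, and all branches have the same distortion constant. -/
theorem lintegral_trunc_le {β C : ℝ} {m : Measure (ℕ → ℕ)} [IsFiniteMeasure m]
    (h : BoundedDistortion β C m)
    (N : ℕ) (c : (Fin N → ℕ) → ℝ≥0∞) {v : ℕ → ℕ} {k : ℕ} {A B : Set (ℕ → ℕ)}
    (hA : MeasurableSet A) (hB : MeasurableSet B) (hAv : A ⊆ PiNat.cylinder v k)
    (hBv : B ⊆ PiNat.cylinder v k) :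
    (∫⁻ x in shift^[N] ⁻¹' A, c (trunc N x) ∂m) * m B ≤
      ENNReal.ofReal (Real.exp (C * β ^ k)) *
        ((∫⁻ x in shift^[N] ⁻¹' B, c (trunc N x) ∂m) * m A) := by
  have hexp : ∀ A, MeasurableSet A → ∫⁻ x in shift^[N] ⁻¹' A, c (trunc N x) ∂m =
      ∑' t, c t * m (trunc N ⁻¹' {t} ∩ shift^[N] ⁻¹' A) := by
    intro A hA
    have h1 := lintegral_map (μ := m.restrict (shift^[N] ⁻¹' A)) (measurable_of_countable c)
      (measurable_trunc N)
    rw [← h1, lintegral_countable']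
    refine tsum_congr fun t => ?_
    rw [Measure.map_apply (measurable_trunc N) (measurableSet_singleton t),
      Measure.restrict_apply (measurable_trunc N (measurableSet_singleton t))]
  rw [hexp A hA, hexp B hB, ← ENNReal.tsum_mul_right, ← ENNReal.tsum_mul_right,
    ← ENNReal.tsum_mul_left]
  refine ENNReal.tsum_le_tsum fun t => ?_
  obtain ⟨w, rfl⟩ := trunc_surjective N t
  rw [trunc_preimage_singleton]
  calc c (trunc N w) * m (PiNat.cylinder w N ∩ shift^[N] ⁻¹' A) * m B
      = c (trunc N w) * (m (prepend w N A) * m B) := by rw [mul_assoc]; rfl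
    _ ≤ c (trunc N w) * (ENNReal.ofReal (Real.exp (C * β ^ k)) * (m (prepend w N B) * m A)) := by
        exact mul_le_mul_right (h w N v k A B hA hB hAv hBv) _
    _ = _ := by rw [prepend]; ring

/-- A shift-invariant measure which is absolutely continuous with respect to a measure with bounded
distortion has a regular density. -/
theorem hasRegularDensity_of_invariant {β C : ℝ} {μ m : Measure (ℕ → ℕ)} [IsFiniteMeasure m]
    [IsFiniteMeasure μ] (h : BoundedDistortion β C m) (hac : μ ≪ m)
    (hinv : MeasurePreserving shift μ μ) : HasRegularDensity β C μ m := by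
  intro v k A B hA hB hAv hBv
  set g : (ℕ → ℕ) → ℝ := fun x => (μ.rnDeriv m x).toReal with hg
  have hgi : Integrable g m := Measure.integrable_toReal_rnDeriv
  set gN : ℕ → (ℕ → ℕ) → ℝ := fun N => m[g | truncFiltration N] with hgN
  have hnn : ∀ N, 0 ≤ᵐ[m] gN N := fun N =>
    condExp_nonneg (Filter.Eventually.of_forall fun x => ENNReal.toReal_nonneg)
  have hgNi : ∀ N, Integrable (gN N) m := fun N => integrable_condExp
  have hlevy : Filter.Tendsto (fun N => ∫ x, |gN N x - g x| ∂m) Filter.atTop (𝓝 0) := by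
    have h1 := hgi.tendsto_eLpNorm_condExp (ℱ := truncFiltration) (by
      rw [iSup_truncFiltration]
      exact (Measure.measurable_rnDeriv μ m).ennreal_toReal.stronglyMeasurable)
    have h2 := (ENNReal.tendsto_toReal ENNReal.zero_ne_top).comp h1
    refine h2.congr fun N => ?_
    rw [Function.comp_apply, eLpNorm_one_eq_lintegral_enorm,
      integral_eq_lintegral_of_nonneg_ae (Filter.Eventually.of_forall fun _ => abs_nonneg _)
      (show AEStronglyMeasurable (fun x => |gN N x - g x|) m from
        ((hgNi N).sub hgi).abs.aestronglyMeasurable)]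
    congr 1
    refine lintegral_congr fun x => ?_
    rw [← Real.enorm_eq_ofReal_abs]; rfl
  -- By invariance `μ(A)` is the integral of the density `g` over the `N`-th shift preimage of `A`.
  -- Lévy's theorem allows `g` to be replaced by its conditional expectation given `N` symbols, and
  -- for such weights the distortion estimate is available.
  have hlim : ∀ A, MeasurableSet A →
      Filter.Tendsto (fun N => ∫ x in shift^[N] ⁻¹' A, gN N x ∂m) Filter.atTop (𝓝 (μ.real A)) := by
    intro A hA
    rw [tendsto_iff_norm_sub_tendsto_zero]
    refine squeeze_zero (fun _ => norm_nonneg _) (fun N => ?_) hlevy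
    have hAN := measurable_shift_iterate N hA
    have e1 : μ.real A = ∫ x in shift^[N] ⁻¹' A, g x ∂m := by
      rw [Measure.setIntegral_toReal_rnDeriv hac, measureReal_def, measureReal_def,
        (hinv.iterate N).measure_preimage hA.nullMeasurableSet]
    rw [e1, ← integral_sub (hgNi N).integrableOn hgi.integrableOn]
    refine (norm_integral_le_integral_norm _).trans ?_
    exact setIntegral_le_integral ((hgNi N).sub hgi).abs
      (Filter.Eventually.of_forall fun _ => abs_nonneg _)
  have hineq : ∀ N, (∫ x in shift^[N] ⁻¹' A, gN N x ∂m) * m.real B ≤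
      Real.exp (C * β ^ k) * ((∫ x in shift^[N] ⁻¹' B, gN N x ∂m) * m.real A) := by
    intro N
    have hmeas : Measurable[MeasurableSpace.comap (trunc N) inferInstance] (gN N) :=
      stronglyMeasurable_condExp.measurable
    obtain ⟨c, -, hc⟩ := hmeas.exists_eq_measurable_comp
    have e1 : ∀ A, MeasurableSet A → ENNReal.ofReal (∫ x in shift^[N] ⁻¹' A, gN N x ∂m) =
        ∫⁻ x in shift^[N] ⁻¹' A, ENNReal.ofReal (c (trunc N x)) ∂m := fun A hA => by
      rw [ofReal_integral_eq_lintegral_ofReal (hgNi N).integrableOn (ae_restrict_of_ae (hnn N)), hc]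
      rfl
    have h1 := lintegral_trunc_le h N (fun t => ENNReal.ofReal (c t)) hA hB hAv hBv
    rw [← e1 A hA, ← e1 B hB] at h1
    have hpos : ∀ A, 0 ≤ ∫ x in shift^[N] ⁻¹' A, gN N x ∂m := fun A =>
      integral_nonneg_of_ae (ae_restrict_of_ae (hnn N))
    have h2 := ENNReal.toReal_mono (by finiteness) h1
    simpa only [ENNReal.toReal_mul, ENNReal.toReal_ofReal (hpos _),
      ENNReal.toReal_ofReal (Real.exp_pos _).le, measureReal_def] using h2
  have hfinal := le_of_tendsto_of_tendsto' ((hlim A hA).mul_const (m.real B))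
    (((hlim B hB).mul_const (m.real A)).const_mul (Real.exp (C * β ^ k))) hineq
  have h3 := ENNReal.ofReal_le_ofReal hfinal
  rwa [ENNReal.ofReal_mul measureReal_nonneg, ENNReal.ofReal_mul (Real.exp_pos _).le,
    ENNReal.ofReal_mul measureReal_nonneg, ofReal_measureReal, ofReal_measureReal,
    ofReal_measureReal, ofReal_measureReal] at h3

/-- Passage from `μ` to `m` on the prepended sets, distortion of `m`, and passage back to `μ` on `A`
and `B` each cost one factor `exp (C βᵏ)`. This explains `3 * C`. -/
theorem BoundedDistortion.of_hasRegularDensity {β C : ℝ} (hβ0 : 0 < β) (hβ1 : β < 1) (hC : 0 ≤ C)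
    {μ m : Measure (ℕ → ℕ)} [IsFiniteMeasure m]
    [IsFiniteMeasure μ] (h : BoundedDistortion β C m) (hac : μ ≪ m)
    (hd : HasRegularDensity β C μ m) : BoundedDistortion β (3 * C) μ := by
  intro w n v k A B hA hB hAv hBv
  have hA1 := measurableSet_prepend w n hA
  have hB1 := measurableSet_prepend w n hB
  rcases eq_or_ne (m (prepend w n A)) 0 with h0 | n1
  · rw [hac h0, zero_mul]; exact zero_le
  rcases eq_or_ne (m B) 0 with h0 | n2
  · rw [hac h0, mul_zero]; exact zero_le
  have i2 := h w n v k A B hA hB hAv hBv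
  have n3 : m (prepend w n B) ≠ 0 := fun h0 => by
    rw [h0, zero_mul, mul_zero, nonpos_iff_eq_zero, mul_eq_zero] at i2
    exact i2.elim n1 n2
  have n4 : m A ≠ 0 := fun h0 => by
    rw [h0, mul_zero, mul_zero, nonpos_iff_eq_zero, mul_eq_zero] at i2
    exact i2.elim n1 n2
  have i1 := hd _ _ _ _ hA1 hB1 (prepend_subset_cylinder w v n k hAv)
    (prepend_subset_cylinder w v n k hBv)
  have i3 := hd v k B A hB hA hBv hAv
  set e := ENNReal.ofReal (Real.exp (C * β ^ k)) with he
  have hle : ENNReal.ofReal (Real.exp (C * β ^ (n + k))) ≤ e := by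
    rw [he]
    gcongr ENNReal.ofReal (Real.exp (C * ?_))
    exact pow_le_pow_of_le_one hβ0.le hβ1.le (by omega)
  have hee : ENNReal.ofReal (Real.exp (3 * C * β ^ k)) = e * e * e := by
    rw [he, ← ENNReal.ofReal_mul (Real.exp_pos _).le, ← ENNReal.ofReal_mul (by positivity),
      ← Real.exp_add, ← Real.exp_add]
    ring_nf
  rw [hee]
  have hfin : m (prepend w n A) * m B * (m (prepend w n B) * m A) ≠ ⊤ := by finiteness
  refine (ENNReal.mul_le_mul_iff_right (mul_ne_zero (mul_ne_zero n1 n2) (mul_ne_zero n3 n4))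
    hfin).1 ?_
  have hprod := mul_le_mul' (mul_le_mul' (i1.trans (mul_le_mul_left hle _)) i2) i3
  refine le_trans (le_of_eq ?_) (hprod.trans (le_of_eq ?_)) <;> ring

end Symbolic

/-! ### Integrals over partitions and over functions of a map -/

section Integrals

variable {X : Type*} [MeasurableSpace X] {ν : Measure X}

theorem abs_setIntegral_le_of_partition {ι : Type*} [Countable ι] [IsFiniteMeasure ν]
    {Q : ι → Set X} (hQ : ∀ i, MeasurableSet (Q i)) (hdisj : Pairwise fun i j => Disjoint (Q i) (Q j))
    (hcov : ⋃ i, Q i = univ) {H : X → ℝ} (hH : Integrable H ν) {E : Set X} (hE : MeasurableSet E)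
    {c : ℝ} (h : ∀ i, |∫ z in E ∩ Q i, H z ∂ν| ≤ c * ν.real (E ∩ Q i)) :
    |∫ z in E, H z ∂ν| ≤ c * ν.real E := by
  have hE' : ⋃ i, E ∩ Q i = E := by rw [← inter_iUnion, hcov, inter_univ]
  have hm : ∀ i, MeasurableSet (E ∩ Q i) := fun i => hE.inter (hQ i)
  have hd : Pairwise (Function.onFun Disjoint fun i => E ∩ Q i) := fun i j hij =>
    (hdisj hij).mono inter_subset_right inter_subset_right
  have h1 := hasSum_integral_iUnion (μ := ν) hm hd (f := H) hH.integrableOn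
  have h2 := hasSum_integral_iUnion (μ := ν) hm hd (f := fun _ => (1 : ℝ))
    (integrable_const _).integrableOn
  rw [hE'] at h1 h2
  simp only [setIntegral_const, smul_eq_mul, mul_one] at h2
  rw [← h1.tsum_eq, ← Real.norm_eq_abs]
  refine tsum_of_norm_bounded (h2.mul_left c) fun i => ?_
  rw [Real.norm_eq_abs]
  exact h i

/-- The assumption says that the conditional expectation of `H` given `S` vanishes, and `ξ ∘ S` can
be pulled out of it. -/
theorem integral_mul_comp_eq_zero [IsFiniteMeasure ν] {S : X → X} (hS : Measurable S) {H : X → ℝ}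
    (hH : Integrable H ν) (h : ∀ E, MeasurableSet E → ∫ z in S ⁻¹' E, H z ∂ν = 0) {ξ : X → ℝ}
    (hξ : Measurable ξ) {c : ℝ} (hc : ∀ z, |ξ z| ≤ c) : ∫ z, H z * ξ (S z) ∂ν = 0 := by
  have hm : MeasurableSpace.comap S inferInstance ≤ (inferInstance : MeasurableSpace X) :=
    hS.comap_le
  have h0 : (fun _ => (0 : ℝ)) =ᵐ[ν] ν[H | MeasurableSpace.comap S inferInstance] := by
    refine ae_eq_condExp_of_forall_setIntegral_eq hm hH (fun _ _ _ => integrableOn_zero) ?_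
      aestronglyMeasurable_const
    rintro s ⟨E, hE, rfl⟩ -
    simp [h E hE]
  have hmeas : StronglyMeasurable[MeasurableSpace.comap S inferInstance] (fun z => ξ (S z)) :=
    (hξ.comp (comap_measurable S)).stronglyMeasurable
  have hint : Integrable (H * fun z => ξ (S z)) ν :=
    hH.mul_bdd (c := c) (hξ.comp hS).aestronglyMeasurable (Filter.Eventually.of_forall fun z => hc _)
  have h1 := condExp_mul_of_stronglyMeasurable_right hmeas hint hH
  have h2 : ∫ z, (H * fun z => ξ (S z)) z ∂ν = 0 := by
    rw [← integral_condExp hm, integral_congr_ae h1]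
    have : ν[H | MeasurableSpace.comap S inferInstance] * (fun z => ξ (S z)) =ᵐ[ν] fun _ => 0 := by
      filter_upwards [h0] with z hz
      rw [Pi.mul_apply, ← hz, zero_mul]
    rw [integral_congr_ae this, integral_zero]
  exact h2

end Integrals

/-! ### Invariant measures on the symbolic tower -/

section SymbolicTower

/-- The tower map over the full shift with roof function `x ↦ R (x 0)`. -/
def symTower (R : ℕ → ℕ) (z : (ℕ → ℕ) × ℕ) : (ℕ → ℕ) × ℕ :=
  if z.2 + 1 < R (z.1 0) then (z.1, z.2 + 1) else (shift z.1, 0)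

/-- The base measure of a measure on the tower. -/
def baseMeasure (ν : Measure ((ℕ → ℕ) × ℕ)) : Measure (ℕ → ℕ) :=
  (ν.restrict (univ ×ˢ {0})).map Prod.fst

/-- Observables which are Lipschitz with respect to the symbolic distance `β ^ s`. -/
structure SymLipschitz (β a b : ℝ) (φ : (ℕ → ℕ) × ℕ → ℝ) : Prop where
  bound : ∀ z, |φ z| ≤ b
  osc : ∀ (m : ℕ) (x y : ℕ → ℕ) (l : ℕ), y ∈ PiNat.cylinder x m → |φ (x, l) - φ (y, l)| ≤ a * β ^ m

theorem baseMeasure_apply (ν : Measure ((ℕ → ℕ) × ℕ)) {A : Set (ℕ → ℕ)} (hA : MeasurableSet A) :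
    baseMeasure ν A = ν (A ×ˢ {0}) := by
  rw [baseMeasure, Measure.map_apply measurable_fst hA,
    Measure.restrict_apply (measurable_fst hA)]
  congr 1
  ext z
  simp

instance (ν : Measure ((ℕ → ℕ) × ℕ)) [IsFiniteMeasure ν] : IsFiniteMeasure (baseMeasure ν) := by
  unfold baseMeasure; infer_instance

/-- Such a function is a limit of functions of the level and finitely many symbols, and these live
on a countable set. -/
theorem SymLipschitz.measurable {β a b : ℝ} (hβ0 : 0 < β) (hβ1 : β < 1) {φ : (ℕ → ℕ) × ℕ → ℝ}
    (h : SymLipschitz β a b φ) : Measurable φ := by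
  choose sec hsec using trunc_surjective
  have h1 : ∀ m, Measurable fun z : (ℕ → ℕ) × ℕ => φ (sec m (trunc m z.1), z.2) := fun m => by
    have h2 : Measurable fun q : (Fin m → ℕ) × ℕ => φ (sec m q.1, q.2) := measurable_of_countable _
    exact h2.comp (((measurable_trunc m).comp measurable_fst).prodMk measurable_snd)
  refine measurable_of_tendsto_metrizable h1 ?_
  rw [tendsto_pi_nhds]
  rintro ⟨x, l⟩
  rw [tendsto_iff_norm_sub_tendsto_zero]
  have h3 : Filter.Tendsto (fun m : ℕ => a * β ^ m) Filter.atTop (𝓝 0) := by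
    simpa using (tendsto_pow_atTop_nhds_zero_of_lt_one hβ0.le hβ1).const_mul a
  refine squeeze_zero (fun _ => norm_nonneg _) (fun m => ?_) h3
  refine h.osc m _ _ l ?_
  rw [← trunc_preimage_singleton, mem_preimage, mem_singleton_iff]
  exact (hsec m _).symm

theorem measurableSet_symbol (n i : ℕ) : MeasurableSet {x : ℕ → ℕ | x n = i} :=
  measurableSet_eq_fun (measurable_pi_apply n) measurable_const

/-- The basic properties of an invariant measure on the symbolic tower. -/
structure IsTowerMeasure (R : ℕ → ℕ) (ν : Measure ((ℕ → ℕ) × ℕ)) : Prop where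
  R_pos : ∀ i, 0 < R i
  isProbabilityMeasure : IsProbabilityMeasure ν
  measurePreserving : MeasurePreserving (symTower R) ν ν
  level_lt : ∀ᵐ z ∂ν, z.2 < R (z.1 0)

namespace IsTowerMeasure

variable {R : ℕ → ℕ} {ν : Measure ((ℕ → ℕ) × ℕ)} (h : IsTowerMeasure R ν)
include h

theorem measure_level_succ_le {A : Set (ℕ → ℕ)} (hA : MeasurableSet A) (l : ℕ) :
    ν (A ×ˢ {l + 1}) ≤ ν (A ×ˢ {l}) := by
  rw [← h.measurePreserving.measure_preimage (hA.prod (measurableSet_singleton _)).nullMeasurableSet]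
  refine measure_mono ?_
  rintro ⟨x, n⟩ hz
  simp only [mem_preimage, symTower] at hz
  split_ifs at hz with hlt
  · simpa using hz
  · simp at hz

theorem measure_level_le {A : Set (ℕ → ℕ)} (hA : MeasurableSet A) (l : ℕ) :
    ν (A ×ˢ {l}) ≤ baseMeasure ν A := by
  induction l with
  | zero => rw [baseMeasure_apply ν hA]
  | succ l ih => exact (h.measure_level_succ_le hA l).trans ih

omit h in
theorem symTower_preimage_succ {A : Set (ℕ → ℕ)} {i : ℕ} (hi : ∀ x ∈ A, x 0 = i) {l : ℕ}
    (hl : l + 1 < R i) : symTower R ⁻¹' (A ×ˢ {l + 1}) = A ×ˢ {l} := by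
  ext ⟨x, n⟩
  simp only [mem_preimage, symTower]
  split_ifs with hlt
  · simp
  · simp only [mem_prod, mem_singleton_iff, Nat.right_eq_add, Nat.add_eq_zero_iff, one_ne_zero,
      and_false, false_iff, not_and]
    rintro hx rfl
    rw [hi x hx] at hlt
    exact hlt hl

omit h in
theorem symTower_preimage_succ_eq_empty {A : Set (ℕ → ℕ)} {i : ℕ} (hi : ∀ x ∈ A, x 0 = i) {l : ℕ}
    (hl : ¬ l + 1 < R i) : symTower R ⁻¹' (A ×ˢ {l + 1}) = ∅ := by
  ext ⟨x, n⟩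
  simp only [mem_preimage, symTower]
  split_ifs with hlt
  · simp only [mem_prod, mem_singleton_iff, add_left_inj, mem_empty_iff_false, iff_false, not_and]
    rintro hx rfl
    rw [hi x hx] at hlt
    exact hl hlt
  · simp

theorem measure_level_eq {A : Set (ℕ → ℕ)} (hA : MeasurableSet A) {i : ℕ} (hi : ∀ x ∈ A, x 0 = i)
    {l : ℕ} (hl : l < R i) : ν (A ×ˢ {l}) = baseMeasure ν A := by
  induction l with
  | zero => rw [baseMeasure_apply ν hA]
  | succ l ih =>
    rw [← h.measurePreserving.measure_preimage
      (hA.prod (measurableSet_singleton _)).nullMeasurableSet, symTower_preimage_succ hi hl]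
    exact ih (by omega)

theorem measure_level_eq_zero {A : Set (ℕ → ℕ)} {i : ℕ} (hi : ∀ x ∈ A, x 0 = i)
    {l : ℕ} (hl : ¬ l < R i) : ν (A ×ˢ {l}) = 0 := by
  refine measure_mono_null ?_ h.level_lt
  rintro ⟨x, n⟩ ⟨hx, hn⟩
  simp only [mem_singleton_iff] at hn
  simp only [mem_compl_iff, mem_ofPred_eq]
  rw [hi x hx, hn]; exact hl

/-- The base is entered only from the top floors, at level `R i - 1` over the symbol `i`. The
equality is almost sure, since points above the roof form a null set but also map to the base. -/
theorem preimage_base_ae (A : Set (ℕ → ℕ)) : symTower R ⁻¹' (A ×ˢ {0}) =ᵐ[ν]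
    ⋃ i, (({x | x 0 = i} ∩ shift ⁻¹' A) ×ˢ {R i - 1} : Set ((ℕ → ℕ) × ℕ)) := by
  filter_upwards [h.level_lt] with ⟨x, n⟩ hz
  refine propext ?_
  change symTower R (x, n) ∈ A ×ˢ {0} ↔
    (x, n) ∈ ⋃ i, (({x | x 0 = i} ∩ shift ⁻¹' A) ×ˢ {R i - 1} : Set ((ℕ → ℕ) × ℕ))
  simp only at hz
  simp only [symTower, mem_iUnion, mem_prod, mem_inter_iff, mem_ofPred_eq, mem_preimage,
    mem_singleton_iff]
  split_ifs with hlt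
  · simp only [and_false, false_iff, not_exists, not_and]
    rintro i ⟨rfl, -⟩
    omega
  · simp only [and_true]
    constructor
    · exact fun hx => ⟨x 0, ⟨rfl, hx⟩, by omega⟩
    · rintro ⟨i, ⟨-, hx⟩, -⟩; exact hx

omit h in
theorem disjoint_tops (A : Set (ℕ → ℕ)) : Pairwise (Function.onFun Disjoint fun i : ℕ =>
    (({x | x 0 = i} ∩ shift ⁻¹' A) ×ˢ {R i - 1} : Set ((ℕ → ℕ) × ℕ))) := by
  intro i j hij
  refine Set.disjoint_left.2 ?_
  rintro ⟨x, n⟩ ⟨⟨hi, -⟩, -⟩ ⟨⟨hj, -⟩, -⟩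
  exact hij (hi.symm.trans hj)

omit h in
theorem measurableSet_top {A : Set (ℕ → ℕ)} (hA : MeasurableSet A) (i : ℕ) :
    MeasurableSet (({x | x 0 = i} ∩ shift ⁻¹' A) ×ˢ {R i - 1} : Set ((ℕ → ℕ) × ℕ)) :=
  ((measurableSet_symbol 0 i).inter (measurable_shift hA)).prod (measurableSet_singleton _)

theorem measure_top {A : Set (ℕ → ℕ)} (hA : MeasurableSet A) (i : ℕ) :
    ν (({x | x 0 = i} ∩ shift ⁻¹' A) ×ˢ {R i - 1}) =
      baseMeasure ν ({x | x 0 = i} ∩ shift ⁻¹' A) :=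
  h.measure_level_eq ((measurableSet_symbol 0 i).inter (measurable_shift hA)) (fun _ hx => hx.1)
    (by have := h.R_pos i; omega)

theorem hasSum_setIntegral_base {H : (ℕ → ℕ) × ℕ → ℝ} (hH : Integrable H ν) {S : (ℕ → ℕ) × ℕ → _}
    (hS : MeasurePreserving S ν ν) {A : Set (ℕ → ℕ)} (hA : MeasurableSet A) :
    HasSum (fun i => ∫ z in S ⁻¹' (({x | x 0 = i} ∩ shift ⁻¹' A) ×ˢ {R i - 1}), H z ∂ν)
      (∫ z in S ⁻¹' (symTower R ⁻¹' (A ×ˢ {0})), H z ∂ν) := by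
  have h1 := hasSum_integral_iUnion (μ := ν) (f := H)
    (fun i => hS.measurable (measurableSet_top (R := R) hA i))
    (fun i j hij => (disjoint_tops (R := R) A hij).preimage S) hH.integrableOn
  rw [← preimage_iUnion] at h1
  rw [setIntegral_congr_set (hS.quasiMeasurePreserving.preimage_ae_eq (h.preimage_base_ae A))]
  exact h1

/-- By invariance of `ν`, the mass of `A` at level `0` is the mass of its preimage on the top
floors. Each floor over a symbol carries the same mass as the part of the base below it. -/
theorem measurePreserving_shift : MeasurePreserving shift (baseMeasure ν) (baseMeasure ν) := by
  have := h.isProbabilityMeasure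
  refine ⟨measurable_shift, Measure.ext fun A hA => ?_⟩
  rw [Measure.map_apply measurable_shift hA, baseMeasure_apply ν hA,
    ← h.measurePreserving.measure_preimage (hA.prod (measurableSet_singleton _)).nullMeasurableSet,
    measure_congr (h.preimage_base_ae A),
    measure_iUnion (disjoint_tops A) (measurableSet_top hA)]
  simp_rw [h.measure_top hA]
  rw [← measure_iUnion]
  · congr 1; ext x; simp
  · intro i j hij
    refine Set.disjoint_left.2 ?_
    rintro x ⟨hi, -⟩ ⟨hj, -⟩
    exact hij (hi.symm.trans hj)
  · exact fun i => (measurableSet_symbol 0 i).inter (measurable_shift hA)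

/-- No level has more mass than the base, so a null base would make the whole tower null. -/
theorem baseMeasure_univ_pos : 0 < (baseMeasure ν).real univ := by
  have := h.isProbabilityMeasure
  refine ENNReal.toReal_pos (fun h0 => ?_) (measure_ne_top _ _)
  have h1 : ν (⋃ l : ℕ, (univ : Set (ℕ → ℕ)) ×ˢ {l}) = 0 :=
    measure_iUnion_null fun l => le_antisymm ((h.measure_level_le MeasurableSet.univ l).trans h0.le)
      zero_le
  have h2 : (⋃ l : ℕ, (univ : Set (ℕ → ℕ)) ×ˢ {l} : Set ((ℕ → ℕ) × ℕ)) = univ := by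
    ext ⟨x, n⟩; simp
  rw [h2, measure_univ] at h1
  exact one_ne_zero h1

end IsTowerMeasure

end SymbolicTower

/-! ### Lipschitz densities obtained from averages over cylinders -/

section Density

variable {ν : Measure ((ℕ → ℕ) × ℕ)}

/-- The cylinder of length `m` at the level of a point. -/
def levelCyl (m : ℕ) (z : (ℕ → ℕ) × ℕ) : Set ((ℕ → ℕ) × ℕ) := PiNat.cylinder z.1 m ×ˢ {z.2}

theorem measurableSet_levelCyl (m : ℕ) (z : (ℕ → ℕ) × ℕ) : MeasurableSet (levelCyl m z) :=
  (measurableSet_cylinder _ _).prod (measurableSet_singleton _)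

theorem levelCyl_eq {m n : ℕ} (hmn : n ≤ m) {x y : ℕ → ℕ} {l : ℕ} (h : y ∈ PiNat.cylinder x m) :
    levelCyl n (y, l) = levelCyl n (x, l) := by
  have h1 : PiNat.cylinder y n = PiNat.cylinder x n :=
    PiNat.mem_cylinder_iff_eq.1 (PiNat.cylinder_anti x hmn h)
  simp only [levelCyl, h1]

/-- The partition of the tower into cylinders of length `m`. -/
def levelPart (m : ℕ) (q : (Fin m → ℕ) × ℕ) : Set ((ℕ → ℕ) × ℕ) := (trunc m ⁻¹' {q.1}) ×ˢ {q.2}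

theorem levelPart_eq (m : ℕ) (z : (ℕ → ℕ) × ℕ) : levelPart m (trunc m z.1, z.2) = levelCyl m z := by
  rw [levelPart, trunc_preimage_singleton]; rfl

theorem measurableSet_levelPart (m : ℕ) (q : (Fin m → ℕ) × ℕ) : MeasurableSet (levelPart m q) :=
  (measurable_trunc m (measurableSet_singleton _)).prod (measurableSet_singleton _)

theorem disjoint_levelPart (m : ℕ) : Pairwise fun p q => Disjoint (levelPart m p) (levelPart m q) := by
  rintro ⟨s, k⟩ ⟨t, l⟩ hne
  refine Set.disjoint_left.2 ?_
  rintro ⟨x, n⟩ ⟨h1, h2⟩ ⟨h3, h4⟩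
  simp only [mem_preimage, mem_singleton_iff] at h1 h2 h3 h4
  exact hne (by rw [← h1, ← h3, ← h2, ← h4])

theorem iUnion_levelPart (m : ℕ) : ⋃ q, levelPart m q = univ := by
  refine eq_univ_of_forall fun z => mem_iUnion.2 ⟨(trunc m z.1, z.2), ?_⟩
  exact ⟨rfl, rfl⟩

theorem exists_levelPart_eq (m : ℕ) (q : (Fin m → ℕ) × ℕ) : ∃ z, levelPart m q = levelCyl m z := by
  obtain ⟨x, hx⟩ := trunc_surjective m q.1
  refine ⟨(x, q.2), ?_⟩
  rw [← levelPart_eq]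
  simp [hx]

/-- Averages of a set function over cylinders; on null cylinders the previous average is kept. -/
def cylAverage (ν : Measure ((ℕ → ℕ) × ℕ)) (σ : Set ((ℕ → ℕ) × ℕ) → ℝ) :
    ℕ → (ℕ → ℕ) × ℕ → ℝ
  | 0, z => σ (levelCyl 0 z) / ν.real (levelCyl 0 z)
  | m + 1, z => if ν.real (levelCyl (m + 1) z) = 0 then cylAverage ν σ m z else
      σ (levelCyl (m + 1) z) / ν.real (levelCyl (m + 1) z)

variable {σ : Set ((ℕ → ℕ) × ℕ) → ℝ} {a b β : ℝ}

theorem cylAverage_eq {m : ℕ} {z : (ℕ → ℕ) × ℕ} (h : ν.real (levelCyl m z) ≠ 0) :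
    cylAverage ν σ m z = σ (levelCyl m z) / ν.real (levelCyl m z) := by
  cases m with
  | zero => rfl
  | succ m => rw [cylAverage, if_neg h]

theorem abs_cylAverage_le (hb : 0 ≤ b) (hσ : ∀ E, MeasurableSet E → |σ E| ≤ b * ν.real E) (m : ℕ)
    (z : (ℕ → ℕ) × ℕ) : |cylAverage ν σ m z| ≤ b := by
  have h1 : ∀ m, |σ (levelCyl m z) / ν.real (levelCyl m z)| ≤ b := fun m => by
    rw [abs_div, abs_of_nonneg measureReal_nonneg]
    exact div_le_of_le_mul₀ measureReal_nonneg hb (hσ _ (measurableSet_levelCyl m z))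
  induction m with
  | zero => exact h1 0
  | succ m ih =>
    rw [cylAverage]
    split_ifs
    · exact ih
    · exact h1 _

theorem cylAverage_congr {m n : ℕ} (hmn : n ≤ m) {x y : ℕ → ℕ} {l : ℕ}
    (h : y ∈ PiNat.cylinder x m) : cylAverage ν σ n (y, l) = cylAverage ν σ n (x, l) := by
  induction n with
  | zero => simp only [cylAverage, levelCyl_eq hmn h]
  | succ n ih => simp only [cylAverage, levelCyl_eq hmn h, ih (by omega)]

/-- A set function with small oscillation on cylinders has a Lipschitz density. -/
theorem exists_symLipschitz_density [IsProbabilityMeasure ν] (hβ0 : 0 < β) (hβ1 : β < 1)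
    {S : (ℕ → ℕ) × ℕ → (ℕ → ℕ) × ℕ} (hS : MeasurePreserving S ν ν) {F : (ℕ → ℕ) × ℕ → ℝ}
    (hF : Integrable F ν) (ha : 0 ≤ a) (hb : 0 ≤ b)
    (hbound : ∀ E, MeasurableSet E → |∫ z in S ⁻¹' E, F z ∂ν| ≤ b * ν.real E)
    (hosc : ∀ (m : ℕ) (v : ℕ → ℕ) (l : ℕ) (A B : Set (ℕ → ℕ)), 1 ≤ m → MeasurableSet A →
      MeasurableSet B → A ⊆ PiNat.cylinder v m → B ⊆ PiNat.cylinder v m →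
      |(∫ z in S ⁻¹' (A ×ˢ {l}), F z ∂ν) * ν.real (B ×ˢ {l}) -
        (∫ z in S ⁻¹' (B ×ˢ {l}), F z ∂ν) * ν.real (A ×ˢ {l})| ≤
        a * β ^ m * (ν.real (A ×ˢ {l}) * ν.real (B ×ˢ {l}))) :
    ∃ g, SymLipschitz β (2 * (a / (1 - β)) + 2 * b) b g ∧
      ∀ ξ : (ℕ → ℕ) × ℕ → ℝ, Measurable ξ → ∀ c : ℝ, (∀ z, |ξ z| ≤ c) →
        ∫ z, F z * ξ (S z) ∂ν = ∫ z, g z * ξ z ∂ν := by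
  set σ : Set ((ℕ → ℕ) × ℕ) → ℝ := fun E => ∫ z in S ⁻¹' E, F z ∂ν with hσ
  set G := cylAverage ν σ with hG
  -- Consecutive averages are compared by applying `hosc` to a cylinder and the next smaller one.
  -- The sequence starts at length `1`, because `hosc` gives no information for `m = 0`.
  have hstep : ∀ (z : (ℕ → ℕ) × ℕ) (n : ℕ), dist (G (n + 1) z) (G (n + 1 + 1) z) ≤ a * β * β ^ n := by
    intro z n
    rw [hG]
    by_cases h0 : ν.real (levelCyl (n + 1 + 1) z) = 0
    · rw [show cylAverage ν σ (n + 1 + 1) z = cylAverage ν σ (n + 1) z from if_pos h0, dist_self]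
      positivity
    have hsub : PiNat.cylinder z.1 (n + 1 + 1) ⊆ PiNat.cylinder z.1 (n + 1) :=
      PiNat.cylinder_anti z.1 (Nat.le_succ _)
    have h1 : ν.real (levelCyl (n + 1) z) ≠ 0 := by
      refine (lt_of_lt_of_le (lt_of_le_of_ne measureReal_nonneg (Ne.symm h0)) ?_).ne'
      exact measureReal_mono (prod_mono hsub le_rfl)
    rw [cylAverage_eq h0, cylAverage_eq h1, dist_comm, Real.dist_eq]
    have h2 := hosc (n + 1) z.1 z.2 _ _ (by omega) (measurableSet_cylinder z.1 (n + 1 + 1))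
      (measurableSet_cylinder z.1 (n + 1)) hsub le_rfl
    have p0 : 0 < ν.real (levelCyl (n + 1 + 1) z) := lt_of_le_of_ne measureReal_nonneg (Ne.symm h0)
    have p1 : 0 < ν.real (levelCyl (n + 1) z) := lt_of_le_of_ne measureReal_nonneg (Ne.symm h1)
    rw [div_sub_div _ _ h0 h1, abs_div, abs_of_pos (mul_pos p0 p1), div_le_iff₀ (mul_pos p0 p1)]
    rw [mul_comm (ν.real (levelCyl (n + 1 + 1) z)) (σ _)]
    refine h2.trans (le_of_eq ?_)
    simp only [levelCyl]; ring
  have hcauchy : ∀ z, CauchySeq fun n => G (n + 1) z := fun z =>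
    cauchySeq_of_le_geometric β (a * β) hβ1 (hstep z)
  choose g hg using fun z => cauchySeq_tendsto_of_complete (hcauchy z)
  have hdist : ∀ z n, |G (n + 1) z - g z| ≤ a / (1 - β) * β ^ (n + 1) := fun z n => by
    have := dist_le_of_le_geometric_of_tendsto β (a * β) hβ1 (hstep z) (hg z) n
    rw [Real.dist_eq] at this
    refine this.trans (le_of_eq ?_)
    ring
  have hgb : ∀ z, |g z| ≤ b := fun z =>
    le_of_tendsto' (hg z).abs fun n => abs_cylAverage_le hb hbound _ _
  have hβ' : 0 ≤ a / (1 - β) := div_nonneg ha (by linarith)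
  -- Two points of one cylinder have a common average, and each value of `g` is within `a / (1 - β)
  -- * β ^ m` of it. The summand `2 * b` covers the trivial case `m = 0`.
  have hLip : SymLipschitz β (2 * (a / (1 - β)) + 2 * b) b g := by
    refine ⟨hgb, fun m x y l hxy => ?_⟩
    cases m with
    | zero =>
      have h1 := (abs_sub (g (x, l)) (g (y, l))).trans (add_le_add (hgb _) (hgb _))
      rw [pow_zero, mul_one]; linarith
    | succ m =>
      have h1 := hdist (x, l) m
      have h2 := hdist (y, l) m
      rw [show G (m + 1) (y, l) = G (m + 1) (x, l) from cylAverage_congr le_rfl hxy] at h2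
      have h3 : |g (x, l) - g (y, l)| ≤ 2 * (a / (1 - β)) * β ^ (m + 1) := by
        rw [abs_le] at h1 h2 ⊢
        constructor <;> linarith [h1.1, h1.2, h2.1, h2.2]
      refine h3.trans ?_
      gcongr
      linarith
  have hgm : Measurable g := hLip.measurable hβ0 hβ1
  have hgi : Integrable g ν := Integrable.of_bound hgm.aestronglyMeasurable b
    (Filter.Eventually.of_forall hgb)
  have hgS : Integrable (fun z => g (S z)) ν := hS.integrable_comp_of_integrable hgi
  have hcomp : ∀ E, MeasurableSet E → ∫ z in S ⁻¹' E, g (S z) ∂ν = ∫ z in E, g z ∂ν := by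
    intro E hE
    rw [← integral_indicator (hS.measurable hE), ← integral_indicator hE]
    have h1 := integral_map (μ := ν) hS.measurable.aemeasurable
      (f := E.indicator g) (hgm.indicator hE).aestronglyMeasurable
    rw [hS.map_eq] at h1
    rw [h1]; rfl
  have hH : Integrable (fun z => F z - g (S z)) ν := hF.sub hgS
  -- On each cylinder of length `m + 1` both `F` and `g ∘ S` are compared with the cylinder average.
  -- The errors are of order `β ^ (m + 1)` times the measure; they sum over the partition and vanish
  -- as `m` grows.
  have hzero : ∀ E, MeasurableSet E → ∫ z in S ⁻¹' E, (F z - g (S z)) ∂ν = 0 := by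
    intro E hE
    have hest : ∀ m : ℕ, |∫ z in S ⁻¹' E, (F z - g (S z)) ∂ν| ≤
        (a + a / (1 - β)) * β ^ (m + 1) * ν.real (S ⁻¹' E) := by
      intro m
      refine abs_setIntegral_le_of_partition (Q := fun q => S ⁻¹' levelPart (m + 1) q)
        (fun q => hS.measurable (measurableSet_levelPart _ q))
        (fun p q hpq => (disjoint_levelPart (m + 1) hpq).preimage S)
        (by rw [← preimage_iUnion, iUnion_levelPart, preimage_univ]) hH (hS.measurable hE) fun q => ?_
      obtain ⟨⟨v, l⟩, hq⟩ := exists_levelPart_eq (m + 1) q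
      rw [hq, ← preimage_inter]
      set A : Set (ℕ → ℕ) := PiNat.cylinder v (m + 1) ∩ {x | (x, l) ∈ E} with hA
      have hEA : E ∩ levelCyl (m + 1) (v, l) = A ×ˢ {l} := by
        ext ⟨x, n⟩
        simp only [levelCyl, mem_inter_iff, mem_prod, mem_singleton_iff, hA, mem_ofPred_eq]
        constructor
        · rintro ⟨h1, h2, rfl⟩; exact ⟨⟨h2, h1⟩, rfl⟩
        · rintro ⟨⟨h2, h1⟩, rfl⟩; exact ⟨h1, h2, rfl⟩
      have hAm : MeasurableSet A := (measurableSet_cylinder _ _).inter (measurable_prodMk_right hE)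
      have hAl : MeasurableSet (A ×ˢ {l} : Set ((ℕ → ℕ) × ℕ)) := hAm.prod (measurableSet_singleton _)
      rw [hEA, measureReal_def, hS.measure_preimage hAl.nullMeasurableSet, ← measureReal_def]
      by_cases h0 : ν.real (levelCyl (m + 1) (v, l)) = 0
      · have hA0 : ν (S ⁻¹' (A ×ˢ {l})) = 0 := by
          rw [hS.measure_preimage hAl.nullMeasurableSet]
          refine measure_mono_null ?_ ((measureReal_eq_zero_iff (measure_ne_top _ _)).1 h0)
          exact prod_mono inter_subset_left le_rfl
        rw [setIntegral_measure_zero _ hA0, abs_zero]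
        have : 0 ≤ ν.real (A ×ˢ {l}) := measureReal_nonneg
        positivity
      have p0 : 0 < ν.real (levelCyl (m + 1) (v, l)) :=
        lt_of_le_of_ne measureReal_nonneg (Ne.symm h0)
      rw [integral_sub hF.integrableOn hgS.integrableOn, hcomp _ hAl]
      have e1 : |σ (A ×ˢ {l}) - G (m + 1) (v, l) * ν.real (A ×ˢ {l})| ≤
          a * β ^ (m + 1) * ν.real (A ×ˢ {l}) := by
        have h2 := hosc (m + 1) v l A _ (by omega) hAm (measurableSet_cylinder v (m + 1))
          inter_subset_left le_rfl
        change |σ (A ×ˢ {l}) * ν.real (levelCyl (m + 1) (v, l)) -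
          σ (levelCyl (m + 1) (v, l)) * ν.real (A ×ˢ {l})| ≤
          a * β ^ (m + 1) * (ν.real (A ×ˢ {l}) * ν.real (levelCyl (m + 1) (v, l))) at h2
        rw [hG, cylAverage_eq h0]
        generalize ν.real (levelCyl (m + 1) (v, l)) = P at h2 p0 ⊢
        generalize ν.real (A ×ˢ {l}) = Q at h2 ⊢
        generalize σ (levelCyl (m + 1) (v, l)) = s at h2 ⊢
        generalize σ (A ×ˢ {l}) = t at h2 ⊢
        rw [show t - s / P * Q = (t * P - s * Q) / P by field_simp, abs_div, abs_of_pos p0,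
          div_le_iff₀ p0]
        exact h2.trans (le_of_eq (by ring))
      have e2 : |(∫ z in A ×ˢ {l}, g z ∂ν) - G (m + 1) (v, l) * ν.real (A ×ˢ {l})| ≤
          a / (1 - β) * β ^ (m + 1) * ν.real (A ×ˢ {l}) := by
        have h3 : (∫ z in A ×ˢ {l}, g z ∂ν) - G (m + 1) (v, l) * ν.real (A ×ˢ {l}) =
            ∫ z in A ×ˢ {l}, (g z - G (m + 1) (v, l)) ∂ν := by
          rw [integral_sub hgi.integrableOn (integrable_const _).integrableOn, setIntegral_const,
            smul_eq_mul, mul_comm (ν.real _)]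
        rw [h3, ← Real.norm_eq_abs]
        refine norm_setIntegral_le_of_norm_le_const (measure_lt_top _ _) fun z hz => ?_
        obtain ⟨x, n⟩ := z
        obtain ⟨⟨hx, -⟩, rfl⟩ := hz
        rw [← show G (m + 1) (x, n) = G (m + 1) (v, n) from cylAverage_congr le_rfl hx,
          Real.norm_eq_abs, abs_sub_comm]
        exact hdist _ _
      calc |σ (A ×ˢ {l}) - ∫ z in A ×ˢ {l}, g z ∂ν|
          = |(σ (A ×ˢ {l}) - G (m + 1) (v, l) * ν.real (A ×ˢ {l})) -
            ((∫ z in A ×ˢ {l}, g z ∂ν) - G (m + 1) (v, l) * ν.real (A ×ˢ {l}))| := by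
              congr 1; ring
        _ ≤ _ := (abs_sub _ _).trans (add_le_add e1 e2)
        _ = _ := by ring
    have hlim : Filter.Tendsto (fun m : ℕ => (a + a / (1 - β)) * β ^ (m + 1) * ν.real (S ⁻¹' E))
        Filter.atTop (𝓝 0) := by
      have h1 := (tendsto_pow_atTop_nhds_zero_of_lt_one hβ0.le hβ1).comp (Filter.tendsto_add_atTop_nat 1)
      simpa using (h1.const_mul (a + a / (1 - β))).mul_const (ν.real (S ⁻¹' E))
    exact abs_nonpos_iff.1 (ge_of_tendsto' hlim hest)
  refine ⟨g, hLip, fun ξ hξ c hc => ?_⟩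
  have h1 := integral_mul_comp_eq_zero hS.measurable hH hzero hξ hc
  have i1 : Integrable (fun z => F z * ξ (S z)) ν :=
    hF.mul_bdd (c := c) (hξ.comp hS.measurable).aestronglyMeasurable
      (Filter.Eventually.of_forall fun z => hc _)
  have i2 : Integrable (fun z => g (S z) * ξ (S z)) ν :=
    hgS.mul_bdd (c := c) (hξ.comp hS.measurable).aestronglyMeasurable
      (Filter.Eventually.of_forall fun z => hc _)
  simp only [sub_mul] at h1
  rw [integral_sub i1 i2, sub_eq_zero] at h1
  rw [h1]
  have h2 := integral_map (μ := ν) hS.measurable.aemeasurable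
      (f := fun z => g z * ξ z) (hgm.mul hξ).aestronglyMeasurable
  rw [hS.map_eq] at h2
  exact h2.symm

end Density

/-! ### Uniform regularity under powers of the transfer operator -/

section Transfer

variable {β C : ℝ} {m : Measure (ℕ → ℕ)}

theorem BoundedDistortion.real_le [IsFiniteMeasure m] (h : BoundedDistortion β C m) (w : ℕ → ℕ)
    (n : ℕ) {v : ℕ → ℕ} {k : ℕ} {A B : Set (ℕ → ℕ)} (hA : MeasurableSet A) (hB : MeasurableSet B)
    (hAv : A ⊆ PiNat.cylinder v k) (hBv : B ⊆ PiNat.cylinder v k) :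
    m.real (prepend w n A) * m.real B ≤
      Real.exp (C * β ^ k) * (m.real (prepend w n B) * m.real A) := by
  have h1 := ENNReal.toReal_mono (by finiteness) (h w n v k A B hA hB hAv hBv)
  simpa only [ENNReal.toReal_mul, ENNReal.toReal_ofReal (Real.exp_pos _).le, measureReal_def] using h1

theorem BoundedDistortion.real_prepend_le [IsFiniteMeasure m] (h : BoundedDistortion β C m)
    (w : ℕ → ℕ) (n : ℕ) {A : Set (ℕ → ℕ)} (hA : MeasurableSet A) :
    m.real (prepend w n A) * m.real univ ≤
      Real.exp C * (m.real (PiNat.cylinder w n) * m.real A) := by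
  have h1 := h.real_le w n (v := w) (k := 0) hA MeasurableSet.univ (by simp) (by simp)
  simpa [prepend_univ] using h1

/-- With `s = C βᵏ ≤ C`, both `exp s - 1` and `1 - exp (-s)` are at most `s exp C`. This converts
ratio bounds into difference bounds. -/
theorem BoundedDistortion.abs_sub_le [IsFiniteMeasure m] (h : BoundedDistortion β C m)
    (hβ0 : 0 < β) (hβ1 : β < 1) (hC : 0 ≤ C) (w : ℕ → ℕ)
    (n : ℕ) {v : ℕ → ℕ} {k : ℕ} {A B : Set (ℕ → ℕ)} (hA : MeasurableSet A) (hB : MeasurableSet B)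
    (hAv : A ⊆ PiNat.cylinder v k) (hBv : B ⊆ PiNat.cylinder v k) :
    |m.real (prepend w n A) * m.real B - m.real (prepend w n B) * m.real A| ≤
      C * Real.exp C * β ^ k * (m.real (prepend w n B) * m.real A) := by
  have h1 := h.real_le w n hA hB hAv hBv
  have h2 := h.real_le w n hB hA hBv hAv
  have hβk : β ^ k ≤ 1 := pow_le_one₀ hβ0.le hβ1.le
  have hβk0 : 0 < β ^ k := by positivity
  set s := C * β ^ k with hs
  have hs0 : 0 ≤ s := by positivity
  have hsC : s ≤ C := mul_le_of_le_one_right hC hβk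
  have e1 : Real.exp s - 1 ≤ s * Real.exp C := by
    have := Real.add_one_le_exp (-s)
    have h3 : 1 - s ≤ Real.exp (-s) := by linarith
    have h4 : (1 - s) * Real.exp s ≤ 1 := by
      calc (1 - s) * Real.exp s ≤ Real.exp (-s) * Real.exp s := by gcongr
        _ = 1 := by rw [← Real.exp_add]; simp
    have h5 : Real.exp s ≤ Real.exp C := Real.exp_le_exp.2 hsC
    nlinarith
  have e2 : 1 - Real.exp (-s) ≤ s * Real.exp C := by
    have := Real.add_one_le_exp (-s)
    have h5 : (1 : ℝ) ≤ Real.exp C := Real.one_le_exp hC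
    nlinarith
  have hx : 0 ≤ m.real (prepend w n A) * m.real B := by positivity
  have hy : 0 ≤ m.real (prepend w n B) * m.real A := by positivity
  generalize m.real (prepend w n A) * m.real B = x at *
  generalize m.real (prepend w n B) * m.real A = y at *
  have h6 : Real.exp (-s) * y ≤ x := by
    calc Real.exp (-s) * y ≤ Real.exp (-s) * (Real.exp s * x) := by gcongr
      _ = x := by rw [← mul_assoc, ← Real.exp_add]; simp
  have e3 : C * Real.exp C * β ^ k * y = s * Real.exp C * y := by rw [hs]; ring
  rw [e3, abs_le]
  constructor <;> nlinarith

/-- The elementary estimate behind the preservation of regularity under inverse branches. -/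
theorem abs_cross_sub_le {s t P Q p q b e δ : ℝ} (hP : 0 ≤ P) (hQ : 0 ≤ Q) (hq : 0 ≤ q)
    (hb : 0 ≤ b) (hs : |s| ≤ b * P) (ht : |t| ≤ b * Q)
    (hst : |s * Q - t * P| ≤ e * (P * Q)) (hd : |P * q - Q * p| ≤ δ * (Q * p)) :
    |s * q - t * p| ≤ e * (P * q) + b * δ * (Q * p) := by
  rcases hQ.eq_or_lt with rfl | hQ
  · have ht0 : t = 0 := by simpa using ht
    have h1 : P * q = 0 :=
      abs_nonpos_iff.1 (by simpa only [zero_mul, sub_zero, mul_zero] using hd)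
    have h2 : s * q = 0 := by
      rcases mul_eq_zero.1 h1 with rfl | rfl
      · rw [show s = 0 by simpa using hs]; simp
      · simp
    simp [ht0, h1, h2]
  · have h1 : (s * q - t * p) * Q = (s * Q - t * P) * q + t * (P * q - Q * p) := by ring
    have h2 : |s * q - t * p| * Q ≤ e * (P * Q) * q + b * Q * (δ * (Q * p)) := by
      rw [← abs_of_pos hQ, ← abs_mul, abs_of_pos hQ, h1]
      refine (abs_add_le _ _).trans ?_
      rw [abs_mul, abs_mul, abs_of_nonneg hq]
      gcongr
    refine le_of_mul_le_mul_right (h2.trans (le_of_eq ?_)) hQ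
    ring

variable {ν : Measure ((ℕ → ℕ) × ℕ)} {R : ℕ → ℕ} {a b : ℝ} {φ : (ℕ → ℕ) × ℕ → ℝ}

theorem SymLipschitz.integrable [IsFiniteMeasure ν] (hφ : SymLipschitz β a b φ) (hβ0 : 0 < β)
    (hβ1 : β < 1) : Integrable φ ν :=
  Integrable.of_bound (hφ.measurable hβ0 hβ1).aestronglyMeasurable b
    (Filter.Eventually.of_forall hφ.bound)

theorem SymLipschitz.abs_setIntegral_sub_le [IsFiniteMeasure ν] (hφ : SymLipschitz β a b φ)
    (hβ0 : 0 < β) (hβ1 : β < 1) {k : ℕ} {v : ℕ → ℕ} (l : ℕ) {A : Set (ℕ → ℕ)}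
    (hAv : A ⊆ PiNat.cylinder v k) :
    |(∫ z in A ×ˢ {l}, φ z ∂ν) - φ (v, l) * ν.real (A ×ˢ {l})| ≤
      a * β ^ k * ν.real (A ×ˢ {l}) := by
  have h3 : (∫ z in A ×ˢ {l}, φ z ∂ν) - φ (v, l) * ν.real (A ×ˢ {l}) =
      ∫ z in A ×ˢ {l}, (φ z - φ (v, l)) ∂ν := by
    rw [integral_sub (hφ.integrable hβ0 hβ1).integrableOn (integrable_const _).integrableOn,
      setIntegral_const, smul_eq_mul, mul_comm (ν.real _)]
  rw [h3, ← Real.norm_eq_abs]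
  refine norm_setIntegral_le_of_norm_le_const (measure_lt_top _ _) fun z hz => ?_
  obtain ⟨x, n⟩ := z
  obtain ⟨hx, rfl⟩ := hz
  rw [Real.norm_eq_abs, abs_sub_comm]
  exact hφ.osc k v x n (hAv hx)

theorem SymLipschitz.abs_setIntegral_cross_le [IsFiniteMeasure ν] (hφ : SymLipschitz β a b φ)
    (hβ0 : 0 < β) (hβ1 : β < 1) {k : ℕ} {v : ℕ → ℕ} (l : ℕ) {A B : Set (ℕ → ℕ)}
    (hAv : A ⊆ PiNat.cylinder v k) (hBv : B ⊆ PiNat.cylinder v k) :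
    |(∫ z in A ×ˢ {l}, φ z ∂ν) * ν.real (B ×ˢ {l}) -
      (∫ z in B ×ˢ {l}, φ z ∂ν) * ν.real (A ×ˢ {l})| ≤
      2 * a * β ^ k * (ν.real (A ×ˢ {l}) * ν.real (B ×ˢ {l})) := by
  have h1 := hφ.abs_setIntegral_sub_le (ν := ν) hβ0 hβ1 l hAv
  have h2 := hφ.abs_setIntegral_sub_le (ν := ν) hβ0 hβ1 l hBv
  have p0 : 0 ≤ ν.real (A ×ˢ {l}) := measureReal_nonneg
  have q0 : 0 ≤ ν.real (B ×ˢ {l}) := measureReal_nonneg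
  generalize ν.real (A ×ˢ {l}) = P at *
  generalize ν.real (B ×ˢ {l}) = Q at *
  generalize ∫ z in A ×ˢ {l}, φ z ∂ν = s at *
  generalize ∫ z in B ×ˢ {l}, φ z ∂ν = t at *
  generalize φ (v, l) = c at *
  rw [show s * Q - t * P = (s - c * P) * Q - (t - c * Q) * P by ring]
  refine (abs_sub _ _).trans ?_
  rw [abs_mul, abs_mul, abs_of_nonneg p0, abs_of_nonneg q0]
  nlinarith [mul_le_mul_of_nonneg_right h1 q0, mul_le_mul_of_nonneg_right h2 p0]

theorem abs_setIntegral_preimage_le [IsFiniteMeasure ν] {S : (ℕ → ℕ) × ℕ → (ℕ → ℕ) × ℕ}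
    (hS : MeasurePreserving S ν ν) (hb : ∀ z, |φ z| ≤ b) {E : Set ((ℕ → ℕ) × ℕ)}
    (hE : MeasurableSet E) : |∫ z in S ⁻¹' E, φ z ∂ν| ≤ b * ν.real E := by
  rw [← Real.norm_eq_abs, measureReal_def, ← hS.measure_preimage hE.nullMeasurableSet,
    ← measureReal_def]
  exact norm_setIntegral_le_of_norm_le_const (measure_lt_top _ _) fun z _ => hb z

theorem prepend_one (w : ℕ → ℕ) (A : Set (ℕ → ℕ)) :
    prepend w 1 A = {x | x 0 = w 0} ∩ shift ⁻¹' A := by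
  rw [prepend_succ, prepend_zero]

theorem real_level_zero {A : Set (ℕ → ℕ)} (hA : MeasurableSet A) :
    ν.real (A ×ˢ {0}) = (baseMeasure ν).real A := by
  rw [measureReal_def, measureReal_def, baseMeasure_apply ν hA]

namespace IsTowerMeasure

variable (h : IsTowerMeasure R ν)
include h

theorem measurePreserving_iterate (k : ℕ) : MeasurePreserving (symTower R)^[k] ν ν :=
  h.measurePreserving.iterate k

theorem hasSum_real_top {A : Set (ℕ → ℕ)} (hA : MeasurableSet A) :
    HasSum (fun i => (baseMeasure ν).real ({x | x 0 = i} ∩ shift ⁻¹' A))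
      ((baseMeasure ν).real A) := by
  have := h.isProbabilityMeasure
  have h1 : (baseMeasure ν).real A = (baseMeasure ν).real (⋃ i, {x | x 0 = i} ∩ shift ⁻¹' A) := by
    rw [measureReal_def, ← h.measurePreserving_shift.measure_preimage hA.nullMeasurableSet,
      measureReal_def]
    congr 2; ext x; simp
  have hd : Pairwise (Function.onFun Disjoint fun i : ℕ => {x : ℕ → ℕ | x 0 = i} ∩ shift ⁻¹' A) := by
    intro i j hij
    refine Set.disjoint_left.2 ?_
    rintro x ⟨hi, -⟩ ⟨hj, -⟩
    exact hij (hi.symm.trans hj)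
  have hm : ∀ i, MeasurableSet ({x : ℕ → ℕ | x 0 = i} ∩ shift ⁻¹' A) :=
    fun i => (measurableSet_symbol 0 i).inter (measurable_shift hA)
  have h2 := hasSum_integral_iUnion (μ := baseMeasure ν) hm hd (f := fun _ => (1 : ℝ))
    (integrable_const _).integrableOn
  simp only [setIntegral_const, smul_eq_mul, mul_one] at h2
  rw [h1]; exact h2

/-- The transfer operator preserves the regularity of observables. -/
theorem abs_setIntegral_iterate_cross_le (hβ0 : 0 < β) (hβ1 : β < 1) (hC : 0 ≤ C)
    (hd : BoundedDistortion β C (baseMeasure ν)) (ha : 0 ≤ a) (hb : 0 ≤ b)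
    (hφ : SymLipschitz β a b φ) (k : ℕ) :
    ∀ (m : ℕ) (v : ℕ → ℕ) (l : ℕ) (A B : Set (ℕ → ℕ)), 1 ≤ m → MeasurableSet A →
      MeasurableSet B → A ⊆ PiNat.cylinder v m → B ⊆ PiNat.cylinder v m →
      |(∫ z in (symTower R)^[k] ⁻¹' (A ×ˢ {l}), φ z ∂ν) * ν.real (B ×ˢ {l}) -
        (∫ z in (symTower R)^[k] ⁻¹' (B ×ˢ {l}), φ z ∂ν) * ν.real (A ×ˢ {l})| ≤
        (2 * a + b * (C * Real.exp C) / (1 - β)) * β ^ m *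
          (ν.real (A ×ˢ {l}) * ν.real (B ×ˢ {l})) := by
  have := h.isProbabilityMeasure
  have h1β : 0 < 1 - β := by linarith
  -- Each return to the base lengthens cylinders by one symbol, which shrinks the inductive bound to
  -- `K β`, and adds `b C exp C` from the distortion of the branch. The choice gives `K β + b C exp
  -- C ≤ K`, so the bound does not grow with `k`. Climbing a level costs nothing.
  set K := 2 * a + b * (C * Real.exp C) / (1 - β) with hK
  have hK0 : 0 ≤ K := by positivity
  have hK2 : 2 * a ≤ K := by
    have : 0 ≤ b * (C * Real.exp C) / (1 - β) := by positivity
    linarith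
  induction k with
  | zero =>
    intro m v l A B hm hA hB hAv hBv
    refine (hφ.abs_setIntegral_cross_le (ν := ν) hβ0 hβ1 l hAv hBv).trans ?_
    gcongr
  | succ k ih =>
    intro m v l A B hm hA hB hAv hBv
    have hpre : ∀ E : Set ((ℕ → ℕ) × ℕ), (symTower R)^[k + 1] ⁻¹' E =
        (symTower R)^[k] ⁻¹' (symTower R ⁻¹' E) := fun E => by
      rw [Function.iterate_succ', preimage_comp]
    have hA0 : ∀ x ∈ A, x 0 = v 0 := fun x hx => hAv hx 0 (by omega)
    have hB0 : ∀ x ∈ B, x 0 = v 0 := fun x hx => hBv hx 0 (by omega)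
    rw [hpre, hpre]
    cases l with
    | succ l =>
      by_cases hl : l + 1 < R (v 0)
      · have e : ∀ A, MeasurableSet A → (∀ x ∈ A, x 0 = v 0) →
            ν.real (A ×ˢ {l + 1}) = ν.real (A ×ˢ {l}) := fun A hA hA0 => by
          rw [measureReal_def, measureReal_def, h.measure_level_eq hA hA0 hl,
            h.measure_level_eq hA hA0 (by omega)]
        rw [symTower_preimage_succ hA0 hl, symTower_preimage_succ hB0 hl, e A hA hA0, e B hB hB0]
        exact ih m v l A B hm hA hB hAv hBv
      · rw [symTower_preimage_succ_eq_empty hA0 hl, symTower_preimage_succ_eq_empty hB0 hl]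
        simp only [preimage_empty, setIntegral_empty, zero_mul, sub_zero, abs_zero]
        positivity
    | zero =>
      have hφi := hφ.integrable (ν := ν) hβ0 hβ1
      have sA := h.hasSum_setIntegral_base hφi (h.measurePreserving_iterate k) hA
      have sB := h.hasSum_setIntegral_base hφi (h.measurePreserving_iterate k) hB
      have mA := h.hasSum_real_top hA
      have mB := h.hasSum_real_top hB
      rw [real_level_zero hA, real_level_zero hB]
      set p := (baseMeasure ν).real A
      set q := (baseMeasure ν).real B
      have hs := (sA.mul_right q).sub (sB.mul_right p)
      rw [← hs.tsum_eq, ← Real.norm_eq_abs]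
      have hbd := ((mA.mul_right q).mul_left (K * β ^ (m + 1))).add
        ((mB.mul_right p).mul_left (b * (C * Real.exp C * β ^ m)))
      refine (tsum_of_norm_bounded hbd fun i => ?_).trans ?_
      · set w : ℕ → ℕ := fun _ => i
        have hAi := prepend_subset_cylinder w v 1 m hAv
        have hBi := prepend_subset_cylinder w v 1 m hBv
        have hAim := measurableSet_prepend w 1 hA
        have hBim := measurableSet_prepend w 1 hB
        have e1 := ih (1 + m) _ (R i - 1) _ _ (by omega) hAim hBim hAi hBi
        have e2 := hd.abs_sub_le hβ0 hβ1 hC w 1 hA hB hAv hBv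
        have tA : ν.real ((prepend w 1 A) ×ˢ {R i - 1}) = (baseMeasure ν).real (prepend w 1 A) := by
          rw [measureReal_def, measureReal_def, prepend_one, h.measure_top hA]
        have tB : ν.real ((prepend w 1 B) ×ˢ {R i - 1}) = (baseMeasure ν).real (prepend w 1 B) := by
          rw [measureReal_def, measureReal_def, prepend_one, h.measure_top hB]
        have b1 := abs_setIntegral_preimage_le (h.measurePreserving_iterate k) hφ.bound
          (hAim.prod (measurableSet_singleton (R i - 1)))
        have b2 := abs_setIntegral_preimage_le (h.measurePreserving_iterate k) hφ.bound
          (hBim.prod (measurableSet_singleton (R i - 1)))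
        rw [tA, tB] at e1
        rw [tA] at b1
        rw [tB] at b2
        have e3 := abs_cross_sub_le measureReal_nonneg measureReal_nonneg
          measureReal_nonneg hb b1 b2 e1 e2
        rw [prepend_one, prepend_one] at e3
        rw [Real.norm_eq_abs, add_comm m 1]
        exact e3
      · have h3 : K * β + b * (C * Real.exp C) ≤ K := by
          have : K * (1 - β) = 2 * a * (1 - β) + b * (C * Real.exp C) := by
            rw [hK]; field_simp
          nlinarith
        have hp : 0 ≤ p := measureReal_nonneg
        have hq : 0 ≤ q := measureReal_nonneg
        calc K * β ^ (m + 1) * (p * q) + b * (C * Real.exp C * β ^ m) * (q * p)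
            = (K * β + b * (C * Real.exp C)) * β ^ m * (p * q) := by ring
          _ ≤ K * β ^ m * (p * q) := by gcongr

/-- The function `g` is the image of `φ` under the `k`-th power of the transfer operator, described
by duality. What matters is that `K₀` does not depend on `k`: the image may itself be used as an
observable in the decay of correlations. -/
theorem exists_transfer (hβ0 : 0 < β) (hβ1 : β < 1) (hC : 0 ≤ C)
    (hd : BoundedDistortion β C (baseMeasure ν)) : ∃ K₀ : ℝ, 1 ≤ K₀ ∧ ∀ (a b : ℝ)
      (φ : (ℕ → ℕ) × ℕ → ℝ), 0 ≤ a → 0 ≤ b → SymLipschitz β a b φ → ∀ k : ℕ,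
      ∃ g, SymLipschitz β (K₀ * (a + b)) b g ∧
        ∀ ξ : (ℕ → ℕ) × ℕ → ℝ, Measurable ξ → ∀ c : ℝ, (∀ z, |ξ z| ≤ c) →
          ∫ z, φ z * ξ ((symTower R)^[k] z) ∂ν = ∫ z, g z * ξ z ∂ν := by
  have := h.isProbabilityMeasure
  have h1β : 0 < 1 - β := by linarith
  set D := C * Real.exp C / (1 - β) with hD
  have hD0 : 0 ≤ D := by positivity
  refine ⟨2 * ((2 + D) / (1 - β)) + 2, ?_, fun a b φ ha hb hφ k => ?_⟩
  · have : 0 ≤ 2 * ((2 + D) / (1 - β)) := by positivity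
    linarith
  obtain ⟨g, hg, hint⟩ := exists_symLipschitz_density hβ0 hβ1 (h.measurePreserving_iterate k)
    (hφ.integrable hβ0 hβ1) (a := 2 * a + b * (C * Real.exp C) / (1 - β)) (by positivity) hb
    (fun E hE => abs_setIntegral_preimage_le (h.measurePreserving_iterate k) hφ.bound hE)
    (h.abs_setIntegral_iterate_cross_le hβ0 hβ1 hC hd ha hb hφ k)
  refine ⟨g, ⟨hg.bound, fun m x y l hxy => (hg.osc m x y l hxy).trans ?_⟩, hint⟩
  gcongr
  rw [mul_div_assoc, ← hD]
  have : (2 * a + b * D) / (1 - β) ≤ (2 + D) / (1 - β) * (a + b) := by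
    rw [div_mul_eq_mul_div]
    gcongr
    nlinarith
  nlinarith

end IsTowerMeasure

end Transfer

/-! ### Push-forward along a single branch -/

section Branch

variable {β C : ℝ} {ν : Measure ((ℕ → ℕ) × ℕ)} {R : ℕ → ℕ} {a b : ℝ} {φ : (ℕ → ℕ) × ℕ → ℝ}

theorem symTower_iterate_of_lt {x : ℕ → ℕ} {l t : ℕ} (hlt : l + t < R (x 0)) :
    (symTower R)^[t] (x, l) = (x, l + t) := by
  induction t with
  | zero => rfl
  | succ t ih =>
    rw [Function.iterate_succ_apply', ih (by omega), symTower, if_pos (by omega)]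
    rfl

theorem symTower_iterate_roof {x : ℕ → ℕ} (hR : 0 < R (x 0)) :
    (symTower R)^[R (x 0)] (x, 0) = (shift x, 0) := by
  obtain ⟨r, hr⟩ := Nat.exists_eq_add_of_lt hR
  rw [hr, Function.iterate_succ_apply', symTower_iterate_of_lt (by omega), symTower,
    if_neg (by simp only; omega)]

theorem symTower_iterate_sum (hR : ∀ i, 0 < R i) (N : ℕ) (x : ℕ → ℕ) :
    (symTower R)^[∑ j ∈ Finset.range N, R (x j)] (x, 0) = (shift^[N] x, 0) := by
  induction N with
  | zero => rfl
  | succ N ih =>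
    rw [Finset.sum_range_succ, add_comm, Function.iterate_add_apply, ih,
      Function.iterate_succ_apply']
    have h1 : shift^[N] x 0 = x N := by rw [shift_iterate_apply, zero_add]
    have h2 := symTower_iterate_roof (R := R) (x := shift^[N] x) (hR _)
    rwa [h1] at h2

/-- The time needed to leave the first `N` symbols of `w`, starting at level `l`. -/
def exitTime (R : ℕ → ℕ) (w : ℕ → ℕ) (N l : ℕ) : ℕ := (∑ j ∈ Finset.range N, R (w j)) - l

theorem symTower_iterate_exitTime (hR : ∀ i, 0 < R i) {w : ℕ → ℕ} {N l : ℕ} (hN : 1 ≤ N)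
    (hl : l < R (w 0)) {x : ℕ → ℕ} (hx : x ∈ PiNat.cylinder w N) :
    (symTower R)^[exitTime R w N l] (x, l) = (shift^[N] x, 0) := by
  have h0 : x 0 = w 0 := hx 0 (by omega)
  have hsum : ∑ j ∈ Finset.range N, R (w j) = ∑ j ∈ Finset.range N, R (x j) :=
    Finset.sum_congr rfl fun j hj => by rw [hx j (Finset.mem_range.1 hj)]
  have hle : l ≤ ∑ j ∈ Finset.range N, R (x j) := by
    refine hl.le.trans ?_
    rw [← h0]
    exact Finset.single_le_sum (f := fun j => R (x j)) (fun _ _ => Nat.zero_le _)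
      (Finset.mem_range.2 (by omega))
  have h1 := symTower_iterate_sum hR N x
  have h2 : (symTower R)^[l] (x, 0) = (x, l) := by
    have := symTower_iterate_of_lt (R := R) (x := x) (l := 0) (t := l) (by rw [h0]; omega)
    simpa using this
  rw [← Nat.sub_add_cancel hle, Function.iterate_add_apply, h2] at h1
  rw [exitTime, hsum]
  exact h1

/-- At its exit time a cylinder of length `N` on one level is carried to the base, its points losing
exactly their first `N` symbols. Oscillation of `φ` on cylinders of length `N + m` becomes
oscillation on length `m`, hence `a βᴺ`; distortion contributes a multiple of `b`. Bounded
distortion also yields the factor `ν (cylinder)`, which makes the bounds summable over cylinders. -/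
theorem IsTowerMeasure.exists_branch_transfer (h : IsTowerMeasure R ν) (hβ0 : 0 < β) (hβ1 : β < 1)
    (hC : 0 ≤ C) (hd : BoundedDistortion β C (baseMeasure ν)) : ∃ K₁ : ℝ, 0 < K₁ ∧ ∀ (a b : ℝ)
      (φ : (ℕ → ℕ) × ℕ → ℝ), 0 ≤ a → 0 ≤ b → SymLipschitz β a b φ →
      ∀ (w : ℕ → ℕ) (N l : ℕ), 1 ≤ N → l < R (w 0) →
      ∃ H, SymLipschitz β (K₁ * (a * β ^ N + b) * ν.real (PiNat.cylinder w N ×ˢ {l}))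
          (K₁ * (a * β ^ N + b) * ν.real (PiNat.cylinder w N ×ˢ {l})) H ∧
        ∀ ξ : (ℕ → ℕ) × ℕ → ℝ, Measurable ξ → ∀ c : ℝ, (∀ z, |ξ z| ≤ c) →
          ∫ z in PiNat.cylinder w N ×ˢ {l}, φ z * ξ ((symTower R)^[exitTime R w N l] z) ∂ν =
            ∫ z, H z * ξ z ∂ν := by
  have := h.isProbabilityMeasure
  have h1β : 0 < 1 - β := by linarith
  have hμ := h.baseMeasure_univ_pos
  set D := C * Real.exp C with hD
  have hD0 : 0 ≤ D := by positivity
  set M := Real.exp C / (baseMeasure ν).real univ with hM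
  have hM0 : 0 < M := by positivity
  refine ⟨(2 * ((2 + D) / (1 - β)) + 2) * M, by positivity,
    fun a b φ ha hb hφ w N l hN hl => ?_⟩
  set W : Set ((ℕ → ℕ) × ℕ) := PiNat.cylinder w N ×ˢ {l} with hW
  have hWm : MeasurableSet W := (measurableSet_cylinder w N).prod (measurableSet_singleton l)
  set S := (symTower R)^[exitTime R w N l] with hS
  have hSm : MeasurePreserving S ν ν := h.measurePreserving_iterate _
  have hφi := hφ.integrable (ν := ν) hβ0 hβ1
  have hlev : ∀ A, MeasurableSet A → ν.real (prepend w N A ×ˢ {l}) =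
      (baseMeasure ν).real (prepend w N A) := fun A hA => by
    rw [measureReal_def, measureReal_def, h.measure_level_eq (measurableSet_prepend w N hA)
      (fun x hx => hx.1 0 (by omega)) hl]
  have hWμ : ν.real W = (baseMeasure ν).real (PiNat.cylinder w N) := by
    have := hlev univ MeasurableSet.univ
    rwa [prepend_univ] at this
  have hle : ∀ A, MeasurableSet A → (baseMeasure ν).real (prepend w N A) ≤
      M * ν.real W * (baseMeasure ν).real A := fun A hA => by
    rw [hWμ, hM, div_mul_eq_mul_div, div_mul_eq_mul_div, le_div_iff₀ hμ, mul_assoc]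
    exact hd.real_prepend_le w N hA
  -- On the cylinder the map `S` forgets `N` symbols and lands at level `0`, so only the section of
  -- `E` at level `0` matters.
  have hpre : ∀ E, MeasurableSet E → ∫ z in S ⁻¹' E, W.indicator φ z ∂ν =
      ∫ z in prepend w N {x | (x, 0) ∈ E} ×ˢ {l}, φ z ∂ν := fun E hE => by
    rw [setIntegral_indicator hWm]
    congr 2
    ext ⟨x, n⟩
    simp only [hW, mem_inter_iff, mem_preimage, mem_prod, mem_singleton_iff, prepend,
      mem_ofPred_eq]
    constructor
    · rintro ⟨h1, h2, rfl⟩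
      rw [hS, symTower_iterate_exitTime h.R_pos hN hl h2] at h1
      exact ⟨⟨h2, h1⟩, rfl⟩
    · rintro ⟨⟨h2, h1⟩, rfl⟩
      rw [hS, symTower_iterate_exitTime h.R_pos hN hl h2]
      exact ⟨h1, h2, rfl⟩
  have hsec : ∀ E : Set ((ℕ → ℕ) × ℕ), MeasurableSet E → MeasurableSet {x | (x, 0) ∈ E} :=
    fun E hE => measurable_prodMk_right hE
  have hint : ∀ A, MeasurableSet A → |∫ z in prepend w N A ×ˢ {l}, φ z ∂ν| ≤
      b * (baseMeasure ν).real (prepend w N A) := fun A hA => by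
    rw [← hlev A hA, ← Real.norm_eq_abs]
    exact norm_setIntegral_le_of_norm_le_const (measure_lt_top _ _) fun z _ => hφ.bound z
  have hbM : 0 ≤ b * (M * ν.real W) := by positivity
  have haM : 0 ≤ (2 * a * β ^ N + b * D) * (M * ν.real W) := by positivity
  obtain ⟨g, hg, hgint⟩ := exists_symLipschitz_density hβ0 hβ1 hSm (hφi.indicator hWm) haM hbM
    (fun E hE => by
      rw [hpre E hE]
      calc _ ≤ b * (M * ν.real W * (baseMeasure ν).real {x | (x, 0) ∈ E}) :=
            (hint _ (hsec E hE)).trans (by gcongr; exact hle _ (hsec E hE))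
        _ ≤ b * (M * ν.real W * ν.real E) := by
            gcongr
            rw [← real_level_zero (hsec E hE)]
            refine measureReal_mono ?_
            rintro ⟨x, n⟩ ⟨hx, hn⟩
            rw [mem_singleton_iff] at hn
            subst hn
            exact hx
        _ = _ := by ring)
    (fun m v l' A B hm hA hB hAv hBv => by
      rw [hpre _ (hA.prod (measurableSet_singleton _)), hpre _ (hB.prod (measurableSet_singleton _))]
      cases l' with
      | succ l' =>
        have e : ∀ A : Set (ℕ → ℕ), {x | ((x, 0) : (ℕ → ℕ) × ℕ) ∈ A ×ˢ {l' + 1}} = ∅ := fun A => by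
          ext x; simp
        rw [e, e]
        simp only [prepend, preimage_empty, inter_empty, empty_prod, setIntegral_empty, zero_mul,
          sub_zero, abs_zero]
        positivity
      | zero =>
        have e : ∀ A : Set (ℕ → ℕ), {x | ((x, 0) : (ℕ → ℕ) × ℕ) ∈ A ×ˢ {0}} = A := fun A => by
          ext x; simp
        rw [e, e, real_level_zero hA, real_level_zero hB]
        have e1 := hφ.abs_setIntegral_cross_le (ν := ν) hβ0 hβ1 l
          (prepend_subset_cylinder w v N m hAv) (prepend_subset_cylinder w v N m hBv)
        rw [hlev A hA, hlev B hB] at e1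
        have e2 := hd.abs_sub_le hβ0 hβ1 hC w N hA hB hAv hBv
        have e3 := abs_cross_sub_le measureReal_nonneg measureReal_nonneg
          measureReal_nonneg hb (hint A hA) (hint B hB) e1 e2
        refine e3.trans ?_
        calc _ ≤ 2 * a * β ^ (N + m) * (M * ν.real W * (baseMeasure ν).real A *
                (baseMeasure ν).real B) + b * (C * Real.exp C * β ^ m) *
                (M * ν.real W * (baseMeasure ν).real B * (baseMeasure ν).real A) := by
              gcongr
              · exact hle A hA
              · exact hle B hB
          _ = _ := by rw [hD, pow_add]; ring)
  refine ⟨g, ⟨fun z => (hg.bound z).trans ?_, fun m x y l' hxy => (hg.osc m x y l' hxy).trans ?_⟩,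
    fun ξ hξ c hc => ?_⟩
  · have : 0 ≤ (2 + D) / (1 - β) := by positivity
    calc b * (M * ν.real W) = 1 * M * (0 + b) * ν.real W := by ring
      _ ≤ _ := by gcongr; · linarith
                  · positivity
  · gcongr
    calc 2 * ((2 * a * β ^ N + b * D) * (M * ν.real W) / (1 - β)) + 2 * (b * (M * ν.real W))
        = (2 * ((2 * (a * β ^ N) + D * b) / (1 - β)) + 2 * b) * M * ν.real W := by
          field_simp
      _ ≤ (2 * ((2 + D) * (a * β ^ N + b) / (1 - β)) + 2 * (a * β ^ N + b)) * M * ν.real W := by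
          have : 0 ≤ a * β ^ N := by positivity
          gcongr
          · nlinarith
          · linarith
      _ = _ := by ring
  · rw [← hgint ξ hξ c hc, ← integral_indicator hWm]
    congr 1
    ext z
    by_cases hz : z ∈ W <;> simp [hz]

end Branch

/-! ### Correlation decay and tails of the roof function -/

section Decay

variable {β C : ℝ} {ν : Measure ((ℕ → ℕ) × ℕ)} {R : ℕ → ℕ} {a b : ℝ} {φ : (ℕ → ℕ) × ℕ → ℝ}

/-- Decay of correlations for Lipschitz observables of the symbolic tower. -/
def SymDecay (R : ℕ → ℕ) (ν : Measure ((ℕ → ℕ) × ℕ)) (β K : ℝ) (r : ℕ → ℝ) : Prop :=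
  ∀ (a b a' b' : ℝ) (ψ ξ : (ℕ → ℕ) × ℕ → ℝ), 0 ≤ a → 0 ≤ b → 0 ≤ a' → 0 ≤ b' →
    SymLipschitz β a b ψ → SymLipschitz β a' b' ξ → ∀ n : ℕ, 1 ≤ n →
    |∫ z, ψ z * ξ ((symTower R)^[n] z) ∂ν - (∫ z, ψ z ∂ν) * ∫ z, ξ z ∂ν| ≤
      K * (a + b) * (a' + b') * r n

/-- Decay of the integrals of centred Lipschitz observables against bounded functions of the
future. -/
def UnifDecay (R : ℕ → ℕ) (ν : Measure ((ℕ → ℕ) × ℕ)) (β : ℝ) (j : ℕ) (e : ℝ) : Prop :=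
  ∀ (c : ℝ) (φ : (ℕ → ℕ) × ℕ → ℝ), 0 ≤ c → SymLipschitz β c c φ → ∫ z, φ z ∂ν = 0 →
    ∀ ξ : (ℕ → ℕ) × ℕ → ℝ, Measurable ξ → (∀ z, |ξ z| ≤ 1) →
      |∫ z, φ z * ξ ((symTower R)^[j] z) ∂ν| ≤ c * e

theorem measurable_symTower (R : ℕ → ℕ) : Measurable (symTower R) := by
  refine Measurable.ite ?_ ?_ ?_
  · refine measurableSet_lt (measurable_snd.add_const 1) ?_
    exact (measurable_of_countable R).comp ((measurable_pi_apply 0).comp measurable_fst)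
  · exact measurable_fst.prodMk (measurable_snd.add_const 1)
  · exact (measurable_shift.comp measurable_fst).prodMk measurable_const

theorem UnifDecay.mono {j : ℕ} {e : ℝ} (h : UnifDecay R ν β j e) {i : ℕ} (hij : j ≤ i) :
    UnifDecay R ν β i e := by
  intro c φ hc hφ h0 ξ hξ hξ1
  have := h c φ hc hφ h0 (fun z => ξ ((symTower R)^[i - j] z))
    (hξ.comp ((measurable_symTower R).iterate _)) (fun z => hξ1 _)
  simpa only [← Function.iterate_add_apply, Nat.sub_add_cancel hij] using this

theorem symTower_iterate_snd_le (t : ℕ) (z : (ℕ → ℕ) × ℕ) :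
    ((symTower R)^[t] z).2 ≤ z.2 + t := by
  induction t with
  | zero => rfl
  | succ t ih =>
    rw [Function.iterate_succ_apply', symTower]
    split_ifs
    · simp only; omega
    · simp

theorem symLipschitz_level (p : ℕ → ℝ) (hp : ∀ l, |p l| ≤ 1) :
    SymLipschitz β 0 1 fun z : (ℕ → ℕ) × ℕ => p z.2 :=
  ⟨fun z => hp _, fun m x y l _ => by simp⟩

theorem integral_abs_eq {X : Type*} [MeasurableSpace X] {ν : Measure X} {g : X → ℝ}
    (hg : Measurable g) : ∃ s : X → ℝ, Measurable s ∧ (∀ z, |s z| ≤ 1) ∧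
      ∫ z, |g z| ∂ν = ∫ z, g z * s z ∂ν := by
  refine ⟨fun z => if 0 ≤ g z then 1 else -1, ?_, fun z => ?_, ?_⟩
  · exact Measurable.ite (measurableSet_le measurable_const hg) measurable_const measurable_const
  · dsimp only; split_ifs <;> simp
  · congr 1; ext z; dsimp only; split_ifs with h0
    · rw [abs_of_nonneg h0, mul_one]
    · rw [abs_of_neg (not_le.1 h0), mul_neg_one]

namespace IsTowerMeasure

variable (h : IsTowerMeasure R ν)
include h

/-- The decay is tested on the indicators of the base and of the levels above `t`. From the base no
level above `t` is reached in `t` steps, so the correlation equals the product of the two measures.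
Both indicators depend on the level alone, so their Lipschitz constant is `0`. -/
theorem tail_le {K : ℝ} {r : ℕ → ℝ} (hdec : SymDecay R ν β K r) {t : ℕ} (ht : 1 ≤ t) :
    ν.real {z | t < z.2} ≤ K / (baseMeasure ν).real univ * r t := by
  have := h.isProbabilityMeasure
  have hμ := h.baseMeasure_univ_pos
  have h1 := hdec 0 1 0 1 _ _ le_rfl zero_le_one le_rfl zero_le_one
    (symLipschitz_level (fun l => if l = 0 then 1 else 0) fun l => by split_ifs <;> simp)
    (symLipschitz_level (fun l => if t < l then 1 else 0) fun l => by split_ifs <;> simp) t ht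
  have e0 : ∫ z : (ℕ → ℕ) × ℕ, (if z.2 = 0 then (1 : ℝ) else 0) *
      (if t < ((symTower R)^[t] z).2 then 1 else 0) ∂ν = 0 := by
    refine integral_eq_zero_of_ae (Filter.Eventually.of_forall fun z => ?_)
    have h2 := symTower_iterate_snd_le (R := R) t z
    dsimp only
    by_cases hz : z.2 = 0
    · rw [if_neg (show ¬ t < ((symTower R)^[t] z).2 by omega), mul_zero]; rfl
    · rw [if_neg hz, zero_mul]; rfl
  have hm1 : MeasurableSet {z : (ℕ → ℕ) × ℕ | z.2 = 0} := measurable_snd (measurableSet_singleton 0)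
  have hm2 : MeasurableSet {z : (ℕ → ℕ) × ℕ | t < z.2} :=
    measurableSet_lt measurable_const measurable_snd
  have e1 : ∫ z : (ℕ → ℕ) × ℕ, (if z.2 = 0 then (1 : ℝ) else 0) ∂ν = (baseMeasure ν).real univ := by
    rw [← real_level_zero MeasurableSet.univ, ← integral_indicator_one
      (MeasurableSet.univ.prod (measurableSet_singleton 0))]
    congr 1; ext z; simp [indicator_apply]
  have e2 : ∫ z : (ℕ → ℕ) × ℕ, (if t < z.2 then (1 : ℝ) else 0) ∂ν = ν.real {z | t < z.2} := by
    rw [← integral_indicator_one hm2]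
    congr 1; ext z; simp [indicator_apply]
  rw [e0, e1, e2, zero_sub, abs_neg, abs_of_nonneg (by positivity)] at h1
  rw [div_mul_eq_mul_div, le_div_iff₀ hμ]
  linarith

/-- Base points with roof above `t` are at level `t` after `t` steps, and `ν` is invariant. -/
theorem real_roof_gt_le (t : ℕ) :
    (baseMeasure ν).real {x | t < R (x 0)} ≤ ν.real {z | t ≤ z.2} := by
  have := h.isProbabilityMeasure
  have hm : MeasurableSet {x : ℕ → ℕ | t < R (x 0)} :=
    measurableSet_lt measurable_const ((measurable_of_countable R).comp (measurable_pi_apply 0))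
  have hm2 : MeasurableSet {z : (ℕ → ℕ) × ℕ | t ≤ z.2} :=
    measurableSet_le measurable_const measurable_snd
  rw [← real_level_zero hm, measureReal_def, measureReal_def,
    ← (h.measurePreserving_iterate t).measure_preimage hm2.nullMeasurableSet]
  refine ENNReal.toReal_mono (measure_ne_top _ _) (measure_mono ?_)
  rintro ⟨x, n⟩ ⟨hx, hn⟩
  rw [mem_singleton_iff] at hn
  subst hn
  rw [mem_preimage, symTower_iterate_of_lt (by rw [zero_add]; exact hx)]
  simp

theorem real_exit_gt_le (t : ℕ) :
    ν.real {z | z.2 + t < R (z.1 0)} ≤ ν.real {z | t ≤ z.2} := by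
  have := h.isProbabilityMeasure
  have hm2 : MeasurableSet {z : (ℕ → ℕ) × ℕ | t ≤ z.2} :=
    measurableSet_le measurable_const measurable_snd
  rw [measureReal_def, measureReal_def,
    ← (h.measurePreserving_iterate t).measure_preimage hm2.nullMeasurableSet]
  refine ENNReal.toReal_mono (measure_ne_top _ _) (measure_mono ?_)
  rintro ⟨x, n⟩ hx
  rw [mem_preimage, symTower_iterate_of_lt hx]
  simp

/-- Over a cylinder of length `1`, every level below the roof is a copy of the base. Bounded
distortion decouples the first symbol from the later ones, at the price of a constant. Shift
invariance of the base measure then reduces the later symbol to the first. -/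
theorem real_roof_shift_gt_le (hd : BoundedDistortion β C (baseMeasure ν)) (i t : ℕ) :
    ν.real {z | t < R (z.1 (i + 1))} ≤
      Real.exp C / (baseMeasure ν).real univ * ν.real {z | t ≤ z.2} := by
  have := h.isProbabilityMeasure
  have hμ := h.baseMeasure_univ_pos
  set E : Set ((ℕ → ℕ) × ℕ) := {z | t < R (z.1 (i + 1))} with hE
  have hEm : MeasurableSet E := measurableSet_lt measurable_const
    ((measurable_of_countable R).comp ((measurable_pi_apply _).comp measurable_fst))
  set A : Set (ℕ → ℕ) := {x | t < R (x i)} with hA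
  have hAm : MeasurableSet A :=
    measurableSet_lt measurable_const ((measurable_of_countable R).comp (measurable_pi_apply _))
  have hm0 : MeasurableSet {x : ℕ → ℕ | t < R (x 0)} :=
    measurableSet_lt measurable_const ((measurable_of_countable R).comp (measurable_pi_apply 0))
  have hAμ : (baseMeasure ν).real A ≤ ν.real {z | t ≤ z.2} := by
    refine le_trans (le_of_eq ?_) (h.real_roof_gt_le t)
    rw [measureReal_def, measureReal_def,
      ← (h.measurePreserving_shift.iterate i).measure_preimage hm0.nullMeasurableSet]
    congr 2; ext x
    simp only [hA, mem_ofPred_eq, mem_preimage, shift_iterate_apply, zero_add]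
  have hi : Integrable (E.indicator (1 : (ℕ → ℕ) × ℕ → ℝ)) ν :=
    (integrable_const (1 : ℝ)).indicator hEm
  have key := abs_setIntegral_le_of_partition (c := Real.exp C / (baseMeasure ν).real univ *
    ν.real {z | t ≤ z.2}) (measurableSet_levelPart 1) (disjoint_levelPart 1)
    (iUnion_levelPart 1) hi MeasurableSet.univ (fun q => by
      rw [univ_inter, setIntegral_indicator hEm]
      simp only [Pi.one_apply, setIntegral_const, smul_eq_mul, mul_one]
      rw [abs_of_nonneg measureReal_nonneg]
      obtain ⟨⟨w, l⟩, hq⟩ := exists_levelPart_eq 1 q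
      rw [hq]
      have e1 : levelCyl 1 (w, l) ∩ E = prepend w 1 A ×ˢ {l} := by
        ext ⟨x, n⟩
        simp only [levelCyl, hE, hA, mem_inter_iff, mem_prod, mem_ofPred_eq, prepend, mem_preimage,
          shift_iterate_apply]
        tauto
      rw [e1]
      by_cases hl : l < R (w 0)
      · have e2 : ν.real (levelCyl 1 (w, l)) = (baseMeasure ν).real (PiNat.cylinder w 1) := by
          rw [measureReal_def, measureReal_def, levelCyl, h.measure_level_eq
            (measurableSet_cylinder w 1) (fun x hx => hx 0 (by omega)) hl]
        have e3 : ν.real (prepend w 1 A ×ˢ {l}) = (baseMeasure ν).real (prepend w 1 A) := by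
          rw [measureReal_def, measureReal_def, h.measure_level_eq (measurableSet_prepend w 1 hAm)
            (fun x hx => hx.1 0 (by omega)) hl]
        rw [e2, e3, div_mul_eq_mul_div, div_mul_eq_mul_div, le_div_iff₀ hμ]
        refine (hd.real_prepend_le w 1 hAm).trans ?_
        calc _ ≤ Real.exp C * ((baseMeasure ν).real (PiNat.cylinder w 1) * ν.real {z | t ≤ z.2}) := by
              gcongr
          _ = _ := by ring
      · rw [measureReal_def, h.measure_level_eq_zero (fun x hx => hx.1 0 (by omega)) hl]
        simp only [ENNReal.toReal_zero]
        positivity)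
  rw [setIntegral_univ, integral_indicator_one hEm, probReal_univ (μ := ν), mul_one,
    abs_of_nonneg measureReal_nonneg] at key
  exact key

/-- The points that need more than `j` steps to exhaust their first `N` symbols. -/
theorem real_exitTime_gt_le (hd : BoundedDistortion β C (baseMeasure ν)) {N j t : ℕ} (hN : 1 ≤ N)
    (htj : N * t ≤ j) :
    ν.real {z | z.2 < R (z.1 0) ∧ j < exitTime R z.1 N z.2} ≤
      (1 + N * (Real.exp C / (baseMeasure ν).real univ)) * ν.real {z | t ≤ z.2} := by
  have := h.isProbabilityMeasure
  -- If the rest of the first excursion and the `N - 1` following ones all last at most `t`, the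
  -- exit time is at most `N * t ≤ j`. Hence one of the `N` excursions is long.
  have hsub : {z : (ℕ → ℕ) × ℕ | z.2 < R (z.1 0) ∧ j < exitTime R z.1 N z.2} ⊆
      {z | z.2 + t < R (z.1 0)} ∪
        ⋃ i ∈ Finset.range (N - 1), {z : (ℕ → ℕ) × ℕ | t < R (z.1 (i + 1))} := by
    rintro ⟨x, l⟩ ⟨h1, h2⟩
    by_contra hcon
    simp only [mem_union, mem_iUnion, mem_ofPred_eq, Finset.mem_range, not_or, not_lt,
      not_exists] at hcon h1 h2
    obtain ⟨N, rfl⟩ : ∃ N', N = N' + 1 := ⟨N - 1, by omega⟩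
    rw [exitTime, Finset.sum_range_succ'] at h2
    have h3 : ∑ i ∈ Finset.range N, R (x (i + 1)) ≤ ∑ i ∈ Finset.range N, t :=
      Finset.sum_le_sum fun i hi => hcon.2 i (by simpa using hi)
    rw [Finset.sum_const, Finset.card_range, smul_eq_mul] at h3
    have h4 : (N + 1) * t = N * t + t := by ring
    omega
  refine (measureReal_mono hsub).trans ((measureReal_union_le _ _).trans ?_)
  rw [add_mul, one_mul]
  refine add_le_add (h.real_exit_gt_le t) ((measureReal_biUnion_finset_le _ _).trans ?_)
  refine (Finset.sum_le_sum fun i _ => h.real_roof_shift_gt_le hd i t).trans ?_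
  rw [Finset.sum_const, Finset.card_range, nsmul_eq_mul, mul_assoc]
  have : ((N - 1 : ℕ) : ℝ) ≤ N := by exact_mod_cast Nat.sub_le _ _
  have := h.baseMeasure_univ_pos
  gcongr

end IsTowerMeasure

end Decay

/-! ### Bootstrap for L¹ decay without loss in the exponent -/

section Bootstrap

variable {β C : ℝ} {ν : Measure ((ℕ → ℕ) × ℕ)} {R : ℕ → ℕ} {a b : ℝ} {φ : (ℕ → ℕ) × ℕ → ℝ}

theorem SymLipschitz.mono {a' b' : ℝ} (hφ : SymLipschitz β a b φ) (hβ0 : 0 < β) (ha : a ≤ a')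
    (hb : b ≤ b') : SymLipschitz β a' b' φ :=
  ⟨fun z => (hφ.bound z).trans hb, fun m x y l hxy => (hφ.osc m x y l hxy).trans (by gcongr)⟩

theorem mem_levelPart_self (m : ℕ) (z : (ℕ → ℕ) × ℕ) : z ∈ levelPart m (trunc m z.1, z.2) :=
  ⟨rfl, rfl⟩

theorem eq_of_mem_levelPart {m : ℕ} {q : (Fin m → ℕ) × ℕ} {z : (ℕ → ℕ) × ℕ}
    (hz : z ∈ levelPart m q) : (trunc m z.1, z.2) = q := Prod.ext hz.1 hz.2

/-- Averages of a Lipschitz function over the cylinders of length `N`. -/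
theorem SymLipschitz.exists_average [IsProbabilityMeasure ν] (hβ0 : 0 < β) (hβ1 : β < 1)
    (hφ : SymLipschitz β a b φ) (N : ℕ) : ∃ G : (Fin N → ℕ) × ℕ → ℝ,
      (∀ q, ∀ z ∈ levelPart N q, |φ z - G q| ≤ a * β ^ N) ∧
      ∀ q, ∫ z in levelPart N q, (φ z - G q) ∂ν = 0 := by
  have key : ∀ q, ∃ c : ℝ, (∀ z ∈ levelPart N q, |φ z - c| ≤ a * β ^ N) ∧
      ∫ z in levelPart N q, (φ z - c) ∂ν = 0 := by
    intro q
    obtain ⟨⟨v, l⟩, hq⟩ := exists_levelPart_eq N q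
    have hosc : ∀ x ∈ PiNat.cylinder v N, ∀ y ∈ PiNat.cylinder v N,
        |φ (x, l) - φ (y, l)| ≤ a * β ^ N := fun x hx y hy =>
      hφ.osc N x y l (by rw [PiNat.mem_cylinder_iff_eq.1 hx]; exact hy)
    rw [hq]
    by_cases h0 : ν.real (levelCyl N (v, l)) = 0
    · refine ⟨φ (v, l), ?_, ?_⟩
      · rintro ⟨x, n⟩ ⟨hx, hn⟩
        rw [mem_singleton_iff] at hn
        subst hn
        exact hosc x hx v (PiNat.self_mem_cylinder v N)
      · exact setIntegral_measure_zero _ ((measureReal_eq_zero_iff (measure_ne_top _ _)).1 h0)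
    · have p0 : 0 < ν.real (levelCyl N (v, l)) := lt_of_le_of_ne measureReal_nonneg (Ne.symm h0)
      refine ⟨(∫ z in levelCyl N (v, l), φ z ∂ν) / ν.real (levelCyl N (v, l)), ?_, ?_⟩
      · rintro ⟨x, n⟩ ⟨hx, hn⟩
        rw [mem_singleton_iff] at hn
        subst hn
        have hA : PiNat.cylinder v N ⊆ PiNat.cylinder x N := by
          rw [PiNat.mem_cylinder_iff_eq.1 hx]
        have h1 := hφ.abs_setIntegral_sub_le (ν := ν) hβ0 hβ1 n hA
        change |(∫ z in levelCyl N (v, n), φ z ∂ν) - φ (x, n) * ν.real (levelCyl N (v, n))| ≤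
          a * β ^ N * ν.real (levelCyl N (v, n)) at h1
        change 0 < ν.real (levelCyl N (v, n)) at p0
        change |φ (x, n) - (∫ z in levelCyl N (v, n), φ z ∂ν) / ν.real (levelCyl N (v, n))| ≤ _
        generalize ν.real (levelCyl N (v, n)) = P at *
        generalize ∫ z in levelCyl N (v, n), φ z ∂ν = s at *
        rw [show φ (x, n) - s / P = -((s - φ (x, n) * P) / P) by field_simp; ring, abs_neg, abs_div,
          abs_of_pos p0, div_le_iff₀ p0]
        exact h1
      · rw [integral_sub (hφ.integrable hβ0 hβ1).integrableOn (integrable_const _).integrableOn,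
          setIntegral_const, smul_eq_mul, mul_div_cancel₀ _ h0, sub_self]
  choose G hG1 hG2 using key
  exact ⟨G, hG1, hG2⟩

theorem measurable_comp_levelPart {N : ℕ} (G : (Fin N → ℕ) × ℕ → ℝ) :
    Measurable fun z : (ℕ → ℕ) × ℕ => G (trunc N z.1, z.2) :=
  (measurable_of_countable G).comp
    (((measurable_trunc N).comp measurable_fst).prodMk measurable_snd)

theorem trunc_eq_of_mem_cylinder {m N : ℕ} (hNm : N ≤ m) {x y : ℕ → ℕ} (h : y ∈ PiNat.cylinder x m) :
    trunc N y = trunc N x := funext fun i => h i (i.2.trans_le hNm)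

/-- The function can change, by at most `2`, only on cylinders shorter than `N`, where `β ^ m ≥ β ^
N`. The large constant `(β ^ N)⁻¹` is harmless because the bootstrap keeps `N` fixed. -/
theorem symLipschitz_of_trunc (hβ0 : 0 < β) (hβ1 : β < 1) {N : ℕ} (s : (Fin N → ℕ) × ℕ → ℝ)
    (hs : ∀ q, |s q| ≤ 1) : SymLipschitz β (2 * (β ^ N)⁻¹) 1 fun z => s (trunc N z.1, z.2) := by
  refine ⟨fun z => hs _, fun m x y l hxy => ?_⟩
  rcases le_total N m with hNm | hmN
  · rw [trunc_eq_of_mem_cylinder hNm hxy, sub_self, abs_zero]; positivity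
  · refine (abs_sub _ _).trans ((add_le_add (hs _) (hs _)).trans ?_)
    have : β ^ N ≤ β ^ m := pow_le_pow_of_le_one hβ0.le hβ1.le hmN
    rw [mul_assoc, inv_mul_eq_div]
    have h1 : 1 ≤ β ^ m / β ^ N := (one_le_div (by positivity)).2 this
    linarith

theorem SymLipschitz.sub_average (hβ0 : 0 < β) (hβ1 : β < 1) (ha : 0 ≤ a)
    (hφ : SymLipschitz β a b φ) {N : ℕ} {G : (Fin N → ℕ) × ℕ → ℝ}
    (hG : ∀ q, ∀ z ∈ levelPart N q, |φ z - G q| ≤ a * β ^ N) :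
    SymLipschitz β (2 * a) (a * β ^ N) fun z => φ z - G (trunc N z.1, z.2) := by
  refine ⟨fun z => hG _ z (mem_levelPart_self N z), fun m x y l hxy => ?_⟩
  rcases le_total N m with hNm | hmN
  · rw [trunc_eq_of_mem_cylinder hNm hxy, sub_sub_sub_cancel_right]
    refine (hφ.osc m x y l hxy).trans ?_
    have : 0 ≤ a * β ^ m := by positivity
    linarith
  · refine (abs_sub _ _).trans ((add_le_add (hG _ (x, l) (mem_levelPart_self N (x, l)))
      (hG _ (y, l) (mem_levelPart_self N (y, l)))).trans ?_)
    have : β ^ N ≤ β ^ m := pow_le_pow_of_le_one hβ0.le hβ1.le hmN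
    have := mul_le_mul_of_nonneg_left this ha
    linarith

theorem exists_sign (N : ℕ) (G : (Fin N → ℕ) × ℕ → ℝ) : ∃ s : (Fin N → ℕ) × ℕ → ℝ,
    (∀ q, |s q| ≤ 1) ∧ ∀ q, |G q| = G q * s q := by
  refine ⟨fun q => if 0 ≤ G q then 1 else -1, fun q => ?_, fun q => ?_⟩
  · dsimp only; split_ifs <;> simp
  · dsimp only; split_ifs with h0
    · rw [abs_of_nonneg h0, mul_one]
    · rw [abs_of_neg (not_le.1 h0), mul_neg_one]

theorem measurableSet_exit (R : ℕ → ℕ) (N j : ℕ) :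
    MeasurableSet {z : (ℕ → ℕ) × ℕ | z.2 < R (z.1 0) ∧ j < exitTime R z.1 N z.2} := by
  have h1 : ∀ i, Measurable fun z : (ℕ → ℕ) × ℕ => R (z.1 i) := fun i =>
    (measurable_of_countable R).comp ((measurable_pi_apply i).comp measurable_fst)
  have h2 : Measurable fun z : (ℕ → ℕ) × ℕ => exitTime R z.1 N z.2 :=
    (Finset.measurable_sum _ fun i _ => h1 i).sub measurable_snd
  exact (measurableSet_lt measurable_snd (h1 0)).inter (measurableSet_lt measurable_const h2)

namespace IsTowerMeasure

variable (h : IsTowerMeasure R ν)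
include h

/-- One step of the bootstrap: decay at time `j` and correlation decay give decay at
time `4 j`. -/
theorem unifDecay_step (hβ0 : 0 < β) (hβ1 : β < 1) (hC : 0 ≤ C)
    (hd : BoundedDistortion β C (baseMeasure ν)) {K : ℝ} {r : ℕ → ℝ}
    (hdec : SymDecay R ν β K r) : ∃ K₀ : ℝ, 1 ≤ K₀ ∧ ∀ (N j : ℕ) (e : ℝ), 1 ≤ N → 1 ≤ j → 0 ≤ e →
      UnifDecay R ν β j e →
      UnifDecay R ν β (4 * j) (2 * K * (2 * (β ^ N)⁻¹ + 1) * r (2 * j) +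
        K₀ * ν.real {z | z.2 < R (z.1 0) ∧ j < exitTime R z.1 N z.2} + K₀ * β ^ N * e) := by
  have := h.isProbabilityMeasure
  obtain ⟨K₀, hK₀, htr⟩ := h.exists_transfer hβ0 hβ1 hC hd
  obtain ⟨K₁, hK₁, hbr⟩ := h.exists_branch_transfer hβ0 hβ1 hC hd
  -- With `a = 2 * K₀ * c`, the late cylinders contribute `a = c * (2 * K₀)` and the others `3 * K₁
  -- * a = c * (6 * K₀ * K₁)`.
  refine ⟨2 * K₀ + 6 * K₀ * K₁, by nlinarith, fun N j e hN hj he hP c φ hc hφ h0 ξ hξ hξ1 => ?_⟩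
  -- The `4 j` steps are divided into `2 j` steps that turn `φ` into the regular function `g`, and
  -- `2 j` steps that serve to leave a cylinder and apply the hypothesis at time `j`.
  obtain ⟨g, hg, hgint⟩ := htr c c φ hc hc hφ (2 * j)
  set a := K₀ * (c + c) with ha
  have ha0 : 0 ≤ a := by positivity
  obtain ⟨G, hG1, hG2⟩ := hg.exists_average (ν := ν) hβ0 hβ1 N
  obtain ⟨s, hs1, hs2⟩ := exists_sign N G
  set pr : (ℕ → ℕ) × ℕ → (Fin N → ℕ) × ℕ := fun z => (trunc N z.1, z.2) with hpr
  have hh := hg.sub_average hβ0 hβ1 ha0 hG1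
  have hhm := hh.measurable hβ0 hβ1
  have hhi : Integrable (fun z => g z - G (pr z)) ν := hh.integrable hβ0 hβ1
  have hGm : Measurable fun z => G (pr z) := measurable_comp_levelPart G
  have hsm : Measurable fun z => s (pr z) := measurable_comp_levelPart s
  have hgi : Integrable g ν := hg.integrable hβ0 hβ1
  have hGi : Integrable (fun z => G (pr z)) ν := by
    exact (hgi.sub hhi).congr (Filter.Eventually.of_forall fun z => by simp)
  set T := symTower R with hT
  have hTm : ∀ k, Measurable T^[k] := fun k => (measurable_symTower R).iterate k
  -- The L¹ norm of the averages is the integral of `G` against its sign, which depends on `N`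
  -- symbols and the level. As `g - G` has mean zero on each cylinder, `G` may be replaced by `g`,
  -- and decay of correlations at time `2 j` applies.
  have habs : ∫ z, |G (pr z)| ∂ν ≤ c * (2 * K * (2 * (β ^ N)⁻¹ + 1) * r (2 * j)) := by
    have e1 : ∫ z, |G (pr z)| ∂ν = ∫ z, G (pr z) * s (pr z) ∂ν := by simp only [hs2]
    have hz : ∫ z, (g z - G (pr z)) * s (pr z) ∂ν = 0 := by
      have hI : Integrable (fun z => (g z - G (pr z)) * s (pr z)) ν :=
        hhi.mul_bdd (c := 1) hsm.aestronglyMeasurable (Filter.Eventually.of_forall fun z => hs1 _)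
      have h2 := abs_setIntegral_le_of_partition (c := 0) (measurableSet_levelPart N)
        (disjoint_levelPart N) (iUnion_levelPart N) hI MeasurableSet.univ (fun q => by
          rw [univ_inter, zero_mul]
          have h3 : ∫ z in levelPart N q, (g z - G (pr z)) * s (pr z) ∂ν =
              ∫ z in levelPart N q, (g z - G q) * s q ∂ν :=
            setIntegral_congr_fun (measurableSet_levelPart N q) fun z hz => by
              simp only [hpr, eq_of_mem_levelPart hz]
          rw [h3, integral_mul_const, hG2 q, zero_mul, abs_zero])
      rw [setIntegral_univ, zero_mul] at h2
      exact abs_nonpos_iff.1 h2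
    have hI1 : Integrable (fun z => g z * s (pr z)) ν :=
      hgi.mul_bdd (c := 1) hsm.aestronglyMeasurable (Filter.Eventually.of_forall fun z => hs1 _)
    have hI2 : Integrable (fun z => G (pr z) * s (pr z)) ν :=
      hGi.mul_bdd (c := 1) hsm.aestronglyMeasurable (Filter.Eventually.of_forall fun z => hs1 _)
    simp only [sub_mul] at hz
    rw [integral_sub hI1 hI2, sub_eq_zero] at hz
    have h4 := hdec c c (2 * (β ^ N)⁻¹) 1 φ _ hc hc (by positivity) zero_le_one hφ
      (symLipschitz_of_trunc hβ0 hβ1 s hs1) (2 * j) (by omega)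
    rw [h0, zero_mul, sub_zero] at h4
    rw [e1, ← hz, ← hgint _ hsm 1 fun z => hs1 _]
    refine (le_abs_self _).trans (h4.trans (le_of_eq ?_))
    ring
  set Bad : Set ((ℕ → ℕ) × ℕ) := {z | z.2 < R (z.1 0) ∧ j < exitTime R z.1 N z.2} with hBad
  have hBm : MeasurableSet Bad := measurableSet_exit R N j
  set ζ : (ℕ → ℕ) × ℕ → ℝ := fun z => ξ (T^[2 * j] z) with hζ
  have hζm : Measurable ζ := hξ.comp (hTm _)
  have hζ1 : ∀ z, |ζ z| ≤ 1 := fun z => hξ1 _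
  have hI : Integrable (fun z => (g z - G (pr z)) * ζ z) ν :=
    hhi.mul_bdd (c := 1) hζm.aestronglyMeasurable (Filter.Eventually.of_forall fun z => hζ1 _)
  have hIG : Integrable (fun z => G (pr z) * ζ z) ν :=
    hGi.mul_bdd (c := 1) hζm.aestronglyMeasurable (Filter.Eventually.of_forall fun z => hζ1 _)
  have hbad : |∫ z in Bad, (g z - G (pr z)) * ζ z ∂ν| ≤ a * β ^ N * ν.real Bad := by
    rw [← Real.norm_eq_abs]
    refine norm_setIntegral_le_of_norm_le_const (measure_lt_top _ _) fun z _ => ?_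
    rw [Real.norm_eq_abs, abs_mul]
    calc |g z - G (pr z)| * |ζ z| ≤ a * β ^ N * 1 := by
          gcongr
          · exact hh.bound z
          · exact hζ1 z
      _ = _ := mul_one _
  -- A cylinder left by time `j` is pushed forward along its branch to a mean-zero Lipschitz
  -- function, and at least `j` steps remain. The branch bound with Lipschitz constant `2 a` and sup
  -- bound `a βᴺ` gives `2 a βᴺ + a βᴺ`, whence the factor `3`.
  have hgood : |∫ z in Badᶜ, (g z - G (pr z)) * ζ z ∂ν| ≤ 3 * K₁ * (a * β ^ N) * e := by
    have h2 := abs_setIntegral_le_of_partition (c := 3 * K₁ * (a * β ^ N) * e)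
      (measurableSet_levelPart N) (disjoint_levelPart N) (iUnion_levelPart N) hI hBm.compl
      (fun q => ?_)
    · refine h2.trans (mul_le_of_le_one_right (by positivity) measureReal_le_one)
    obtain ⟨⟨w, l⟩, hq⟩ := exists_levelPart_eq N q
    have hRHS : 0 ≤ 3 * K₁ * (a * β ^ N) * e * ν.real (Badᶜ ∩ levelPart N q) := by positivity
    by_cases hl : l < R (w 0)
    swap
    · rw [setIntegral_measure_zero, abs_zero]
      · exact hRHS
      · refine measure_mono_null inter_subset_right ?_
        rw [hq]
        exact h.measure_level_eq_zero (A := PiNat.cylinder w N) (fun x hx => hx 0 (by omega)) hl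
    have hexit : ∀ x ∈ PiNat.cylinder w N, exitTime R x N l = exitTime R w N l := fun x hx => by
      rw [exitTime, exitTime, Finset.sum_congr rfl fun i hi => by rw [hx i (Finset.mem_range.1 hi)]]
    have hmem : ∀ x ∈ PiNat.cylinder w N, ((x, l) ∈ Bad ↔ j < exitTime R w N l) := fun x hx => by
      simp only [hBad, mem_ofPred_eq, hexit x hx, hx 0 (by omega), hl, true_and]
    by_cases hτ : j < exitTime R w N l
    · have : Badᶜ ∩ levelPart N q = ∅ := by
        rw [hq]
        refine eq_empty_of_forall_notMem ?_
        rintro ⟨x, n⟩ ⟨h1, hx, hn⟩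
        rw [mem_singleton_iff] at hn
        subst hn
        exact h1 ((hmem x hx).2 hτ)
      rw [this, setIntegral_empty, abs_zero]
      rw [this] at hRHS
      exact hRHS
    have hsub : Badᶜ ∩ levelPart N q = levelCyl N (w, l) := by
      rw [hq]
      refine inter_eq_right.2 ?_
      rintro ⟨x, n⟩ ⟨hx, hn⟩
      rw [mem_singleton_iff] at hn
      subst hn
      exact fun h1 => hτ ((hmem x hx).1 h1)
    rw [hsub]
    obtain ⟨H, hH, hHint⟩ := hbr (2 * a) (a * β ^ N) _ (by positivity) (by positivity) hh w N l hN hl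
    have hHmean : ∫ z, H z ∂ν = 0 := by
      have h5 := hHint (fun _ => 1) measurable_const 1 fun _ => by simp
      simp only [mul_one] at h5
      rw [← h5]
      have h6 : ∫ z in PiNat.cylinder w N ×ˢ {l}, (g z - G (trunc N z.1, z.2)) ∂ν =
          ∫ z in levelPart N q, (g z - G q) ∂ν := by
        have : (PiNat.cylinder w N ×ˢ {l} : Set ((ℕ → ℕ) × ℕ)) = levelPart N q := hq.symm
        rw [this]
        exact setIntegral_congr_fun (measurableSet_levelPart N q) fun z hz => by
          simp only [eq_of_mem_levelPart hz]
      rw [h6, hG2]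
    have hτ' : exitTime R w N l ≤ 2 * j := by omega
    have h7 := hHint (fun z => ξ (T^[2 * j - exitTime R w N l] z)) (hξ.comp (hTm _)) 1
      fun z => hξ1 _
    simp only [hT, ← Function.iterate_add_apply, Nat.sub_add_cancel hτ'] at h7
    have h8 := (hP.mono (show j ≤ 2 * j - exitTime R w N l by omega)) _ H (by positivity) hH hHmean
      ξ hξ hξ1
    change |∫ z in PiNat.cylinder w N ×ˢ {l}, (g z - G (trunc N z.1, z.2)) *
      ξ ((symTower R)^[2 * j] z) ∂ν| ≤ _
    rw [h7]
    refine h8.trans (le_of_eq ?_)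
    simp only [levelCyl]; ring
  have hsplit : ∫ z, φ z * ξ (T^[4 * j] z) ∂ν = ∫ z, G (pr z) * ζ z ∂ν +
      (∫ z in Bad, (g z - G (pr z)) * ζ z ∂ν + ∫ z in Badᶜ, (g z - G (pr z)) * ζ z ∂ν) := by
    rw [integral_add_compl hBm hI, ← integral_add hIG hI]
    have h1 := hgint ζ hζm 1 hζ1
    simp only [hζ, ← Function.iterate_add_apply] at h1
    rw [show 4 * j = 2 * j + 2 * j by ring]
    rw [hT, h1]
    congr 1; ext z; simp only [hζ, hT]; ring
  have hG3 : |∫ z, G (pr z) * ζ z ∂ν| ≤ ∫ z, |G (pr z)| ∂ν := by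
    refine (abs_integral_le_integral_abs).trans (integral_mono hIG.abs hGi.abs fun z => ?_)
    simp only [abs_mul]
    exact mul_le_of_le_one_right (abs_nonneg _) (hζ1 z)
  rw [hsplit]
  refine (abs_add_le _ _).trans ((add_le_add (hG3.trans habs) ((abs_add_le _ _).trans
    (add_le_add hbad hgood))).trans ?_)
  have hβN : β ^ N ≤ 1 := pow_le_one₀ hβ0.le hβ1.le
  have hβN0 : 0 < β ^ N := by positivity
  have t1 : a * β ^ N * ν.real Bad ≤ c * ((2 * K₀ + 6 * K₀ * K₁) * ν.real Bad) := by
    calc a * β ^ N * ν.real Bad ≤ a * 1 * ν.real Bad := by gcongr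
      _ = c * ((2 * K₀) * ν.real Bad) := by rw [ha]; ring
      _ ≤ _ := by gcongr; nlinarith
  have t2 : 3 * K₁ * (a * β ^ N) * e ≤ c * ((2 * K₀ + 6 * K₀ * K₁) * β ^ N * e) := by
    calc 3 * K₁ * (a * β ^ N) * e = c * ((6 * K₀ * K₁) * β ^ N * e) := by rw [ha]; ring
      _ ≤ _ := by gcongr; nlinarith
  rw [mul_add c, mul_add c, add_assoc]
  exact add_le_add le_rfl (add_le_add t1 t2)

end IsTowerMeasure

end Bootstrap

/-- `g` is the image of `φ` under the `k`-th power of the transfer operator of `T`. -/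
structure IsTransfer {X : Type*} [MeasurableSpace X] (ν : Measure X) (T : X → X) (b : ℝ)
    (φ : X → ℝ) (k : ℕ) (g : X → ℝ) : Prop where
  measurable : Measurable g
  bound : ∀ z, |g z| ≤ b
  integral_eq : ∀ ξ : X → ℝ, Measurable ξ → ∀ c : ℝ, (∀ z, |ξ z| ≤ c) →
    ∫ z, φ z * ξ (T^[k] z) ∂ν = ∫ z, g z * ξ z ∂ν

/-! ### L¹ decay of the transferred observables -/

section

variable {β C : ℝ} {ν : Measure ((ℕ → ℕ) × ℕ)} {R : ℕ → ℕ}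

namespace IsTowerMeasure

variable (h : IsTowerMeasure R ν)
include h

/-- The exit estimate is used with `t = j / N`, which is at least `j / (2 N)` once `j ≥ N`. For `j <
N` the right side exceeds `1`. -/
theorem exists_exitTime_tail (hd : BoundedDistortion β C (baseMeasure ν)) {K : ℝ} (hK : 0 < K)
    {α : ℝ} (hα : 0 < α) (hdec : SymDecay R ν β K fun n => (n : ℝ) ^ (-α)) {N : ℕ} (hN : 1 ≤ N) :
    ∃ V : ℝ, 0 < V ∧ ∀ j : ℕ, 1 ≤ j →
      ν.real {z | z.2 < R (z.1 0) ∧ j < exitTime R z.1 N z.2} ≤ V * (j : ℝ) ^ (-α) := by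
  have := h.isProbabilityMeasure
  have hμ := h.baseMeasure_univ_pos
  set κ := K / (baseMeasure ν).real univ with hκ
  have hκ0 : 0 < κ := by positivity
  set W := (κ + 1) * (2 : ℝ) ^ α with hW
  have h2α : (1 : ℝ) ≤ 2 ^ α := Real.one_le_rpow (by norm_num) hα.le
  have hW0 : 0 < W := by positivity
  have htail : ∀ t : ℕ, 1 ≤ t → ν.real {z | t ≤ z.2} ≤ W * (t : ℝ) ^ (-α) := by
    intro t ht
    rcases ht.eq_or_lt with rfl | ht
    · refine measureReal_le_one.trans ?_
      rw [Nat.cast_one, Real.one_rpow, mul_one, hW]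
      nlinarith
    · have h1 := h.tail_le hdec (t := t - 1) (by omega)
      have e : {z : (ℕ → ℕ) × ℕ | t - 1 < z.2} = {z | t ≤ z.2} := by ext z; simp only [mem_ofPred_eq]; omega
      rw [e] at h1
      refine h1.trans ?_
      have h2 : ((t - 1 : ℕ) : ℝ) ^ (-α) ≤ ((t : ℝ) / 2) ^ (-α) := by
        refine Real.rpow_le_rpow_of_nonpos (by positivity) ?_ (by linarith)
        rw [Nat.cast_sub (by omega), Nat.cast_one]
        have : (2 : ℝ) ≤ t := by exact_mod_cast ht
        linarith
      have h3 : ((t : ℝ) / 2) ^ (-α) = 2 ^ α * (t : ℝ) ^ (-α) := by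
        rw [Real.div_rpow (by positivity) (by norm_num), Real.rpow_neg (by norm_num : (0:ℝ) ≤ 2)]
        field_simp
      rw [h3] at h2
      calc κ * ((t - 1 : ℕ) : ℝ) ^ (-α) ≤ (κ + 1) * (2 ^ α * (t : ℝ) ^ (-α)) := by
            gcongr; linarith
        _ = _ := by rw [hW]; ring
  set M := 1 + N * (Real.exp C / (baseMeasure ν).real univ) with hM
  have hM1 : 1 ≤ M := by
    have : 0 ≤ N * (Real.exp C / (baseMeasure ν).real univ) := by positivity
    linarith
  set V := M * (W + 1) * (2 * N : ℝ) ^ α with hV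
  have hN1 : (1 : ℝ) ≤ N := by exact_mod_cast hN
  have hV0 : 0 < V := by positivity
  refine ⟨V, hV0, fun j hj => ?_⟩
  have hj0 : (0 : ℝ) < j := by exact_mod_cast hj
  have e : ((j : ℝ) / (2 * N)) ^ (-α) = (2 * N : ℝ) ^ α * (j : ℝ) ^ (-α) := by
    rw [Real.div_rpow (by positivity) (by positivity),
      Real.rpow_neg (by positivity : (0 : ℝ) ≤ 2 * N)]
    field_simp
  have hVe : V * (j : ℝ) ^ (-α) = M * ((W + 1) * ((j : ℝ) / (2 * N)) ^ (-α)) := by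
    rw [e, hV]; ring
  rw [hVe]
  by_cases hjN : j < N
  · refine measureReal_le_one.trans ?_
    have h1 : (1 : ℝ) ≤ ((j : ℝ) / (2 * N)) ^ (-α) := by
      refine Real.one_le_rpow_of_pos_of_le_one_of_nonpos (by positivity) ?_ (by linarith)
      rw [div_le_one (by positivity)]
      have : (j : ℝ) ≤ N := by exact_mod_cast hjN.le
      linarith
    have h2 : (1 : ℝ) ≤ (W + 1) * ((j : ℝ) / (2 * N)) ^ (-α) := by nlinarith
    nlinarith
  · have ht1 : 1 ≤ j / N := by
      rw [Nat.le_div_iff_mul_le (by omega)]; omega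
    refine (h.real_exitTime_gt_le hd (t := j / N) (by omega) (Nat.mul_div_le j N)).trans ?_
    have h1 := htail _ ht1
    have h2 : ((j / N : ℕ) : ℝ) ^ (-α) ≤ ((j : ℝ) / (2 * N)) ^ (-α) := by
      refine Real.rpow_le_rpow_of_nonpos (by positivity) ?_ (by linarith)
      rw [div_le_iff₀ (by positivity)]
      have h3 : j < N * (j / N + 1) := by
        have := Nat.div_add_mod j N
        have := Nat.mod_lt j (show 0 < N by omega)
        rw [mul_add]; omega
      have h4 : j ≤ (j / N) * (2 * N) := by nlinarith
      exact_mod_cast h4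
    gcongr
    refine h1.trans ?_
    gcongr
    linarith

/-- For `N` with `K₀ βᴺ ≤ 4^(-α) / 2`, the bootstrap gives a recursion of the form `e (4 j) ≤ A
j^(-α) + (4^(-α) / 2) e j`. It is compatible with `e j = E j^(-α)` for large `E`. Monotonicity of
the decay fills in the times between powers of `4`. -/
theorem exists_unifDecay_rpow (hβ0 : 0 < β) (hβ1 : β < 1) (hC : 0 ≤ C)
    (hd : BoundedDistortion β C (baseMeasure ν)) {K : ℝ} (hK : 0 < K) {α : ℝ} (hα : 0 < α)
    (hdec : SymDecay R ν β K fun n => (n : ℝ) ^ (-α)) :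
    ∃ E : ℝ, 0 < E ∧ ∀ k : ℕ, 1 ≤ k → UnifDecay R ν β k (E * (k : ℝ) ^ (-α)) := by
  have := h.isProbabilityMeasure
  obtain ⟨K₀, hK₀, hstep⟩ := h.unifDecay_step hβ0 hβ1 hC hd hdec
  obtain ⟨N₀, hN₀⟩ := exists_pow_lt_of_lt_one (show 0 < (4 : ℝ) ^ (-α) / 2 / K₀ by positivity) hβ1
  set N := N₀ + 1 with hN
  have hβN : K₀ * β ^ N ≤ (4 : ℝ) ^ (-α) / 2 := by
    have h1 : β ^ N ≤ β ^ N₀ := pow_le_pow_of_le_one hβ0.le hβ1.le (by omega)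
    have h2 := h1.trans hN₀.le
    rw [le_div_iff₀ (by positivity)] at h2
    linarith
  obtain ⟨V, hV0, hexit⟩ := h.exists_exitTime_tail hd hK hα hdec (show 1 ≤ N by omega)
  set A := 2 * K * (2 * (β ^ N)⁻¹ + 1) + K₀ * V with hA
  have hA0 : 0 < A := by positivity
  -- The summand `1` covers the trivial bound at time `1`; the rest makes `A` at most half of `E * 4
  -- ^ (-α)`.
  set E := 1 + 2 * A * (4 : ℝ) ^ α with hE
  have hE0 : 0 < E := by positivity
  have hpow : ∀ i : ℕ, UnifDecay R ν β (4 ^ i) (E * (((4 ^ i : ℕ) : ℝ)) ^ (-α)) := by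
    intro i
    induction i with
    | zero =>
      intro c φ hc hφ _ ξ hξ hξ1
      rw [pow_zero, Nat.cast_one, Real.one_rpow, mul_one, ← Real.norm_eq_abs]
      have h1 := norm_integral_le_of_norm_le_const (μ := ν) (C := c * 1)
        (f := fun z => φ z * ξ ((symTower R)^[1] z)) (Filter.Eventually.of_forall fun z => by
          rw [norm_mul]
          exact mul_le_mul (hφ.bound z) (hξ1 _) (norm_nonneg _) hc)
      rw [probReal_univ, mul_one, mul_one] at h1
      refine h1.trans ?_
      have : (1 : ℝ) ≤ E := by
        have : 0 ≤ 2 * A * (4 : ℝ) ^ α := by positivity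
        linarith
      nlinarith
    | succ i ih =>
      have h1 := hstep N (4 ^ i) _ (by omega) (Nat.one_le_pow _ _ (by norm_num)) (by positivity) ih
      rw [← pow_succ'] at h1
      intro c φ hc hφ h0 ξ hξ hξ1
      refine (h1 c φ hc hφ h0 ξ hξ hξ1).trans ?_
      refine mul_le_mul_of_nonneg_left ?_ hc
      set x : ℝ := ((4 ^ i : ℕ) : ℝ) with hx
      have hx1 : 0 < x := by rw [hx]; positivity
      have e1 : (((4 ^ (i + 1) : ℕ) : ℝ)) ^ (-α) = 4 ^ (-α) * x ^ (-α) := by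
        rw [pow_succ', Nat.cast_mul, Real.mul_rpow (by positivity) hx1.le]; simp
      have e2 : (((2 * 4 ^ i : ℕ) : ℝ)) ^ (-α) ≤ x ^ (-α) := by
        refine Real.rpow_le_rpow_of_nonpos hx1 ?_ (by linarith)
        rw [Nat.cast_mul, ← hx]; push_cast; linarith
      rw [e1]
      have e3 := hexit (4 ^ i) (Nat.one_le_pow _ _ (by norm_num))
      have e4 : A = (E - 1) * 4 ^ (-α) / 2 := by
        rw [hE, Real.rpow_neg (by norm_num : (0 : ℝ) ≤ 4)]; field_simp; ring
      calc 2 * K * (2 * (β ^ N)⁻¹ + 1) * ((2 * 4 ^ i : ℕ) : ℝ) ^ (-α) +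
            K₀ * ν.real {z | z.2 < R (z.1 0) ∧ 4 ^ i < exitTime R z.1 N z.2} +
            K₀ * β ^ N * (E * x ^ (-α))
          ≤ 2 * K * (2 * (β ^ N)⁻¹ + 1) * x ^ (-α) + K₀ * (V * x ^ (-α)) +
            (4 : ℝ) ^ (-α) / 2 * (E * x ^ (-α)) :=
            add_le_add (add_le_add (mul_le_mul_of_nonneg_left e2 (by positivity))
              (mul_le_mul_of_nonneg_left e3 (by positivity)))
              (mul_le_mul_of_nonneg_right hβN (by positivity))
        _ = (A + (4 : ℝ) ^ (-α) / 2 * E) * x ^ (-α) := by rw [hA]; ring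
        _ ≤ (E * 4 ^ (-α)) * x ^ (-α) := by
            gcongr
            rw [e4]
            have : (0 : ℝ) < 4 ^ (-α) := by positivity
            nlinarith
        _ = _ := by ring
  refine ⟨E * 4 ^ α, by positivity, fun k hk => ?_⟩
  have hlog := Nat.pow_log_le_self 4 (show k ≠ 0 by omega)
  have hlog2 := Nat.lt_pow_succ_log_self (show 1 < 4 by norm_num) k
  intro c φ hc hφ h0 ξ hξ hξ1
  refine ((hpow (Nat.log 4 k)).mono hlog c φ hc hφ h0 ξ hξ hξ1).trans ?_
  refine mul_le_mul_of_nonneg_left ?_ hc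
  rw [mul_assoc]
  refine mul_le_mul_of_nonneg_left ?_ hE0.le
  have hk0 : (0 : ℝ) < k := by exact_mod_cast hk
  have h3 : ((k : ℝ) / 4) ^ (-α) = 4 ^ α * (k : ℝ) ^ (-α) := by
    rw [Real.div_rpow (by positivity) (by norm_num), Real.rpow_neg (by norm_num : (0:ℝ) ≤ 4)]
    field_simp
  rw [← h3]
  refine Real.rpow_le_rpow_of_nonpos (by positivity) ?_ (by linarith)
  rw [div_le_iff₀ (by norm_num)]
  rw [pow_succ] at hlog2
  exact_mod_cast hlog2.le

theorem exists_transfer_seq (hβ0 : 0 < β) (hβ1 : β < 1) (hC : 0 ≤ C)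
    (hd : BoundedDistortion β C (baseMeasure ν)) : ∃ K₀ : ℝ, 1 ≤ K₀ ∧ ∀ (a b : ℝ)
      (φ : (ℕ → ℕ) × ℕ → ℝ), 0 ≤ a → 0 ≤ b → SymLipschitz β a b φ →
      ∃ g : ℕ → (ℕ → ℕ) × ℕ → ℝ, g 0 = φ ∧ ∀ k, SymLipschitz β (K₀ * (a + b)) b (g k) ∧
        IsTransfer ν (symTower R) b φ k (g k) := by
  obtain ⟨K₀, hK₀, htr⟩ := h.exists_transfer hβ0 hβ1 hC hd
  refine ⟨K₀, hK₀, fun a b φ ha hb hφ => ?_⟩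
  choose g hg hgint using htr a b φ ha hb hφ
  -- At `k = 0` the function `φ` itself is taken, since telescoping needs `g 0 = φ` everywhere and
  -- duality alone determines the function only almost everywhere.
  refine ⟨fun k => if k = 0 then φ else g k, if_pos rfl, fun k => ?_⟩
  dsimp only
  split_ifs with hk
  · subst hk
    refine ⟨hφ.mono hβ0 (by nlinarith) le_rfl, hφ.measurable hβ0 hβ1, hφ.bound, fun _ _ _ _ => rfl⟩
  · exact ⟨hg k, (hg k).measurable hβ0 hβ1, (hg k).bound, hgint k⟩

theorem exists_transfer_rpow (hβ0 : 0 < β) (hβ1 : β < 1) (hC : 0 ≤ C)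
    (hd : BoundedDistortion β C (baseMeasure ν)) {K : ℝ} (hK : 0 < K) {α : ℝ} (hα : 0 < α)
    (hdec : SymDecay R ν β K fun n => (n : ℝ) ^ (-α)) :
    ∃ E : ℝ, 0 < E ∧ ∀ (a b : ℝ) (φ : (ℕ → ℕ) × ℕ → ℝ), 0 ≤ a → 0 ≤ b → SymLipschitz β a b φ →
      ∫ z, φ z ∂ν = 0 → ∃ g : ℕ → (ℕ → ℕ) × ℕ → ℝ, g 0 = φ ∧
        (∀ k, IsTransfer ν (symTower R) b φ k (g k)) ∧
        ∀ k : ℕ, 1 ≤ k → ∫ z, |g k z| ∂ν ≤ E * (a + b) * (k : ℝ) ^ (-α) := by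
  obtain ⟨K₀, hK₀, htr⟩ := h.exists_transfer_seq hβ0 hβ1 hC hd
  obtain ⟨E, hE, hdecay⟩ := h.exists_unifDecay_rpow hβ0 hβ1 hC hd hK hα hdec
  refine ⟨E, hE, fun a b φ ha hb hφ h0 => ?_⟩
  obtain ⟨g, hg0, hg⟩ := htr a b φ ha hb hφ
  refine ⟨g, hg0, fun k => (hg k).2, fun k hk => ?_⟩
  obtain ⟨s, hs, hs1, hseq⟩ := integral_abs_eq (ν := ν) (hg k).2.measurable
  rw [hseq, ← (hg k).2.integral_eq s hs 1 hs1]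
  have h1 := hdecay k hk (a + b) φ (by positivity) (hφ.mono hβ0 (by linarith) (by linarith)) h0 s
    hs hs1
  refine (le_abs_self _).trans (h1.trans (le_of_eq ?_))
  ring

/-- Decay of correlations is applied to `φ` and `g k`, whose norm is bounded uniformly in `k`. By
duality this bounds `∫ (g k)²`, and Cauchy-Schwarz passes to the L¹ norm. The square root only
replaces `τ` by `τ / 2`, so no bootstrap is needed here. -/
theorem exists_transfer_exp (hβ0 : 0 < β) (hβ1 : β < 1) (hC : 0 ≤ C)
    (hd : BoundedDistortion β C (baseMeasure ν)) {K : ℝ} (hK : 0 < K) {τ θ : ℝ}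
    (hdec : SymDecay R ν β K fun n => Real.exp (-(τ * (n : ℝ) ^ θ))) :
    ∃ E : ℝ, 0 < E ∧ ∀ (a b : ℝ) (φ : (ℕ → ℕ) × ℕ → ℝ), 0 ≤ a → 0 ≤ b → SymLipschitz β a b φ →
      ∫ z, φ z ∂ν = 0 → ∃ g : ℕ → (ℕ → ℕ) × ℕ → ℝ, g 0 = φ ∧
        (∀ k, IsTransfer ν (symTower R) b φ k (g k)) ∧
        ∀ k : ℕ, 1 ≤ k → ∫ z, |g k z| ∂ν ≤ E * (a + b) * Real.exp (-(τ / 2 * (k : ℝ) ^ θ)) := by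
  have := h.isProbabilityMeasure
  obtain ⟨K₀, hK₀, htr⟩ := h.exists_transfer_seq hβ0 hβ1 hC hd
  refine ⟨√(2 * K * K₀), by positivity, fun a b φ ha hb hφ h0 => ?_⟩
  obtain ⟨g, hg0, hg⟩ := htr a b φ ha hb hφ
  refine ⟨g, hg0, fun k => (hg k).2, fun k hk => ?_⟩
  have hgm := (hg k).2.measurable
  have h1 := hdec a b (K₀ * (a + b)) b φ (g k) ha hb (by positivity) hb hφ (hg k).1 k hk
  rw [h0, zero_mul, sub_zero, (hg k).2.integral_eq (g k) hgm b (hg k).2.bound] at h1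
  have hgi : Integrable (g k) ν := (hg k).1.integrable hβ0 hβ1
  have hg2 : Integrable (fun z => g k z * g k z) ν :=
    hgi.mul_bdd (c := b) hgm.aestronglyMeasurable (Filter.Eventually.of_forall (hg k).2.bound)
  set I := ∫ z, |g k z| ∂ν with hI
  have hI0 : 0 ≤ I := integral_nonneg fun z => abs_nonneg _
  have hcs : I ^ 2 ≤ ∫ z, g k z * g k z ∂ν := by
    have h2 : 0 ≤ ∫ z, (g k z * g k z - 2 * I * |g k z| + I ^ 2) ∂ν := by
      refine integral_nonneg fun z => ?_
      simp only [Pi.zero_apply]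
      have := sq_nonneg (|g k z| - I)
      rw [sub_sq, sq_abs] at this
      nlinarith
    have i1 : Integrable (fun z => 2 * I * |g k z|) ν := hgi.abs.const_mul _
    have i2 : Integrable (fun z => g k z * g k z - 2 * I * |g k z|) ν := hg2.sub i1
    rw [integral_add i2 (integrable_const _), integral_sub hg2 i1, integral_const_mul,
      integral_const, probReal_univ, one_smul] at h2
    nlinarith
  have hfin : I ^ 2 ≤ (√(2 * K * K₀) * (a + b) * Real.exp (-(τ / 2 * (k : ℝ) ^ θ))) ^ 2 := by
    rw [mul_pow, mul_pow, Real.sq_sqrt (by positivity), ← Real.exp_nat_mul]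
    have e : ((2 : ℕ) : ℝ) * -(τ / 2 * (k : ℝ) ^ θ) = -(τ * (k : ℝ) ^ θ) := by push_cast; ring
    rw [e]
    refine hcs.trans ((le_abs_self _).trans (h1.trans ?_))
    calc K * (a + b) * (K₀ * (a + b) + b) * Real.exp (-(τ * (k : ℝ) ^ θ))
        ≤ K * (a + b) * (2 * K₀ * (a + b)) * Real.exp (-(τ * (k : ℝ) ^ θ)) := by
          gcongr; nlinarith
      _ = _ := by ring
  exact le_of_sq_le_sq hfin (by positivity)

end IsTowerMeasure

end

/-! ### Elementary inequalities for powers and exponentials -/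

section Elementary

theorem exp_le_one_add_add_sq (x : ℝ) : Real.exp x ≤ 1 + x + x ^ 2 * Real.exp |x| := by
  rcases le_total |x| 1 with h | h
  · have h1 := (abs_le.1 (Real.abs_exp_sub_one_sub_id_le h)).2
    have h2 : (1 : ℝ) ≤ Real.exp |x| := Real.one_le_exp (abs_nonneg x)
    nlinarith [sq_nonneg x]
  · rcases le_abs.1 h with h' | h'
    · rw [abs_of_nonneg (by linarith)]
      have h2 : 0 < Real.exp x := Real.exp_pos x
      have h3 : 1 ≤ x ^ 2 := by nlinarith
      nlinarith
    · have h2 : (1 : ℝ) ≤ Real.exp |x| := Real.one_le_exp (abs_nonneg x)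
      have h3 : Real.exp x ≤ 1 := Real.exp_le_one_iff.2 (by linarith)
      nlinarith

/-- Second order upper bound for `|x + y| ^ s`. -/
theorem exists_abs_add_rpow_le {s : ℝ} (hs : 2 ≤ s) : ∃ C : ℝ, 0 < C ∧ ∀ x y : ℝ,
    |x + y| ^ s ≤ |x| ^ s + s * (|x| ^ (s - 2) * x) * y + C * (|x| ^ (s - 2) * y ^ 2 + |y| ^ s) := by
  have hs0 : 0 < s := by linarith
  refine ⟨s ^ 2 * Real.exp s + 3 ^ s + s * 2 ^ s, by positivity, fun x y => ?_⟩
  set C := s ^ 2 * Real.exp s + 3 ^ s + s * 2 ^ s with hC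
  have hC0 : 0 < C := by positivity
  -- If `|x| ≤ 2 |y|`, every term is dominated by `|y| ^ s`. Otherwise the inequality is a second
  -- order expansion in `t = y / x`, with `|t| < 1 / 2`.
  rcases le_or_gt |x| (2 * |y|) with h | h
  · have h1 : |x + y| ^ s ≤ 3 ^ s * |y| ^ s := by
      rw [← Real.mul_rpow (by norm_num) (abs_nonneg y)]
      refine Real.rpow_le_rpow (abs_nonneg _) ?_ hs0.le
      linarith [abs_add_le x y]
    have h2 : |s * (|x| ^ (s - 2) * x) * y| ≤ s * 2 ^ s * |y| ^ s := by
      have e1 : |x| ^ (s - 2) ≤ (2 * |y|) ^ (s - 2) :=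
        Real.rpow_le_rpow (abs_nonneg _) h (by linarith)
      rw [abs_mul, abs_mul, abs_mul, abs_of_pos hs0, abs_of_nonneg (by positivity : 0 ≤ |x| ^ (s - 2))]
      rcases (abs_nonneg y).eq_or_lt with hy | hy
      · rw [← hy]; simp only [mul_zero]; positivity
      calc s * (|x| ^ (s - 2) * |x|) * |y| ≤ s * ((2 * |y|) ^ (s - 2) * (2 * |y|)) * (2 * |y|) := by
            gcongr; linarith
        _ = s * ((2 * |y|) ^ (s - 2) * (2 * |y|) ^ (2 : ℝ)) := by rw [Real.rpow_two]; ring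
        _ = s * 2 ^ s * |y| ^ s := by
            rw [← Real.rpow_add (by positivity), Real.mul_rpow (by norm_num) hy.le]
            ring_nf
    have h3 := (abs_le.1 h2).1
    have h4 : 0 ≤ |x| ^ s := by positivity
    have h5 : 0 ≤ C * (|x| ^ (s - 2) * y ^ 2) := by positivity
    have h6 : (3 ^ s + s * 2 ^ s) * |y| ^ s ≤ C * |y| ^ s := by
      gcongr
      have : 0 ≤ s ^ 2 * Real.exp s := by positivity
      rw [hC]; linarith
    nlinarith
  · have hx : 0 < |x| := lt_of_le_of_lt (by positivity) h
    have hx0 : x ≠ 0 := abs_pos.1 hx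
    set t := y / x with ht
    have hyx : y = x * t := by rw [ht]; field_simp
    have htabs : |t| < 1 / 2 := by
      rw [ht, abs_div, div_lt_iff₀ hx]; linarith
    have ht1 := abs_lt.1 htabs
    have e1 : |x + y| ^ s = |x| ^ s * (1 + t) ^ s := by
      rw [hyx, show x + x * t = x * (1 + t) by ring, abs_mul, abs_of_pos (by linarith : 0 < 1 + t),
        Real.mul_rpow hx.le (by linarith)]
    have e2 : |x| ^ (s - 2) * x ^ 2 = |x| ^ s := by
      rw [← sq_abs, ← Real.rpow_two, ← Real.rpow_add hx]; ring_nf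
    have e3 : s * (|x| ^ (s - 2) * x) * y = |x| ^ s * (s * t) := by
      rw [← e2, hyx]; ring
    have e4 : |x| ^ (s - 2) * y ^ 2 = |x| ^ s * t ^ 2 := by
      rw [← e2, hyx]; ring
    have h1 : (1 + t) ^ s ≤ 1 + s * t + s ^ 2 * Real.exp s * t ^ 2 := by
      calc (1 + t) ^ s ≤ Real.exp t ^ s := by
            refine Real.rpow_le_rpow (by linarith) ?_ hs0.le
            linarith [Real.add_one_le_exp t]
        _ = Real.exp (s * t) := by rw [← Real.exp_mul]; ring_nf
        _ ≤ 1 + s * t + (s * t) ^ 2 * Real.exp |s * t| := exp_le_one_add_add_sq _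
        _ ≤ 1 + s * t + (s * t) ^ 2 * Real.exp s := by
            gcongr
            rw [abs_mul, abs_of_pos hs0]
            nlinarith
        _ = _ := by ring
    rw [e1, e3, e4]
    have h2 : 0 ≤ |x| ^ s := by positivity
    have h3 : 0 ≤ C * |y| ^ s := by positivity
    have h4 : s ^ 2 * Real.exp s * t ^ 2 ≤ C * t ^ 2 := by
      gcongr
      have : (0 : ℝ) ≤ 3 ^ s + s * 2 ^ s := by positivity
      rw [hC]; linarith
    have h5 := mul_le_mul_of_nonneg_left (h1.trans (add_le_add_right h4 _)) h2
    nlinarith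

theorem rpow_mul_sq_le {s a b : ℝ} (hs : 2 ≤ s) (ha : 0 ≤ a) (hb : 0 ≤ b) :
    a ^ (s - 2) * b ^ 2 ≤ a ^ s + b ^ s := by
  have key : ∀ c : ℝ, 0 ≤ c → c ^ (s - 2) * c ^ 2 = c ^ s := fun c hc => by
    rw [← Real.rpow_two, ← Real.rpow_add_of_nonneg hc (by linarith) (by norm_num)]; ring_nf
  have ha' : 0 ≤ a ^ s := by positivity
  have hb' : 0 ≤ b ^ s := by positivity
  rcases le_total a b with h | h
  · calc a ^ (s - 2) * b ^ 2 ≤ b ^ (s - 2) * b ^ 2 := by gcongr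
      _ = b ^ s := key b hb
      _ ≤ _ := by linarith
  · calc a ^ (s - 2) * b ^ 2 ≤ a ^ (s - 2) * a ^ 2 := by gcongr
      _ = a ^ s := key a ha
      _ ≤ _ := by linarith

/-- Scaling `a` by `n^(-1/s)` and `b` by `n^((s-2)/(2s))` leaves the product on the left unchanged.
The coefficient `1 / n` keeps the growth over `n` steps bounded in the moment recursion. -/
theorem rpow_mul_sq_le_weighted {s a b n : ℝ} (hs : 2 ≤ s) (ha : 0 ≤ a) (hb : 0 ≤ b) (hn : 0 < n) :
    a ^ (s - 2) * b ^ 2 ≤ a ^ s / n + n ^ (s / 2 - 1) * b ^ s := by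
  have hs0 : 0 < s := by linarith
  have h := rpow_mul_sq_le hs (show 0 ≤ n ^ (-(1 / s)) * a by positivity)
    (show 0 ≤ n ^ ((s - 2) / (2 * s)) * b by positivity)
  rw [Real.mul_rpow (by positivity) ha, Real.mul_rpow (by positivity) ha,
    Real.mul_rpow (by positivity) hb, mul_pow, ← Real.rpow_mul hn.le, ← Real.rpow_mul hn.le,
    ← Real.rpow_mul hn.le, ← Real.rpow_natCast (n ^ ((s - 2) / (2 * s))) 2,
    ← Real.rpow_mul hn.le] at h
  have e1 : -(1 / s) * s = -1 := by field_simp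
  have e2 : (s - 2) / (2 * s) * s = s / 2 - 1 := by field_simp
  have e3 : n ^ (-(1 / s) * (s - 2)) * n ^ ((s - 2) / (2 * s) * ((2 : ℕ) : ℝ)) = 1 := by
    rw [← Real.rpow_add hn]
    have : -(1 / s) * (s - 2) + (s - 2) / (2 * s) * ((2 : ℕ) : ℝ) = 0 := by
      push_cast; field_simp; ring
    rw [this, Real.rpow_zero]
  rw [e1, e2, Real.rpow_neg_one] at h
  calc a ^ (s - 2) * b ^ 2 = (n ^ (-(1 / s) * (s - 2)) * n ^ ((s - 2) / (2 * s) * ((2 : ℕ) : ℝ))) *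
        (a ^ (s - 2) * b ^ 2) := by rw [e3, one_mul]
    _ = n ^ (-(1 / s) * (s - 2)) * a ^ (s - 2) * (n ^ ((s - 2) / (2 * s) * ((2 : ℕ) : ℝ)) * b ^ 2) := by
        ring
    _ ≤ _ := h
    _ = _ := by ring

/-- This is convexity of `|x| ^ s`: Bernoulli's inequality for `|y / x|`, multiplied by `|x| ^ s`.
-/
theorem abs_rpow_tangent {s : ℝ} (hs : 2 ≤ s) (x y : ℝ) :
    |x| ^ s + s * (|x| ^ (s - 2) * x) * (y - x) ≤ |y| ^ s := by
  have hs0 : 0 < s := by linarith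
  rcases eq_or_ne x 0 with rfl | hx
  · simp only [abs_zero, mul_zero, zero_mul, add_zero]
    rw [Real.zero_rpow hs0.ne']; positivity
  have hx' : 0 < |x| := abs_pos.2 hx
  have e2 : |x| ^ (s - 2) * x ^ 2 = |x| ^ s := by
    rw [← sq_abs, ← Real.rpow_two, ← Real.rpow_add hx']; ring_nf
  have hb := one_add_mul_self_le_rpow_one_add (s := |y / x| - 1) (p := s)
    (by linarith [abs_nonneg (y / x)]) (by linarith)
  rw [add_sub_cancel] at hb
  have h1 : y / x ≤ |y / x| := le_abs_self _
  have h2 : 1 + s * (y / x - 1) ≤ |y / x| ^ s := by nlinarith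
  have h3 := mul_le_mul_of_nonneg_left h2 (show 0 ≤ |x| ^ s by positivity)
  rw [← Real.mul_rpow hx'.le (abs_nonneg _), ← abs_mul, mul_div_cancel₀ _ hx] at h3
  refine le_trans (le_of_eq ?_) h3
  rw [← e2]
  field_simp

end Elementary

/-! ### Maximal and moment inequalities for reverse martingale differences -/

section Maximal

variable {X : Type*} [MeasurableSpace X] {ν : Measure X} {S : X → X} {u : X → ℝ} {b : ℝ}

/-- `u` is orthogonal to all bounded functions of `S`. -/
def IsReverseDiff (ν : Measure X) (S : X → X) (u : X → ℝ) : Prop :=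
  ∀ ξ : X → ℝ, Measurable ξ → ∀ c : ℝ, (∀ z, |ξ z| ≤ c) → ∫ z, u z * ξ (S z) ∂ν = 0

theorem measurable_birkhoffSum (hS : Measurable S) (hu : Measurable u) (N : ℕ) :
    Measurable (birkhoffSum S u N) := by
  unfold birkhoffSum
  exact Finset.measurable_sum _ fun i _ => hu.comp (hS.iterate i)

omit [MeasurableSpace X] in
theorem abs_birkhoffSum_le (hub : ∀ z, |u z| ≤ b) (N : ℕ) (z : X) :
    |birkhoffSum S u N z| ≤ N * b := by
  unfold birkhoffSum
  refine (Finset.abs_sum_le_sum_abs _ _).trans ((Finset.sum_le_sum fun i _ => hub _).trans ?_)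
  simp

omit [MeasurableSpace X] in
theorem exists_bound_comp {ψ : ℝ → ℝ} (hψ : Continuous ψ) {f : X → ℝ} {B : ℝ}
    (hf : ∀ z, |f z| ≤ B) : ∃ c, ∀ z, |ψ (f z)| ≤ c := by
  obtain ⟨c, hc⟩ := (isCompact_Icc (a := -B) (b := B)).exists_bound_of_continuousOn hψ.continuousOn
  exact ⟨c, fun z => hc _ (abs_le.1 (hf z))⟩

theorem integrable_comp_of_bound [IsFiniteMeasure ν] {ψ : ℝ → ℝ} (hψ : Continuous ψ) {f : X → ℝ}
    (hfm : Measurable f) {B : ℝ} (hf : ∀ z, |f z| ≤ B) : Integrable (fun z => ψ (f z)) ν := by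
  obtain ⟨c, hc⟩ := exists_bound_comp hψ hf
  exact Integrable.of_bound (hψ.measurable.comp hfm).aestronglyMeasurable c
    (Filter.Eventually.of_forall hc)

theorem MeasurePreserving.integral_comp_of_measurable {T : X → X} (hT : MeasurePreserving T ν ν)
    {f : X → ℝ} (hf : Measurable f) : ∫ z, f (T z) ∂ν = ∫ z, f z ∂ν := by
  have h1 := integral_map (μ := ν) hT.measurable.aemeasurable (f := f) hf.aestronglyMeasurable
  rw [hT.map_eq] at h1
  exact h1.symm

/-- A maximal inequality for the reversed partial sums. -/
theorem mul_measure_exists_le [IsProbabilityMeasure ν] (hS : MeasurePreserving S ν ν)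
    (hu : Measurable u) (hub : ∀ z, |u z| ≤ b) (hu0 : IsReverseDiff ν S u) {ψ ψ' : ℝ → ℝ}
    (hψ : Continuous ψ) (hψ' : Continuous ψ') (hnn : ∀ x, 0 ≤ ψ x)
    (htan : ∀ x y, ψ x + ψ' x * (y - x) ≤ ψ y) (c : ℝ) (N : ℕ) :
    c * ν.real {z | ∃ k ≤ N, c ≤ ψ (birkhoffSum S u (N - k) (S^[k] z))} ≤
      ∫ z, ψ (birkhoffSum S u N z) ∂ν := by
  set Z : ℕ → X → ℝ := birkhoffSum S u with hZ
  have hZm : ∀ N, Measurable (Z N) := measurable_birkhoffSum hS.measurable hu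
  have hZb : ∀ N z, |Z N z| ≤ N * b := abs_birkhoffSum_le hub
  have hZi : ∀ N, Integrable (fun z => ψ (Z N z)) ν := fun N =>
    integrable_comp_of_bound hψ (hZm N) (hZb N)
  set M : ℕ → Set X := fun N => {z | ∃ k ≤ N, c ≤ ψ (Z (N - k) (S^[k] z))} with hM
  have hMm : ∀ N, MeasurableSet (M N) := fun N => by
    have e : M N = ⋃ k ∈ Finset.range (N + 1), {z | c ≤ ψ (Z (N - k) (S^[k] z))} := by
      ext z; simp [hM]
    rw [e]
    exact Finset.measurableSet_biUnion _ fun k _ => measurableSet_le measurable_const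
      (hψ.measurable.comp ((hZm _).comp (hS.measurable.iterate k)))
  -- The indices `k ≥ 1` of the event at time `N + 1` form the `S`-preimage of the event at time
  -- `N`. Only `k = 0` adds new points, and on these `ψ (Z (N + 1))` is itself at least `c`.
  have hMs : ∀ N, M (N + 1) = S ⁻¹' M N ∪ ({z | c ≤ ψ (Z (N + 1) z)} \ S ⁻¹' M N) := by
    intro N
    rw [union_sdiff_self]
    ext z
    simp only [hM, mem_ofPred_eq, mem_union, mem_preimage]
    constructor
    · rintro ⟨k, hk, h⟩
      cases k with
      | zero => right; exact h
      | succ k =>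
        left
        refine ⟨k, by omega, ?_⟩
        rwa [Nat.add_sub_add_right, Function.iterate_succ_apply] at h
    · rintro (⟨k, hk, h⟩ | h)
      · refine ⟨k + 1, by omega, ?_⟩
        rwa [Nat.add_sub_add_right, Function.iterate_succ_apply]
      · exact ⟨0, by omega, h⟩
  have hcheb : ∀ N, ∀ E ⊆ {z | c ≤ ψ (Z N z)}, MeasurableSet E →
      c * ν.real E ≤ ∫ z in E, ψ (Z N z) ∂ν := fun N E hE hEm => by
    have h1 : ∫ z in E, c ∂ν ≤ ∫ z in E, ψ (Z N z) ∂ν :=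
      setIntegral_mono_on (integrable_const _).integrableOn (hZi N).integrableOn hEm
        fun z hz => hE hz
    rwa [setIntegral_const, smul_eq_mul, mul_comm] at h1
  -- This is Doob's argument. As `Z (N + 1) = u + Z N ∘ S`, convexity bounds `ψ (Z (N + 1))` below
  -- by its tangent at `Z N ∘ S`. On a set of the form `S⁻¹ M` the linear term integrates to zero
  -- because `u` is orthogonal to functions of `S`.
  have key : ∀ N, c * ν.real (M N) ≤ ∫ z in M N, ψ (Z N z) ∂ν := by
    intro N
    induction N with
    | zero =>
      refine hcheb 0 _ ?_ (hMm 0)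
      rintro z ⟨k, hk, h⟩
      obtain rfl : k = 0 := by omega
      exact h
    | succ N ih =>
      have hpm : MeasurableSet (S ⁻¹' M N) := hS.measurable (hMm N)
      have hEm : MeasurableSet {z | c ≤ ψ (Z (N + 1) z)} :=
        measurableSet_le measurable_const (hψ.measurable.comp (hZm _))
      have h2 := hcheb (N + 1) ({z | c ≤ ψ (Z (N + 1) z)} \ S ⁻¹' M N) sdiff_subset (hEm.diff hpm)
      rw [hMs, measureReal_union disjoint_sdiff_right (hEm.diff hpm),
        setIntegral_union disjoint_sdiff_right (hEm.diff hpm) (hZi _).integrableOn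
        (hZi _).integrableOn, mul_add]
      refine add_le_add ?_ h2
      have h3 : ν.real (S ⁻¹' M N) = ν.real (M N) := by
        rw [measureReal_def, measureReal_def, hS.measure_preimage (hMm N).nullMeasurableSet]
      rw [h3]
      refine ih.trans ?_
      -- compare with the tangent
      obtain ⟨c', hc'⟩ := exists_bound_comp hψ' (hZb N)
      have h4 : ∫ z, u z * (M N).indicator (fun z => ψ' (Z N z)) (S z) ∂ν = 0 := by
        refine hu0 _ ((hψ'.measurable.comp (hZm N)).indicator (hMm N)) |c'| fun z => ?_
        by_cases hz : z ∈ M N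
        · rw [indicator_of_mem hz]; exact (hc' z).trans (le_abs_self _)
        · rw [indicator_of_notMem hz, abs_zero]; exact abs_nonneg _
      have h5 : ∫ z in M N, ψ (Z N z) ∂ν = ∫ z in S ⁻¹' M N, ψ (Z N (S z)) ∂ν := by
        rw [← integral_indicator (hMm N), ← integral_indicator hpm]
        have := MeasurePreserving.integral_comp_of_measurable hS
          ((hψ.measurable.comp (hZm N)).indicator (hMm N))
        rw [Function.comp_def] at this
        rw [← this]; rfl
      have i1 : Integrable (fun z => ψ (Z N (S z))) ν :=
        integrable_comp_of_bound hψ ((hZm N).comp hS.measurable) fun z => hZb N _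
      have i2 : Integrable (fun z => ψ' (Z N (S z)) * u z) ν :=
        (integrable_comp_of_bound hψ' ((hZm N).comp hS.measurable) fun z => hZb N _).mul_bdd
          (c := b) hu.aestronglyMeasurable (Filter.Eventually.of_forall hub)
      have h6 : ∫ z in S ⁻¹' M N, ψ' (Z N (S z)) * u z ∂ν = 0 := by
        rw [← integral_indicator hpm, ← h4]
        congr 1; ext z
        by_cases hz : S z ∈ M N
        · rw [indicator_of_mem hz, indicator_of_mem (show z ∈ S ⁻¹' M N from hz), mul_comm]
        · rw [indicator_of_notMem hz, indicator_of_notMem (show z ∉ S ⁻¹' M N from hz), mul_zero]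
      calc ∫ z in M N, ψ (Z N z) ∂ν = ∫ z in S ⁻¹' M N, (ψ (Z N (S z)) + ψ' (Z N (S z)) * u z) ∂ν := by
            rw [integral_add i1.integrableOn i2.integrableOn, h6, add_zero, h5]
        _ ≤ ∫ z in S ⁻¹' M N, ψ (Z (N + 1) z) ∂ν := by
            refine setIntegral_mono (i1.add i2).integrableOn (hZi _).integrableOn fun z => ?_
            have h7 := htan (Z N (S z)) (Z (N + 1) z)
            rw [show Z (N + 1) z - Z N (S z) = u z by rw [hZ, birkhoffSum_succ']; ring] at h7
            exact h7
  exact (key N).trans (setIntegral_le_integral (hZi N) (Filter.Eventually.of_forall fun z => hnn _))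

omit [MeasurableSpace X] in
theorem birkhoffSum_eq_sub (N k : ℕ) (hk : k ≤ N) (z : X) :
    birkhoffSum S u k z = birkhoffSum S u N z - birkhoffSum S u (N - k) (S^[k] z) := by
  have := birkhoffSum_add S u k (N - k) z
  rw [Nat.add_sub_cancel' hk] at this
  rw [this]; ring

omit [MeasurableSpace X] in
-- A forward sum is the difference of the reversed sums with indices `0` and `k`, so one of these
-- has at least half its size. This is the origin of the factor `2` in the thresholds.
theorem setOf_exists_le_abs_birkhoffSum_subset (N : ℕ) (x : ℝ) :
    {z | ∃ k ≤ N, 2 * x ≤ |birkhoffSum S u k z|} ⊆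
      {z | ∃ k ≤ N, x ≤ |birkhoffSum S u (N - k) (S^[k] z)|} := by
  rintro z ⟨k, hk, h⟩
  rw [birkhoffSum_eq_sub N k hk] at h
  have h1 := abs_sub (birkhoffSum S u N z) (birkhoffSum S u (N - k) (S^[k] z))
  by_cases h2 : x ≤ |birkhoffSum S u (N - k) (S^[k] z)|
  · exact ⟨k, hk, h2⟩
  · refine ⟨0, Nat.zero_le _, ?_⟩
    simp only [Nat.sub_zero, Function.iterate_zero, id]
    linarith

/-- Moment bound for sums of reverse martingale differences. -/
theorem exists_moment_bound {s : ℝ} (hs : 2 ≤ s) : ∃ C : ℝ, 0 < C ∧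
    ∀ {X : Type} [MeasurableSpace X] {ν : Measure X} [IsProbabilityMeasure ν] {S : X → X} {u : X → ℝ}
      {b : ℝ}, MeasurePreserving S ν ν → Measurable u → (∀ z, |u z| ≤ b) → IsReverseDiff ν S u →
      ∀ N : ℕ, ∫ z, |birkhoffSum S u N z| ^ s ∂ν ≤ C * (N : ℝ) ^ (s / 2) * ∫ z, |u z| ^ s ∂ν := by
  obtain ⟨C, hC, hineq⟩ := exists_abs_add_rpow_le hs
  have hs0 : 0 < s := by linarith
  refine ⟨2 * C * Real.exp C, by positivity, ?_⟩
  intro X _ ν _ S u b hS hu hub hu0 N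
  rcases Nat.eq_zero_or_pos N with rfl | hN
  · simp [birkhoffSum_zero, Real.zero_rpow hs0.ne', Real.zero_rpow (show s / 2 ≠ 0 by positivity)]
  have hN1 : (1 : ℝ) ≤ N := by exact_mod_cast hN
  have hN0 : (0 : ℝ) < N := by linarith
  have hcont : Continuous fun x : ℝ => |x| ^ s := continuous_abs.rpow_const fun _ => Or.inr hs0.le
  have hcont2 : Continuous fun x : ℝ => s * (|x| ^ (s - 2) * x) :=
    continuous_const.mul ((continuous_abs.rpow_const fun _ => Or.inr (by linarith)).mul continuous_id)
  set Z : ℕ → X → ℝ := birkhoffSum S u with hZ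
  have hZm : ∀ N, Measurable (Z N) := measurable_birkhoffSum hS.measurable hu
  have hZb : ∀ N z, |Z N z| ≤ N * b := abs_birkhoffSum_le hub
  set e := ∫ z, |u z| ^ s ∂ν with he
  have he0 : 0 ≤ e := integral_nonneg fun z => by positivity
  set m := (N : ℝ) ^ (s / 2 - 1) with hm
  have hm1 : 1 ≤ m := Real.one_le_rpow hN1 (by linarith)
  have hue : Integrable (fun z => |u z| ^ s) ν := integrable_comp_of_bound hcont hu hub
  -- In the expansion of `|Z k ∘ S + u| ^ s` the first order term has integral zero, and the mixed
  -- second order term is split with weight `N`.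
  have hstep : ∀ k, ∫ z, |Z (k + 1) z| ^ s ∂ν ≤ (1 + C / N) * ∫ z, |Z k z| ^ s ∂ν + 2 * C * m * e := by
    intro k
    have hZS : Measurable fun z => Z k (S z) := (hZm k).comp hS.measurable
    have i1 : Integrable (fun z => |Z k (S z)| ^ s) ν :=
      integrable_comp_of_bound hcont hZS fun z => hZb k _
    obtain ⟨c', hc'⟩ := exists_bound_comp hcont2 (hZb k)
    have i2 : Integrable (fun z => s * (|Z k (S z)| ^ (s - 2) * Z k (S z)) * u z) ν :=
      (integrable_comp_of_bound hcont2 hZS fun z => hZb k _).mul_bdd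
        (c := b) hu.aestronglyMeasurable (Filter.Eventually.of_forall hub)
    have h2 : ∫ z, s * (|Z k (S z)| ^ (s - 2) * Z k (S z)) * u z ∂ν = 0 := by
      rw [← hu0 (fun z => s * (|Z k z| ^ (s - 2) * Z k z)) (hcont2.measurable.comp (hZm k)) c' hc']
      congr 1; ext z; ring
    have h3 : ∫ z, |Z k (S z)| ^ s ∂ν = ∫ z, |Z k z| ^ s ∂ν :=
      MeasurePreserving.integral_comp_of_measurable hS (hcont.measurable.comp (hZm k))
    calc ∫ z, |Z (k + 1) z| ^ s ∂ν
        ≤ ∫ z, ((1 + C / N) * |Z k (S z)| ^ s + s * (|Z k (S z)| ^ (s - 2) * Z k (S z)) * u z +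
            2 * C * m * |u z| ^ s) ∂ν := by
          refine integral_mono (integrable_comp_of_bound hcont (hZm _) (hZb _))
            (((i1.const_mul _).add i2).add (hue.const_mul _)) fun z => ?_
          dsimp only
          rw [show Z (k + 1) z = Z k (S z) + u z by rw [hZ, birkhoffSum_succ', add_comm]]
          refine (hineq _ _).trans ?_
          have h4 := rpow_mul_sq_le_weighted hs (abs_nonneg (Z k (S z))) (abs_nonneg (u z)) hN0
          rw [sq_abs, ← hm] at h4
          have h5 := mul_le_mul_of_nonneg_left h4 hC.le
          have h6 : |u z| ^ s ≤ m * |u z| ^ s := le_mul_of_one_le_left (by positivity) hm1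
          have h7 := mul_le_mul_of_nonneg_left h6 hC.le
          have h8 : C * (|Z k (S z)| ^ s / N) = C / N * |Z k (S z)| ^ s := by ring
          nlinarith
      _ = _ := by
          have j1 : Integrable (fun z => (1 + C / N) * |Z k (S z)| ^ s +
            s * (|Z k (S z)| ^ (s - 2) * Z k (S z)) * u z) ν := (i1.const_mul _).add i2
          rw [integral_add j1 (hue.const_mul _), integral_add (i1.const_mul _) i2,
            integral_const_mul, integral_const_mul, h2, h3, add_zero]
  -- A discrete Gronwall argument: for `k = N` the factor is at most `exp C`, and `N * N ^ (s / 2 -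
  -- 1) = N ^ (s / 2)`.
  have hind : ∀ k : ℕ, ∫ z, |Z k z| ^ s ∂ν ≤ (1 + C / N) ^ k * (k * (2 * C * m * e)) := by
    intro k
    induction k with
    | zero => simp [hZ, birkhoffSum_zero, Real.zero_rpow hs0.ne']
    | succ k ih =>
      have h1 : (1 : ℝ) ≤ 1 + C / N := by
        have : 0 ≤ C / N := by positivity
        linarith
      have h2 : (1 : ℝ) ≤ (1 + C / N) ^ (k + 1) := one_le_pow₀ h1
      have h3 : 0 ≤ 2 * C * m * e := by positivity
      calc _ ≤ (1 + C / N) * ((1 + C / N) ^ k * (k * (2 * C * m * e))) + 2 * C * m * e :=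
            (hstep k).trans (by gcongr)
        _ ≤ (1 + C / N) ^ (k + 1) * (k * (2 * C * m * e)) + (1 + C / N) ^ (k + 1) * (2 * C * m * e) := by
            rw [pow_succ']
            refine add_le_add (le_of_eq (by ring)) ?_
            rw [← pow_succ']
            exact le_mul_of_one_le_left h3 h2
        _ = _ := by push_cast; ring
  have hexp : (1 + C / N) ^ N ≤ Real.exp C := by
    calc (1 + C / N) ^ N ≤ Real.exp (C / N) ^ N := by
          gcongr; linarith [Real.add_one_le_exp (C / N)]
      _ = Real.exp C := by rw [← Real.exp_nat_mul]; congr 1; field_simp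
  refine (hind N).trans ?_
  calc (1 + C / N) ^ N * (N * (2 * C * m * e)) ≤ Real.exp C * (N * (2 * C * m * e)) := by gcongr
    _ = 2 * C * Real.exp C * (N * m) * e := by ring
    _ = _ := by
        rw [hm, ← Real.rpow_one_add' hN0.le (by linarith)]
        ring_nf

end Maximal

/-! ### Hoeffding bounds for reverse martingale differences -/

section MaximalTails

variable {X : Type*} [MeasurableSpace X] {ν : Measure X} {S : X → X} {u : X → ℝ} {b : ℝ}

/-- On `[-b, b]` the convex function `exp (l x)` lies below its chord. The chord is affine in `x`,
so its linear part disappears upon integration against functions of `S`. -/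
theorem exp_mul_le_cosh_add {b x : ℝ} (hb : 0 < b) (hx : |x| ≤ b) (l : ℝ) :
    Real.exp (l * x) ≤ Real.cosh (l * b) + Real.sinh (l * b) / b * x := by
  have hx' := abs_le.1 hx
  have h := convexOn_exp.2 (mem_univ (l * b)) (mem_univ (-(l * b)))
    (show 0 ≤ (b + x) / (2 * b) from div_nonneg (by linarith) (by linarith))
    (show 0 ≤ (b - x) / (2 * b) from div_nonneg (by linarith) (by linarith))
    (by field_simp; ring)
  simp only [smul_eq_mul] at h
  have e : (b + x) / (2 * b) * (l * b) + (b - x) / (2 * b) * -(l * b) = l * x := by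
    field_simp; ring
  rw [e] at h
  refine h.trans (le_of_eq ?_)
  rw [Real.cosh_eq, Real.sinh_eq]
  field_simp; ring

/-- Each further summand multiplies the exponential moment by at most `cosh (l b) ≤ exp ((l b)² /
2)`. -/
theorem integral_exp_birkhoffSum_le [IsProbabilityMeasure ν] (hS : MeasurePreserving S ν ν)
    (hu : Measurable u) (hb : 0 < b) (hub : ∀ z, |u z| ≤ b) (hu0 : IsReverseDiff ν S u) (l : ℝ)
    (N : ℕ) : ∫ z, Real.exp (l * birkhoffSum S u N z) ∂ν ≤ Real.exp (N * (l * b) ^ 2 / 2) := by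
  have hcont : Continuous fun x : ℝ => Real.exp (l * x) := by fun_prop
  have hZm : ∀ N, Measurable (birkhoffSum S u N) := measurable_birkhoffSum hS.measurable hu
  have hZb : ∀ N z, |birkhoffSum S u N z| ≤ N * b := abs_birkhoffSum_le hub
  induction N with
  | zero => simp [birkhoffSum_zero]
  | succ N ih =>
    have hZS : Measurable fun z => birkhoffSum S u N (S z) := (hZm N).comp hS.measurable
    have i1 : Integrable (fun z => Real.exp (l * birkhoffSum S u N (S z))) ν :=
      integrable_comp_of_bound hcont hZS fun z => hZb N _
    have i2 : Integrable (fun z => u z * Real.exp (l * birkhoffSum S u N (S z))) ν :=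
      i1.bdd_mul (c := b) hu.aestronglyMeasurable (Filter.Eventually.of_forall hub)
    obtain ⟨c', hc'⟩ := exists_bound_comp hcont (hZb N)
    have h2 := hu0 (fun z => Real.exp (l * birkhoffSum S u N z)) (hcont.measurable.comp (hZm N)) c' hc'
    have h3 : ∫ z, Real.exp (l * birkhoffSum S u N (S z)) ∂ν =
        ∫ z, Real.exp (l * birkhoffSum S u N z) ∂ν :=
      MeasurePreserving.integral_comp_of_measurable hS (hcont.measurable.comp (hZm N))
    calc ∫ z, Real.exp (l * birkhoffSum S u (N + 1) z) ∂ν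
        ≤ ∫ z, (Real.cosh (l * b) * Real.exp (l * birkhoffSum S u N (S z)) +
            Real.sinh (l * b) / b * (u z * Real.exp (l * birkhoffSum S u N (S z)))) ∂ν := by
          refine integral_mono (integrable_comp_of_bound hcont (hZm _) (hZb _))
            ((i1.const_mul _).add (i2.const_mul _)) fun z => ?_
          dsimp only
          rw [birkhoffSum_succ', mul_add, Real.exp_add]
          have := mul_le_mul_of_nonneg_right (exp_mul_le_cosh_add hb (hub z) l)
            (Real.exp_pos (l * birkhoffSum S u N (S z))).le
          refine this.trans (le_of_eq (by ring))
      _ = Real.cosh (l * b) * ∫ z, Real.exp (l * birkhoffSum S u N z) ∂ν := by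
          rw [integral_add (i1.const_mul _) (i2.const_mul _), integral_const_mul,
            integral_const_mul, h2, h3, mul_zero, add_zero]
      _ ≤ Real.exp ((l * b) ^ 2 / 2) * Real.exp (N * (l * b) ^ 2 / 2) := by
          gcongr
          exact Real.cosh_le_exp_half_sq _
      _ = _ := by rw [← Real.exp_add]; push_cast; ring_nf

theorem IsReverseDiff.neg (hu0 : IsReverseDiff ν S u) : IsReverseDiff ν S (-u) := by
  intro ξ hξ c hc
  simp only [Pi.neg_apply, neg_mul, integral_neg, hu0 ξ hξ c hc, neg_zero]

theorem measure_exists_ge_le_exp [IsProbabilityMeasure ν] (hS : MeasurePreserving S ν ν)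
    (hu : Measurable u) (hb : 0 < b) (hub : ∀ z, |u z| ≤ b) (hu0 : IsReverseDiff ν S u) {x : ℝ}
    (hx : 0 < x) {N : ℕ} (hN : 1 ≤ N) :
    ν.real {z | ∃ k ≤ N, x ≤ birkhoffSum S u (N - k) (S^[k] z)} ≤
      Real.exp (-(x ^ 2 / (2 * N * b ^ 2))) := by
  have hN0 : (0 : ℝ) < N := by exact_mod_cast hN
  -- This `l` minimises `N (l b)² / 2 - l x`.
  set l := x / (N * b ^ 2) with hl
  have hl0 : 0 < l := by positivity
  have h1 := mul_measure_exists_le hS hu hub hu0 (ψ := fun y => Real.exp (l * y))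
    (ψ' := fun y => l * Real.exp (l * y)) (by fun_prop) (by fun_prop) (fun y => (Real.exp_pos _).le)
    (fun y w => by
      have h2 := Real.add_one_le_exp (l * w - l * y)
      have h3 : Real.exp (l * w) = Real.exp (l * y) * Real.exp (l * w - l * y) := by
        rw [← Real.exp_add]; ring_nf
      rw [h3]
      have h4 := mul_le_mul_of_nonneg_left h2 (Real.exp_pos (l * y)).le
      refine le_trans (le_of_eq (by ring)) h4) (Real.exp (l * x)) N
  simp only [Real.exp_le_exp, mul_le_mul_iff_right₀ hl0] at h1
  have h5 := h1.trans (integral_exp_birkhoffSum_le hS hu hb hub hu0 l N)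
  rw [← le_div_iff₀' (Real.exp_pos _), ← Real.exp_sub] at h5
  refine h5.trans (le_of_eq ?_)
  congr 1
  rw [hl]; field_simp; ring

theorem measure_max_abs_ge_le_exp [IsProbabilityMeasure ν] (hS : MeasurePreserving S ν ν)
    (hu : Measurable u) (hb : 0 < b) (hub : ∀ z, |u z| ≤ b) (hu0 : IsReverseDiff ν S u) {x : ℝ}
    (hx : 0 < x) {N : ℕ} (hN : 1 ≤ N) :
    ν.real {z | ∃ k ≤ N, 2 * x ≤ |birkhoffSum S u k z|} ≤
      2 * Real.exp (-(x ^ 2 / (2 * N * b ^ 2))) := by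
  have h1 := measure_exists_ge_le_exp hS hu hb hub hu0 hx hN
  have h2 := measure_exists_ge_le_exp hS hu.neg hb (u := -u) (fun z => by simpa using hub z)
    hu0.neg hx hN
  refine (measureReal_mono (setOf_exists_le_abs_birkhoffSum_subset N x)).trans ?_
  have hsub : {z | ∃ k ≤ N, x ≤ |birkhoffSum S u (N - k) (S^[k] z)|} ⊆
      {z | ∃ k ≤ N, x ≤ birkhoffSum S u (N - k) (S^[k] z)} ∪
        {z | ∃ k ≤ N, x ≤ birkhoffSum S (-u) (N - k) (S^[k] z)} := by
    rintro z ⟨k, hk, h⟩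
    rcases le_abs.1 h with h | h
    · exact Or.inl ⟨k, hk, h⟩
    · exact Or.inr ⟨k, hk, by rw [birkhoffSum_neg]; exact h⟩
  refine (measureReal_mono hsub).trans ((measureReal_union_le _ _).trans ?_)
  linarith

end MaximalTails

/-! ### Block decomposition at a scale `L` -/

section Blocks

theorem exists_measure_max_abs_ge_le_moment {s : ℝ} (hs : 2 ≤ s) : ∃ C : ℝ, 0 < C ∧
    ∀ {X : Type} [MeasurableSpace X] {ν : Measure X} [IsProbabilityMeasure ν] {S : X → X} {u : X → ℝ}
      {b : ℝ}, MeasurePreserving S ν ν → Measurable u → (∀ z, |u z| ≤ b) → IsReverseDiff ν S u →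
      ∀ (N : ℕ) (x : ℝ), 0 < x → ν.real {z | ∃ k ≤ N, 2 * x ≤ |birkhoffSum S u k z|} ≤
        C * x ^ (-s) * (N : ℝ) ^ (s / 2) * ∫ z, |u z| ^ s ∂ν := by
  obtain ⟨C, hC, hmom⟩ := exists_moment_bound hs
  have hs0 : 0 < s := by linarith
  refine ⟨C, hC, ?_⟩
  intro X _ ν _ S u b hS hu hub hu0 N x hx
  have hcont : Continuous fun x : ℝ => |x| ^ s := continuous_abs.rpow_const fun _ => Or.inr hs0.le
  have hcont2 : Continuous fun x : ℝ => s * (|x| ^ (s - 2) * x) :=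
    continuous_const.mul ((continuous_abs.rpow_const fun _ => Or.inr (by linarith)).mul continuous_id)
  have h1 := mul_measure_exists_le hS hu hub hu0 hcont hcont2 (fun y => by positivity)
    (fun y w => abs_rpow_tangent hs y w) (x ^ s) N
  refine (measureReal_mono (setOf_exists_le_abs_birkhoffSum_subset N x)).trans ?_
  have hsub : {z | ∃ k ≤ N, x ≤ |birkhoffSum S u (N - k) (S^[k] z)|} ⊆
      {z | ∃ k ≤ N, x ^ s ≤ |birkhoffSum S u (N - k) (S^[k] z)| ^ s} := by
    rintro z ⟨k, hk, h⟩
    exact ⟨k, hk, Real.rpow_le_rpow hx.le h hs0.le⟩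
  refine (measureReal_mono hsub).trans ?_
  have h2 := h1.trans (hmom hS hu hub hu0 N)
  rw [← le_div_iff₀' (by positivity)] at h2
  refine h2.trans (le_of_eq ?_)
  rw [Real.rpow_neg hx.le]; ring

variable {X : Type*} [MeasurableSpace X] {ν : Measure X} {T : X → X} {d : X → ℝ}

omit [MeasurableSpace X] in
theorem birkhoffSum_two_mul_blocks (L m : ℕ) (z : X) :
    birkhoffSum T d (2 * L * m) z =
      birkhoffSum T^[2 * L] (birkhoffSum T d L) m z +
        birkhoffSum T^[2 * L] (birkhoffSum T d L) m (T^[L] z) := by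
  induction m with
  | zero => simp
  | succ m ih =>
    rw [show 2 * L * (m + 1) = 2 * L * m + (L + L) by ring, birkhoffSum_add, birkhoffSum_add, ih,
      birkhoffSum_succ, birkhoffSum_succ, ← Function.iterate_mul, ← Function.iterate_add_apply,
      ← Function.iterate_add_apply, add_comm L (2 * L * m)]
    ring

omit [MeasurableSpace X] in
/-- Partial sums are controlled by sums over blocks of length `L` of even and odd index, and by the
sums of the absolute values over single blocks. -/
theorem setOf_exists_le_abs_subset_blocks {L : ℕ} (hL : 1 ≤ L) (n : ℕ) (x : ℝ) :
    {z | ∃ k ≤ n, 6 * x ≤ |birkhoffSum T d k z|} ⊆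
      ({z | ∃ m ≤ n / L + 1, 2 * x ≤ |birkhoffSum T^[2 * L] (birkhoffSum T d L) m z|} ∪
        T^[L] ⁻¹' {z | ∃ m ≤ n / L + 1, 2 * x ≤ |birkhoffSum T^[2 * L] (birkhoffSum T d L) m z|}) ∪
      ⋃ j ∈ Finset.range (n / L + 1), T^[L * j] ⁻¹' {z | 2 * x ≤ birkhoffSum T (fun w => |d w|) L z} := by
  rintro z ⟨k, hk, h⟩
  by_contra hcon
  simp only [mem_union, mem_iUnion, mem_preimage, mem_ofPred_eq, not_or, not_exists, not_and, not_le,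
    Finset.mem_range] at hcon
  obtain ⟨⟨h1, h2⟩, h3⟩ := hcon
  have hj : k / L ≤ n / L := Nat.div_le_div_right hk
  have hpart := h3 (k / L) (by omega)
  have hkdm : L * (k / L) + k % L = k := Nat.div_add_mod k L
  have e1 := birkhoffSum_add T d (L * (k / L)) (k % L) z
  rw [hkdm] at e1
  have h4 : |birkhoffSum T d (k % L) (T^[L * (k / L)] z)| < 2 * x := by
    refine lt_of_le_of_lt ?_ hpart
    unfold birkhoffSum
    refine (Finset.abs_sum_le_sum_abs _ _).trans (Finset.sum_le_sum_of_subset_of_nonneg ?_ ?_)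
    · exact Finset.range_mono (Nat.mod_lt k (by omega)).le
    · exact fun _ _ _ => abs_nonneg _
  have h5 : |birkhoffSum T d (L * (k / L)) z| < 2 * x + 2 * x := by
    -- An even number of complete blocks splits into equally many even and odd ones; otherwise there
    -- is one more block of even index.
    obtain ⟨m, hm | hm⟩ := Nat.even_or_odd' (k / L)
    · rw [hm, show L * (2 * m) = 2 * L * m by ring, birkhoffSum_two_mul_blocks]
      exact (abs_add_le _ _).trans_lt (add_lt_add (h1 m (by omega)) (h2 m (by omega)))
    · have e2 : birkhoffSum T d (L * (2 * m + 1)) z =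
          birkhoffSum T^[2 * L] (birkhoffSum T d L) (m + 1) z +
            birkhoffSum T^[2 * L] (birkhoffSum T d L) m (T^[L] z) := by
        rw [show L * (2 * m + 1) = 2 * L * m + L by ring, birkhoffSum_add,
          birkhoffSum_two_mul_blocks, birkhoffSum_succ, ← Function.iterate_mul]
        ring
      rw [hm, e2]
      exact (abs_add_le _ _).trans_lt (add_lt_add (h1 _ (by omega)) (h2 _ (by omega)))
  have h6 := abs_add_le (birkhoffSum T d (L * (k / L)) z)
    (birkhoffSum T d (k % L) (T^[L * (k / L)] z))
  rw [← e1] at h6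
  linarith

/-- By invariance `d ∘ Tⁱ` is orthogonal to functions of `T^(i+L)`. For all `i < L` these include
the functions of `T^(2L)`. This is why every other block is left out. -/
theorem IsReverseDiff.block [IsFiniteMeasure ν] (hT : MeasurePreserving T ν ν) (hd : Measurable d)
    {B : ℝ} (hdB : ∀ z, |d z| ≤ B) {L : ℕ} (h : IsReverseDiff ν T^[L] d) :
    IsReverseDiff ν T^[2 * L] (birkhoffSum T d L) := by
  intro ξ hξ c hc
  have hi : ∀ i : ℕ, Integrable (fun z => d (T^[i] z) * ξ (T^[2 * L] z)) ν := fun i => by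
    have h1 : Integrable (fun z => d (T^[i] z)) ν := Integrable.of_bound
      (hd.comp (hT.measurable.iterate i)).aestronglyMeasurable B
      (Filter.Eventually.of_forall fun z => hdB _)
    exact h1.mul_bdd (c := c) (hξ.comp (hT.measurable.iterate _)).aestronglyMeasurable
      (Filter.Eventually.of_forall fun z => hc _)
  have h1 : ∀ i ∈ Finset.range L, ∫ z, d (T^[i] z) * ξ (T^[2 * L] z) ∂ν = 0 := by
    intro i hi
    have hiL := Finset.mem_range.1 hi
    have hξ' : Measurable fun z => ξ (T^[L - i] z) := hξ.comp (hT.measurable.iterate _)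
    have h2 := h (fun z => ξ (T^[L - i] z)) hξ' c fun z => hc _
    have h3 := MeasurePreserving.integral_comp_of_measurable (hT.iterate i)
      (f := fun z => d z * ξ (T^[L - i] (T^[L] z)))
      (hd.mul (hξ'.comp (hT.measurable.iterate L)))
    rw [h2] at h3
    rw [← h3]
    congr 1; ext z
    rw [← Function.iterate_add_apply, ← Function.iterate_add_apply]
    congr 3; omega
  unfold birkhoffSum
  simp only [Finset.sum_mul]
  rw [integral_finsetSum _ fun i _ => hi i]
  exact Finset.sum_eq_zero h1

theorem integral_birkhoffSum_rpow_le [IsFiniteMeasure ν] {s : ℝ} (hs : 1 ≤ s)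
    (hT : MeasurePreserving T ν ν) (hd : Measurable d) {B : ℝ} (hdB : ∀ z, |d z| ≤ B) {L : ℕ}
    (hL : 1 ≤ L) : ∫ z, birkhoffSum T (fun w => |d w|) L z ^ s ∂ν ≤
      (L : ℝ) ^ s * ∫ z, |d z| ^ s ∂ν := by
  have hs0 : 0 < s := by linarith
  have hL0 : (0 : ℝ) < L := by exact_mod_cast hL
  have hcont : Continuous fun x : ℝ => |x| ^ s := continuous_abs.rpow_const fun _ => Or.inr hs0.le
  have hi : ∀ i : ℕ, Integrable (fun z => |d (T^[i] z)| ^ s) ν := fun i =>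
    integrable_comp_of_bound hcont (hd.comp (hT.measurable.iterate i)) fun z => hdB _
  have h1 : ∀ i : ℕ, ∫ z, |d (T^[i] z)| ^ s ∂ν = ∫ z, |d z| ^ s ∂ν := fun i =>
    MeasurePreserving.integral_comp_of_measurable (hT.iterate i) (hcont.measurable.comp hd)
  have hDm : Measurable (birkhoffSum T (fun w => |d w|) L) :=
    measurable_birkhoffSum hT.measurable hd.abs L
  have hDb := abs_birkhoffSum_le (S := T) (u := fun w => |d w|) (b := B)
    (fun z => by rw [abs_abs]; exact hdB z) L
  have hD0 : ∀ z, 0 ≤ birkhoffSum T (fun w => |d w|) L z := fun z =>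
    Finset.sum_nonneg fun i _ => abs_nonneg _
  calc ∫ z, birkhoffSum T (fun w => |d w|) L z ^ s ∂ν
      ≤ ∫ z, (L : ℝ) ^ (s - 1) * ∑ i ∈ Finset.range L, |d (T^[i] z)| ^ s ∂ν := by
        refine integral_mono ?_ ((integrable_finsetSum _ fun i _ => hi i).const_mul _) fun z => ?_
        · exact (integrable_comp_of_bound hcont hDm hDb).congr
            (Filter.Eventually.of_forall fun z => by dsimp only; rw [abs_of_nonneg (hD0 z)])
        · have := Real.rpow_sum_le_const_mul_sum_rpow_of_nonneg (s := Finset.range L)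
            (f := fun i => |d (T^[i] z)|) hs fun i _ => abs_nonneg _
          rwa [Finset.card_range] at this
    _ = (L : ℝ) ^ (s - 1) * (L * ∫ z, |d z| ^ s ∂ν) := by
        rw [integral_const_mul, integral_finsetSum _ fun i _ => hi i]
        simp only [h1, Finset.sum_const, Finset.card_range, nsmul_eq_mul]
    _ = _ := by
        rw [← mul_assoc, Real.rpow_sub_one hL0.ne', div_mul_cancel₀ _ hL0.ne']

theorem measureReal_preimage_eq {S : X → X} (hS : MeasurePreserving S ν ν) {E : Set X}
    (hE : MeasurableSet E) : ν.real (S ⁻¹' E) = ν.real E := by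
  rw [measureReal_def, measureReal_def, hS.measure_preimage hE.nullMeasurableSet]

theorem measurableSet_exists_le_abs_birkhoffSum (hT : Measurable T) (hd : Measurable d) (n : ℕ)
    (x : ℝ) : MeasurableSet {z | ∃ k ≤ n, x ≤ |birkhoffSum T d k z|} := by
  have e : {z | ∃ k ≤ n, x ≤ |birkhoffSum T d k z|} =
      ⋃ k ∈ Finset.range (n + 1), {z | x ≤ |birkhoffSum T d k z|} := by
    ext z; simp
  rw [e]
  exact Finset.measurableSet_biUnion _ fun k _ =>
    measurableSet_le measurable_const (measurable_birkhoffSum hT hd k).abs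

theorem measure_max_le_blocks [IsFiniteMeasure ν] (hT : MeasurePreserving T ν ν)
    (hd : Measurable d) {L : ℕ} (hL : 1 ≤ L) (n : ℕ) (x : ℝ) :
    ν.real {z | ∃ k ≤ n, 6 * x ≤ |birkhoffSum T d k z|} ≤
      2 * ν.real {z | ∃ m ≤ n / L + 1, 2 * x ≤ |birkhoffSum T^[2 * L] (birkhoffSum T d L) m z|} +
      ((n / L : ℕ) + 1) * ν.real {z | 2 * x ≤ birkhoffSum T (fun w => |d w|) L z} := by
  refine (measureReal_mono (setOf_exists_le_abs_subset_blocks hL n x)).trans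
    ((measureReal_union_le _ _).trans (add_le_add ((measureReal_union_le _ _).trans ?_) ?_))
  · rw [measureReal_preimage_eq (hT.iterate L)
      (measurableSet_exists_le_abs_birkhoffSum (hT.measurable.iterate _)
        (measurable_birkhoffSum hT.measurable hd L) _ _)]
    linarith
  · refine (measureReal_biUnion_finset_le _ _).trans (le_of_eq ?_)
    have hm : MeasurableSet {z | 2 * x ≤ birkhoffSum T (fun w => |d w|) L z} :=
      measurableSet_le measurable_const (measurable_birkhoffSum hT.measurable hd.abs L)
    simp only [measureReal_preimage_eq (hT.iterate _) hm, Finset.sum_const, Finset.card_range,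
      nsmul_eq_mul]
    push_cast; ring

/-- The threshold `6 x` is shared by the even blocks, the odd blocks and the last incomplete block.
The first two are reverse martingale sums with about `n / L` terms. For the incomplete block
Markov's inequality is applied to each of the `n / L + 1` blocks; this number is absorbed into its
power `s / 2 ≥ 1`. -/
theorem exists_measure_max_le_scale {s : ℝ} (hs : 2 ≤ s) : ∃ C : ℝ, 0 < C ∧
    ∀ {X : Type} [MeasurableSpace X] {ν : Measure X} [IsProbabilityMeasure ν] {T : X → X} {d : X → ℝ}
      {B : ℝ}, MeasurePreserving T ν ν → Measurable d → (∀ z, |d z| ≤ B) →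
      ∀ L : ℕ, 1 ≤ L → IsReverseDiff ν T^[L] d → ∀ (n : ℕ) (x : ℝ), 0 < x →
      ν.real {z | ∃ k ≤ n, 6 * x ≤ |birkhoffSum T d k z|} ≤
        C * x ^ (-s) * ((n : ℝ) / L + 1) ^ (s / 2) * (L : ℝ) ^ s * ∫ z, |d z| ^ s ∂ν := by
  obtain ⟨C, hC, hmax⟩ := exists_measure_max_abs_ge_le_moment hs
  have hs0 : 0 < s := by linarith
  refine ⟨2 * C + 1, by positivity, ?_⟩
  intro X _ ν _ T d B hT hd hdB L hL hrd n x hx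
  have hL0 : (0 : ℝ) < L := by exact_mod_cast hL
  set e := ∫ z, |d z| ^ s ∂ν with he
  have he0 : 0 ≤ e := integral_nonneg fun z => by positivity
  have hcont : Continuous fun x : ℝ => |x| ^ s := continuous_abs.rpow_const fun _ => Or.inr hs0.le
  have hDm : Measurable (birkhoffSum T (fun w => |d w|) L) :=
    measurable_birkhoffSum hT.measurable hd.abs L
  have hDb := abs_birkhoffSum_le (S := T) (u := fun w => |d w|) (b := B)
    (fun z => by rw [abs_abs]; exact hdB z) L
  have hD0 : ∀ z, 0 ≤ birkhoffSum T (fun w => |d w|) L z := fun z =>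
    Finset.sum_nonneg fun i _ => abs_nonneg _
  have hDle := integral_birkhoffSum_rpow_le (by linarith : 1 ≤ s) hT hd hdB hL
  have hDi : Integrable (fun z => birkhoffSum T (fun w => |d w|) L z ^ s) ν :=
    (integrable_comp_of_bound hcont hDm hDb).congr
      (Filter.Eventually.of_forall fun z => by dsimp only; rw [abs_of_nonneg (hD0 z)])
  have hum := measurable_birkhoffSum hT.measurable hd L
  have hub := abs_birkhoffSum_le (S := T) hdB L
  have hule : ∫ z, |birkhoffSum T d L z| ^ s ∂ν ≤ (L : ℝ) ^ s * e := by
    refine (integral_mono (integrable_comp_of_bound hcont hum hub) hDi fun z => ?_).trans hDle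
    exact Real.rpow_le_rpow (abs_nonneg _) (Finset.abs_sum_le_sum_abs _ _) hs0.le
  have hrat : ((n / L : ℕ) : ℝ) + 1 ≤ (n : ℝ) / L + 1 := by
    have := @Nat.cast_div_le ℝ _ _ _ n L
    linarith
  set q := (n : ℝ) / L + 1 with hq
  have hq1 : 1 ≤ q := by
    have : 0 ≤ (n : ℝ) / L := by positivity
    linarith
  have h1 := hmax (hT.iterate (2 * L)) hum hub (hrd.block hT hd hdB) (n / L + 1) x hx
  have h2 : ν.real {z | 2 * x ≤ birkhoffSum T (fun w => |d w|) L z} ≤ x ^ (-s) * ((L : ℝ) ^ s * e) := by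
    have h3 := mul_meas_ge_le_integral_of_nonneg (μ := ν) (f := fun z =>
      birkhoffSum T (fun w => |d w|) L z ^ s)
      (Filter.Eventually.of_forall fun z => Real.rpow_nonneg (hD0 z) s) hDi (x ^ s)
    rw [Real.rpow_neg hx.le, ← div_eq_inv_mul, le_div_iff₀' (by positivity)]
    refine le_trans ?_ (h3.trans hDle)
    refine mul_le_mul_of_nonneg_left (measureReal_mono fun z hz => ?_) (by positivity)
    simp only [mem_ofPred_eq] at hz ⊢
    exact Real.rpow_le_rpow hx.le (by linarith) hs0.le
  refine (measure_max_le_blocks hT hd hL n x).trans ?_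
  have hxs : 0 < x ^ (-s) := by positivity
  have hLs : 0 < (L : ℝ) ^ s := by positivity
  have hqs : q ≤ q ^ (s / 2) := by
    nth_rewrite 1 [← Real.rpow_one q]
    exact Real.rpow_le_rpow_of_exponent_le hq1 (by linarith)
  calc _ ≤ 2 * (C * x ^ (-s) * q ^ (s / 2) * ((L : ℝ) ^ s * e)) +
        q ^ (s / 2) * (x ^ (-s) * ((L : ℝ) ^ s * e)) := by
        refine add_le_add (mul_le_mul_of_nonneg_left (h1.trans ?_) (by norm_num))
          (mul_le_mul (hrat.trans hqs) h2 measureReal_nonneg (by positivity))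
        push_cast
        refine mul_le_mul (mul_le_mul_of_nonneg_left ?_ (by positivity)) hule
          (integral_nonneg fun z => by positivity) (by positivity)
        exact Real.rpow_le_rpow (by positivity) hrat (by positivity)
    _ = _ := by ring

/-- The condition `L * B < 2 * x` makes a large sum of absolute values within one block impossible.
Only the two Hoeffding terms remain. -/
theorem measure_max_le_exp_scale [IsProbabilityMeasure ν] {B : ℝ} (hT : MeasurePreserving T ν ν)
    (hd : Measurable d) (hB : 0 < B) (hdB : ∀ z, |d z| ≤ B) {L : ℕ} (hL : 1 ≤ L)
    (hrd : IsReverseDiff ν T^[L] d) (n : ℕ) {x : ℝ} (hx : L * B < 2 * x) :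
    ν.real {z | ∃ k ≤ n, 6 * x ≤ |birkhoffSum T d k z|} ≤
      4 * Real.exp (-(x ^ 2 / (2 * ((n : ℝ) / L + 1) * (L * B) ^ 2))) := by
  have hL0 : (0 : ℝ) < L := by exact_mod_cast hL
  have hx0 : 0 < x := by
    have : 0 < L * B := by positivity
    linarith
  have hum := measurable_birkhoffSum hT.measurable hd L
  have hub := abs_birkhoffSum_le (S := T) hdB L
  have h1 := measure_max_abs_ge_le_exp (hT.iterate (2 * L)) hum (by positivity) hub
    (hrd.block hT hd hdB) hx0 (Nat.le_add_left 1 (n / L))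
  have h2 : ν.real {z | 2 * x ≤ birkhoffSum T (fun w => |d w|) L z} = 0 := by
    have : {z | 2 * x ≤ birkhoffSum T (fun w => |d w|) L z} = ∅ := by
      refine eq_empty_of_forall_notMem fun z hz => ?_
      have h3 := abs_birkhoffSum_le (S := T) (u := fun w => |d w|) (b := B)
        (fun z => by rw [abs_abs]; exact hdB z) L z
      have h4 := (le_abs_self _).trans h3
      simp only [mem_ofPred_eq] at hz
      linarith
    rw [this, measureReal_empty]
  refine (measure_max_le_blocks hT hd hL n x).trans ?_
  rw [h2, mul_zero, add_zero]
  refine (mul_le_mul_of_nonneg_left h1 (by norm_num)).trans ?_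
  rw [← mul_assoc]
  have hrat : ((n / L + 1 : ℕ) : ℝ) ≤ (n : ℝ) / L + 1 := by
    have := @Nat.cast_div_le ℝ _ _ _ n L
    push_cast; linarith
  have hp : (0 : ℝ) < ((n / L + 1 : ℕ) : ℝ) := by positivity
  have h5 : x ^ 2 / (2 * ((n : ℝ) / L + 1) * (L * B) ^ 2) ≤
      x ^ 2 / (2 * ((n / L + 1 : ℕ) : ℝ) * (L * B) ^ 2) := by gcongr
  refine mul_le_mul (by norm_num) (Real.exp_le_exp.2 (neg_le_neg h5)) (Real.exp_pos _).le
    (by norm_num)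

end Blocks

/-! ### Telescoping over conditional expectations, and union bounds -/

section Telescope

variable {X : Type*} [MeasurableSpace X] {ν : Measure X} {T : X → X} {φ : X → ℝ} {b : ℝ}

/-- The function `g_k ∘ Tᵏ`, the conditional expectation of `φ` given `Tᵏ`. -/
def transferComp (T : X → X) (g : ℕ → X → ℝ) (k : ℕ) (z : X) : ℝ := g k (T^[k] z)

variable {g : ℕ → X → ℝ}

/-- For every `k ≤ p'`, the function `g k ∘ Tᵏ` has the same integrals as `φ` against functions of
`T^p'`, by duality and invariance. -/
theorem isReverseDiff_transferComp_sub [IsFiniteMeasure ν] (hT : MeasurePreserving T ν ν)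
    (hg : ∀ k, IsTransfer ν T b φ k (g k)) {p p' : ℕ} (hpp : p ≤ p') :
    IsReverseDiff ν T^[p'] fun z => transferComp T g p z - transferComp T g p' z := by
  intro ξ hξ c hc
  have hTm : ∀ k, Measurable T^[k] := fun k => hT.measurable.iterate k
  have hi : ∀ k, Integrable (fun z => transferComp T g k z * ξ (T^[p'] z)) ν := fun k => by
    have h1 : Integrable (fun z => transferComp T g k z) ν := Integrable.of_bound
      ((hg k).measurable.comp (hTm k)).aestronglyMeasurable b
      (Filter.Eventually.of_forall fun z => (hg k).bound _)
    exact h1.mul_bdd (c := c) (hξ.comp (hTm _)).aestronglyMeasurable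
      (Filter.Eventually.of_forall fun z => hc _)
  have key : ∀ k ≤ p', ∫ z, transferComp T g k z * ξ (T^[p'] z) ∂ν =
      ∫ z, φ z * ξ (T^[p'] z) ∂ν := by
    intro k hk
    have hξ' : Measurable fun z => ξ (T^[p' - k] z) := hξ.comp (hTm _)
    have h1 := (hg k).integral_eq (fun z => ξ (T^[p' - k] z)) hξ' c fun z => hc _
    have h2 := MeasurePreserving.integral_comp_of_measurable (hT.iterate k)
      (f := fun z => g k z * ξ (T^[p' - k] z)) ((hg k).measurable.mul hξ')
    simp only [← Function.iterate_add_apply, Nat.sub_add_cancel hk] at h1 h2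
    rw [h1, ← h2]; rfl
  simp only [sub_mul]
  rw [integral_sub (hi _) (hi _), key p hpp, key p' le_rfl, sub_self]

theorem measurable_transferComp (hT : Measurable T) (hg : ∀ k, IsTransfer ν T b φ k (g k)) (k : ℕ) :
    Measurable (transferComp T g k) := (hg k).measurable.comp (hT.iterate k)

theorem abs_transferComp_le (hg : ∀ k, IsTransfer ν T b φ k (g k)) (k : ℕ) (z : X) :
    |transferComp T g k z| ≤ b := (hg k).bound _

theorem abs_transferComp_sub_le (hg : ∀ k, IsTransfer ν T b φ k (g k)) (p p' : ℕ) (z : X) :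
    |transferComp T g p z - transferComp T g p' z| ≤ 2 * b := by
  have h1 := abs_transferComp_le (T := T) hg p z
  have h2 := abs_transferComp_le (T := T) hg p' z
  exact (abs_sub _ _).trans (by linarith)

theorem integral_abs_transferComp (hT : MeasurePreserving T ν ν)
    (hg : ∀ k, IsTransfer ν T b φ k (g k)) (k : ℕ) :
    ∫ z, |transferComp T g k z| ∂ν = ∫ z, |g k z| ∂ν :=
  MeasurePreserving.integral_comp_of_measurable (hT.iterate k) (hg k).measurable.abs

/-- All but one of the `s` powers are estimated by the sup norm, and the last one is kept in L¹.
This is the source of the product `‖φ‖_β ‖φ‖_∞^(2q-1)` in the final bound. -/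
theorem integral_abs_sub_rpow_le [IsFiniteMeasure ν] (hT : MeasurePreserving T ν ν) (hb : 0 ≤ b)
    (hg : ∀ k, IsTransfer ν T b φ k (g k)) {s : ℝ} (hs : 1 ≤ s) (p p' : ℕ) :
    ∫ z, |transferComp T g p z - transferComp T g p' z| ^ s ∂ν ≤
      (2 * b) ^ (s - 1) * (∫ z, |g p z| ∂ν + ∫ z, |g p' z| ∂ν) := by
  have hi : ∀ k, Integrable (transferComp T g k) ν := fun k => Integrable.of_bound
    (measurable_transferComp hT.measurable hg k).aestronglyMeasurable b
    (Filter.Eventually.of_forall fun z => (hg k).bound _)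
  have hcont : Continuous fun x : ℝ => |x| ^ s :=
    continuous_abs.rpow_const fun _ => Or.inr (by linarith)
  rw [← integral_abs_transferComp hT hg, ← integral_abs_transferComp hT hg,
    ← integral_add (hi p).abs (hi p').abs, ← integral_const_mul]
  refine integral_mono (integrable_comp_of_bound hcont
    ((measurable_transferComp hT.measurable hg p).sub (measurable_transferComp hT.measurable hg p'))
    (abs_transferComp_sub_le hg p p')) (((hi p).abs.add (hi p').abs).const_mul _) fun z => ?_
  dsimp only
  set t := |transferComp T g p z - transferComp T g p' z| with ht
  have ht0 : 0 ≤ t := abs_nonneg _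
  have h1 : t ^ s = t ^ (s - 1) * t := by
    nth_rewrite 3 [← Real.rpow_one t]
    rw [← Real.rpow_add_of_nonneg ht0 (by linarith) (by norm_num)]
    ring_nf
  rw [h1]
  refine mul_le_mul ?_ (abs_sub _ _) ht0 (by positivity)
  exact Real.rpow_le_rpow ht0 (abs_transferComp_sub_le hg p p' z) (by linarith)

omit [MeasurableSpace X] in
theorem eq_sum_transferComp (hg0 : g 0 = φ) (p : ℕ → ℕ) (hp : p 0 = 0) (J : ℕ) (z : X) :
    φ z = ∑ j ∈ Finset.range J, (transferComp T g (p j) z - transferComp T g (p (j + 1)) z) +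
      transferComp T g (p J) z := by
  rw [Finset.sum_range_sub' fun j => transferComp T g (p j) z, hp]
  simp [transferComp, hg0]

theorem measure_max_le_remainder [IsFiniteMeasure ν] (hT : MeasurePreserving T ν ν)
    {r : X → ℝ} (hr : Measurable r) {B : ℝ} (hrB : ∀ z, |r z| ≤ B) (n : ℕ) {y : ℝ} (hy : 0 < y) :
    ν.real {z | ∃ k ≤ n, y ≤ |birkhoffSum T r k z|} ≤ n * (∫ z, |r z| ∂ν) / y := by
  have hi : ∀ i : ℕ, Integrable (fun z => |r (T^[i] z)|) ν := fun i => (Integrable.of_bound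
    (hr.comp (hT.measurable.iterate i)).aestronglyMeasurable B
    (Filter.Eventually.of_forall fun z => hrB _)).abs
  have h1 := mul_meas_ge_le_integral_of_nonneg (μ := ν) (f := fun z =>
      ∑ i ∈ Finset.range n, |r (T^[i] z)|)
      (Filter.Eventually.of_forall fun z => Finset.sum_nonneg fun i _ => abs_nonneg _)
      (integrable_finsetSum _ fun i _ => hi i) y
  have h2 : ∀ i : ℕ, ∫ z, |r (T^[i] z)| ∂ν = ∫ z, |r z| ∂ν := fun i =>
    MeasurePreserving.integral_comp_of_measurable (hT.iterate i) hr.abs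
  rw [integral_finsetSum _ fun i _ => hi i] at h1
  simp only [h2, Finset.sum_const, Finset.card_range, nsmul_eq_mul] at h1
  rw [le_div_iff₀' hy]
  refine le_trans (mul_le_mul_of_nonneg_left (measureReal_mono ?_) hy.le) h1
  rintro z ⟨k, hk, h⟩
  refine h.trans ?_
  unfold birkhoffSum
  exact (Finset.abs_sum_le_sum_abs _ _).trans (Finset.sum_le_sum_of_subset_of_nonneg
    (Finset.range_mono hk) fun _ _ _ => abs_nonneg _)

theorem measure_max_le_sum [IsFiniteMeasure ν] (d : ℕ → X → ℝ) (r : X → ℝ) (J : ℕ)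
    (hφ : ∀ z, φ z = ∑ j ∈ Finset.range J, d j z + r z) (x : ℕ → ℝ) {y t : ℝ}
    (hxy : ∑ j ∈ Finset.range J, 6 * x j + y ≤ t) (n : ℕ) :
    ν.real {z | ∃ k ≤ n, t ≤ |birkhoffSum T φ k z|} ≤
      ∑ j ∈ Finset.range J, ν.real {z | ∃ k ≤ n, 6 * x j ≤ |birkhoffSum T (d j) k z|} +
        ν.real {z | ∃ k ≤ n, y ≤ |birkhoffSum T r k z|} := by
  have hsub : {z | ∃ k ≤ n, t ≤ |birkhoffSum T φ k z|} ⊆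
      (⋃ j ∈ Finset.range J, {z | ∃ k ≤ n, 6 * x j ≤ |birkhoffSum T (d j) k z|}) ∪
        {z | ∃ k ≤ n, y ≤ |birkhoffSum T r k z|} := by
    rintro z ⟨k, hk, h⟩
    by_contra hcon
    simp only [mem_union, mem_iUnion, mem_ofPred_eq, not_or, not_exists, not_and, not_le,
      Finset.mem_range] at hcon
    obtain ⟨h1, h2⟩ := hcon
    have e : birkhoffSum T φ k z =
        ∑ j ∈ Finset.range J, birkhoffSum T (d j) k z + birkhoffSum T r k z := by
      simp only [birkhoffSum, hφ, Finset.sum_add_distrib]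
      rw [Finset.sum_comm]
    have h3 : |birkhoffSum T φ k z| < t := by
      rw [e]
      refine (abs_add_le _ _).trans_lt (lt_of_lt_of_le ?_ hxy)
      refine add_lt_add_of_le_of_lt ((Finset.abs_sum_le_sum_abs _ _).trans
        (Finset.sum_le_sum fun j hj => (h1 j (Finset.mem_range.1 hj) k hk).le)) (h2 k hk)
    linarith
  exact (measureReal_mono hsub).trans ((measureReal_union_le _ _).trans
    (add_le_add (measureReal_biUnion_finset_le _ _) le_rfl))

/-- Passage from maxima over finite times to the supremum over all large times. -/
theorem measure_exists_ge_le_tsum [IsFiniteMeasure ν] {ε : ℝ} (hε : 0 < ε) {n : ℕ} (hn : 1 ≤ n)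
    {a : ℕ → ℝ} (ha : Summable a) (h : ∀ i, ν.real {z | ∃ k ≤ 2 ^ (i + 1) * n,
      ε / 2 * ((2 ^ (i + 1) * n : ℕ) : ℝ) ≤ |birkhoffSum T φ k z|} ≤ a i) :
    ν.real {z | ∃ j, n ≤ j ∧ ε * j ≤ |birkhoffSum T φ j z|} ≤ ∑' i, a i := by
  have ha0 : ∀ i, 0 ≤ a i := fun i => measureReal_nonneg.trans (h i)
  have hsub : {z | ∃ j, n ≤ j ∧ ε * j ≤ |birkhoffSum T φ j z|} ⊆
      ⋃ i : ℕ, {z | ∃ k ≤ 2 ^ (i + 1) * n,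
        ε / 2 * ((2 ^ (i + 1) * n : ℕ) : ℝ) ≤ |birkhoffSum T φ k z|} := by
    rintro z ⟨j, hj, h⟩
    -- With this index `i`, `2^i n ≤ j < 2^(i+1) n`. So `j` is at least half of the endpoint, which
    -- halves `ε`.
    refine mem_iUnion.2 ⟨Nat.log 2 (j / n), j, ?_, ?_⟩
    · have h1 := Nat.lt_pow_succ_log_self (show 1 < 2 by norm_num) (j / n)
      have h2 := Nat.div_add_mod j n
      have h3 := Nat.mod_lt j (show 0 < n by omega)
      have h4 : j < n * (j / n + 1) := by rw [mul_add]; omega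
      calc j ≤ n * (j / n + 1) := h4.le
        _ ≤ n * 2 ^ (Nat.log 2 (j / n) + 1) := Nat.mul_le_mul_left _ h1
        _ = _ := mul_comm _ _
    · refine le_trans ?_ h
      have h1 := Nat.pow_log_le_self 2 (show j / n ≠ 0 from
        (Nat.div_pos hj (by omega)).ne')
      have h2 : 2 ^ (Nat.log 2 (j / n) + 1) * n ≤ 2 * j := by
        calc 2 ^ (Nat.log 2 (j / n) + 1) * n = 2 * (2 ^ (Nat.log 2 (j / n)) * n) := by ring
          _ ≤ 2 * (j / n * n) := by gcongr
          _ ≤ 2 * j := by gcongr; exact Nat.div_mul_le_self j n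
      have h3 : ((2 ^ (Nat.log 2 (j / n) + 1) * n : ℕ) : ℝ) ≤ 2 * j := by exact_mod_cast h2
      calc _ ≤ ε / 2 * (2 * j) := by gcongr
        _ = _ := by ring
  refine ENNReal.toReal_le_of_le_ofReal (tsum_nonneg ha0) ?_
  refine (measure_mono hsub).trans ((measure_iUnion_le _).trans ?_)
  rw [ENNReal.ofReal_tsum_of_nonneg ha0 ha]
  refine ENNReal.tsum_le_tsum fun i => ?_
  rw [← ofReal_measureReal]
  exact ENNReal.ofReal_le_ofReal (h i)

end Telescope

/-! ### Polynomial large deviations -/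

section Polynomial

/-- The scale used in the dyadic decomposition. -/
def dyadicScale : ℕ → ℕ
  | 0 => 0
  | j + 1 => 2 ^ j

theorem sum_pow_sub_le {r : ℝ} (hr0 : 0 ≤ r) (hr1 : r < 1) (m : ℕ) :
    ∑ j ∈ Finset.range (m + 1), r ^ (m - j) ≤ 1 / (1 - r) := by
  have h := Finset.sum_range_reflect (fun j => r ^ j) (m + 1)
  simp only [Nat.add_sub_cancel] at h
  rw [h, one_div, ← tsum_geometric_of_lt_one hr0 hr1]
  exact (summable_geometric_of_lt_one hr0 hr1).sum_le_tsum _ fun _ _ => by positivity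

/-- The contribution of a single dyadic scale. -/
theorem dyadic_term_le {α q c ε n ρ σ : ℝ} {m j : ℕ} (hα : 0 < α) (hq : α < q)
    (hc : 0 < c) (hε : 0 < ε) (hρ : 0 < ρ) (hσ : 1 < σ) (hρσ : ρ ^ (-(2 * q)) = σ)
    (hσ2 : (2 : ℝ) ^ (q - α) = σ ^ 2) (hjm : j ≤ m) (hmn : (2 : ℝ) ^ m ≤ n) :
    (ε * n * c * ρ ^ (m - j)) ^ (-(2 * q)) * (n / 2 ^ j + 1) ^ q * ((2 : ℝ) ^ j) ^ (2 * q) *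
      ((2 : ℝ) ^ j) ^ (-α) ≤
      c ^ (-(2 * q)) * 2 ^ q * ε ^ (-(2 * q)) * n ^ (-α) * σ⁻¹ ^ (m - j) := by
  have hσ0 : 0 < σ := by linarith
  have h2j : (0 : ℝ) < 2 ^ j := by positivity
  have hn : 0 < n := lt_of_lt_of_le (by positivity) hmn
  have hjn : (2 : ℝ) ^ j ≤ n := (pow_le_pow_right₀ (by norm_num) hjm).trans hmn
  have e1 : (ε * n * c * ρ ^ (m - j)) ^ (-(2 * q)) =
      ε ^ (-(2 * q)) * n ^ (-(2 * q)) * c ^ (-(2 * q)) * σ ^ (m - j) := by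
    rw [Real.mul_rpow (by positivity) (by positivity), Real.mul_rpow (by positivity) hc.le,
      Real.mul_rpow hε.le hn.le, ← Real.rpow_pow_comm hρ.le, hρσ]
  have e2 : (n / 2 ^ j + 1) ^ q ≤ 2 ^ q * n ^ q * ((2 : ℝ) ^ j) ^ (-q) := by
    calc (n / 2 ^ j + 1) ^ q ≤ (2 * n * (2 ^ j)⁻¹) ^ q := by
          refine Real.rpow_le_rpow (by positivity) ?_ (by linarith)
          have : 1 ≤ n / 2 ^ j := (one_le_div h2j).2 hjn
          have e : 2 * n * ((2 : ℝ) ^ j)⁻¹ = n / 2 ^ j + n / 2 ^ j := by field_simp; ring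
          rw [e]; linarith
      _ = _ := by
          rw [Real.mul_rpow (by positivity) (by positivity), Real.mul_rpow (by norm_num) hn.le,
            Real.inv_rpow h2j.le, Real.rpow_neg h2j.le]
  -- The powers of the scale combine to the positive exponent `q - α`, that is, to `σ ^ 2` per
  -- scale. The decreasing thresholds cost `σ ^ (m - j)`, which is half of this gain, and `σ⁻¹ ^ (m
  -- - j)` is left.
  have e3 : ((2 : ℝ) ^ j) ^ (-q) * ((2 : ℝ) ^ j) ^ (2 * q) * ((2 : ℝ) ^ j) ^ (-α) = (σ ^ 2) ^ j := by
    rw [← Real.rpow_add h2j, ← Real.rpow_add h2j, ← hσ2, Real.rpow_pow_comm (by norm_num)]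
    congr 1; ring
  have e4 : (σ ^ 2) ^ m ≤ n ^ (q - α) := by
    rw [← hσ2, Real.rpow_pow_comm (by norm_num)]
    exact Real.rpow_le_rpow (by positivity) hmn (by linarith)
  have e5 : σ ^ (m - j) * (σ ^ 2) ^ j = (σ ^ 2) ^ m * σ⁻¹ ^ (m - j) := by
    obtain ⟨i, rfl⟩ := Nat.exists_eq_add_of_le hjm
    rw [Nat.add_sub_cancel_left, inv_pow, ← pow_mul, ← pow_mul]
    field_simp
    ring
  have e6 : n ^ (-(2 * q)) * n ^ q * n ^ (q - α) = n ^ (-α) := by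
    rw [← Real.rpow_add hn, ← Real.rpow_add hn]; ring_nf
  have hcq : 0 < c ^ (-(2 * q)) := by positivity
  calc _ ≤ ε ^ (-(2 * q)) * n ^ (-(2 * q)) * c ^ (-(2 * q)) * σ ^ (m - j) *
        (2 ^ q * n ^ q * ((2 : ℝ) ^ j) ^ (-q)) * ((2 : ℝ) ^ j) ^ (2 * q) * ((2 : ℝ) ^ j) ^ (-α) := by
        rw [e1]; gcongr
    _ = c ^ (-(2 * q)) * 2 ^ q * ε ^ (-(2 * q)) * (n ^ (-(2 * q)) * n ^ q) *
        (σ ^ (m - j) * (((2 : ℝ) ^ j) ^ (-q) * ((2 : ℝ) ^ j) ^ (2 * q) * ((2 : ℝ) ^ j) ^ (-α))) := by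
        ring
    _ = c ^ (-(2 * q)) * 2 ^ q * ε ^ (-(2 * q)) * (n ^ (-(2 * q)) * n ^ q) *
        ((σ ^ 2) ^ m * σ⁻¹ ^ (m - j)) := by rw [e3, e5]
    _ ≤ c ^ (-(2 * q)) * 2 ^ q * ε ^ (-(2 * q)) * (n ^ (-(2 * q)) * n ^ q) *
        (n ^ (q - α) * σ⁻¹ ^ (m - j)) := by gcongr
    _ = c ^ (-(2 * q)) * 2 ^ q * ε ^ (-(2 * q)) * (n ^ (-(2 * q)) * n ^ q * n ^ (q - α)) *
        σ⁻¹ ^ (m - j) := by ring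
    _ = _ := by rw [e6]

/-- The differences over dyadic scales up to about `n` have contributions growing geometrically with
the scale, because `q > α`. Thresholds decreasing geometrically away from the top scale `m = Nat.log
2 n` keep both the thresholds and the probabilities summable. What remains beyond the top scale has
L¹ norm of order `n^(-α)`, and Markov's inequality suffices for it. -/
theorem exists_measure_max_le_rpow {α q : ℝ} (hα : 0 < α) (hq1 : 1 < q) (hq : α < q) :
    ∃ C : ℝ, 0 < C ∧ ∀ {X : Type} [MeasurableSpace X] {ν : Measure X} [IsProbabilityMeasure ν]
      {T : X → X} {φ : X → ℝ} {b A : ℝ} {g : ℕ → X → ℝ}, MeasurePreserving T ν ν → g 0 = φ →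
      (∀ k, IsTransfer ν T b φ k (g k)) → 0 < b → b ≤ A →
      (∀ k : ℕ, 1 ≤ k → ∫ z, |g k z| ∂ν ≤ A * (k : ℝ) ^ (-α)) → ∀ (n : ℕ) (ε : ℝ), 1 ≤ n → 0 < ε →
      ε ≤ 2 * b → ν.real {z | ∃ k ≤ n, ε * n ≤ |birkhoffSum T φ k z|} ≤
        C * A * b ^ (2 * q - 1) * ε ^ (-(2 * q)) * (n : ℝ) ^ (-α) := by
  obtain ⟨C, hC, hscale⟩ := exists_measure_max_le_scale (s := 2 * q) (by linarith)
  set σ : ℝ := 2 ^ ((q - α) / 2) with hσdef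
  have hσ : 1 < σ := Real.one_lt_rpow (by norm_num) (by linarith)
  have hσ0 : 0 < σ := by linarith
  set ρ : ℝ := σ ^ (-(1 / (2 * q))) with hρdef
  have hρ : 0 < ρ := by positivity
  have hq0 : 0 < q := by linarith
  have hρ1 : ρ < 1 := Real.rpow_lt_one_of_one_lt_of_neg hσ (by
    have : 0 < 1 / (2 * q) := by positivity
    linarith)
  have hρσ : ρ ^ (-(2 * q)) = σ := by
    rw [hρdef, ← Real.rpow_mul hσ0.le]
    have : -(1 / (2 * q)) * -(2 * q) = 1 := by field_simp
    rw [this, Real.rpow_one]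
  have hσ2 : (2 : ℝ) ^ (q - α) = σ ^ 2 := by
    rw [hσdef, ← Real.rpow_natCast, ← Real.rpow_mul (by norm_num)]
    congr 1; push_cast; ring
  -- This choice makes the thresholds `6 * x j` add up to at most `ε * n / 2`; the other half is
  -- left for the remainder.
  set c := (1 - ρ) / 12 with hcdef
  have hc : 0 < c := by rw [hcdef]; linarith
  have hσi : σ⁻¹ < 1 := inv_lt_one_of_one_lt₀ hσ
  set D := C * (2 ^ (2 * q - 1) * (2 ^ α + 1)) * (c ^ (-(2 * q)) * 2 ^ q) * (1 / (1 - σ⁻¹)) with hD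
  have h1σ : 0 < 1 - σ⁻¹ := by linarith
  have hD0 : 0 < D := by positivity
  refine ⟨D + 2 * 2 ^ α * 2 ^ (2 * q - 1), by positivity, ?_⟩
  intro X _ ν _ T φ b A g hT hg0 hg hb hbA hgA n ε hn hε hεb
  have hA : 0 < A := by linarith
  have hn0 : (0 : ℝ) < n := by exact_mod_cast hn
  set m := Nat.log 2 n with hm
  have hmn : (2 : ℝ) ^ m ≤ n := by exact_mod_cast Nat.pow_log_le_self 2 (by omega)
  have hnm : (n : ℝ) ≤ 2 * 2 ^ m := by
    have := Nat.lt_pow_succ_log_self (show 1 < 2 by norm_num) n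
    rw [pow_succ', ← hm] at this
    exact_mod_cast this.le
  set d : ℕ → X → ℝ := fun j z => transferComp T g (dyadicScale j) z -
    transferComp T g (dyadicScale (j + 1)) z with hd
  set r : X → ℝ := transferComp T g (dyadicScale (m + 1)) with hr
  have hmono : ∀ j, dyadicScale j ≤ dyadicScale (j + 1) := fun j => by
    cases j with
    | zero => exact Nat.zero_le _
    | succ j => exact Nat.pow_le_pow_right (by norm_num) (Nat.le_succ j)
  have hsum := measure_max_le_sum (ν := ν) (T := T) (φ := φ) d r (m + 1)
    (fun z => eq_sum_transferComp hg0 dyadicScale rfl (m + 1) z)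
    (fun j => ε * n * c * ρ ^ (m - j)) (y := ε * n / 2) (t := ε * n) (by
      have h1 := sum_pow_sub_le hρ.le hρ1 m
      have e : ∑ j ∈ Finset.range (m + 1), 6 * (ε * n * c * ρ ^ (m - j)) =
          6 * (ε * n * c) * ∑ j ∈ Finset.range (m + 1), ρ ^ (m - j) := by
        rw [Finset.mul_sum]; exact Finset.sum_congr rfl fun j _ => by ring
      have h2 : 6 * (ε * n * c) * ∑ j ∈ Finset.range (m + 1), ρ ^ (m - j) ≤
          6 * (ε * n * c) * (1 / (1 - ρ)) := by gcongr
      have h3 : 6 * (ε * n * c) * (1 / (1 - ρ)) = ε * n / 2 := by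
        have : 1 - ρ ≠ 0 := by linarith
        rw [hcdef]; field_simp; ring
      rw [e]; linarith) n
  refine hsum.trans ?_
  rw [add_mul, add_mul, add_mul, add_mul]
  refine add_le_add ?_ ?_
  · have hterm : ∀ j ∈ Finset.range (m + 1),
        ν.real {z | ∃ k ≤ n, 6 * (ε * n * c * ρ ^ (m - j)) ≤ |birkhoffSum T (d j) k z|} ≤
          C * (2 ^ (2 * q - 1) * (2 ^ α + 1)) * (c ^ (-(2 * q)) * 2 ^ q) *
            (A * b ^ (2 * q - 1) * ε ^ (-(2 * q)) * (n : ℝ) ^ (-α)) * σ⁻¹ ^ (m - j) := by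
      intro j hj
      have hjm : j ≤ m := by have := Finset.mem_range.1 hj; omega
      have h1 := hscale hT ((measurable_transferComp hT.measurable hg _).sub
        (measurable_transferComp hT.measurable hg _)) (abs_transferComp_sub_le hg _ _)
        (2 ^ j) Nat.one_le_two_pow (isReverseDiff_transferComp_sub hT hg (hmono j)) n
        (ε * n * c * ρ ^ (m - j)) (by positivity)
      have h2 := integral_abs_sub_rpow_le hT hb.le hg (show 1 ≤ 2 * q by linarith) (dyadicScale j)
        (dyadicScale (j + 1))
      have h3 : ∫ z, |g (dyadicScale j) z| ∂ν + ∫ z, |g (dyadicScale (j + 1)) z| ∂ν ≤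
          A * (2 ^ α + 1) * ((2 : ℝ) ^ j) ^ (-α) := by
        have h4 : ∫ z, |g (dyadicScale (j + 1)) z| ∂ν ≤ A * ((2 : ℝ) ^ j) ^ (-α) := by
          have := hgA (2 ^ j) Nat.one_le_two_pow
          push_cast at this
          exact this
        have h5 : ∫ z, |g (dyadicScale j) z| ∂ν ≤ A * 2 ^ α * ((2 : ℝ) ^ j) ^ (-α) := by
          cases j with
          | zero =>
            rw [pow_zero, Real.one_rpow, mul_one]
            have h6 : ∫ z, |g (dyadicScale 0) z| ∂ν ≤ b := by
              have h7 := norm_integral_le_of_norm_le_const (μ := ν) (C := b)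
                (f := fun z => |g (dyadicScale 0) z|) (Filter.Eventually.of_forall fun z => by
                  rw [Real.norm_eq_abs, abs_abs]; exact (hg _).bound z)
              rw [probReal_univ, mul_one] at h7
              exact (le_abs_self _).trans h7
            have h8 : (1 : ℝ) ≤ 2 ^ α := Real.one_le_rpow (by norm_num) hα.le
            nlinarith
          | succ j =>
            have := hgA (2 ^ j) Nat.one_le_two_pow
            push_cast at this
            refine this.trans (le_of_eq ?_)
            rw [pow_succ, Real.mul_rpow (by positivity) (by norm_num),
              Real.rpow_neg (by norm_num : (0 : ℝ) ≤ 2)]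
            field_simp
        linarith
      have h4 := dyadic_term_le hα hq hc hε hρ hσ hρσ hσ2 hjm hmn
      have e0 : 2 * q / 2 = q := by ring
      rw [e0] at h1
      push_cast at h1
      refine h1.trans ?_
      calc _ ≤ C * (ε * n * c * ρ ^ (m - j)) ^ (-(2 * q)) * ((n : ℝ) / 2 ^ j + 1) ^ q *
            ((2 : ℝ) ^ j) ^ (2 * q) * ((2 * b) ^ (2 * q - 1) *
              (A * (2 ^ α + 1) * ((2 : ℝ) ^ j) ^ (-α))) := by
            refine mul_le_mul_of_nonneg_left (h2.trans ?_) (by positivity)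
            gcongr
        _ = C * (2 ^ (2 * q - 1) * (2 ^ α + 1)) * (A * b ^ (2 * q - 1)) *
            ((ε * n * c * ρ ^ (m - j)) ^ (-(2 * q)) * ((n : ℝ) / 2 ^ j + 1) ^ q *
            ((2 : ℝ) ^ j) ^ (2 * q) * ((2 : ℝ) ^ j) ^ (-α)) := by
            rw [Real.mul_rpow (by norm_num) hb.le]; ring
        _ ≤ C * (2 ^ (2 * q - 1) * (2 ^ α + 1)) * (A * b ^ (2 * q - 1)) *
            (c ^ (-(2 * q)) * 2 ^ q * ε ^ (-(2 * q)) * (n : ℝ) ^ (-α) * σ⁻¹ ^ (m - j)) := by gcongr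
        _ = _ := by ring
    refine (Finset.sum_le_sum hterm).trans ?_
    rw [← Finset.mul_sum]
    have h5 := sum_pow_sub_le (inv_nonneg.2 hσ0.le) hσi m
    calc _ ≤ C * (2 ^ (2 * q - 1) * (2 ^ α + 1)) * (c ^ (-(2 * q)) * 2 ^ q) *
            (A * b ^ (2 * q - 1) * ε ^ (-(2 * q)) * (n : ℝ) ^ (-α)) * (1 / (1 - σ⁻¹)) := by gcongr
      _ = _ := by rw [hD]; ring
  · have h1 := measure_max_le_remainder (ν := ν) hT (measurable_transferComp hT.measurable hg _)
      (abs_transferComp_le hg (dyadicScale (m + 1))) n (y := ε * n / 2) (by positivity)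
    refine h1.trans ?_
    rw [integral_abs_transferComp hT hg]
    have h2 := hgA (2 ^ m) Nat.one_le_two_pow
    push_cast at h2
    change ∫ z, |g (dyadicScale (m + 1)) z| ∂ν ≤ _ at h2
    have h3 : ((2 : ℝ) ^ m) ^ (-α) ≤ 2 ^ α * (n : ℝ) ^ (-α) := by
      have h4 : ((n : ℝ) / 2) ^ (-α) = 2 ^ α * (n : ℝ) ^ (-α) := by
        rw [Real.div_rpow hn0.le (by norm_num), Real.rpow_neg (by norm_num : (0 : ℝ) ≤ 2)]
        field_simp
      rw [← h4]
      exact Real.rpow_le_rpow_of_nonpos (by positivity) (by linarith) (by linarith)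
    -- Markov's inequality gives only `ε⁻¹`. The assumption `ε ≤ 2 * b` trades it for the
    -- homogeneous expression with `ε ^ (-(2 * q))`.
    have h5 : ε⁻¹ ≤ 2 ^ (2 * q - 1) * b ^ (2 * q - 1) * ε ^ (-(2 * q)) := by
      rw [← Real.mul_rpow (by norm_num) hb.le]
      calc ε⁻¹ = ε ^ (2 * q - 1) * ε ^ (-(2 * q)) := by
            rw [← Real.rpow_add hε, ← Real.rpow_neg_one]; ring_nf
        _ ≤ _ := by
            gcongr
            linarith
    calc (n : ℝ) * (∫ z, |g (dyadicScale (m + 1)) z| ∂ν) / (ε * n / 2)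
        = 2 * (∫ z, |g (dyadicScale (m + 1)) z| ∂ν) * ε⁻¹ := by field_simp
      _ ≤ 2 * (A * (2 ^ α * (n : ℝ) ^ (-α))) *
          (2 ^ (2 * q - 1) * b ^ (2 * q - 1) * ε ^ (-(2 * q))) := by
          gcongr
          exact h2.trans (by gcongr)
      _ = _ := by ring

theorem exists_measure_sup_le_rpow {α q : ℝ} (hα : 0 < α) (hq1 : 1 < q) (hq : α < q) :
    ∃ C : ℝ, 0 < C ∧ ∀ {X : Type} [MeasurableSpace X] {ν : Measure X} [IsProbabilityMeasure ν]
      {T : X → X} {φ : X → ℝ} {b A : ℝ} {g : ℕ → X → ℝ}, MeasurePreserving T ν ν → g 0 = φ →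
      (∀ k, IsTransfer ν T b φ k (g k)) → 0 < b → b ≤ A →
      (∀ k : ℕ, 1 ≤ k → ∫ z, |g k z| ∂ν ≤ A * (k : ℝ) ^ (-α)) → ∀ (n : ℕ) (ε : ℝ), 1 ≤ n → 0 < ε →
      ε ≤ 2 * b → ν.real {z | ∃ j, n ≤ j ∧ ε * j ≤ |birkhoffSum T φ j z|} ≤
        C * A * b ^ (2 * q - 1) * ε ^ (-(2 * q)) * (n : ℝ) ^ (-α) := by
  obtain ⟨C, hC, hmax⟩ := exists_measure_max_le_rpow hα hq1 hq
  -- Each doubling of the time multiplies the bound by `κ < 1`, so the sum over dyadic times is a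
  -- geometric series.
  set κ : ℝ := 2 ^ (-α) with hκ
  have hκ0 : 0 < κ := by positivity
  have hκ1 : κ < 1 := Real.rpow_lt_one_of_one_lt_of_neg (by norm_num) (by linarith)
  have h1κ : 0 < 1 - κ := by linarith
  refine ⟨C * 2 ^ (2 * q) * (κ * (1 - κ)⁻¹), by positivity, ?_⟩
  intro X _ ν _ T φ b A g hT hg0 hg hb hbA hgA n ε hn hε hεb
  have hn0 : (0 : ℝ) < n := by exact_mod_cast hn
  have hsumm : HasSum (fun i : ℕ => C * A * b ^ (2 * q - 1) * (ε / 2) ^ (-(2 * q)) *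
      (n : ℝ) ^ (-α) * κ * κ ^ i)
      (C * A * b ^ (2 * q - 1) * (ε / 2) ^ (-(2 * q)) * (n : ℝ) ^ (-α) * κ * (1 - κ)⁻¹) :=
    (hasSum_geometric_of_lt_one hκ0.le hκ1).mul_left _
  refine (measure_exists_ge_le_tsum hε hn hsumm.summable fun i => ?_).trans ?_
  · have h1 := hmax hT hg0 hg hb hbA hgA (2 ^ (i + 1) * n) (ε / 2)
      (Nat.mul_pos (by positivity) hn) (by positivity) (by linarith)
    refine h1.trans (le_of_eq ?_)
    have e : ((2 ^ (i + 1) * n : ℕ) : ℝ) ^ (-α) = κ ^ (i + 1) * (n : ℝ) ^ (-α) := by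
      push_cast
      rw [Real.mul_rpow (by positivity) hn0.le, hκ, Real.rpow_pow_comm (by norm_num)]
    rw [e]; ring
  · rw [hsumm.tsum_eq]
    refine le_of_eq ?_
    rw [Real.div_rpow hε.le (by norm_num), Real.rpow_neg (by norm_num : (0 : ℝ) ≤ 2)]
    field_simp

end Polynomial

/-! ### Stretched exponential large deviations -/

section StretchedExponential

theorem exists_pow_mul_exp_le {τ θ : ℝ} (hτ : 0 < τ) (hθ : 0 < θ) (k : ℕ) : ∃ C : ℝ, 0 < C ∧
    ∀ x : ℝ, 1 ≤ x → x ^ k * Real.exp (-(τ * x ^ θ)) ≤ C := by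
  obtain ⟨N, hN⟩ := exists_nat_ge ((k : ℝ) / θ)
  refine ⟨N.factorial / τ ^ N, by positivity, fun x hx => ?_⟩
  have hx0 : 0 < x := by linarith
  have h1 : x ^ k ≤ (x ^ θ) ^ N := by
    rw [← Real.rpow_natCast x k, ← Real.rpow_natCast (x ^ θ) N, ← Real.rpow_mul hx0.le]
    refine Real.rpow_le_rpow_of_exponent_le hx ?_
    rw [div_le_iff₀ hθ] at hN
    linarith
  have h2 := Real.pow_div_factorial_le_exp (x := τ * x ^ θ) (by positivity) N
  rw [mul_pow, div_le_iff₀ (by positivity)] at h2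
  rw [Real.exp_neg, ← div_eq_mul_inv, div_le_div_iff₀ (Real.exp_pos _) (by positivity)]
  calc x ^ k * τ ^ N ≤ (x ^ θ) ^ N * τ ^ N := by gcongr
    _ = τ ^ N * (x ^ θ) ^ N := mul_comm _ _
    _ ≤ _ := by linarith

/-- The scales `0, p, 2 p, 4 p, …`. -/
def scaledDyadic (p : ℕ) : ℕ → ℕ
  | 0 => 0
  | j + 1 => p * 2 ^ j

theorem scaledDyadic_mono (p j : ℕ) : scaledDyadic p j ≤ scaledDyadic p (j + 1) := by
  cases j with
  | zero => exact Nat.zero_le _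
  | succ j => exact Nat.mul_le_mul_left _ (Nat.pow_le_pow_right (by norm_num) (Nat.le_succ j))

variable {X : Type} [MeasurableSpace X] {ν : Measure X} {T : X → X} {φ : X → ℝ} {b : ℝ}
  {g : ℕ → X → ℝ}

/-- At the first scale the difference is merely bounded, by `2 * b`, so Hoeffding is the tool.
Substituting threshold `ε n / 24`, about `n / p` blocks and block bound `2 p b` gives `n ε² / (9216
p b²)`, where `9216 = 24² * 16`. -/
theorem measure_max_first_scale_le [IsProbabilityMeasure ν] (hT : MeasurePreserving T ν ν)
    (hg : ∀ k, IsTransfer ν T b φ k (g k)) (hb : 0 < b) {K : ℝ} (hbK : b ≤ K)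
    {n p : ℕ} {ε y : ℝ} (hp : 1 ≤ p) (hpn : p ≤ n) (hε : 0 < ε) (hpε : 24 * (p * b) < ε * n)
    (hpy : y * p ≤ n * ε ^ 2 / K ^ 2) :
    ν.real {z | ∃ k ≤ n, 6 * (ε * n / 24) ≤ |birkhoffSum T
      (fun z => transferComp T g 0 z - transferComp T g p z) k z|} ≤ 4 * Real.exp (-(y / 9216)) := by
  have hp0 : (0 : ℝ) < p := by exact_mod_cast hp
  have hpn' : (p : ℝ) ≤ n := by exact_mod_cast hpn
  have hn0 : (0 : ℝ) < n := by linarith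
  have hK : 0 < K := by linarith
  have h1 := measure_max_le_exp_scale hT ((measurable_transferComp hT.measurable hg 0).sub
    (measurable_transferComp hT.measurable hg p)) (show 0 < 2 * b by linarith)
    (abs_transferComp_sub_le hg 0 p) hp (isReverseDiff_transferComp_sub hT hg (Nat.zero_le p)) n
    (x := ε * n / 24) (by linarith)
  refine h1.trans (mul_le_mul_of_nonneg_left (Real.exp_le_exp.2 (neg_le_neg ?_)) (by norm_num))
  have h2 : (n : ℝ) / p + 1 ≤ 2 * (n / p) := by
    have : 1 ≤ (n : ℝ) / p := (one_le_div hp0).2 hpn'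
    linarith
  calc y / 9216 = y * p / (9216 * p) := by field_simp
    _ ≤ (n * ε ^ 2 / K ^ 2) / (9216 * p) := by gcongr
    _ ≤ (n * ε ^ 2 / b ^ 2) / (9216 * p) := by gcongr
    _ = (ε * n / 24) ^ 2 / (2 * (2 * (n / p)) * (p * (2 * b)) ^ 2) := by field_simp; ring
    _ ≤ _ := by gcongr

/-- Beyond the first scale the L¹ norms are stretched exponentially small, so second moments
suffice. All losses in the scale, including those from the halved thresholds, are collected in the
fifth power. The assumption `b * K ≤ ε ^ 2 * n` removes the dependence on `ε` and `n`. -/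
theorem measure_max_scale_le_exp [IsProbabilityMeasure ν] {τ θ E C₀ K : ℝ} (hC₀ : 0 < C₀)
    (hscale : ∀ {d : X → ℝ} {B : ℝ}, Measurable d → (∀ z, |d z| ≤ B) →
      ∀ L : ℕ, 1 ≤ L → IsReverseDiff ν T^[L] d → ∀ (n : ℕ) (x : ℝ), 0 < x →
      ν.real {z | ∃ k ≤ n, 6 * x ≤ |birkhoffSum T d k z|} ≤
        C₀ * x ^ (-2 : ℝ) * ((n : ℝ) / L + 1) ^ (2 / 2 : ℝ) * (L : ℝ) ^ (2 : ℝ) *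
          ∫ z, |d z| ^ (2 : ℝ) ∂ν)
    (hτ : 0 < τ) (hθ : 0 < θ) (hE : 0 < E) (hT : MeasurePreserving T ν ν)
    (hg : ∀ k, IsTransfer ν T b φ k (g k)) (hb : 0 < b) (hbK : b ≤ K)
    (hgE : ∀ k : ℕ, 1 ≤ k → ∫ z, |g k z| ∂ν ≤ E * K * Real.exp (-(τ * (k : ℝ) ^ θ)))
    {n p : ℕ} {ε : ℝ} (hn : 1 ≤ n) (hp1 : 1 ≤ p) (hε : 0 < ε) (hKn : b * K ≤ ε ^ 2 * n) (j : ℕ) :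
    ν.real {z | ∃ k ≤ n, 6 * (ε * n / 24 * (1 / 2) ^ (j + 1)) ≤
      |birkhoffSum T (fun z => transferComp T g (scaledDyadic p (j + 1)) z -
        transferComp T g (scaledDyadic p (j + 1 + 1)) z) k z|} ≤
      C₀ * 576 * 128 * E * (1 / 2) ^ j * (((p * 2 ^ j : ℕ) : ℝ) ^ 5 *
        Real.exp (-(τ * ((p * 2 ^ j : ℕ) : ℝ) ^ θ))) := by
  have hK : 0 < K := by linarith
  have hn0 : (0 : ℝ) < n := by exact_mod_cast hn
  have hn1 : (1 : ℝ) ≤ n := by exact_mod_cast hn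
  set P : ℝ := ((p * 2 ^ j : ℕ) : ℝ) with hPdef
  have h2P : (2 : ℝ) ^ j ≤ P := by
    rw [hPdef]; exact_mod_cast Nat.le_mul_of_pos_left (2 ^ j) hp1
  have h2j : (0 : ℝ) < 2 ^ j := by positivity
  have hP0 : 0 < P := by linarith
  have hLP : ((p * 2 ^ (j + 1) : ℕ) : ℝ) = 2 * P := by rw [hPdef]; push_cast; ring
  have h1 := hscale ((measurable_transferComp hT.measurable hg _).sub
      (measurable_transferComp hT.measurable hg _)) (abs_transferComp_sub_le hg _ _)
      (p * 2 ^ (j + 1)) (Nat.mul_pos hp1 (by positivity))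
      (isReverseDiff_transferComp_sub hT hg (scaledDyadic_mono p (j + 1))) n
      (ε * n / 24 * (1 / 2) ^ (j + 1)) (by positivity)
  have h2 := integral_abs_sub_rpow_le hT hb.le hg one_le_two (scaledDyadic p (j + 1))
      (scaledDyadic p (j + 1 + 1))
  have h3 : ∫ z, |g (scaledDyadic p (j + 1)) z| ∂ν + ∫ z, |g (scaledDyadic p (j + 1 + 1)) z| ∂ν ≤
      2 * E * K * Real.exp (-(τ * P ^ θ)) := by
    have h4 := hgE (p * 2 ^ j) (Nat.mul_pos hp1 (by positivity))
    have h5 := hgE (p * 2 ^ (j + 1)) (Nat.mul_pos hp1 (by positivity))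
    rw [hLP] at h5
    have h6 : Real.exp (-(τ * (2 * P) ^ θ)) ≤ Real.exp (-(τ * P ^ θ)) := by
      refine Real.exp_le_exp.2 (neg_le_neg ?_)
      gcongr
      linarith
    have h7 := mul_le_mul_of_nonneg_left h6 (show 0 ≤ E * K by positivity)
    change ∫ z, |g (scaledDyadic p (j + 1)) z| ∂ν ≤ _ at h4
    change ∫ z, |g (scaledDyadic p (j + 1 + 1)) z| ∂ν ≤ _ at h5
    linarith
  have hnL : (n : ℝ) / (2 * P) + 1 ≤ 2 * n := by
    have hP1 : 1 ≤ P := le_trans (one_le_pow₀ (by norm_num)) h2P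
    have : (n : ℝ) / (2 * P) ≤ n := div_le_self hn0.le (by linarith)
    linarith
  have hxinv : b * K / (ε ^ 2 * n) ≤ 1 := by rwa [div_le_one (by positivity)]
  have hx0 : 0 < ε * n / 24 * (1 / 2) ^ (j + 1) := by positivity
  have e1 : (ε * n / 24 * (1 / 2) ^ (j + 1)) ^ (-2 : ℝ) =
      576 * 4 * (2 ^ j) ^ 2 / (ε ^ 2 * n ^ 2) := by
    rw [Real.rpow_neg hx0.le, Real.rpow_two, pow_succ, one_div, inv_pow]
    field_simp
    ring
  have h4 : ∫ z, |transferComp T g (scaledDyadic p (j + 1)) z -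
      transferComp T g (scaledDyadic p (j + 1 + 1)) z| ^ (2 : ℝ) ∂ν ≤
      2 * b * (2 * E * K * Real.exp (-(τ * P ^ θ))) := by
    rw [show (2 : ℝ) - 1 = 1 by norm_num, Real.rpow_one] at h2
    exact h2.trans (mul_le_mul_of_nonneg_left h3 (by positivity))
  rw [e1, hLP, show (2 : ℝ) / 2 = 1 by norm_num, Real.rpow_one, Real.rpow_two] at h1
  refine h1.trans ?_
  have hP1 : (2 ^ j) ^ 3 * P ^ 2 ≤ P ^ 5 := by
    calc ((2 : ℝ) ^ j) ^ 3 * P ^ 2 ≤ P ^ 3 * P ^ 2 := by gcongr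
      _ = P ^ 5 := by ring
  have he : 0 < Real.exp (-(τ * P ^ θ)) := Real.exp_pos _
  generalize Real.exp (-(τ * P ^ θ)) = e at *
  calc _ ≤ C₀ * (576 * 4 * (2 ^ j) ^ 2 / (ε ^ 2 * n ^ 2)) * (2 * n) * (2 * P) ^ 2 *
        (2 * b * (2 * E * K * e)) := by
        refine mul_le_mul ?_ h4 (integral_nonneg fun z => Real.rpow_nonneg (abs_nonneg _) _)
          (by positivity)
        exact mul_le_mul_of_nonneg_right (mul_le_mul_of_nonneg_left hnL (by positivity))
          (by positivity)
    _ = C₀ * 576 * 128 * E * (1 / 2) ^ j * (((2 ^ j) ^ 3 * P ^ 2) * e) *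
        (b * K / (ε ^ 2 * n)) := by
        rw [one_div_pow]
        field_simp
        ring
    _ ≤ C₀ * 576 * 128 * E * (1 / 2) ^ j * (P ^ 5 * e) * 1 := by
        refine mul_le_mul ?_ hxinv (by positivity) (by positivity)
        exact mul_le_mul_of_nonneg_left (mul_le_mul_of_nonneg_right hP1 he.le) (by positivity)
    _ = _ := mul_one _

set_option maxHeartbeats 800000 in
-- With `x = n ε² / K²` and first scale `p ≈ x^(1/(θ+1))`, Hoeffding's exponent `x / p` and the
-- decay exponent `p^θ` are both of order `y = x^(θ/(θ+1))`. Half of the rate `τ` is spent on the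
-- polynomial factors at the later scales.
theorem exists_measure_max_le_exp {τ θ E : ℝ} (hτ : 0 < τ) (hθ : 0 < θ) (hE : 0 < E) :
    ∃ C c : ℝ, 0 < C ∧ 0 < c ∧ ∀ {X : Type} [MeasurableSpace X] {ν : Measure X}
      [IsProbabilityMeasure ν] {T : X → X} {φ : X → ℝ} {b K : ℝ} {g : ℕ → X → ℝ},
      MeasurePreserving T ν ν → g 0 = φ →
      (∀ k, IsTransfer ν T b φ k (g k)) → 0 < b → b ≤ K →
      (∀ k : ℕ, 1 ≤ k → ∫ z, |g k z| ∂ν ≤ E * K * Real.exp (-(τ * (k : ℝ) ^ θ))) →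
      ∀ (n : ℕ) (ε : ℝ), 1 ≤ n → 0 < ε → ε ≤ 2 * b →
      ν.real {z | ∃ k ≤ n, ε * n ≤ |birkhoffSum T φ k z|} ≤
        C * Real.exp (-(c * (n * ε ^ 2 / K ^ 2) ^ (θ / (θ + 1)))) := by
  obtain ⟨C₀, hC₀, hscale⟩ := exists_measure_max_le_scale (s := 2) le_rfl
  obtain ⟨C₁, hC₁, hpoly⟩ := exists_pow_mul_exp_le (show 0 < τ / 2 by positivity) hθ 5
  set c := min (1 / 9216) (τ / 2 * (1 / 2) ^ θ) with hc
  have hc0 : 0 < c := lt_min (by norm_num) (by positivity)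
  set D := C₀ * 576 * 128 * E * C₁ with hD
  have hD0 : 0 < D := by positivity
  -- The first summand makes the bound trivial when `y < 49`. For `y ≥ 49`, `49 v K ≤ x K ≤ 2 ε n`,
  -- which gives the room `24 p b < ε n` that the Hoeffding step requires.
  refine ⟨Real.exp (c * 49) + (4 + 2 * D + 2 * E * C₁), c, by positivity, hc0, ?_⟩
  intro X _ ν _ T φ b K g hT hg0 hg hb hbK hgE n ε hn hε hεb
  set x := n * ε ^ 2 / K ^ 2 with hx
  set y := x ^ (θ / (θ + 1)) with hy
  have hK : 0 < K := by linarith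
  have hn0 : (0 : ℝ) < n := by exact_mod_cast hn
  have hn1 : (1 : ℝ) ≤ n := by exact_mod_cast hn
  have hx0 : 0 < x := by positivity
  have hθ1 : 0 < θ + 1 := by linarith
  rw [add_mul]
  rcases lt_or_ge y 49 with hy49 | hy49
  · refine measureReal_le_one.trans (le_trans ?_ (le_add_of_nonneg_right (by positivity)))
    rw [← Real.exp_add]
    refine Real.one_le_exp ?_
    nlinarith
  refine le_trans ?_ (le_add_of_nonneg_left (by positivity))
  have hx1 : 1 ≤ x := by
    by_contra hlt
    have : y ≤ 1 := Real.rpow_le_one hx0.le (not_le.1 hlt).le (by positivity)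
    linarith
  set v := x ^ (1 / (θ + 1)) with hv
  have hv1 : 1 ≤ v := Real.one_le_rpow hx1 (by positivity)
  have hyv : y * v = x := by
    rw [hy, hv, ← Real.rpow_add hx0]
    have : θ / (θ + 1) + 1 / (θ + 1) = 1 := by field_simp
    rw [this, Real.rpow_one]
  have hvθ : v ^ θ = y := by
    rw [hy, hv, ← Real.rpow_mul hx0.le]; congr 1; field_simp
  set p := ⌊v⌋₊ with hp
  have hp1 : 1 ≤ p := Nat.le_floor (by exact_mod_cast hv1)
  have hp1' : (1 : ℝ) ≤ p := by exact_mod_cast hp1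
  have hpv : (p : ℝ) ≤ v := Nat.floor_le (by linarith)
  have hvp : v / 2 ≤ p := by
    have := Nat.lt_floor_add_one v
    rw [← hp] at this
    linarith
  have hxn : x ≤ 4 * n := by
    rw [hx, div_le_iff₀ (by positivity)]
    have h1 : ε ^ 2 ≤ (2 * K) ^ 2 := by gcongr; linarith
    have h2 := mul_le_mul_of_nonneg_left h1 hn0.le
    linarith
  have hvx : 49 * v ≤ x := by rw [← hyv]; gcongr
  have hpn : p ≤ n := by
    have : (p : ℝ) ≤ n := by linarith
    exact_mod_cast this
  have hpε : 24 * (p * b) < ε * n := by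
    have h1 : x * K ≤ 2 * (ε * n) := by
      have e : x * K = (ε * n) * (ε / K) := by rw [hx]; field_simp
      have h2 : ε / K ≤ 2 := by rw [div_le_iff₀ hK]; linarith
      rw [e]
      have : 0 < ε * n := by positivity
      nlinarith
    have h3 : (p : ℝ) * b ≤ v * K := by gcongr
    have h4 : 49 * v * K ≤ x * K := by gcongr
    have h5 : 0 < v * K := by positivity
    nlinarith
  have hpexp : Real.exp (-(τ / 2 * (p : ℝ) ^ θ)) ≤ Real.exp (-(c * y)) := by
    refine Real.exp_le_exp.2 (neg_le_neg ?_)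
    calc c * y ≤ τ / 2 * (1 / 2) ^ θ * y := by gcongr; exact min_le_right _ _
      _ = τ / 2 * (v / 2) ^ θ := by
          rw [← hvθ, mul_assoc, ← Real.mul_rpow (by norm_num) (by linarith)]; ring_nf
      _ ≤ _ := by gcongr
  have hP : ∀ j : ℕ, ((p * 2 ^ j : ℕ) : ℝ) ^ 5 *
      Real.exp (-(τ * ((p * 2 ^ j : ℕ) : ℝ) ^ θ)) ≤ C₁ * Real.exp (-(c * y)) := by
    intro j
    set P : ℝ := ((p * 2 ^ j : ℕ) : ℝ) with hPdef
    have hpP : (p : ℝ) ≤ P := by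
      rw [hPdef]; exact_mod_cast Nat.le_mul_of_pos_right p (by positivity)
    have hP1 : 1 ≤ P := hp1'.trans hpP
    have e : Real.exp (-(τ * P ^ θ)) = Real.exp (-(τ / 2 * P ^ θ)) * Real.exp (-(τ / 2 * P ^ θ)) := by
      rw [← Real.exp_add]; ring_nf
    rw [e, ← mul_assoc]
    refine mul_le_mul (hpoly P hP1) (le_trans (Real.exp_le_exp.2 (neg_le_neg ?_)) hpexp)
      (Real.exp_pos _).le hC₁.le
    gcongr
  set d : ℕ → X → ℝ := fun j z => transferComp T g (scaledDyadic p j) z -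
    transferComp T g (scaledDyadic p (j + 1)) z with hd
  -- With `n + 1` differences the last scale `p * 2 ^ n` is at least `n`, so the remainder is small
  -- enough for Markov's inequality.
  have hsum := measure_max_le_sum (ν := ν) (T := T) (φ := φ) d
    (transferComp T g (scaledDyadic p (n + 1))) (n + 1)
    (fun z => eq_sum_transferComp hg0 (scaledDyadic p) rfl (n + 1) z)
    (fun j => ε * n / 24 * (1 / 2) ^ j) (y := ε * n / 2) (t := ε * n) (by
      have h1 := (summable_geometric_two).sum_le_tsum (Finset.range (n + 1)) fun _ _ => by positivity
      rw [tsum_geometric_two] at h1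
      have e : ∑ j ∈ Finset.range (n + 1), 6 * (ε * n / 24 * (1 / 2) ^ j) =
          ε * n / 4 * ∑ j ∈ Finset.range (n + 1), (1 / 2 : ℝ) ^ j := by
        rw [Finset.mul_sum]; exact Finset.sum_congr rfl fun j _ => by ring
      have : 0 < ε * n := by positivity
      rw [e]; nlinarith) n
  refine hsum.trans ?_
  rw [Finset.sum_range_succ']
  have hfirst : ν.real {z | ∃ k ≤ n, 6 * (ε * n / 24 * (1 / 2) ^ 0) ≤ |birkhoffSum T (d 0) k z|} ≤
      4 * Real.exp (-(c * y)) := by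
    have h1 := measure_max_first_scale_le hT hg hb hbK hp1 hpn hε hpε
      (y := y) (by rw [← hx, ← hyv]; gcongr)
    rw [pow_zero, mul_one]
    have e : d 0 = fun z => transferComp T g 0 z - transferComp T g p z := by
      ext z; simp [hd, scaledDyadic]
    rw [e]
    refine h1.trans ?_
    gcongr
    have : c ≤ 1 / 9216 := min_le_left _ _
    have : c * y ≤ 1 / 9216 * y := by gcongr
    linarith
  have hmid : ∀ j ∈ Finset.range n,
      ν.real {z | ∃ k ≤ n, 6 * (ε * n / 24 * (1 / 2) ^ (j + 1)) ≤ |birkhoffSum T (d (j + 1)) k z|} ≤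
      D * Real.exp (-(c * y)) * (1 / 2) ^ j := by
    intro j _
    have hxinv : b * K ≤ ε ^ 2 * n := by
      have : x * K ^ 2 = n * ε ^ 2 := by rw [hx]; field_simp
      nlinarith
    refine (measure_max_scale_le_exp hC₀ (hscale hT) hτ hθ hE hT hg hb hbK hgE hn hp1 hε hxinv j).trans ?_
    refine (mul_le_mul_of_nonneg_left (hP j)
      (show 0 ≤ C₀ * 576 * 128 * E * (1 / 2 : ℝ) ^ j by positivity)).trans (le_of_eq ?_)
    rw [hD]; ring
  have hmid' : ∑ j ∈ Finset.range n, ν.real {z | ∃ k ≤ n,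
      6 * (ε * n / 24 * (1 / 2) ^ (j + 1)) ≤ |birkhoffSum T (d (j + 1)) k z|} ≤
      2 * D * Real.exp (-(c * y)) := by
    refine (Finset.sum_le_sum hmid).trans ?_
    rw [← Finset.mul_sum]
    have h1 := (summable_geometric_two).sum_le_tsum (Finset.range n) fun _ _ => by positivity
    rw [tsum_geometric_two] at h1
    have : 0 < D * Real.exp (-(c * y)) := by positivity
    nlinarith
  have hrem : ν.real {z | ∃ k ≤ n, ε * n / 2 ≤
      |birkhoffSum T (transferComp T g (scaledDyadic p (n + 1))) k z|} ≤
      2 * E * C₁ * Real.exp (-(c * y)) := by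
    have h1 := measure_max_le_remainder (ν := ν) hT (measurable_transferComp hT.measurable hg _)
      (abs_transferComp_le hg (scaledDyadic p (n + 1))) n (y := ε * n / 2) (by positivity)
    rw [integral_abs_transferComp hT hg] at h1
    refine h1.trans ?_
    have h2 := hgE (p * 2 ^ n) (Nat.mul_pos hp1 (by positivity))
    change ∫ z, |g (scaledDyadic p (n + 1)) z| ∂ν ≤ _ at h2
    set P : ℝ := ((p * 2 ^ n : ℕ) : ℝ) with hPdef
    have hnP : (n : ℝ) ≤ P := by
      rw [hPdef]
      exact_mod_cast (Nat.lt_two_pow_self).le.trans (Nat.le_mul_of_pos_left (2 ^ n) hp1)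
    have hP1 : 1 ≤ P := hn1.trans hnP
    -- Since `x ≥ 1`, `(K / ε)² ≤ n`. The factor `ε⁻¹` of Markov's inequality is thus polynomial in
    -- the scale.
    have hKε : K / ε ≤ P ^ 5 := by
      have h3 : (K / ε) ^ 2 ≤ n := by
        have e : (K / ε) ^ 2 * x = n := by rw [hx]; field_simp
        nlinarith [sq_nonneg (K / ε)]
      have h4 : K / ε ≤ n := by
        by_contra hlt
        have := not_le.1 hlt
        nlinarith
      exact h4.trans (hnP.trans (le_self_pow₀ hP1 (by norm_num)))
    calc (n : ℝ) * (∫ z, |g (scaledDyadic p (n + 1)) z| ∂ν) / (ε * n / 2)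
        = 2 * (∫ z, |g (scaledDyadic p (n + 1)) z| ∂ν) / ε := by field_simp
      _ ≤ 2 * (E * K * Real.exp (-(τ * P ^ θ))) / ε := by gcongr
      _ = 2 * E * ((K / ε) * Real.exp (-(τ * P ^ θ))) := by field_simp
      _ ≤ 2 * E * (P ^ 5 * Real.exp (-(τ * P ^ θ))) := by gcongr
      _ ≤ 2 * E * (C₁ * Real.exp (-(c * y))) :=
          mul_le_mul_of_nonneg_left (hP n) (by positivity)
      _ = _ := by ring
  have := add_le_add (add_le_add hmid' hfirst) hrem
  refine this.trans (le_of_eq ?_)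
  ring

/-- Halving `ε` turns `x` into `x / 4`, and doubling the time multiplies the exponent by `2 ^ η`.
Once `w = (x / 4) ^ η ≥ 1`, the dyadic terms decay at least geometrically; for `w < 1` the bound is
trivial. -/
theorem exists_measure_sup_le_exp {τ θ E : ℝ} (hτ : 0 < τ) (hθ : 0 < θ) (hE : 0 < E) :
    ∃ C c : ℝ, 0 < C ∧ 0 < c ∧ ∀ {X : Type} [MeasurableSpace X] {ν : Measure X}
      [IsProbabilityMeasure ν] {T : X → X} {φ : X → ℝ} {b K : ℝ} {g : ℕ → X → ℝ},
      MeasurePreserving T ν ν → g 0 = φ →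
      (∀ k, IsTransfer ν T b φ k (g k)) → 0 < b → b ≤ K →
      (∀ k : ℕ, 1 ≤ k → ∫ z, |g k z| ∂ν ≤ E * K * Real.exp (-(τ * (k : ℝ) ^ θ))) →
      ∀ (n : ℕ) (ε : ℝ), 1 ≤ n → 0 < ε → ε ≤ 2 * b →
      ν.real {z | ∃ j, n ≤ j ∧ ε * j ≤ |birkhoffSum T φ j z|} ≤
        C * Real.exp (-(c * (n * ε ^ 2 / K ^ 2) ^ (θ / (θ + 1)))) := by
  obtain ⟨C, c, hC, hc, hmax⟩ := exists_measure_max_le_exp hτ hθ hE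
  set η := θ / (θ + 1) with hη
  have hη0 : 0 < η := by positivity
  set κ := η * Real.log 2 with hκ
  have hκ0 : 0 < κ := mul_pos hη0 (Real.log_pos (by norm_num))
  set r := Real.exp (-(c * κ)) with hr
  have hr1 : r < 1 := Real.exp_lt_one_iff.2 (by have := mul_pos hc hκ0; linarith)
  have h1r : 0 < 1 - r := by linarith
  refine ⟨Real.exp c + C * (1 - r)⁻¹, c * (1 / 4) ^ η, by positivity, by positivity, ?_⟩
  intro X _ ν _ T φ b K g hT hg0 hg hb hbK hgE n ε hn hε hεb
  have hn0 : (0 : ℝ) < n := by exact_mod_cast hn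
  have hK : 0 < K := by linarith
  set x := n * ε ^ 2 / K ^ 2 with hx
  have hx0 : 0 < x := by positivity
  set w := (x / 4) ^ η with hw
  have hw0 : 0 < w := by positivity
  have ew : c * (1 / 4) ^ η * x ^ η = c * w := by
    rw [hw, mul_assoc, ← Real.mul_rpow (by norm_num) hx0.le]; ring_nf
  rw [ew, add_mul]
  rcases lt_or_ge w 1 with hw1 | hw1
  · refine measureReal_le_one.trans (le_trans ?_ (le_add_of_nonneg_right (by positivity)))
    rw [← Real.exp_add]
    refine Real.one_le_exp ?_
    nlinarith
  refine le_trans ?_ (le_add_of_nonneg_left (by positivity))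
  have hsumm : HasSum (fun i : ℕ => C * Real.exp (-(c * w)) * r ^ i)
      (C * Real.exp (-(c * w)) * (1 - r)⁻¹) :=
    (hasSum_geometric_of_lt_one (Real.exp_pos _).le hr1).mul_left _
  refine (measure_exists_ge_le_tsum hε hn hsumm.summable fun i => ?_).trans ?_
  · refine (hmax hT hg0 hg hb hbK hgE (2 ^ (i + 1) * n) (ε / 2)
      (Nat.mul_pos (by positivity) hn) (by positivity) (by linarith)).trans ?_
    have e1 : ((2 ^ (i + 1) * n : ℕ) : ℝ) * (ε / 2) ^ 2 / K ^ 2 = 2 ^ (i + 1) * (x / 4) := by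
      rw [hx]; push_cast; ring
    rw [e1, Real.mul_rpow (by positivity) (by positivity), ← hw, hr, ← Real.exp_nat_mul, mul_assoc,
      ← Real.exp_add]
    refine mul_le_mul_of_nonneg_left (Real.exp_le_exp.2 ?_) hC.le
    -- Bounding the exponential growth from below by a linear function suffices for a geometric
    -- series of ratio `exp (-(c * κ))`.
    have e2 : 1 + i * κ ≤ ((2 : ℝ) ^ (i + 1)) ^ η := by
      have h1 : ((2 : ℝ) ^ (i + 1)) ^ η = Real.exp (((i : ℝ) + 1) * κ) := by
        rw [Real.rpow_def_of_pos (by positivity), Real.log_pow, hκ]; push_cast; ring_nf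
      have h2 := Real.add_one_le_exp (((i : ℝ) + 1) * κ)
      rw [h1]
      nlinarith
    have hi : (0 : ℝ) ≤ i := Nat.cast_nonneg i
    have h3 : (1 + i * κ) * w ≤ ((2 : ℝ) ^ (i + 1)) ^ η * w := by gcongr
    have h4 : i * κ ≤ i * κ * w := le_mul_of_one_le_right (by positivity) hw1
    have h5 : c * (w + i * κ) ≤ c * (((2 : ℝ) ^ (i + 1)) ^ η * w) := by
      gcongr; linarith
    linarith
  · rw [hsumm.tsum_eq]
    exact le_of_eq (by ring)

end StretchedExponential

/-! ### Coding of the Young tower -/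

namespace YoungStructure

variable {d : ℕ} {M : Type u} [EMetricSpace M]
  [ChartedSpace (EuclideanSpace ℝ (Fin d)) M] [IsManifold (𝓡 d) 1 M] [MeasurableSpace M]
  [RiemannianBundle (fun y : M => TangentSpace (𝓡 d) y)] {f : M → M} {U : ℕ → Set M}
  {Y : YoungStructure (d := d) f U}

/-- The coding of the points of the tower by their itinerary and their level. -/
def coding (z : Y.Tower) : (ℕ → ℕ) × ℕ := (Y.itin (base z), level z)

theorem measurable_base : Measurable (base : Y.Tower → M) :=
  (measurable_subtype_coe (p := fun z : M × ℕ => z.1 ∈ Y.Λ' ∧ z.2 < Y.R z.1)).fst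

theorem measurable_level : Measurable (level : Y.Tower → ℕ) :=
  (measurable_subtype_coe (p := fun z : M × ℕ => z.1 ∈ Y.Λ' ∧ z.2 < Y.R z.1)).snd

theorem R_base (z : Y.Tower) : Y.R (base z) = Y.Ri ((coding z).1 0) := R_eq z.2.1

theorem level_lt_R (z : Y.Tower) : level z < Y.R (base z) := z.2.2

/-- The return time is a function of the first symbol, and passing to the return shifts the
itinerary. -/
theorem coding_towerMap (z : Y.Tower) :
    coding (Y.towerMap z) = symTower Y.Ri (coding z) := by
  have hR := R_base z
  by_cases h : level z + 1 < Y.R (base z)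
  · have h' : (coding z).2 + 1 < Y.Ri ((coding z).1 0) := by rw [← hR]; exact h
    have e : Y.towerMap z = ⟨(base z, level z + 1), z.2.1, h⟩ := dif_pos h
    rw [symTower, if_pos h', e]
    rfl
  · have h' : ¬ (coding z).2 + 1 < Y.Ri ((coding z).1 0) := by rw [← hR]; exact h
    have e : Y.towerMap z = ⟨(Y.fR (base z), 0), Y.fR_mem z.2.1, Y.R_pos (Y.fR_mem z.2.1)⟩ :=
      dif_neg h
    rw [symTower, if_neg h', e]
    exact Prod.ext (itin_fR_eq_shift _) rfl

theorem coding_iterate (n : ℕ) (z : Y.Tower) :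
    coding (Y.towerMap^[n] z) = (symTower Y.Ri)^[n] (coding z) := by
  induction n generalizing z with
  | zero => rfl
  | succ n ih => rw [Function.iterate_succ_apply, ih, coding_towerMap, Function.iterate_succ_apply]

section Measurable

variable [BorelSpace M]

theorem measurable_coding (hf : IsPiecewiseC1Diffeo (d := d) f U) :
    Measurable (coding : Y.Tower → (ℕ → ℕ) × ℕ) :=
  ((measurable_itin hf).comp measurable_base).prodMk measurable_level

theorem isTowerMeasure_map (hf : IsPiecewiseC1Diffeo (d := d) f U) {ν : Measure Y.Tower}
    (hν : Y.IsSRB ν) : IsTowerMeasure Y.Ri (ν.map coding) where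
  R_pos := Y.Ri_pos
  isProbabilityMeasure := by
    have := hν.isProbabilityMeasure
    exact Measure.isProbabilityMeasure_map (measurable_coding hf).aemeasurable
  measurePreserving := by
    refine ⟨measurable_symTower _, ?_⟩
    rw [Measure.map_map (measurable_symTower _) (measurable_coding hf)]
    have : symTower Y.Ri ∘ coding = coding ∘ Y.towerMap := funext fun z => (coding_towerMap z).symm
    rw [this, ← Measure.map_map (measurable_coding hf) hν.measurePreserving.measurable,
      hν.measurePreserving.map_eq]
  level_lt := by
    rw [ae_map_iff (measurable_coding hf).aemeasurable]
    · exact Filter.Eventually.of_forall fun z => by rw [← R_base]; exact level_lt_R z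
    · exact measurableSet_lt measurable_snd
        ((measurable_of_countable Y.Ri).comp ((measurable_pi_apply 0).comp measurable_fst))

/-- The conditional measures are absolutely continuous on their own unstable disks. The holonomy
carries null sets of itineraries between disks, so one fixed disk `b` serves for all of them. -/
theorem baseMeasure_absolutelyContinuous (hf : IsPiecewiseC1Diffeo (d := d) f U)
    {ν : Measure Y.Tower} (hν : Y.IsSRB ν) (b : Y.Γu.K) :
    baseMeasure (ν.map coding) ≪ Y.unstableMeasure b := by
  obtain ⟨η, κ, _, _, hνη, hκ⟩ := hν.exists_conditionals
  refine Measure.AbsolutelyContinuous.mk fun A hA h0 => ?_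
  have hS : MeasurableSet (coding ⁻¹' (A ×ˢ {0}) : Set Y.Tower) :=
    measurable_coding hf (hA.prod (measurableSet_singleton _))
  rw [baseMeasure_apply _ hA,
    Measure.map_apply (measurable_coding hf) (hA.prod (measurableSet_singleton _)), hνη,
    Measure.bind_apply hS κ.aemeasurable, lintegral_eq_zero_iff (κ.measurable_coe hS)]
  filter_upwards [hκ] with q hq
  have h1 : Y.Γu.leb q.1 (Y.itin ⁻¹' A ∩ Y.Λ') = 0 := by
    rw [← unstableMeasure_apply hf _ hA]
    exact unstableMeasure_absolutelyContinuous hf q.1 b h0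
  have h2 := hq.2 h1
  rw [Measure.map_apply measurable_base ((measurable_itin hf hA).inter (measurableSet_Λ' hf))] at h2
  refine measure_mono_null (fun z hz => ?_) h2
  exact ⟨hz.1, z.2.1⟩

/-- The constant records the route: `2 C` for one step on an unstable disk, division by `1 - β` for
all branches, and a factor `3` for the passage to the base measure of the SRB measure. -/
theorem exists_boundedDistortion (hf : IsPiecewiseC1Diffeo (d := d) f U) {ν : Measure Y.Tower}
    (hν : Y.IsSRB ν) :
    ∃ C : ℝ, 0 ≤ C ∧ BoundedDistortion Y.β C (baseMeasure (ν.map coding)) := by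
  have hprob := hν.isProbabilityMeasure
  have htow := isTowerMeasure_map hf hν
  have := htow.isProbabilityMeasure
  obtain ⟨z⟩ : Nonempty Y.Tower := nonempty_of_isProbabilityMeasure ν
  obtain ⟨b, -⟩ := exists_unstable (Λ'_subset_Λ z.2.1)
  have hfin := isFiniteMeasure_unstableMeasure hf b
  have hC := Y.C_pos
  have h1 : 0 < 1 - Y.β := sub_pos.2 Y.β_lt_one
  have hbd := boundedDistortion_of_one_step Y.β_pos Y.β_lt_one (C := 2 * Y.C) (by positivity)
    (m := Y.unstableMeasure b) fun i v k A B hA hB hAv hBv =>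
      unstableMeasure_gibbs hf b i hA hB hAv hBv
  have hac := baseMeasure_absolutelyContinuous hf hν b
  exact ⟨3 * (2 * Y.C / (1 - Y.β)), by positivity,
    hbd.of_hasRegularDensity Y.β_pos Y.β_lt_one (by positivity) hac
      (hasRegularDensity_of_invariant hbd hac htow.measurePreserving_shift)⟩

end Measurable

end YoungStructure

/-- Lipschitz functions on a subset of the symbolic tower extend to the whole symbolic tower. -/
theorem exists_symLipschitz_extension {ι : Type*} {β a b : ℝ} (hβ0 : 0 < β) (hβ1 : β < 1)
    (ha : 0 ≤ a) (hb : 0 ≤ b) (c : ι → (ℕ → ℕ) × ℕ) (φ : ι → ℝ) (hφ : ∀ i, |φ i| ≤ b)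
    (hosc : ∀ (m : ℕ) (i j : ι), (c i).2 = (c j).2 → (c j).1 ∈ PiNat.cylinder (c i).1 m →
      |φ i - φ j| ≤ a * β ^ m) :
    ∃ ψ : (ℕ → ℕ) × ℕ → ℝ, SymLipschitz β a b ψ ∧ ∀ i, ψ (c i) = φ i := by
  let J : (ℕ → ℕ) × ℕ → Type _ := fun z =>
    {q : ι × ℕ // (c q.1).2 = z.2 ∧ (c q.1).1 ∈ PiNat.cylinder z.1 q.2}
  -- This is McShane's extension for the symbolic ultrametric. The infimum runs over pairs of a
  -- coded point on the same level and a number of symbols in which it agrees with `z`. On a level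
  -- without coded points the infimum over the empty family is `0`.
  let ext : (ℕ → ℕ) × ℕ → ℝ := fun z => ⨅ q : J z, φ q.1.1 + a * β ^ q.1.2
  have hlow : ∀ i (m : ℕ), -b ≤ φ i + a * β ^ m := fun i m => by
    have h1 := (abs_le.1 (hφ i)).1
    have h2 : 0 ≤ a * β ^ m := by positivity
    linarith
  have hbdd : ∀ z, BddBelow (range fun q : J z => φ q.1.1 + a * β ^ q.1.2) := fun z =>
    ⟨-b, by rintro _ ⟨q, rfl⟩; exact hlow _ _⟩
  have hext : ∀ z, -b ≤ ext z := fun z => Real.le_iInf (fun q => hlow _ _) (by linarith)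
  have hstep : ∀ (m : ℕ) (x y : ℕ → ℕ) (l : ℕ), y ∈ PiNat.cylinder x m →
      ext (y, l) ≤ ext (x, l) + a * β ^ m := by
    intro m x y l hxy
    by_cases hne : Nonempty (J (x, l))
    · rw [← sub_le_iff_le_add]
      refine le_ciInf fun q => ?_
      obtain ⟨⟨i, k⟩, hl, hc⟩ := q
      rw [sub_le_iff_le_add]
      have hmem : (c i).1 ∈ PiNat.cylinder y (min k m) := fun n hn => by
        rw [hc n (lt_of_lt_of_le hn (min_le_left _ _)),
          hxy n (lt_of_lt_of_le hn (min_le_right _ _))]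
      refine (ciInf_le (hbdd (y, l)) ⟨(i, min k m), hl, hmem⟩).trans ?_
      change φ i + a * β ^ min k m ≤ φ i + a * β ^ k + a * β ^ m
      have h1 : 0 ≤ a * β ^ k := by positivity
      have h2 : 0 ≤ a * β ^ m := by positivity
      rcases min_choice k m with h | h <;> rw [h] <;> linarith
    · have hne' : IsEmpty (J (x, l)) := not_nonempty_iff.1 hne
      by_cases hne2 : Nonempty (J (y, l))
      · obtain ⟨⟨⟨i, k⟩, hl, hc⟩⟩ := hne2
        exact absurd ⟨⟨(i, 0), hl, fun n hn => absurd hn (Nat.not_lt_zero n)⟩⟩ hne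
      · have hne2' : IsEmpty (J (y, l)) := not_nonempty_iff.1 hne2
        have e1 : ext (x, l) = 0 := Real.iInf_of_isEmpty _
        have e2 : ext (y, l) = 0 := Real.iInf_of_isEmpty _
        rw [e1, e2]
        positivity
  refine ⟨fun z => min (ext z) b, ⟨fun z => abs_le.2 ⟨le_min (hext z) (by linarith),
    min_le_right _ _⟩, fun m x y l hxy => ?_⟩, fun i => ?_⟩
  · have h1 := hstep m x y l hxy
    have h2 := hstep m y x l ((PiNat.mem_cylinder_comm _ _ _).1 hxy)
    refine (abs_min_sub_min_le_max _ _ _ _).trans ?_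
    rw [sub_self, abs_zero]
    exact max_le (abs_le.2 ⟨by linarith, by linarith⟩) (by positivity)
  · have h1 : φ i ≤ ext (c i) := by
      have : Nonempty (J (c i)) := ⟨⟨(i, 0), rfl, fun n hn => absurd hn (Nat.not_lt_zero n)⟩⟩
      refine le_ciInf fun q => ?_
      have := (abs_le.1 (hosc q.1.2 i q.1.1 q.2.1.symm q.2.2)).2
      linarith
    have h2 : ext (c i) ≤ φ i := by
      have ht : Filter.Tendsto (fun m : ℕ => φ i + a * β ^ m) Filter.atTop (𝓝 (φ i)) := by
        simpa using ((tendsto_pow_atTop_nhds_zero_of_lt_one hβ0.le hβ1).const_mul a).const_add (φ i)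
      exact ge_of_tendsto' ht fun m =>
        ciInf_le (hbdd (c i)) ⟨(i, m), rfl, fun n _ => rfl⟩
    have h3 := (abs_le.1 (hφ i)).2
    simp only [le_antisymm h2 h1, min_eq_left h3]

/-! ### Comparison of the norms on the tower and on the symbolic tower -/

namespace YoungStructure

variable {d : ℕ} {M : Type u} [EMetricSpace M]
  [ChartedSpace (EuclideanSpace ℝ (Fin d)) M] [IsManifold (𝓡 d) 1 M] [MeasurableSpace M]
  [RiemannianBundle (fun y : M => TangentSpace (𝓡 d) y)] {f : M → M} {U : ℕ → Set M}
  {Y : YoungStructure (d := d) f U}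

theorem dynDist_nonneg (y z : Y.Tower) : 0 ≤ Y.dynDist y z := by
  unfold dynDist powSep
  have := Y.β_pos
  split_ifs <;> positivity

theorem dynDist_le_one (y z : Y.Tower) : Y.dynDist y z ≤ 1 := by
  have := powSep_le Y.β_pos Y.β_lt_one (m := 0) (s := Y.sep y z) (by simp)
  rwa [pow_zero] at this

theorem dynDist_le {y z : Y.Tower} {m : ℕ} (hl : (coding y).2 = (coding z).2)
    (h : (coding z).1 ∈ PiNat.cylinder (coding y).1 m) : Y.dynDist y z ≤ Y.β ^ m := by
  refine powSep_le Y.β_pos Y.β_lt_one ?_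
  rw [sep, if_pos (show level y = level z from hl)]
  exact le_sepTime Y.pairwise_disjoint y.2.1 z.2.1 fun j hj => (h j hj).symm

theorem supNorm_nonneg (φ : Y.Tower → ℝ) : 0 ≤ Y.supNorm φ := Real.iSup_nonneg fun _ => abs_nonneg _

theorem seminorm_nonneg (φ : Y.Tower → ℝ) : 0 ≤ Y.seminorm φ :=
  Real.iSup_nonneg fun _ => div_nonneg (abs_nonneg _) (dynDist_nonneg _ _)

/-- A real supremum is meaningful only for a bounded family. Boundedness holds because the dynamical
distance is at most `1`, so a function in `F` oscillates by at most its constant. -/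
theorem abs_le_supNorm {φ : Y.Tower → ℝ} (hφ : φ ∈ Y.F) (z : Y.Tower) : |φ z| ≤ Y.supNorm φ := by
  obtain ⟨C, hC, h⟩ := hφ
  refine le_ciSup (f := fun z => |φ z|) ⟨|φ z| + C, ?_⟩ z
  rintro _ ⟨y, rfl⟩
  have h1 : |φ y - φ z| ≤ C :=
    (h y z).trans (mul_le_of_le_one_right hC.le (dynDist_le_one y z))
  have h2 := abs_add_le (φ y - φ z) (φ z)
  rw [sub_add_cancel] at h2
  change |φ y| ≤ _
  linarith

theorem abs_sub_le_seminorm {φ : Y.Tower → ℝ} (hφ : φ ∈ Y.F) (y z : Y.Tower) :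
    |φ y - φ z| ≤ Y.seminorm φ * Y.dynDist y z := by
  obtain ⟨C, hC, h⟩ := hφ
  rcases (dynDist_nonneg y z).eq_or_lt with h0 | hpos
  · have := h y z
    rw [← h0, mul_zero] at this ⊢
    exact this
  rcases eq_or_ne y z with rfl | hne
  · rw [sub_self, abs_zero]
    exact mul_nonneg (seminorm_nonneg φ) hpos.le
  rw [← div_le_iff₀ hpos]
  refine le_ciSup (f := fun q : {q : Y.Tower × Y.Tower // q.1 ≠ q.2} =>
    |φ q.1.1 - φ q.1.2| / Y.dynDist q.1.1 q.1.2) ⟨C, ?_⟩ ⟨(y, z), hne⟩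
  rintro _ ⟨q, rfl⟩
  exact div_le_of_le_mul₀ (dynDist_nonneg _ _) hC.le (h _ _)

theorem exists_symLipschitz {φ : Y.Tower → ℝ} (hφ : φ ∈ Y.F) :
    ∃ ψ : (ℕ → ℕ) × ℕ → ℝ, SymLipschitz Y.β (Y.seminorm φ) (Y.supNorm φ) ψ ∧
      ∀ z, ψ (coding z) = φ z :=
  exists_symLipschitz_extension Y.β_pos Y.β_lt_one (seminorm_nonneg φ) (supNorm_nonneg φ)
    coding φ (abs_le_supNorm hφ) fun _ y z hl hc => (abs_sub_le_seminorm hφ y z).trans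
      (mul_le_mul_of_nonneg_left (dynDist_le hl hc) (seminorm_nonneg φ))

/-- On one level the symbolic oscillation bound applies, in the limit of all cylinder lengths if the
points never separate. On different levels the distance is `1`, and the sup bound gives `2 * b`. -/
theorem abs_sub_comp_coding_le {a b : ℝ} (ha : 0 ≤ a) (hb : 0 ≤ b) {ψ : (ℕ → ℕ) × ℕ → ℝ}
    (hψ : SymLipschitz Y.β a b ψ) (y z : Y.Tower) :
    |ψ (coding y) - ψ (coding z)| ≤ (a + 2 * b) * Y.dynDist y z := by
  by_cases hl : level y = level z
  · have ez : coding z = (Y.itin (base z), level y) := by rw [hl]; rfl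
    have key : ∀ m : ℕ, (m : ℕ∞) ≤ Y.sep y z →
        |ψ (coding y) - ψ (coding z)| ≤ a * Y.β ^ m := by
      intro m hm
      rw [sep, if_pos hl] at hm
      rw [ez]
      refine hψ.osc m _ _ _ fun j hj => ?_
      exact (itinerary_eq_of_lt_sepTime y.2.1 z.2.1 (lt_of_lt_of_le (by exact_mod_cast hj) hm)).symm
    unfold dynDist powSep
    split_ifs with htop
    · have ht : Filter.Tendsto (fun m : ℕ => a * Y.β ^ m) Filter.atTop (𝓝 ((a + 2 * b) * 0)) := by
        simpa using (tendsto_pow_atTop_nhds_zero_of_lt_one Y.β_pos.le Y.β_lt_one).const_mul a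
      exact ge_of_tendsto' ht fun m => key m (by rw [htop]; exact le_top)
    · have := key (Y.sep y z).toNat (by rw [ENat.natCast_toNat htop])
      have h2 : 0 ≤ Y.β ^ (Y.sep y z).toNat := pow_nonneg Y.β_pos.le _
      nlinarith
  · have h1 : Y.dynDist y z = 1 := by simp [dynDist, sep, if_neg hl, powSep]
    rw [h1, mul_one]
    have h2 := abs_sub (ψ (coding y)) (ψ (coding z))
    have h3 := hψ.bound (coding y)
    have h4 := hψ.bound (coding z)
    linarith

theorem comp_coding_mem_F {a b : ℝ} (ha : 0 ≤ a) (hb : 0 ≤ b) {ψ : (ℕ → ℕ) × ℕ → ℝ}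
    (hψ : SymLipschitz Y.β a b ψ) : (fun z : Y.Tower => ψ (coding z)) ∈ Y.F :=
  ⟨a + 2 * b + 1, by positivity, fun y z => (abs_sub_comp_coding_le ha hb hψ y z).trans
    (mul_le_mul_of_nonneg_right (by linarith) (dynDist_nonneg y z))⟩

theorem normβ_comp_coding_le {a b : ℝ} (ha : 0 ≤ a) (hb : 0 ≤ b) {ψ : (ℕ → ℕ) × ℕ → ℝ}
    (hψ : SymLipschitz Y.β a b ψ) :
    Y.normβ (fun z : Y.Tower => ψ (coding z)) ≤ 3 * (a + b) := by
  have h1 : Y.seminorm (fun z : Y.Tower => ψ (coding z)) ≤ a + 2 * b :=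
    Real.iSup_le (fun q => div_le_of_le_mul₀ (dynDist_nonneg _ _) (by positivity)
      (abs_sub_comp_coding_le ha hb hψ _ _)) (by positivity)
  have h2 : Y.supNorm (fun z : Y.Tower => ψ (coding z)) ≤ b :=
    Real.iSup_le (fun z => hψ.bound _) hb
  unfold normβ
  linarith

theorem normβ_nonneg (φ : Y.Tower → ℝ) : 0 ≤ Y.normβ φ :=
  add_nonneg (seminorm_nonneg φ) (supNorm_nonneg φ)

end YoungStructure

/-! ### Large deviations on the Young tower -/

namespace YoungStructure

variable {d : ℕ} {M : Type u} [EMetricSpace M]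
  [ChartedSpace (EuclideanSpace ℝ (Fin d)) M] [IsManifold (𝓡 d) 1 M] [MeasurableSpace M]
  [RiemannianBundle (fun y : M => TangentSpace (𝓡 d) y)] {f : M → M} {U : ℕ → Set M}
  {Y : YoungStructure (d := d) f U}

/-- Averages and mean are both bounded by `‖φ‖_∞`, so only `ε < 2 ‖φ‖_∞` needs an argument. This
also disposes of `φ = 0`. -/
theorem mld_eq_zero {ν : Measure Y.Tower} [IsProbabilityMeasure ν] {φ : Y.Tower → ℝ}
    (hφ : φ ∈ Y.F) {ε : ℝ} (hε : 2 * Y.supNorm φ ≤ ε) {n : ℕ} (hn : 1 ≤ n) :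
    mld ν Y.towerMap φ ε n = 0 := by
  have hint : |∫ w, φ w ∂ν| ≤ Y.supNorm φ := by
    have := norm_integral_le_of_norm_le_const (μ := ν) (f := φ)
      (Filter.Eventually.of_forall (abs_le_supNorm hφ))
    simpa using this
  unfold mld
  rw [show {z | _} = (∅ : Set Y.Tower) from ?_, measure_empty, ENNReal.toReal_zero]
  refine eq_empty_of_forall_notMem fun z hz => ?_
  simp only [mem_ofPred_eq, lt_iSup_iff] at hz
  obtain ⟨j, hj, hlt⟩ := hz
  have hj0 : (0 : ℝ) < j := by exact_mod_cast hn.trans hj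
  have h1 := ENNReal.ofReal_lt_ofReal_iff'.1 hlt
  have h2 : |(1 / (j : ℝ)) * ∑ i ∈ Finset.range j, φ (Y.towerMap^[i] z)| ≤ Y.supNorm φ := by
    rw [abs_mul, abs_of_pos (by positivity), one_div, inv_mul_le_iff₀ hj0]
    refine (Finset.abs_sum_le_sum_abs _ _).trans ((Finset.sum_le_sum fun i _ =>
      abs_le_supNorm hφ _).trans (le_of_eq ?_))
    rw [Finset.sum_const, Finset.card_range, nsmul_eq_mul]
  have h3 := abs_sub ((1 / (j : ℝ)) * ∑ i ∈ Finset.range j, φ (Y.towerMap^[i] z)) (∫ w, φ w ∂ν)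
  linarith [h1.1]

section Measurable

variable [BorelSpace M]

/-- A symbolic observable composed with the coding has norm at most three times its symbolic
constants; two observables give the factor `9`. -/
theorem symDecay_map (hf : IsPiecewiseC1Diffeo (d := d) f U) {ν : Measure Y.Tower} {C : ℝ}
    (hC : 0 < C) {r : ℕ → ℝ} (hr : ∀ n, 0 ≤ r n)
    (h : ∀ ψ ∈ Y.F, ∀ ξ ∈ Y.F, ∀ n : ℕ, 1 ≤ n →
      corr ν Y.towerMap ψ ξ n ≤ C * Y.normβ ψ * Y.normβ ξ * r n) :
    SymDecay Y.Ri (ν.map coding) Y.β (9 * C) r := by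
  intro a b a' b' ψ ξ ha hb ha' hb' hψ hξ n hn
  have hm := measurable_coding (Y := Y) hf
  have hψm := hψ.measurable Y.β_pos Y.β_lt_one
  have hξm := hξ.measurable Y.β_pos Y.β_lt_one
  rw [integral_map hm.aemeasurable hψm.aestronglyMeasurable,
    integral_map hm.aemeasurable hξm.aestronglyMeasurable,
    integral_map hm.aemeasurable (f := fun z => ψ z * ξ ((symTower Y.Ri)^[n] z))
      (hψm.mul (hξm.comp ((measurable_symTower _).iterate n))).aestronglyMeasurable]
  simp_rw [← coding_iterate]
  refine (h _ (comp_coding_mem_F ha hb hψ) _ (comp_coding_mem_F ha' hb' hξ) n hn).trans ?_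
  have h1 := normβ_comp_coding_le ha hb hψ
  have h2 := normβ_comp_coding_le ha' hb' hξ
  have h3 := mul_le_mul h1 h2 (normβ_nonneg _) (by positivity)
  have h4 := mul_le_mul_of_nonneg_right (mul_le_mul_of_nonneg_left h3 hC.le) (hr n)
  refine le_trans (le_of_eq ?_) (h4.trans (le_of_eq ?_)) <;> ring

theorem mld_le (hf : IsPiecewiseC1Diffeo (d := d) f U) {ν : Measure Y.Tower}
    [IsProbabilityMeasure ν] {φ : Y.Tower → ℝ} {ψ : (ℕ → ℕ) × ℕ → ℝ} {c : ℝ}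
    (hψ : ∀ z, ψ (coding z) = φ z - c) (hc : c = ∫ w, φ w ∂ν) (ε : ℝ) {n : ℕ} (hn : 1 ≤ n) :
    mld ν Y.towerMap φ ε n ≤ (ν.map coding).real
      {z | ∃ j, n ≤ j ∧ ε * j ≤ |birkhoffSum (symTower Y.Ri) ψ j z|} := by
  have hm := measurable_coding (Y := Y) hf
  have := Measure.isProbabilityMeasure_map (μ := ν) hm.aemeasurable
  refine ENNReal.toReal_mono (measure_ne_top _ _) ?_
  refine le_trans (measure_mono fun z hz => ?_) (Measure.le_map_apply hm.aemeasurable _)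
  simp only [mem_ofPred_eq, lt_iSup_iff] at hz
  obtain ⟨j, hj, hlt⟩ := hz
  have hj0 : (0 : ℝ) < j := by exact_mod_cast hn.trans hj
  refine ⟨j, hj, ?_⟩
  have h1 := (ENNReal.ofReal_lt_ofReal_iff'.1 hlt).1.le
  have h2 : birkhoffSum (symTower Y.Ri) ψ j (coding z) =
      ∑ i ∈ Finset.range j, φ (Y.towerMap^[i] z) - j * c := by
    simp only [birkhoffSum, ← coding_iterate, hψ, Finset.sum_sub_distrib, Finset.sum_const,
      Finset.card_range, nsmul_eq_mul]
  have h3 : birkhoffSum (symTower Y.Ri) ψ j (coding z) =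
      j * ((1 / (j : ℝ)) * ∑ i ∈ Finset.range j, φ (Y.towerMap^[i] z) - ∫ w, φ w ∂ν) := by
    rw [h2, hc]
    field_simp
  rw [h3, abs_mul, abs_of_pos hj0, mul_comm]
  exact mul_le_mul_of_nonneg_left h1 hj0.le

/-- A Hölder observable of the tower, centred, comes from a symbolic observable. -/
theorem exists_centred_symLipschitz (hf : IsPiecewiseC1Diffeo (d := d) f U) {ν : Measure Y.Tower}
    [IsProbabilityMeasure ν] {φ : Y.Tower → ℝ} (hφ : φ ∈ Y.F) :
    ∃ ψ : (ℕ → ℕ) × ℕ → ℝ, SymLipschitz Y.β (Y.seminorm φ) (2 * Y.supNorm φ) ψ ∧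
      ∫ z, ψ z ∂(ν.map coding) = 0 ∧ ∀ z, ψ (coding z) = φ z - ∫ w, φ w ∂ν := by
  obtain ⟨ψ, hψ, hψφ⟩ := exists_symLipschitz hφ
  have hm := measurable_coding (Y := Y) hf
  have := Measure.isProbabilityMeasure_map (μ := ν) hm.aemeasurable
  have hint : ∫ z, ψ z ∂(ν.map coding) = ∫ w, φ w ∂ν := by
    rw [integral_map hm.aemeasurable (hψ.measurable Y.β_pos Y.β_lt_one).aestronglyMeasurable]
    simp_rw [hψφ]
  have hle : |∫ w, φ w ∂ν| ≤ Y.supNorm φ := by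
    have := norm_integral_le_of_norm_le_const (μ := ν) (f := φ)
      (Filter.Eventually.of_forall (abs_le_supNorm hφ))
    simpa using this
  refine ⟨fun z => ψ z - ∫ w, φ w ∂ν, ⟨fun z => ?_, fun m x y l h => ?_⟩, ?_, fun z => by simp only [hψφ]⟩
  · have h1 := abs_sub (ψ z) (∫ w, φ w ∂ν)
    have h2 := hψ.bound z
    linarith
  · rw [sub_sub_sub_cancel_right]
    exact hψ.osc m x y l h
  · rw [integral_sub (hψ.integrable Y.β_pos Y.β_lt_one) (integrable_const _), hint]
    simp

theorem exists_mld_le_rpow (hf : IsPiecewiseC1Diffeo (d := d) f U) {ν : Measure Y.Tower}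
    (hν : Y.IsSRB ν) {α C : ℝ} (hα : 1 < α) (hC : 0 < C)
    (h : ∀ ψ ∈ Y.F, ∀ ξ ∈ Y.F, ∀ n : ℕ, 1 ≤ n →
      corr ν Y.towerMap ψ ξ n ≤ C * Y.normβ ψ * Y.normβ ξ * (n : ℝ) ^ (-α)) {q : ℝ}
    (hq : max 1 α < q) :
    ∃ D > 0, ∀ φ ∈ Y.F, ∀ ε : ℝ, 0 < ε → ∀ n : ℕ, 1 ≤ n → mld ν Y.towerMap φ ε n ≤
      D * Y.normβ φ * Y.supNorm φ ^ (2 * q - 1) * ε ^ (-(2 * q)) * (n : ℝ) ^ (-α) := by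
  have hprob := hν.isProbabilityMeasure
  have htow := isTowerMeasure_map hf hν
  have := htow.isProbabilityMeasure
  obtain ⟨K, hK, hd⟩ := exists_boundedDistortion hf hν
  obtain ⟨E, hE, htr⟩ := htow.exists_transfer_rpow Y.β_pos Y.β_lt_one hK hd
    (show 0 < 9 * C by positivity) (show 0 < α by linarith)
    (symDecay_map hf hC (fun n => by positivity) h)
  obtain ⟨D, hD, hmax⟩ := exists_measure_sup_le_rpow (show 0 < α by linarith)
    ((le_max_left _ _).trans_lt hq) ((le_max_right _ _).trans_lt hq)
  -- The symbolic observable is centred, hence bounded by `2 ‖φ‖_∞`, which gives `2 ^ (2 * q - 1)`.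
  -- The number `2 * max E 1` serves both for the L¹ decay and for the requirement `b ≤ A`.
  refine ⟨D * (2 * max E 1) * 2 ^ (2 * q - 1), by positivity, fun φ hφ ε hε n hn => ?_⟩
  have hs := supNorm_nonneg φ
  have ha := seminorm_nonneg φ
  have hN := normβ_nonneg φ
  rcases le_or_gt (2 * Y.supNorm φ) ε with hle | hlt
  · rw [mld_eq_zero hφ hle hn]
    positivity
  obtain ⟨ψ, hψ, hψ0, hψφ⟩ := exists_centred_symLipschitz (ν := ν) hf hφ
  obtain ⟨g, hg0, hg, hgE⟩ := htr _ _ ψ ha (by positivity) hψ hψ0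
  have hNe : Y.normβ φ = Y.seminorm φ + Y.supNorm φ := rfl
  have hE1 : E ≤ max E 1 := le_max_left _ _
  have hE2 : 1 ≤ max E 1 := le_max_right _ _
  have hsN : 2 * Y.supNorm φ ≤ 2 * max E 1 * Y.normβ φ := by nlinarith
  have h1 := hmax htow.measurePreserving hg0 hg (show 0 < 2 * Y.supNorm φ by linarith) hsN
    (fun k hk => (hgE k hk).trans (mul_le_mul_of_nonneg_right
      (calc E * (Y.seminorm φ + 2 * Y.supNorm φ) ≤ max E 1 * (2 * Y.normβ φ) :=
              mul_le_mul hE1 (by linarith) (by positivity) (by positivity)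
        _ = 2 * max E 1 * Y.normβ φ := by ring) (by positivity))) n ε hn hε (by linarith)
  refine (mld_le hf hψφ rfl ε hn).trans (h1.trans (le_of_eq ?_))
  rw [Real.mul_rpow zero_le_two hs]
  ring

theorem exists_mld_le_exp (hf : IsPiecewiseC1Diffeo (d := d) f U) {ν : Measure Y.Tower}
    (hν : Y.IsSRB ν) {τ θ C : ℝ} (hτ : 0 < τ) (hθ : 0 < θ) (hC : 0 < C)
    (h : ∀ ψ ∈ Y.F, ∀ ξ ∈ Y.F, ∀ n : ℕ, 1 ≤ n → corr ν Y.towerMap ψ ξ n ≤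
      C * Y.normβ ψ * Y.normβ ξ * Real.exp (-(τ * (n : ℝ) ^ θ))) :
    ∃ c > 0, ∃ D > 0, ∀ φ ∈ Y.F, ∀ ε : ℝ, 0 < ε → ∀ n : ℕ, 1 ≤ n → mld ν Y.towerMap φ ε n ≤
      D * Real.exp (-(c * Y.normβ φ ^ (-(2 * (θ / (θ + 1)))) * (n : ℝ) ^ (θ / (θ + 1)) *
        ε ^ (2 * (θ / (θ + 1))))) := by
  have hprob := hν.isProbabilityMeasure
  have htow := isTowerMeasure_map hf hν
  have := htow.isProbabilityMeasure
  obtain ⟨K, hK, hd⟩ := exists_boundedDistortion hf hν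
  obtain ⟨E, hE, htr⟩ := htow.exists_transfer_exp Y.β_pos Y.β_lt_one hK hd
    (show 0 < 9 * C by positivity) (symDecay_map hf hC (fun n => (Real.exp_pos _).le) h)
  obtain ⟨D, c, hD, hc, hmax⟩ := exists_measure_sup_le_exp (show 0 < τ / 2 by positivity) hθ hE
  set η := θ / (θ + 1) with hη
  refine ⟨c * (1 / 4) ^ η, by positivity, D, hD, fun φ hφ ε hε n hn => ?_⟩
  have hs := supNorm_nonneg φ
  have ha := seminorm_nonneg φ
  rcases le_or_gt (2 * Y.supNorm φ) ε with hle | hlt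
  · rw [mld_eq_zero hφ hle hn]
    positivity
  obtain ⟨ψ, hψ, hψ0, hψφ⟩ := exists_centred_symLipschitz (ν := ν) hf hφ
  obtain ⟨g, hg0, hg, hgE⟩ := htr _ _ ψ ha (by positivity) hψ hψ0
  have hNe : Y.normβ φ = Y.seminorm φ + Y.supNorm φ := rfl
  have hN : 0 < Y.normβ φ := by linarith
  have h1 := hmax htow.measurePreserving hg0 hg (show 0 < 2 * Y.supNorm φ by linarith)
    (show 2 * Y.supNorm φ ≤ 2 * Y.normβ φ by linarith)
    (fun k hk => (hgE k hk).trans (mul_le_mul_of_nonneg_right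
      (mul_le_mul_of_nonneg_left (by linarith) hE.le) (Real.exp_pos _).le)) n ε hn hε (by linarith)
  refine (mld_le hf hψφ rfl ε hn).trans (h1.trans (le_of_eq ?_))
  have hn0 : (0 : ℝ) ≤ n := Nat.cast_nonneg n
  have e : (n : ℝ) * ε ^ 2 / (2 * Y.normβ φ) ^ 2 =
      1 / 4 * (Y.normβ φ ^ (-2 : ℝ) * n * ε ^ (2 : ℝ)) := by
    rw [Real.rpow_neg hN.le, Real.rpow_two, Real.rpow_two]
    field_simp
    norm_num
  rw [e, Real.mul_rpow (by norm_num) (by positivity), Real.mul_rpow (by positivity) (by positivity),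
    Real.mul_rpow (by positivity) hn0, ← Real.rpow_mul hN.le, ← Real.rpow_mul hε.le]
  ring_nf

end Measurable

end YoungStructure

end YoungTower

end

theorem theoremB {d : ℕ} {M : Type*} [EMetricSpace M] [CompactSpace M]
    [ChartedSpace (EuclideanSpace ℝ (Fin d)) M] [IsManifold (𝓡 d) ∞ M]
    [RiemannianBundle (fun y : M => TangentSpace (𝓡 d) y)]
    [IsContMDiffRiemannianBundle (𝓡 d) ∞ (EuclideanSpace ℝ (Fin d))
      (fun y : M => TangentSpace (𝓡 d) y)]
    [IsRiemannianManifold (𝓡 d) M] [MeasurableSpace M] [BorelSpace M]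
    (f : M → M) (U : ℕ → Set M) (hf : YoungTower.IsPiecewiseC1Diffeo (d := d) f U)
    (Y : YoungTower.YoungStructure (d := d) f U) (ν : Measure Y.Tower) (hν : Y.IsSRB ν) :
    (∀ α : ℝ, 1 < α →
      (∃ C > 0, ∀ ψ ∈ Y.F, ∀ ξ ∈ Y.F, ∀ n : ℕ, 1 ≤ n →
        YoungTower.corr ν Y.towerMap ψ ξ n ≤ C * Y.normβ ψ * Y.normβ ξ * (n : ℝ) ^ (-α)) →
      ∀ q : ℝ, max 1 α < q → ∃ Cαq > 0, ∀ φ ∈ Y.F, ∀ ε : ℝ, 0 < ε → ∀ n : ℕ, 1 ≤ n →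
        YoungTower.mld ν Y.towerMap φ ε n ≤
          Cαq * Y.normβ φ * Y.supNorm φ ^ (2 * q - 1) * ε ^ (-(2 * q)) * (n : ℝ) ^ (-α)) ∧
    (∀ τ θ : ℝ, 0 < τ → 0 < θ →
      (∃ C > 0, ∀ ψ ∈ Y.F, ∀ ξ ∈ Y.F, ∀ n : ℕ, 1 ≤ n →
        YoungTower.corr ν Y.towerMap ψ ξ n ≤
          C * Y.normβ ψ * Y.normβ ξ * Real.exp (-(τ * (n : ℝ) ^ θ))) →
      ∃ Cτθ > 0, ∀ φ ∈ Y.F, ∃ Cφ > 0, ∀ θ' τ' : ℝ, θ' = θ / (θ + 1) →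
        τ' = Cτθ * Y.normβ φ ^ (-(2 * θ')) →
        ∀ ε : ℝ, 0 < ε → ∀ n : ℕ, 1 ≤ n →
          YoungTower.mld ν Y.towerMap φ ε n ≤
            Cφ * Real.exp (-(τ' * (n : ℝ) ^ θ' * ε ^ (2 * θ')))) := by

  refine ⟨fun α hα ⟨C, hC, h⟩ q hq => YoungTower.YoungStructure.exists_mld_le_rpow hf hν hα hC h hq,
    fun τ θ hτ hθ ⟨C, hC, h⟩ => ?_⟩
  obtain ⟨c, hc, D, hD, hmax⟩ := YoungTower.YoungStructure.exists_mld_le_exp hf hν hτ hθ hC h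
  -- The prefactor `D` does not depend on `φ`, so it serves as the constant for every observable.
  refine ⟨c, hc, fun φ hφ => ⟨D, hD, fun θ' τ' hθ' hτ' ε hε n hn => ?_⟩⟩
  rw [hτ', hθ']
  exact hmax φ hφ ε hε n hn
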